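/- There are a word-RAM program $P$ (a depth-first search), word-RAM query programs $R$ and $Q$ running in $O(1)$ time, and a fixed decoding function such that the following holds. Let $G$ be a non-empty simple graph with vertex set $\{1,\dots,n\}$ and $m$ edges (directed, or undirected and then regarded as a symmetric directed graph), given by its adjacency array (the number $n$, for each vertex the location of its last neighbour, then the neighbour lists in arbitrary order, each edge of an undirected graph occurring in two lists), and let $s$ be a vertex. Let the word length be $w=\Theta(\lg (n+m))$, with a sufficiently large constant in the lower bound. Let $G'$ be the DFS tree of $G$ obtained by depth-first search from $s$ following the order of the neighbour lists (if some vertices are not reachable from $s$, the search is restarted from the smallest undiscovered vertex until all vertices are discovered, and $G'$ is a forest). The degree of a vertex in $G'$ means its number of children. On a word RAM whose input is read-only, and with all work memory and all registers counted as space: 1. $P$ runs in $O(m+n)$ time, uses $O(n\lg\lg n)$ bits of space (where $\lg\lg n$ is understood to be at least $1$), and reports the vertices in the order in which the search discovers them. 2. The degree sequence is maintained dynamically during the search: for every $k\le n$ there is a moment in the run of $P$ when exactly the first $k$ vertices have been reported, and at which $R$ can return, in $O(1)$ time and without changing the memory, the current degree of any vertex, i.e. the number of its children among the first $k$ discovered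 vertices. 3. When $P$ halts, an initial part of the work memory, of at most $2n+o(n)$ bits, stores the degree sequence of $G'$: it contains a string of at most $2n$ bits from which, together with $n$, the decoding function recovers the degree sequence, and $o(n)$ further bits. From this initial part alone (without the input), $Q$ returns the degree in $G'$ of any vertex in $O(1)$ time, without changing the memory. The programs do not depend on $G$, $n$, $m$ or $w$; the constants in the $O$-bounds and the $o(n)$ term depend only on the constant in the upper bound for $w$. -/

import Mathlib

/-!
# Word RAM with read-only input, adjacency arrays, and depth-first search
-/

/-! ### The word RAM

Words have `w` bits.  A machine has a constant number of registers, a read-only input array of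
words, a random access work memory of `S` words, and a write-only output stream.  Every instruction
takes one step, and an access outside of the input or outside of the `S` words of work memory is a
fault. -/

namespace WordRAM

/-- The word operations, each of unit cost. -/
inductive Op where
  | add | sub | mul | div | mod | and | or | xor | shl | shr | lt

/-- The value of a word operation on `w`-bit words (all results are taken modulo `2 ^ w`). -/
def Op.eval (w : ℕ) : Op → ℕ → ℕ → ℕ
  | .add, a, b => (a + b) % 2 ^ w
  | .sub, a, b => (a + 2 ^ w - b) % 2 ^ w
  | .mul, a, b => (a * b) % 2 ^ w
  | .div, a, b => (a / b) % 2 ^ w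
  | .mod, a, b => (a % b) % 2 ^ w
  | .and, a, b => (a &&& b) % 2 ^ w
  | .or, a, b => (a ||| b) % 2 ^ w
  | .xor, a, b => (a ^^^ b) % 2 ^ w
  | .shl, a, b => (a <<< b) % 2 ^ w
  | .shr, a, b => (a >>> b) % 2 ^ w
  | .lt, a, b => (if a < b then 1 else 0) % 2 ^ w

/-- Instructions of a machine with `k` registers. -/
inductive Instr (k : ℕ) where
  /-- put the constant `c` into register `d` -/
  | const (d : Fin k) (c : ℕ)
  /-- copy register `a` to register `d` -/
  | move (d a : Fin k)
  /-- put the result of a word operation on registers `a`, `b` into register `d` -/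
  | op (f : Op) (d a b : Fin k)
  /-- put the input word whose index is in register `a` into register `d` -/
  | read (d a : Fin k)
  /-- put the memory word whose address is in register `a` into register `d` -/
  | load (d a : Fin k)
  /-- write register `b` to the memory word whose address is in register `a` -/
  | store (a b : Fin k)
  /-- append register `a` to the output stream -/
  | report (a : Fin k)
  /-- continue at program line `l` -/
  | jump (l : ℕ)
  /-- continue at program line `l` if register `a` is zero, else at the next line -/
  | jumpIfZero (a : Fin k) (l : ℕ)
  /-- stop -/
  | halt

/-- A program: a number of registers and a finite list of instructions.  It depends neither on the
input nor on the word length. -/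
structure Program where
  numRegs : ℕ
  code : List (Instr numRegs)

/-- A configuration of a machine with `k` registers. -/
structure Config (k : ℕ) where
  pc : ℕ
  reg : Fin k → ℕ
  mem : ℕ → ℕ
  out : List ℕ

namespace Program

/-- The starting configuration with memory contents `mem` and arguments in registers `0, 1, …`; the
other registers are zero. -/
def start (P : Program) (w : ℕ) (mem : ℕ → ℕ) (args : List ℕ) : Config P.numRegs where
  pc := 0
  reg i := args.getD i 0 % 2 ^ w
  mem := mem
  out := []

/-- The effect of one instruction: the next configuration, or `none` after `halt` or a fault. -/
def exec {k : ℕ} (w : ℕ) (input : List ℕ) (S : ℕ) (c : Config k) : Instr k → Option (Config k)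
  | .const d x => some { c with pc := c.pc + 1, reg := Function.update c.reg d (x % 2 ^ w) }
  | .move d a => some { c with pc := c.pc + 1, reg := Function.update c.reg d (c.reg a) }
  | .op f d a b =>
      some { c with
        pc := c.pc + 1
        reg := Function.update c.reg d (f.eval w (c.reg a) (c.reg b)) }
  | .read d a =>
      (input[c.reg a]?).map fun x =>
        { c with pc := c.pc + 1, reg := Function.update c.reg d (x % 2 ^ w) }
  | .load d a =>
      if c.reg a < S then
        some { c with pc := c.pc + 1, reg := Function.update c.reg d (c.mem (c.reg a)) }
      else none
  | .store a b =>
      if c.reg a < S then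
        some { c with pc := c.pc + 1, mem := Function.update c.mem (c.reg a) (c.reg b) }
      else none
  | .report a => some { c with pc := c.pc + 1, out := c.out ++ [c.reg a] }
  | .jump l => some { c with pc := l }
  | .jumpIfZero a l => some { c with pc := if c.reg a = 0 then l else c.pc + 1 }
  | .halt => none

/-- One step of `P` with word length `w`, the given input, and `S` words of work memory. -/
def step (P : Program) (w : ℕ) (input : List ℕ) (S : ℕ) (c : Config P.numRegs) :
    Option (Config P.numRegs) :=
  (P.code[c.pc]?).bind (exec w input S c)

/-- The configuration after exactly `t` steps, if the machine has neither stopped nor faulted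
before. -/
def run (P : Program) (w : ℕ) (input : List ℕ) (S : ℕ) :
    ℕ → Config P.numRegs → Option (Config P.numRegs)
  | 0, c => some c
  | t + 1, c => (P.step w input S c).bind (P.run w input S t)

/-- The machine has come to a `halt` instruction. -/
def Halted (P : Program) (c : Config P.numRegs) : Prop :=
  P.code[c.pc]? = some .halt

/-- With the given input and the first `S` words of `mem` as its memory, the query program `Q`
answers the query `args` by `ans` within `T` steps, and leaves the memory as it was. -/
def Answers (Q : Program) (w : ℕ) (input : List ℕ) (S : ℕ) (mem : ℕ → ℕ) (args : List ℕ) (T : ℕ)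
    (ans : ℕ) : Prop :=
  ∃ t ≤ T, ∃ c, Q.run w input S t (Q.start w mem args) = some c ∧ Q.Halted c ∧
    c.out = [ans] ∧ c.mem = mem

end Program

/-- The `L` consecutive bits from bit position `a` on of a memory of `w`-bit words. -/
def memBits (w : ℕ) (mem : ℕ → ℕ) (a L : ℕ) : List Bool :=
  (List.range L).map fun i => (mem ((a + i) / w)).testBit ((a + i) % w)

end WordRAM

/-! ### Adjacency arrays -/

/-- The lists of (out-)neighbours of a graph on `n` vertices, in an arbitrary order.  An undirected
graph is a symmetric digraph: each of its edges occurs in two lists. -/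
structure AdjacencyLists {n : ℕ} (G : Digraph (Fin n)) where
  nbr : Fin n → List (Fin n)
  nodup : ∀ v, (nbr v).Nodup
  mem_nbr : ∀ v u, u ∈ nbr v ↔ G.Adj v u

/-- The vertices are called `1, …, n` on the machine. -/
def vertexLabel {n : ℕ} (v : Fin n) : ℕ := v + 1

/-! ### Depth-first search -/

/-- Visit `v`, coming from `p`: nothing happens if `v` has been discovered; otherwise `v` is
discovered, with parent `p`, and its neighbours are visited from `v` one after the other.
`found` lists the discovered vertices, each with its parent, in the order of discovery.
The first argument bounds the depth of the recursion; `n` is always enough, since the vertices that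
are being visited are distinct. -/
def dfsVisit {n : ℕ} (nbr : Fin n → List (Fin n)) :
    ℕ → List (Fin n × Option (Fin n)) → Option (Fin n) → Fin n → List (Fin n × Option (Fin n))
  | 0, found, _, _ => found
  | d + 1, found, p, v =>
      if v ∈ found.map Prod.fst then found
      else (nbr v).foldl (fun f u => dfsVisit nbr d f (some v) u) (found ++ [(v, p)])

/-- The number of children of `v` among the vertices in a list of vertices with their parents. -/
def childCount {n : ℕ} (found : List (Fin n × Option (Fin n))) (v : Fin n) : ℕ :=
  found.countP fun e => e.2 = some v

/-- `⌊lg ⌊lg n⌋⌋ + 1`. -/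
def lglg (n : ℕ) : ℕ := Nat.log 2 (Nat.log 2 n) + 1

namespace AdjacencyLists

variable {n : ℕ} {G : Digraph (Fin n)}

/-- The number of entries of all lists: the number of edges of a directed graph, and twice that
number for an undirected one. -/
def m (A : AdjacencyLists G) : ℕ := ∑ v, (A.nbr v).length

/-- The adjacency array: the number of vertices, then for every vertex the index (in this array,
starting from `0`) of its last neighbour, then the lists of neighbours. -/
def array (A : AdjacencyLists G) : List ℕ :=
  n :: (List.ofFn fun v : Fin n => n + ∑ u ∈ Finset.Iic v, (A.nbr u).length) ++
    (List.ofFn fun v : Fin n => (A.nbr v).map vertexLabel).flatten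

/-- The depth-first search that starts from `s` and, as long as there are undiscovered vertices,
starts again from the first of them: the vertices in the order of discovery, each with its parent in
the depth-first search tree (`none` for roots). -/
def dfs (A : AdjacencyLists G) (s : Fin n) : List (Fin n × Option (Fin n)) :=
  (s :: List.finRange n).foldl (fun f v => dfsVisit A.nbr n f none v) []

end AdjacencyLists

namespace WordRAM

/-! ### A structured language for the word RAM -/

/-! The proof exhibits the programs and verifies them by invariants. They are written in a small
structured language with variables, arrays, a clock and a log of reports. `Big.goes` shows that
compiled code follows this semantics with a bounded number of machine steps per clock unit, and that
every log entry corresponds to an instant of the machine's run at which the memory holds the logged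
arrays. From then on one argues with `wp` about abstract states only.

The search. A full stack would need about `n * lg n` bits, so only a cyclic buffer of two segments
of `n / lg n + 1` entries is kept. An entry that leaves the buffer survives as two fields of `O(lg
lg n)` bits: a colour that names its segment, and the number of the group of neighbours (the list
being cut into about `lg n` groups) in which its last treated neighbour lies. For each segment one
word records its lowest vertex. A dropped segment is rebuilt from there: the successor of an entry
on the stack is the first neighbour, from the recorded group on, with the colour of the segment.
This is correct because each earlier neighbour was discovered before that successor was pushed, so
it is off the stack, in a lower segment, or already rebuilt (`Search.push`, `wp_restore`). A move of
a segment costs `O((n + m) / lg n)`, and between two moves the height of the stack changes by a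
whole segment, so there are at most `2 * lg n` moves (`wp_search`). That the explicit stack computes
the recursively defined search is the content of `contin_pop`, `contin_found` and `contin_push`.

Degrees during the search. Counts below `thr n` are kept in fields. When a count reaches the
threshold, its block of `lb n` vertices gets a table of whole words. Each table can be charged to
`thr n` children of its own block, so there are at most `n / thr n` tables, and the threshold
exceeds the block length by so much that they need only `O(n / ll n)` bits (`Counts`, `wp_incr`,
`mul_lb_le_thr`).

Degrees at the end. The degree sequence is written in unary, with one zero per vertex and at most
`n` ones, hence `2 * n` bits. A query locates the small block of the vertex by a word for the large
block plus a field for the small one. If the code of the small block fits into a chunk of about `lg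
n / 2` bits inside one word, the chunk is cut out and the degree is looked up in a table over all
chunks. Otherwise the block is long and its degrees are listed separately; each long block uses up a
chunk of the string or crosses a word boundary, so there are few of them (`BlocksOk`, `wp_place`,
`wp_query`). Large blocks with a table need none of this.

Everything except the string becomes `O(n)` after multiplication by `ll n` (`base_22_le`), which
gives `o(n)` further bits. The arrays of the final representation lie directly behind a header of
`28` words with all parameters, so the first part of the memory suffices for a query, and the query
programs recover their parameters in constant time. -/

/-- The exact value of a word operation; only `shl` is truncated to the word length. -/
def Op.val (w : ℕ) : Op → ℕ → ℕ → ℕ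
  | .add, a, b => a + b
  | .sub, a, b => a - b
  | .mul, a, b => a * b
  | .div, a, b => a / b
  | .mod, a, b => a % b
  | .and, a, b => a &&& b
  | .or, a, b => a ||| b
  | .xor, a, b => a ^^^ b
  | .shl, a, b => (a <<< b) % 2 ^ w
  | .shr, a, b => a >>> b
  | .lt, a, b => if a < b then 1 else 0

/-- The operation does not overflow. -/
def Op.ok (w : ℕ) : Op → ℕ → ℕ → Prop
  | .add, a, b => a + b < 2 ^ w
  | .sub, a, b => b ≤ a
  | .mul, a, b => a * b < 2 ^ w
  | _, _, _ => True

/-- Only addition, subtraction and multiplication could wrap around, and `Op.ok` excludes this. The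
left shift keeps its reduction, because the search measures the word length by shifting a bit out of
the word. -/
theorem Op.eval_eq {w : ℕ} (hw : 0 < w) {o : Op} {a b : ℕ} (ha : a < 2 ^ w) (hb : b < 2 ^ w)
    (h : o.ok w a b) : o.eval w a b = o.val w a b ∧ o.val w a b < 2 ^ w := by
  have key : ∀ {x y : ℕ}, x = y % 2 ^ w → y < 2 ^ w → x = y ∧ y < 2 ^ w := by
    intro x y h1 h2
    exact ⟨by rw [h1, Nat.mod_eq_of_lt h2], h2⟩
  have hpos : 1 < 2 ^ w := Nat.one_lt_two_pow hw.ne'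
  cases o with
  | add => exact key rfl h
  | sub =>
    have h' : b ≤ a := h
    refine ⟨?_, (Nat.sub_le _ _).trans_lt ha⟩
    simp only [Op.eval, Op.val]
    rw [show a + 2 ^ w - b = a - b + 2 ^ w by omega, Nat.add_mod_right,
      Nat.mod_eq_of_lt ((Nat.sub_le _ _).trans_lt ha)]
  | mul => exact key rfl h
  | div => exact key rfl ((Nat.div_le_self _ _).trans_lt ha)
  | mod => exact key rfl ((Nat.mod_le _ _).trans_lt ha)
  | and => exact key rfl (Nat.and_lt_two_pow _ hb)
  | or => exact key rfl (Nat.or_lt_two_pow ha hb)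
  | xor => exact key rfl (Nat.xor_lt_two_pow ha hb)
  | shl => exact ⟨rfl, Nat.mod_lt _ (by positivity)⟩
  | shr =>
    refine key rfl (lt_of_le_of_lt ?_ ha)
    simp only [Op.val, Nat.shiftRight_eq_div_pow]
    exact Nat.div_le_self _ _
  | lt => exact key rfl (by simp only [Op.val]; split <;> omega)

/-- Expressions over variables, parameters, the input, word arrays and packed arrays.  An array is
named by the parameter that holds its base address. -/
inductive Expr where
  | lit (c : ℕ)
  | var (x : ℕ)
  | par (i : ℕ)
  | bin (o : Op) (a b : Expr)
  | inp (a : Expr)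
  | word (b : ℕ) (a : Expr)
  | field (b : ℕ) (a : Expr)

/-- Structured statements. -/
inductive Stmt where
  | skip
  | assign (x : ℕ) (e : Expr)
  | storeWord (b : ℕ) (i e : Expr)
  | storeField (b : ℕ) (i e : Expr)
  | report (e : Expr)
  | seq (s t : Stmt)
  | ite (e : Expr) (s t : Stmt)
  | loop (e : Expr) (s : Stmt)

/-- The fixed surroundings of a structured program: word length, input, parameters, and the lengths
of the word arrays and of the packed arrays.  The parameters `1`, `2`, `3` are the number of fields
of a word, the number `F` of bits of a field, and `2 ^ F`. -/
structure Env where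
  w : ℕ
  input : List ℕ
  par : ℕ → ℕ
  wlen : ℕ → ℕ
  plen : ℕ → ℕ

/-- The state of a structured program: variables, arrays, the reported values, each with the arrays
at the time of the report, and a clock. -/
structure St where
  reg : ℕ → ℕ
  arr : ℕ → ℕ → ℕ
  log : List (ℕ × (ℕ → ℕ → ℕ))
  clk : ℕ

/-- The input word with the given index. -/
def rd (input : List ℕ) (i : ℕ) : ℕ := input.getD i 0

namespace Expr

/-- Packed and unpacked arrays look alike here; they differ only in the range conditions and in the
compiled code. -/
def val (E : Env) (τ : St) : Expr → ℕ
  | lit c => c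
  | var x => τ.reg x
  | par i => E.par i
  | bin o a b => o.val E.w (a.val E τ) (b.val E τ)
  | inp a => rd E.input (a.val E τ)
  | word b a => τ.arr b (a.val E τ)
  | field b a => τ.arr b (a.val E τ)

/-- The expression can be evaluated without overflow and without access out of range. -/
def ok (E : Env) (τ : St) : Expr → Prop
  | lit c => c < 2 ^ E.w
  | var _ => True
  | par _ => True
  | bin o a b => a.ok E τ ∧ b.ok E τ ∧ o.ok E.w (a.val E τ) (b.val E τ)
  | inp a => a.ok E τ ∧ a.val E τ < E.input.length
  | word b a => a.ok E τ ∧ a.val E τ < E.wlen b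
  | field b a => a.ok E τ ∧ a.val E τ < E.plen b

/-- All variables and parameters are in range, and at most `k` temporaries are needed. -/
def wf : ℕ → Expr → Bool
  | 0, _ => false
  | _ + 1, lit _ => true
  | _ + 1, var x => x < 40
  | _ + 1, par i => i < 48
  | k + 1, bin _ a b => a.wf (k + 1) && b.wf k
  | k + 1, inp a => a.wf (k + 1)
  | k + 1, word b a => decide (b < 48) && a.wf (k + 1)
  | k + 1, field b a => decide (b < 48) && a.wf k && a.wf (k + 1)

end Expr

/-- Advance the clock. -/
def St.tick (τ : St) : St := { τ with clk := τ.clk + 1 }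

/-- Set a variable. -/
def St.setReg (τ : St) (x v : ℕ) : St :=
  { τ with reg := Function.update τ.reg x v, clk := τ.clk + 1 }

/-- Set an array entry. -/
def St.setArr (τ : St) (b i v : ℕ) : St :=
  { τ with
    arr := Function.update τ.arr b (Function.update (τ.arr b) i v)
    clk := τ.clk + 1 }

/-- Report a value. -/
def St.emit (τ : St) (v : ℕ) : St :=
  { τ with log := τ.log ++ [(v, τ.arr)], clk := τ.clk + 1 }

/-- Big-step semantics. -/
inductive Big (E : Env) : Stmt → St → St → Prop
  | skip (τ) : Big E .skip τ τ
  | assign {x e τ} (h : e.ok E τ) : Big E (.assign x e) τ (τ.setReg x (e.val E τ))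
  | storeWord {b i e τ} (hi : i.ok E τ) (he : e.ok E τ) (hb : i.val E τ < E.wlen b) :
      Big E (.storeWord b i e) τ (τ.setArr b (i.val E τ) (e.val E τ))
  | storeField {b i e τ} (hi : i.ok E τ) (he : e.ok E τ) (hb : i.val E τ < E.plen b)
      (hv : e.val E τ < E.par 3) :
      Big E (.storeField b i e) τ (τ.setArr b (i.val E τ) (e.val E τ))
  | report {e τ} (he : e.ok E τ) : Big E (.report e) τ (τ.emit (e.val E τ))
  | seq {s t τ τ₁ τ₂} (h₁ : Big E s τ τ₁) (h₂ : Big E t τ₁ τ₂) : Big E (.seq s t) τ τ₂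
  | ite_true {e s t τ τ'} (he : e.ok E τ) (hv : e.val E τ ≠ 0) (h : Big E s τ.tick τ') :
      Big E (.ite e s t) τ τ'
  | ite_false {e s t τ τ'} (he : e.ok E τ) (hv : e.val E τ = 0) (h : Big E t τ.tick τ') :
      Big E (.ite e s t) τ τ'
  | loop_done {e s τ} (he : e.ok E τ) (hv : e.val E τ = 0) : Big E (.loop e s) τ τ.tick
  | loop_step {e s τ τ₁ τ₂} (he : e.ok E τ) (hv : e.val E τ ≠ 0) (h₁ : Big E s τ.tick τ₁)
      (h₂ : Big E (.loop e s) τ₁ τ₂) : Big E (.loop e s) τ τ₂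

/-! ### Compilation -/

/-- The register with number `x`. -/
def fr (x : ℕ) : Fin 128 := Fin.ofNat 128 x

theorem fr_inj {x y : ℕ} (hx : x < 128) (hy : y < 128) : fr x = fr y ↔ x = y := by
  simp [fr, Fin.ext_iff, Nat.mod_eq_of_lt hx, Nat.mod_eq_of_lt hy]

theorem fr_val {x : ℕ} (hx : x < 128) : (fr x).val = x := by
  simp [fr, Nat.mod_eq_of_lt hx]

/-- Code that puts the value of an expression into temporary `d`. -/
def Expr.code : Expr → ℕ → List (Instr 128)
  | lit c, d => [.const (fr (88 + d)) c]
  | var x, d => [.move (fr (88 + d)) (fr (48 + x))]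
  | par i, d => [.move (fr (88 + d)) (fr i)]
  | bin o a b, d => a.code d ++ b.code (d + 1) ++
      [.op o (fr (88 + d)) (fr (88 + d)) (fr (88 + (d + 1)))]
  | inp a, d => a.code d ++ [.read (fr (88 + d)) (fr (88 + d))]
  | word b a, d => a.code d ++ [.op .add (fr (88 + d)) (fr b) (fr (88 + d)),
      .load (fr (88 + d)) (fr (88 + d))]
  | field b a, d => a.code d ++
      [.op .div (fr (88 + (d + 1))) (fr (88 + d)) (fr 1),
       .op .add (fr (88 + (d + 1))) (fr b) (fr (88 + (d + 1))),
       .load (fr (88 + (d + 1))) (fr (88 + (d + 1))),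
       .op .mod (fr (88 + d)) (fr (88 + d)) (fr 1),
       .op .mul (fr (88 + d)) (fr (88 + d)) (fr 2),
       .op .shr (fr (88 + d)) (fr (88 + (d + 1))) (fr (88 + d)),
       .op .mod (fr (88 + d)) (fr (88 + d)) (fr 3)]

/-- The store part of an assignment to a packed array: index in temporary `0`, value in `1`. -/
def fieldStoreCode (b : ℕ) : List (Instr 128) :=
  [.op .div (fr 90) (fr 88) (fr 1),
   .op .add (fr 90) (fr b) (fr 90),
   .load (fr 91) (fr 90),
   .op .mod (fr 88) (fr 88) (fr 1),
   .op .mul (fr 88) (fr 88) (fr 2),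
   .op .shr (fr 92) (fr 91) (fr 88),
   .op .mod (fr 92) (fr 92) (fr 3),
   .op .shl (fr 92) (fr 92) (fr 88),
   .op .sub (fr 91) (fr 91) (fr 92),
   .op .shl (fr 89) (fr 89) (fr 88),
   .op .add (fr 91) (fr 91) (fr 89),
   .store (fr 90) (fr 91)]

namespace Stmt

/-- Code of a statement, to be put at program line `l`. -/
def code : Stmt → ℕ → List (Instr 128)
  | skip, _ => []
  | assign x e, _ => e.code 0 ++ [.move (fr (48 + x)) (fr 88)]
  | storeWord b i e, _ => i.code 0 ++ e.code 1 ++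
      [.op .add (fr 88) (fr b) (fr 88), .store (fr 88) (fr 89)]
  | storeField b i e, _ => i.code 0 ++ e.code 1 ++ fieldStoreCode b
  | report e, _ => e.code 0 ++ [.report (fr 88)]
  | seq s t, l => s.code l ++ t.code (l + (s.code l).length)
  | ite e s t, l =>
      let a := l + (e.code 0).length + 1
      let b := a + (s.code a).length + 1
      e.code 0 ++ [.jumpIfZero (fr 88) b] ++ s.code a ++ [.jump (b + (t.code b).length)] ++ t.code b
  | loop e s, l =>
      let a := l + (e.code 0).length + 1
      e.code 0 ++ [.jumpIfZero (fr 88) (a + (s.code a).length + 1)] ++ s.code a ++ [.jump l]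

/-- A bound for the number of steps per unit of the clock. -/
def cost : Stmt → ℕ
  | skip => 0
  | assign _ e => (e.code 0).length + 1
  | storeWord _ i e => (i.code 0).length + (e.code 1).length + 2
  | storeField _ i e => (i.code 0).length + (e.code 1).length + 12
  | report e => (e.code 0).length + 1
  | seq s t => max s.cost t.cost
  | ite e s t => max ((e.code 0).length + 2) (max s.cost t.cost)
  | loop e s => max ((e.code 0).length + 2) s.cost

def wf : Stmt → Bool
  | skip => true
  | assign x e => decide (x < 40) && e.wf 40
  | storeWord b i e => decide (b < 48) && i.wf 30 && e.wf 30
  | storeField b i e => decide (b < 48) && i.wf 30 && e.wf 30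
  | report e => e.wf 40
  | seq s t => s.wf && t.wf
  | ite e s t => e.wf 40 && s.wf && t.wf
  | loop e s => e.wf 40 && s.wf

end Stmt

/-! ### Correctness of the compilation -/

/-- The program with 128 registers and the given code. -/
abbrev prog (code : List (Instr 128)) : Program := ⟨128, code⟩

/-- `l` occurs in `code` from line `pc` on. -/
def CodeAt (code : List (Instr 128)) (pc : ℕ) (l : List (Instr 128)) : Prop :=
  ∃ l₁ l₂, code = l₁ ++ l ++ l₂ ∧ l₁.length = pc

theorem CodeAt.left {code pc l l'} (h : CodeAt code pc (l ++ l')) : CodeAt code pc l := by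
  obtain ⟨l₁, l₂, h, h'⟩ := h
  exact ⟨l₁, l' ++ l₂, by simp [h], h'⟩

theorem CodeAt.right {code pc l l'} (h : CodeAt code pc (l ++ l')) :
    CodeAt code (pc + l.length) l' := by
  obtain ⟨l₁, l₂, h, h'⟩ := h
  exact ⟨l₁ ++ l, l₂, by simp [h], by simp [h']⟩

theorem CodeAt.get {code pc i l} (h : CodeAt code pc (i :: l)) : code[pc]? = some i := by
  obtain ⟨l₁, l₂, rfl, rfl⟩ := h
  simp

theorem Program.run_add (P : Program) (w : ℕ) (input : List ℕ) (S a b : ℕ)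
    (c : Config P.numRegs) :
    P.run w input S (a + b) c = (P.run w input S a c).bind (P.run w input S b) := by
  induction a generalizing c with
  | zero => simp [Program.run]
  | succ a ih =>
    rw [Nat.succ_add, Program.run, Program.run]
    cases P.step w input S c with
    | none => rfl
    | some c' => simpa using ih c'

theorem run_trans {P : Program} {w : ℕ} {input : List ℕ} {S a b : ℕ} {c c₁ c₂ : Config P.numRegs}
    (h₁ : P.run w input S a c = some c₁) (h₂ : P.run w input S b c₁ = some c₂) :
    P.run w input S (a + b) c = some c₂ := by
  rw [Program.run_add, h₁]
  exact h₂

theorem run_one {code : List (Instr 128)} {w : ℕ} {input : List ℕ} {S : ℕ} {c c' : Config 128}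
    {i : Instr 128} (hi : code[c.pc]? = some i) (h : Program.exec w input S c i = some c') :
    (prog code).run w input S 1 c = some c' := by
  simp [Program.run, Program.step, hi, h]

/-- Execute a list of instructions one after the other. -/
def execs (w : ℕ) (input : List ℕ) (S : ℕ) : List (Instr 128) → Config 128 → Option (Config 128)
  | [], c => some c
  | i :: l, c => (Program.exec w input S c i).bind (execs w input S l)

theorem execs_append (w : ℕ) (input : List ℕ) (S : ℕ) (l l' : List (Instr 128))
    (c : Config 128) :
    execs w input S (l ++ l') c = (execs w input S l c).bind (execs w input S l') := by
  induction l generalizing c with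
  | nil => rfl
  | cons i l ih =>
    simp only [List.cons_append, execs]
    cases Program.exec w input S c i with
    | none => rfl
    | some c' => simpa using ih c'

/-- The instruction is not a jump. -/
def Instr.straight : Instr 128 → Bool
  | .jump _ => false
  | .jumpIfZero _ _ => false
  | _ => true

/-- Straight instructions raise the program counter by exactly one, so executing the list agrees
with running the machine through the same stretch of code. -/
theorem run_execs {code : List (Instr 128)} {w : ℕ} {input : List ℕ} {S : ℕ}
    {l : List (Instr 128)} {c c' : Config 128} (hc : CodeAt code c.pc l)
    (hl : l.all Instr.straight) (h : execs w input S l c = some c') :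
    (prog code).run w input S l.length c = some c' ∧ c'.pc = c.pc + l.length := by
  induction l generalizing c with
  | nil =>
    simp only [execs, Option.some.injEq] at h
    subst h
    exact ⟨rfl, rfl⟩
  | cons i l ih =>
    simp only [execs] at h
    obtain ⟨c₁, h₁, h₂⟩ := Option.bind_eq_some_iff.mp h
    simp only [List.all_cons, Bool.and_eq_true] at hl
    have hpc : c₁.pc = c.pc + 1 := by
      cases i <;> simp_all [Program.exec, Instr.straight] <;> try (subst h₁; rfl)
      · obtain ⟨x, _, rfl⟩ := h₁; rfl
      · obtain ⟨_, rfl⟩ := h₁; rfl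
      · obtain ⟨_, rfl⟩ := h₁; rfl
    have := ih (c := c₁) (by rw [hpc]; exact CodeAt.right (l := [i]) hc) hl.2 h₂
    refine ⟨?_, by rw [this.2, hpc, List.length_cons]; omega⟩
    rw [List.length_cons, Nat.add_comm]
    exact run_trans (run_one hc.get h₁) this.1

/-- The memory holds the arrays. -/
structure MemRep (E : Env) (arr : ℕ → ℕ → ℕ) (mem : ℕ → ℕ) : Prop where
  lt : ∀ a, mem a < 2 ^ E.w
  word : ∀ b i, i < E.wlen b → mem (E.par b + i) = arr b i
  field : ∀ b i, i < E.plen b →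
    mem (E.par b + i / E.par 1) / 2 ^ (i % E.par 1 * E.par 2) % 2 ^ E.par 2 = arr b i

/-- The arrays fit into `S` words of memory and do not overlap. -/
structure Env.Valid (E : Env) (S : ℕ) : Prop where
  w_pos : 0 < E.w
  S_le : S ≤ 2 ^ E.w
  input_lt : ∀ x ∈ E.input, x < 2 ^ E.w
  word_lt : ∀ b i, i < E.wlen b → E.par b + i < S
  field_lt : ∀ b i, i < E.plen b → E.par b + i / E.par 1 < S
  field_par : ∀ b i, i < E.plen b →
    0 < E.par 1 ∧ E.par 1 * E.par 2 ≤ E.w ∧ E.par 2 < E.w ∧ E.par 3 = 2 ^ E.par 2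
  word_word : ∀ b b' i i', b ≠ b' → i < E.wlen b → i' < E.wlen b' → E.par b + i ≠ E.par b' + i'
  word_field : ∀ b b' i i', i < E.wlen b → i' < E.plen b' →
    E.par b + i ≠ E.par b' + i' / E.par 1
  field_field : ∀ b b' i i', b ≠ b' → i < E.plen b → i' < E.plen b' →
    E.par b + i / E.par 1 ≠ E.par b' + i' / E.par 1

/-- A machine configuration represents an abstract state. -/
structure Rep (E : Env) (τ : St) (c : Config 128) : Prop where
  par : ∀ i < 48, c.reg (fr i) = E.par i
  var : ∀ x < 40, c.reg (fr (48 + x)) = τ.reg x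
  lt : ∀ r, c.reg r < 2 ^ E.w
  mem : MemRep E τ.arr c.mem
  out : c.out = τ.log.map Prod.fst

/-- `c'` differs from `c` only in the temporaries from `d` on, and in the program counter. -/
structure SameBut (d : ℕ) (c c' : Config 128) : Prop where
  mem : c'.mem = c.mem
  out : c'.out = c.out
  reg : ∀ r : Fin 128, r.val < 88 + d → c'.reg r = c.reg r

theorem SameBut.trans {d : ℕ} {c c₁ c₂ : Config 128} (h₁ : SameBut d c c₁) (h₂ : SameBut d c₁ c₂) :
    SameBut d c c₂ :=
  ⟨h₂.mem.trans h₁.mem, h₂.out.trans h₁.out, fun r hr => (h₂.reg r hr).trans (h₁.reg r hr)⟩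

theorem SameBut.mono {d d' : ℕ} (hd : d ≤ d') {c c' : Config 128} (h : SameBut d' c c') :
    SameBut d c c' :=
  ⟨h.mem, h.out, fun r hr => h.reg r (by omega)⟩

theorem Rep.of_same {E : Env} {τ : St} {c c' : Config 128} {d : ℕ} (h : Rep E τ c)
    (hs : SameBut d c c') (hlt : ∀ r, c'.reg r < 2 ^ E.w) : Rep E τ c' where
  par i hi := by rw [hs.reg _ (by rw [fr_val (by omega)]; omega), h.par i hi]
  var x hx := by rw [hs.reg _ (by rw [fr_val (by omega)]; omega), h.var x hx]
  lt := hlt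
  mem := by rw [hs.mem]; exact h.mem
  out := by rw [hs.out]; exact h.out

theorem execs_op {w : ℕ} {input : List ℕ} {S : ℕ} {l : List (Instr 128)} {c : Config 128}
    {o : Op} {d a b : Fin 128} (hw : 0 < w) (ha : c.reg a < 2 ^ w) (hb : c.reg b < 2 ^ w)
    (h : o.ok w (c.reg a) (c.reg b)) :
    execs w input S (.op o d a b :: l) c =
      execs w input S l { c with
        pc := c.pc + 1, reg := Function.update c.reg d (o.val w (c.reg a) (c.reg b)) } := by
  simp [execs, Program.exec, (Op.eval_eq hw ha hb h).1]

theorem update_lt {w : ℕ} {reg : Fin 128 → ℕ} (h : ∀ r, reg r < 2 ^ w) {d : Fin 128} {v : ℕ}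
    (hv : v < 2 ^ w) (r : Fin 128) : Function.update reg d v r < 2 ^ w := by
  rw [Function.update_apply]
  split
  · exact hv
  · exact h r

theorem Op.val_lt {w : ℕ} (hw : 0 < w) {o : Op} {a b : ℕ} (ha : a < 2 ^ w) (hb : b < 2 ^ w)
    (h : o.ok w a b) : o.val w a b < 2 ^ w := (Op.eval_eq hw ha hb h).2

theorem SameBut.update {c : Config 128} {d x v : ℕ} (hx : 88 + d ≤ x) (hx' : x < 128) :
    SameBut d c { c with pc := c.pc + 1, reg := Function.update c.reg (fr x) v } where
  mem := rfl
  out := rfl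
  reg r hr := by
    have : r ≠ fr x := fun h => by rw [h, fr_val hx'] at hr; omega
    simp [this]

/-- One arithmetic step that writes to a temporary. -/
theorem execs_op_same {w : ℕ} (input : List ℕ) (S : ℕ) {c : Config 128} (o : Op)
    (d x : ℕ) {a b : Fin 128} (hw : 0 < w) (hc : ∀ r, c.reg r < 2 ^ w)
    (hx : 88 + d ≤ x) (hx' : x < 128) {u v : ℕ} (ha : c.reg a = u) (hb : c.reg b = v)
    (h : o.ok w u v) :
    ∃ c₁, (∀ l, execs w input S (.op o (fr x) a b :: l) c = execs w input S l c₁) ∧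
      SameBut d c c₁ ∧ (∀ r, c₁.reg r < 2 ^ w) ∧ c₁.reg (fr x) = o.val w u v ∧
      ∀ y < 128, y ≠ x → c₁.reg (fr y) = c.reg (fr y) := by
  subst ha hb
  refine ⟨_, fun l => execs_op hw (hc a) (hc b) h, .update hx hx', update_lt hc (Op.val_lt hw (hc a)
    (hc b) h),
    by simp, fun y hy hyx => ?_⟩
  have : fr y ≠ fr x := fun h => hyx ((fr_inj hy hx').mp h)
  simp [this]

/-- One load into a temporary. -/
theorem execs_load_same {w : ℕ} (input : List ℕ) (S : ℕ) {c : Config 128}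
    (d x : ℕ) {a : Fin 128} (hc : ∀ r, c.reg r < 2 ^ w) (hm : ∀ a, c.mem a < 2 ^ w)
    (hx : 88 + d ≤ x) (hx' : x < 128) {u : ℕ} (ha : c.reg a = u) (h : u < S) :
    ∃ c₁, (∀ l, execs w input S (.load (fr x) a :: l) c = execs w input S l c₁) ∧
      SameBut d c c₁ ∧ (∀ r, c₁.reg r < 2 ^ w) ∧ c₁.reg (fr x) = c.mem u ∧
      ∀ y < 128, y ≠ x → c₁.reg (fr y) = c.reg (fr y) := by
  subst ha
  refine ⟨{ c with pc := c.pc + 1, reg := Function.update c.reg (fr x) (c.mem (c.reg a)) },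
    fun l => by simp [execs, Program.exec, h], .update hx hx', update_lt hc (hm _), by simp,
    fun y hy hyx => ?_⟩
  have : fr y ≠ fr x := fun h => hyx ((fr_inj hy hx').mp h)
  simp [this]

theorem Expr.code_straight (e : Expr) (d : ℕ) : (e.code d).all Instr.straight := by
  induction e generalizing d <;> simp only [Expr.code, List.all_append, List.all_cons, *] <;> rfl

/-- Code for depth `d` writes only to temporaries from `d` on, so the left operand of a binary
operation survives while the right one is evaluated at depth `d + 1`. The budget `k` counts the
temporaries that are left. -/
theorem Expr.execs_code {E : Env} {S : ℕ} (hE : E.Valid S) {τ : St} (e : Expr) {d k : ℕ}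
    (hwf : e.wf k) (hd : d + k ≤ 40) (hok : e.ok E τ) {c : Config 128} (hc : Rep E τ c) :
    ∃ c', execs E.w E.input S (e.code d) c = some c' ∧ SameBut d c c' ∧
      (∀ r, c'.reg r < 2 ^ E.w) ∧ c'.reg (fr (88 + d)) = e.val E τ := by
  have hw := hE.w_pos
  induction e generalizing d k c with
  | lit v =>
    obtain _ | k := k
    · simp [wf] at hwf
    refine ⟨_, rfl, .update le_rfl (by omega), update_lt hc.lt (Nat.mod_lt _ (by positivity)), ?_⟩
    have : v < 2 ^ E.w := hok
    simp [val, Nat.mod_eq_of_lt this]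
  | var x =>
    obtain _ | k := k
    · simp [wf] at hwf
    have hx : x < 40 := by simpa [wf] using hwf
    refine ⟨_, rfl, .update le_rfl (by omega), update_lt hc.lt (hc.lt _), ?_⟩
    simp [val, hc.var x hx]
  | par x =>
    obtain _ | k := k
    · simp [wf] at hwf
    have hx : x < 48 := by simpa [wf] using hwf
    refine ⟨_, rfl, .update le_rfl (by omega), update_lt hc.lt (hc.lt _), ?_⟩
    simp [val, hc.par x hx]
  | bin o a b iha ihb =>
    obtain _ | k := k
    · simp [wf] at hwf
    simp only [wf, Bool.and_eq_true] at hwf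
    obtain ⟨hoa, hob, ho⟩ := hok
    obtain ⟨c₁, h₁, s₁, l₁, v₁⟩ := iha hwf.1 hd hoa hc
    obtain ⟨c₂, h₂, s₂, l₂, v₂⟩ := ihb (d := d + 1) hwf.2 (by omega) hob (hc.of_same s₁ l₁)
    have v₁' : c₂.reg (fr (88 + d)) = a.val E τ := by
      obtain _ | k := k
      · cases b <;> simp [wf] at hwf
      rw [s₂.reg _ (by rw [fr_val (by omega)]; omega), v₁]
    obtain _ | k := k
    · cases b <;> simp [wf] at hwf
    obtain ⟨c₃, h₃, s₃, l₃, v₃, -⟩ := execs_op_same E.input S o d (88 + d) hw l₂ le_rfl (by omega)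
      v₁' v₂ ho
    exact ⟨c₃, by simp only [code, execs_append, h₁, h₂, h₃, Option.bind_some]; rfl,
      (s₁.trans (s₂.mono (by omega))).trans s₃, l₃, v₃⟩
  | inp a iha =>
    obtain _ | k := k
    · simp [wf] at hwf
    obtain ⟨hoa, ho⟩ := hok
    obtain ⟨c₁, h₁, s₁, l₁, v₁⟩ := iha (k := k + 1) hwf hd hoa hc
    have hx : E.input[c₁.reg (fr (88 + d))]? = some (rd E.input (a.val E τ)) := by
      rw [v₁]; simp [ho, rd]
    have hlt : rd E.input (a.val E τ) < 2 ^ E.w := by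
      apply hE.input_lt
      rw [rd, List.getD_eq_getElem _ _ ho]
      exact List.getElem_mem _
    refine ⟨_, by simp only [code, execs_append, h₁, Option.bind_some, execs, Program.exec, hx,
      Option.map_some]; rfl, s₁.trans (.update le_rfl (by omega)), update_lt l₁ (Nat.mod_lt _
          (by positivity)), ?_⟩
    simp only [val, Function.update_self]
    exact Nat.mod_eq_of_lt hlt
  | word b a iha =>
    obtain _ | k := k
    · simp [wf] at hwf
    simp only [wf, Bool.and_eq_true, decide_eq_true_eq] at hwf
    obtain ⟨hoa, ho⟩ := hok
    obtain ⟨c₁, h₁, s₁, l₁, v₁⟩ := iha (k := k + 1) hwf.2 hd hoa hc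
    have r₁ := hc.of_same s₁ l₁
    have hS := hE.word_lt _ _ ho
    obtain ⟨c₂, h₂, s₂, l₂, v₂, -⟩ := execs_op_same E.input S .add d (88 + d) hw l₁ le_rfl
      (by omega) (r₁.par b hwf.1) v₁ (hS.trans_le hE.S_le)
    obtain ⟨c₃, h₃, s₃, l₃, v₃, -⟩ := execs_load_same (w := E.w) E.input S d (88 + d) l₂
      (by rw [s₂.mem]; exact r₁.mem.lt) le_rfl (by omega) v₂ hS
    refine ⟨c₃, by simp only [code, execs_append, h₁, h₂, h₃, Option.bind_some]; rfl,
      (s₁.trans s₂).trans s₃, l₃, ?_⟩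
    rw [v₃, s₂.mem]
    exact r₁.mem.word _ _ ho
  | field b a iha =>
    -- Reading a field needs a second temporary for the containing word, so a budget of one has to
    -- be excluded; the conjunct `a.wf k` in `Expr.wf` does this.
    obtain _ | _ | k := k
    · simp [wf] at hwf
    · cases a <;> simp [wf] at hwf
    simp only [wf, Bool.and_eq_true, decide_eq_true_eq] at hwf
    obtain ⟨hoa, ho⟩ := hok
    obtain ⟨c₁, h₁, s₁, l₁, v₁⟩ := iha (k := k + 2) hwf.2 hd hoa hc
    have r₁ := hc.of_same s₁ l₁
    have hS := hE.field_lt _ _ ho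
    obtain ⟨hK, hKF, hF, hp⟩ := hE.field_par _ _ ho
    set i := a.val E τ with hi
    have hsh : i % E.par 1 * E.par 2 ≤ E.w := le_trans
      (Nat.mul_le_mul_right _ (Nat.mod_lt _ hK).le) hKF
    obtain ⟨c₂, h₂, s₂, l₂, v₂, k₂⟩ := execs_op_same E.input S .div d (88 + (d + 1)) hw l₁
      (by omega) (by omega) v₁ (r₁.par 1 (by norm_num)) trivial
    have r₂ := r₁.of_same s₂ l₂
    obtain ⟨c₃, h₃, s₃, l₃, v₃, k₃⟩ := execs_op_same E.input S .add d (88 + (d + 1)) hw l₂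
      (by omega) (by omega) (r₂.par b hwf.1.1) v₂ (hS.trans_le hE.S_le)
    have r₃ := r₂.of_same s₃ l₃
    obtain ⟨c₄, h₄, s₄, l₄, v₄, k₄⟩ := execs_load_same (w := E.w) E.input S d (88 + (d + 1)) l₃
      r₃.mem.lt (by omega) (by omega) v₃ hS
    have r₄ := r₃.of_same s₄ l₄
    have e₄ : c₄.reg (fr (88 + d)) = i := by
      rw [k₄ _ (by omega) (by omega), k₃ _ (by omega) (by omega), k₂ _ (by omega) (by omega), v₁]
    obtain ⟨c₅, h₅, s₅, l₅, v₅, k₅⟩ := execs_op_same E.input S .mod d (88 + d) hw l₄ (by omega)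
      (by omega) e₄ (r₄.par 1 (by norm_num)) trivial
    have r₅ := r₄.of_same s₅ l₅
    obtain ⟨c₆, h₆, s₆, l₆, v₆, k₆⟩ := execs_op_same E.input S .mul d (88 + d) hw l₅ (by omega)
      (by omega) v₅ (r₅.par 2 (by norm_num))
      (hsh.trans_lt (Nat.lt_two_pow_self))
    have r₆ := r₅.of_same s₆ l₆
    obtain ⟨c₇, h₇, s₇, l₇, v₇, k₇⟩ := execs_op_same E.input S .shr d (88 + d) hw l₆ (by omega)
      (by omega)
      ((k₆ _ (by omega) (by omega)).trans ((k₅ _ (by omega) (by omega)).trans v₄)) v₆ trivial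
    have r₇ := r₆.of_same s₇ l₇
    obtain ⟨c₈, h₈, s₈, l₈, v₈, k₈⟩ := execs_op_same E.input S .mod d (88 + d) hw l₇ (by omega)
      (by omega) v₇ (r₇.par 3 (by norm_num)) trivial
    refine ⟨c₈, ?_, ((((((s₁.trans s₂).trans s₃).trans s₄).trans s₅).trans s₆).trans s₇).trans s₈,
      l₈, ?_⟩
    · simp only [code, execs_append, h₁, h₂, h₃, h₄, h₅, h₆, h₇, h₈, Option.bind_some]; rfl
    · rw [v₈, val, ← hi, ← r₃.mem.field _ _ ho, hp]
      simp only [Op.val, Nat.shiftRight_eq_div_pow]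

/-! ### Stores -/

theorem execs_store {E : Env} {S : ℕ} {c : Config 128} {a b : Fin 128} (h : c.reg a < S) :
    execs E.w E.input S [.store a b] c = some { c with
      pc := c.pc + 1, mem := Function.update c.mem (c.reg a) (c.reg b) } := by
  simp [execs, Program.exec, h]

theorem field_congr {x y t F : ℕ} (h : ∀ b, t ≤ b → b < t + F → x.testBit b = y.testBit b) :
    x / 2 ^ t % 2 ^ F = y / 2 ^ t % 2 ^ F := by
  apply Nat.eq_of_testBit_eq
  intro b
  simp only [Nat.testBit_mod_two_pow, Nat.testBit_div_two_pow]
  by_cases hb : b < F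
  · simp only [hb, decide_true, Bool.true_and]
    exact h _ (by omega) (by omega)
  · simp [hb]

/-- Replacing one field of a word. -/
theorem field_replace {w F s x v : ℕ} (hs : s + F ≤ w) (hx : x < 2 ^ w) (hv : v < 2 ^ F) :
    x / 2 ^ s % 2 ^ F * 2 ^ s ≤ x ∧ v * 2 ^ s < 2 ^ w ∧
    x - x / 2 ^ s % 2 ^ F * 2 ^ s + v * 2 ^ s < 2 ^ w ∧
    (x - x / 2 ^ s % 2 ^ F * 2 ^ s + v * 2 ^ s) / 2 ^ s % 2 ^ F = v ∧
    ∀ t, t + F ≤ s ∨ s + F ≤ t →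
      (x - x / 2 ^ s % 2 ^ F * 2 ^ s + v * 2 ^ s) / 2 ^ t % 2 ^ F = x / 2 ^ t % 2 ^ F := by
  -- The word is split into a high part, the field and a low part. Replacing the field alters only
  -- the middle summand, so no borrow or carry reaches the others.
  have e₁ : x = x / 2 ^ s * 2 ^ s + x % 2 ^ s := by rw [mul_comm]; exact (Nat.div_add_mod _ _).symm
  have e₂ : x / 2 ^ s = x / 2 ^ (s + F) * 2 ^ F + x / 2 ^ s % 2 ^ F := by
    rw [pow_add, ← Nat.div_div_eq_div_mul, mul_comm]; exact (Nat.div_add_mod _ _).symm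
  set hi := x / 2 ^ (s + F) with hhi
  set f := x / 2 ^ s % 2 ^ F with hf
  set lo := x % 2 ^ s with hlo
  have hlo' : lo < 2 ^ s := Nat.mod_lt _ (by positivity)
  have e₃ : x = hi * 2 ^ F * 2 ^ s + f * 2 ^ s + lo := by
    conv_lhs => rw [e₁, e₂]
    ring
  have e₄ : x - f * 2 ^ s + v * 2 ^ s = (hi * 2 ^ F + v) * 2 ^ s + lo := by
    rw [add_mul]; omega
  have hhi' : hi < 2 ^ (w - (s + F)) := by
    rw [hhi, Nat.div_lt_iff_lt_mul (by positivity), ← pow_add, Nat.sub_add_cancel hs]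
    exact hx
  have hbound : ∀ {u}, u < 2 ^ F → (hi * 2 ^ F + u) * 2 ^ s + lo < 2 ^ w := by
    intro u hu
    have h1 : hi * 2 ^ F + u < 2 ^ (w - (s + F)) * 2 ^ F := by
      have : (hi + 1) * 2 ^ F ≤ 2 ^ (w - (s + F)) * 2 ^ F := Nat.mul_le_mul_right _ hhi'
      rw [add_mul] at this; omega
    have h2 : (hi * 2 ^ F + u + 1) * 2 ^ s ≤ 2 ^ (w - (s + F)) * 2 ^ F * 2 ^ s :=
      Nat.mul_le_mul_right _ h1
    have h3 : 2 ^ (w - (s + F)) * 2 ^ F * 2 ^ s = 2 ^ w := by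
      rw [mul_assoc, ← pow_add, ← pow_add]; congr 1; omega
    rw [add_mul] at h2; omega
  have d₁ : ((hi * 2 ^ F + v) * 2 ^ s + lo) / 2 ^ s = hi * 2 ^ F + v := by
    rw [mul_comm, Nat.mul_add_div (by positivity), Nat.div_eq_of_lt hlo', add_zero]
  refine ⟨by omega, ?_, e₄ ▸ hbound hv, ?_, ?_⟩
  · have := hbound hv
    rw [add_mul] at this; omega
  · rw [e₄, d₁, mul_comm, Nat.mul_add_mod, Nat.mod_eq_of_lt hv]
  · intro t ht
    rw [e₄]
    apply field_congr
    intro b hb hb'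
    rcases ht with ht | ht
    · have hb1 : b < s := by omega
      have h1 : ∀ y : ℕ, y.testBit b = (y % 2 ^ s).testBit b := by
        intro y; simp [Nat.testBit_mod_two_pow, hb1]
      rw [h1, h1 x, mul_comm, Nat.mul_add_mod, Nat.mod_eq_of_lt hlo']
    · have h1 : ∀ y : ℕ, y.testBit b = (y / 2 ^ (s + F)).testBit (b - (s + F)) := by
        intro y; rw [Nat.testBit_div_two_pow, Nat.sub_add_cancel (by omega)]
      rw [h1, h1 x, pow_add, ← Nat.div_div_eq_div_mul, d₁, mul_comm hi,
        Nat.mul_add_div (by positivity), Nat.div_eq_of_lt hv, add_zero, ← pow_add]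

/-- Different entries have different addresses by `Env.Valid`, so one write to memory changes one
entry of one array. -/
theorem MemRep.storeWord {E : Env} {S : ℕ} (hE : E.Valid S) {arr : ℕ → ℕ → ℕ} {mem : ℕ → ℕ}
    (h : MemRep E arr mem) {b i v : ℕ} (hi : i < E.wlen b) (hv : v < 2 ^ E.w) :
    MemRep E (Function.update arr b (Function.update (arr b) i v))
      (Function.update mem (E.par b + i) v) where
  lt a := by
    rw [Function.update_apply]; split
    · exact hv
    · exact h.lt a
  word b' i' hi' := by
    by_cases hb : b' = b
    · subst hb
      simp only [Function.update_self, Function.update_apply, Nat.add_left_cancel_iff]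
      split
      · rfl
      · exact h.word _ _ hi'
    · rw [Function.update_of_ne (hE.word_word _ _ _ _ hb hi' hi), Function.update_of_ne hb]
      exact h.word _ _ hi'
  field b' i' hi' := by
    -- An array cannot have both words and fields: `word_field` at two zero indices would separate
    -- an address from itself.
    have hb : b' ≠ b := by
      rintro rfl
      have h0 : 0 < E.plen b' := by omega
      have h1 : 0 < E.wlen b' := by omega
      exact hE.word_field b' b' 0 0 h1 h0 (by simp)
    rw [Function.update_of_ne (hE.word_field _ _ _ _ hi hi').symm, Function.update_of_ne hb]
    exact h.field _ _ hi'

/-- The hypotheses on `y` isolate what matters about the new word: its own field, and the fields at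
positions that do not overlap it. -/
theorem MemRep.storeField {E : Env} {S : ℕ} (hE : E.Valid S) {arr : ℕ → ℕ → ℕ} {mem : ℕ → ℕ}
    (h : MemRep E arr mem) {b i v y : ℕ} (hi : i < E.plen b) (hy : y < 2 ^ E.w)
    (hself : y / 2 ^ (i % E.par 1 * E.par 2) % 2 ^ E.par 2 = v)
    (hne : ∀ t, t + E.par 2 ≤ i % E.par 1 * E.par 2 ∨ i % E.par 1 * E.par 2 + E.par 2 ≤ t →
      y / 2 ^ t % 2 ^ E.par 2 = mem (E.par b + i / E.par 1) / 2 ^ t % 2 ^ E.par 2) :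
    MemRep E (Function.update arr b (Function.update (arr b) i v))
      (Function.update mem (E.par b + i / E.par 1) y) where
  lt a := by
    rw [Function.update_apply]; split
    · exact hy
    · exact h.lt a
  word b' i' hi' := by
    have hb : b' ≠ b := by
      rintro rfl
      have h0 : 0 < E.plen b' := by omega
      have h1 : 0 < E.wlen b' := by omega
      exact hE.word_field b' b' 0 0 h1 h0 (by simp)
    rw [Function.update_of_ne (hE.word_field _ _ _ _ hi' hi), Function.update_of_ne hb]
    exact h.word _ _ hi'
  field b' i' hi' := by
    by_cases hb : b' = b
    · subst hb
      simp only [Function.update_self]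
      by_cases hq : i' / E.par 1 = i / E.par 1
      · rw [hq, Function.update_self]
        by_cases hi'i : i' = i
        · subst hi'i
          rw [hself, Function.update_self]
        · rw [Function.update_of_ne hi'i, hne, ← hq]
          · exact h.field _ _ hi'
          · have hne' : i' % E.par 1 ≠ i % E.par 1 := by
              intro h2
              apply hi'i
              rw [← Nat.div_add_mod i' (E.par 1), hq, h2, Nat.div_add_mod]
            rcases Nat.lt_or_gt_of_ne hne' with h3 | h3
            · left
              have := Nat.mul_le_mul_right (E.par 2) (Nat.succ_le_of_lt h3)
              rwa [Nat.succ_mul] at this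
            · right
              have := Nat.mul_le_mul_right (E.par 2) (Nat.succ_le_of_lt h3)
              rwa [Nat.succ_mul] at this
      · rw [Function.update_of_ne (by omega), Function.update_of_ne (by rintro rfl; exact hq rfl)]
        exact h.field _ _ hi'
    · rw [Function.update_of_ne (hE.field_field _ _ _ _ hb hi' hi), Function.update_of_ne hb]
      exact h.field _ _ hi'

theorem execs_fieldStoreCode {E : Env} {S : ℕ} (hE : E.Valid S) {τ : St} {b i v : ℕ}
    (hb : b < 48) (hi : i < E.plen b) (hv : v < 2 ^ E.par 2) {c : Config 128} (hc : Rep E τ c)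
    (h0 : c.reg (fr 88) = i) (h1 : c.reg (fr 89) = v) :
    ∃ c', execs E.w E.input S (fieldStoreCode b) c = some c' ∧ Rep E (τ.setArr b i v) c' := by
  have hw := hE.w_pos
  have hS := hE.field_lt _ _ hi
  obtain ⟨hK, hKF, hF, hp⟩ := hE.field_par _ _ hi
  set s := i % E.par 1 * E.par 2 with hs
  have hsF : s + E.par 2 ≤ E.w := by
    have := Nat.mul_le_mul_right (E.par 2) (Nat.succ_le_of_lt (Nat.mod_lt i hK))
    rw [Nat.succ_mul] at this; omega
  obtain ⟨c₁, e₁, s₁, l₁, v₁, k₁⟩ := execs_op_same E.input S .div 0 90 hw hc.lt (by omega)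
    (by omega) h0 (hc.par 1 (by norm_num)) trivial
  have r₁ := hc.of_same s₁ l₁
  obtain ⟨c₂, e₂, s₂, l₂, v₂, k₂⟩ := execs_op_same E.input S .add 0 90 hw l₁ (by omega)
    (by omega) (r₁.par b hb) v₁ (hS.trans_le hE.S_le)
  have r₂ := r₁.of_same s₂ l₂
  obtain ⟨c₃, e₃, s₃, l₃, v₃, k₃⟩ := execs_load_same (w := E.w) E.input S 0 91 l₂ r₂.mem.lt
    (by omega) (by omega) v₂ hS
  have r₃ := r₂.of_same s₃ l₃
  set x := c₂.mem (E.par b + i / E.par 1) with hx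
  have hxw : x < 2 ^ E.w := r₂.mem.lt _
  obtain ⟨hr1, hr2, hr3, hr4, hr5⟩ := field_replace hsF hxw hv
  obtain ⟨c₄, e₄, s₄, l₄, v₄, k₄⟩ := execs_op_same E.input S .mod 0 88 hw l₃ (by omega)
    (by omega) ((k₃ 88 (by omega) (by omega)).trans ((k₂ 88 (by omega) (by omega)).trans
      ((k₁ 88 (by omega) (by omega)).trans h0))) (r₃.par 1 (by norm_num)) trivial
  have r₄ := r₃.of_same s₄ l₄
  obtain ⟨c₅, e₅, s₅, l₅, v₅, k₅⟩ := execs_op_same E.input S .mul 0 88 hw l₄ (by omega)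
    (by omega) v₄ (r₄.par 2 (by norm_num)) (show s < _ by
      have := @Nat.lt_two_pow_self E.w; omega)
  have r₅ := r₄.of_same s₅ l₅
  change c₅.reg (fr 88) = s at v₅
  have w₅ : c₅.reg (fr 91) = x := by
    rw [k₅ _ (by omega) (by omega), k₄ _ (by omega) (by omega), v₃]; rfl
  obtain ⟨c₆, e₆, s₆, l₆, v₆, k₆⟩ := execs_op_same E.input S .shr 0 92 hw l₅ (by omega)
    (by omega) w₅ v₅ trivial
  have r₆ := r₅.of_same s₆ l₆
  obtain ⟨c₇, e₇, s₇, l₇, v₇, k₇⟩ := execs_op_same E.input S .mod 0 92 hw l₆ (by omega)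
    (by omega) v₆ (r₆.par 3 (by norm_num)) trivial
  have r₇ := r₆.of_same s₇ l₇
  have u₇ : c₇.reg (fr 88) = s := by
    rw [k₇ _ (by omega) (by omega), k₆ _ (by omega) (by omega), v₅]
  obtain ⟨c₈, e₈, s₈, l₈, v₈, k₈⟩ := execs_op_same E.input S .shl 0 92 hw l₇ (by omega)
    (by omega) v₇ u₇ trivial
  have r₈ := r₇.of_same s₈ l₈
  have w₈ : c₈.reg (fr 91) = x := by
    rw [k₈ _ (by omega) (by omega), k₇ _ (by omega) (by omega), k₆ _ (by omega) (by omega), w₅]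
  have v₈' : c₈.reg (fr 92) = x / 2 ^ s % 2 ^ E.par 2 * 2 ^ s := by
    rw [v₈]
    simp only [Op.val, Nat.shiftRight_eq_div_pow, Nat.shiftLeft_eq, hp]
    exact Nat.mod_eq_of_lt (hr1.trans_lt hxw)
  obtain ⟨c₉, e₉, s₉, l₉, v₉, k₉⟩ := execs_op_same E.input S .sub 0 91 hw l₈ (by omega)
    (by omega) w₈ v₈' hr1
  have r₉ := r₈.of_same s₉ l₉
  have u₉ : c₉.reg (fr 88) = s := by
    rw [k₉ _ (by omega) (by omega), k₈ _ (by omega) (by omega), u₇]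
  have t₉ : c₉.reg (fr 89) = v := by
    rw [k₉ _ (by omega) (by omega), k₈ _ (by omega) (by omega), k₇ _ (by omega) (by omega),
      k₆ _ (by omega) (by omega), k₅ _ (by omega) (by omega), k₄ _ (by omega) (by omega),
      k₃ _ (by omega) (by omega), k₂ _ (by omega) (by omega), k₁ _ (by omega) (by omega), h1]
  obtain ⟨c₁₀, e₁₀, s₁₀, l₁₀, v₁₀, k₁₀⟩ := execs_op_same E.input S .shl 0 89 hw l₉ (by omega)
    (by omega) t₉ u₉ trivial
  have r₁₀ := r₉.of_same s₁₀ l₁₀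
  have v₁₀' : c₁₀.reg (fr 89) = v * 2 ^ s := by
    rw [v₁₀]
    simp only [Op.val, Nat.shiftLeft_eq]
    exact Nat.mod_eq_of_lt hr2
  obtain ⟨c₁₁, e₁₁, s₁₁, l₁₁, v₁₁, k₁₁⟩ := execs_op_same E.input S .add 0 91 hw l₁₀ (by omega)
    (by omega) ((k₁₀ _ (by omega) (by omega)).trans v₉) v₁₀' hr3
  have r₁₁ := r₁₀.of_same s₁₁ l₁₁
  have a₁₁ : c₁₁.reg (fr 90) = E.par b + i / E.par 1 := by
    rw [k₁₁ _ (by omega) (by omega), k₁₀ _ (by omega) (by omega), k₉ _ (by omega) (by omega),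
      k₈ _ (by omega) (by omega), k₇ _ (by omega) (by omega),
      k₆ _ (by omega) (by omega), k₅ _ (by omega) (by omega), k₄ _ (by omega) (by omega),
      k₃ _ (by omega) (by omega), v₂]
    rfl
  have m₁₁ : c₂.mem = c₁₁.mem := by
    rw [s₁₁.mem, s₁₀.mem, s₉.mem, s₈.mem, s₇.mem, s₆.mem, s₅.mem, s₄.mem, s₃.mem]
  refine ⟨{ c₁₁ with
    pc := c₁₁.pc + 1, mem := Function.update c₁₁.mem (c₁₁.reg (fr 90)) (c₁₁.reg (fr 91)) }, ?_, ?_⟩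
  · simp only [fieldStoreCode, e₁, e₂, e₃, e₄, e₅, e₆, e₇, e₈, e₉, e₁₀, e₁₁]
    exact execs_store (by rw [a₁₁]; exact hS)
  · refine ⟨r₁₁.par, r₁₁.var, r₁₁.lt, ?_, r₁₁.out⟩
    rw [a₁₁, v₁₁, ← m₁₁]
    exact r₂.mem.storeField hE hi hr3 hr4 hr5

/-! ### Simulation -/

/-- Between the moments `0` and `t` the machine reports `x`, after having reported `l`; at that time
its memory holds the arrays `x.2`. -/
def Moment (E : Env) (S : ℕ) (code : List (Instr 128)) (c : Config 128) (t : ℕ)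
    (l : List (ℕ × (ℕ → ℕ → ℕ))) (x : ℕ × (ℕ → ℕ → ℕ)) : Prop :=
  ∃ t' < t, ∃ c₁ c₂, (prog code).run E.w E.input S t' c = some c₁ ∧
    (prog code).run E.w E.input S (t' + 1) c = some c₂ ∧ c₁.out = l.map Prod.fst ∧
    c₂.out = (l ++ [x]).map Prod.fst ∧ MemRep E x.2 c₁.mem ∧ c₂.mem = c₁.mem

/-- The machine goes from `c` to line `pc` in a configuration that represents `τ'` (with `z` steps
to spare), with moments of reporting for all entries that are added to the log. -/
def Goes (E : Env) (S : ℕ) (code : List (Instr 128)) (M z : ℕ) (τ τ' : St) (c : Config 128)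
    (pc : ℕ) : Prop :=
  ∃ t c', (prog code).run E.w E.input S t c = some c' ∧ c'.pc = pc ∧ Rep E τ' c' ∧
    t + z + M * τ.clk ≤ M * τ'.clk ∧ τ.log <+: τ'.log ∧
    ∀ l x, τ.log <+: l → l ++ [x] <+: τ'.log → Moment E S code c t l x

theorem Moment.mono {E : Env} {S : ℕ} {code : List (Instr 128)} {c : Config 128} {t t' : ℕ}
    {l x} (h : Moment E S code c t l x) (ht : t ≤ t') : Moment E S code c t' l x := by
  obtain ⟨u, hu, h⟩ := h
  exact ⟨u, by omega, h⟩

theorem Moment.shift {E : Env} {S : ℕ} {code : List (Instr 128)} {c c' : Config 128} {t t' : ℕ}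
    {l x} (h : Moment E S code c' t' l x) (hr : (prog code).run E.w E.input S t c = some c') :
    Moment E S code c (t + t') l x := by
  obtain ⟨u, hu, c₁, c₂, h₁, h₂, h⟩ := h
  exact ⟨t + u, by omega, c₁, c₂, run_trans hr h₁, run_trans (b := u + 1) hr h₂, h⟩

theorem Goes.cons {E : Env} {S : ℕ} {code : List (Instr 128)} {M z : ℕ} {τ τ₁ τ' : St}
    {c c₁ : Config 128} {pc t : ℕ} (hr : (prog code).run E.w E.input S t c = some c₁)
    (ht : t + z + M * τ.clk ≤ M * τ₁.clk) (hl : τ₁.log = τ.log)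
    (h : Goes E S code M 0 τ₁ τ' c₁ pc) :
    Goes E S code M z τ τ' c pc := by
  obtain ⟨t', c', h₁, h₂, h₃, h₄, h₅, h₆⟩ := h
  rw [hl] at h₅ h₆
  exact ⟨t + t', c', run_trans hr h₁, h₂, h₃, by omega, h₅, fun l x hl hx =>
    (h₆ l x hl hx).shift hr⟩

/-- A log entry belongs to the first part of the run or to the second, according to whether it
already occurs in the intermediate log; in the latter case its moment is shifted by the duration of
the first part. -/
theorem Goes.trans {E : Env} {S : ℕ} {code : List (Instr 128)} {M z : ℕ} {τ τ₁ τ' : St}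
    {c : Config 128} {pc pc' : ℕ} (h : Goes E S code M z τ τ₁ c pc)
    (h' : ∀ c₁ : Config 128, c₁.pc = pc → Rep E τ₁ c₁ → Goes E S code M 0 τ₁ τ' c₁ pc') :
    Goes E S code M z τ τ' c pc' := by
  obtain ⟨t, c₁, h₁, h₂, h₃, h₄, h₅, h₆⟩ := h
  obtain ⟨t', c', k₁, k₂, k₃, k₄, k₅, k₆⟩ := h' c₁ h₂ h₃
  refine ⟨t + t', c', run_trans h₁ k₁, k₂, k₃, by omega, h₅.trans k₅, fun l x hl hx => ?_⟩
  by_cases hlen : (l ++ [x]).length ≤ τ₁.log.length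
  · exact (h₆ l x hl (List.prefix_of_prefix_length_le hx k₅ hlen)).mono (by omega)
  · refine (k₆ l x (List.prefix_of_prefix_length_le k₅
      ((List.prefix_append l [x]).trans hx) ?_) hx).shift h₁
    simp at hlen; omega

/-- The spare step reserved by `z = 1` pays for the jump that closes a branch or the body of a loop.
-/
theorem Goes.snoc {E : Env} {S : ℕ} {code : List (Instr 128)} {M : ℕ} {τ τ' : St}
    {c : Config 128} {pc pc' : ℕ} (h : Goes E S code M 1 τ τ' c pc)
    (hj : code[pc]? = some (.jump pc')) : Goes E S code M 0 τ τ' c pc' := by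
  obtain ⟨t, c', h₁, h₂, h₃, h₄, h₅, h₆⟩ := h
  have hone : (prog code).run E.w E.input S 1 c' = some { c' with pc := pc' } :=
    run_one (by rw [h₂]; exact hj) rfl
  exact ⟨t + 1, _, run_trans h₁ hone, rfl, ⟨h₃.par, h₃.var, h₃.lt, h₃.mem, h₃.out⟩, by omega, h₅,
    fun l x hl hx => (h₆ l x hl hx).mono (by omega)⟩

/-- A run that reports nothing and leads to a state with the same log. -/
theorem Goes.single {E : Env} {S : ℕ} {code : List (Instr 128)} {M z : ℕ} {τ τ' : St}
    {c c' : Config 128} {pc t : ℕ} (hr : (prog code).run E.w E.input S t c = some c')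
    (hpc : c'.pc = pc) (hrep : Rep E τ' c') (ht : t + z + M * τ.clk ≤ M * τ'.clk)
    (hl : τ'.log = τ.log) : Goes E S code M z τ τ' c pc := by
  refine ⟨t, c', hr, hpc, hrep, ht, by rw [hl], fun l x h h' => ?_⟩
  have h1 := h.length_le
  have h2 := h'.length_le
  rw [hl] at h2
  simp at h2; omega

theorem run_code {E : Env} {S : ℕ} (hE : E.Valid S) {τ : St} {code : List (Instr 128)} (e : Expr)
    {d k : ℕ} (hwf : e.wf k) (hd : d + k ≤ 40) (hok : e.ok E τ) {c : Config 128} (hc : Rep E τ c)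
    (hcode : CodeAt code c.pc (e.code d)) :
    ∃ c', (prog code).run E.w E.input S (e.code d).length c = some c' ∧
      c'.pc = c.pc + (e.code d).length ∧ SameBut d c c' ∧ Rep E τ c' ∧
      c'.reg (fr (88 + d)) = e.val E τ := by
  obtain ⟨c', h₁, h₂, h₃, h₄⟩ := e.execs_code hE hwf hd hok hc
  obtain ⟨h₅, h₆⟩ := run_execs hcode (e.code_straight d) h₁
  exact ⟨c', h₅, h₆, h₂, hc.of_same h₂ h₃, h₄⟩

theorem Rep.tick {E : Env} {τ : St} {c : Config 128} (h : Rep E τ c) (pc : ℕ) :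
    Rep E τ.tick { c with pc := pc } := ⟨h.par, h.var, h.lt, h.mem, h.out⟩

/-- The code that evaluates a test and branches. -/
theorem run_test {E : Env} {S : ℕ} (hE : E.Valid S) {τ : St} {code : List (Instr 128)} {e : Expr}
    (hwf : e.wf 40) (hok : e.ok E τ) {c : Config 128} (hc : Rep E τ c) {l : ℕ}
    (hcode : CodeAt code c.pc (e.code 0 ++ [.jumpIfZero (fr 88) l])) :
    ∃ c', (prog code).run E.w E.input S ((e.code 0).length + 1) c = some c' ∧
      c'.pc = (if e.val E τ = 0 then l else c.pc + (e.code 0).length + 1) ∧ Rep E τ.tick c' := by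
  obtain ⟨c₁, h₁, h₂, h₃, h₄, h₅⟩ := run_code hE e hwf (by omega) hok hc hcode.left
  have hi := hcode.right.get
  rw [← h₂] at hi
  refine ⟨_, run_trans h₁ (run_one hi rfl), ?_, h₄.tick _⟩
  simp only [h₂]
  rw [← h₅]

/-- The code that evaluates an index and a value. -/
theorem run_pair {E : Env} {S : ℕ} (hE : E.Valid S) {τ : St} {code : List (Instr 128)} {i e : Expr}
    (hi : i.wf 30) (he : e.wf 30) (hoi : i.ok E τ) (hoe : e.ok E τ) {c : Config 128}
    (hc : Rep E τ c) (hcode : CodeAt code c.pc (i.code 0 ++ e.code 1)) :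
    ∃ c', (prog code).run E.w E.input S ((i.code 0).length + (e.code 1).length) c = some c' ∧
      c'.pc = c.pc + (i.code 0).length + (e.code 1).length ∧ Rep E τ c' ∧
      c'.reg (fr 88) = i.val E τ ∧ c'.reg (fr 89) = e.val E τ := by
  obtain ⟨c₁, h₁, h₂, h₃, h₄, h₅⟩ := run_code hE i hi (by omega) hoi hc hcode.left
  have hcode₁ := hcode.right
  rw [← h₂] at hcode₁
  obtain ⟨c₂, k₁, k₂, k₃, k₄, k₅⟩ := run_code hE e he (by omega) hoe h₄ hcode₁
  refine ⟨c₂, run_trans h₁ k₁, by rw [k₂, h₂], k₄, ?_, k₅⟩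
  rw [k₃.reg _ (by rw [fr_val (by omega)]; omega)]
  exact h₅

/-- The induction is on the derivation, not on the statement, because the derivation for a loop
contains one for the same loop. Each basic statement and each test uses one clock unit, and
`Stmt.cost` dominates the length of its code. -/
theorem Big.goes {E : Env} {S : ℕ} (hE : E.Valid S) {code : List (Instr 128)} {M : ℕ} {s : Stmt}
    {τ τ' : St} (h : Big E s τ τ') (hwf : s.wf) (hM : s.cost ≤ M) {c : Config 128}
    (hcode : CodeAt code c.pc (s.code c.pc)) (hc : Rep E τ c) :
    Goes E S code M 0 τ τ' c (c.pc + (s.code c.pc).length) := by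
  have hw := hE.w_pos
  induction h generalizing c with
  | skip τ => exact .single (t := 0) rfl rfl hc (by omega) rfl
  | @assign x e τ h =>
    simp only [Stmt.wf, Bool.and_eq_true, decide_eq_true_eq] at hwf
    obtain ⟨c₁, h₁, h₂, h₃, h₄, h₅⟩ := run_code hE e hwf.2 (by omega) h hc hcode.left
    have hi := hcode.right.get
    rw [← h₂] at hi
    refine .single (run_trans h₁ (run_one hi rfl)) ?_ ?_ ?_ rfl
    · simp [Stmt.code, h₂]; omega
    · refine ⟨fun i hi => ?_, fun y hy => ?_, update_lt h₄.lt (h₄.lt _), h₄.mem, h₄.out⟩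
      · have : fr i ≠ fr (48 + x) := fun h => by rw [fr_inj (by omega) (by omega)] at h; omega
        simp only [Function.update_of_ne this]
        exact h₄.par i hi
      · by_cases hyx : y = x
        · subst hyx
          simp only [Function.update_self, St.setReg]
          exact h₅
        · have : fr (48 + y) ≠ fr (48 + x) := fun h => by
            rw [fr_inj (by omega) (by omega)] at h; omega
          simp only [Function.update_of_ne this, St.setReg, Function.update_of_ne hyx]
          exact h₄.var y hy
    · simp only [Stmt.cost] at hM
      simp only [St.setReg, mul_add]; omega
  | @storeWord b i e τ hi he hb =>
    simp only [Stmt.wf, Bool.and_eq_true, decide_eq_true_eq] at hwf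
    obtain ⟨c₁, h₁, h₂, h₃, h₄, h₅⟩ := run_pair hE hwf.1.2 hwf.2 hi he hc hcode.left
    have hS := hE.word_lt _ _ hb
    obtain ⟨c₂, k₁, k₂, k₃, k₄, k₅⟩ := execs_op_same E.input S .add 0 88 hw h₃.lt (by omega)
      (by omega) (h₃.par b hwf.1.1) h₄ (hS.trans_le hE.S_le)
    have r₂ := h₃.of_same k₂ k₃
    have hcode₁ := hcode.right
    rw [List.length_append, ← add_assoc, ← h₂] at hcode₁
    have k₅' : c₂.reg (fr 89) = e.val E τ := by rw [k₅ _ (by omega) (by omega), h₅]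
    have hex := k₁ [.store (fr 88) (fr 89)]
    rw [execs_store (by rw [k₄]; exact hS)] at hex
    obtain ⟨m₁, m₂⟩ := run_execs hcode₁ rfl hex
    refine .single (run_trans h₁ m₁) ?_ ⟨r₂.par, r₂.var, r₂.lt, ?_, r₂.out⟩ ?_ rfl
    · rw [m₂, h₂]; simp [Stmt.code]; omega
    · simp only [k₄, k₅']
      exact r₂.mem.storeWord hE hb (by rw [← k₅']; exact r₂.lt _)
    · simp only [Stmt.cost] at hM
      simp only [St.setArr, mul_add, List.length_cons, List.length_nil]; omega
  | @storeField b i e τ hi he hb hv =>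
    simp only [Stmt.wf, Bool.and_eq_true, decide_eq_true_eq] at hwf
    obtain ⟨c₁, h₁, h₂, h₃, h₄, h₅⟩ := run_pair hE hwf.1.2 hwf.2 hi he hc hcode.left
    rw [(hE.field_par _ _ hb).2.2.2] at hv
    obtain ⟨c₂, k₁, k₂⟩ := execs_fieldStoreCode hE hwf.1.1 hb hv h₃ h₄ h₅
    have hcode₁ := hcode.right
    rw [List.length_append, ← add_assoc, ← h₂] at hcode₁
    obtain ⟨m₁, m₂⟩ := run_execs hcode₁ rfl k₁
    refine .single (run_trans h₁ m₁) ?_ k₂ ?_ rfl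
    · rw [m₂, h₂]; simp [Stmt.code]; omega
    · simp only [Stmt.cost] at hM
      simp only [St.setArr, mul_add, fieldStoreCode, List.length_cons, List.length_nil]; omega
  | @report e τ he =>
    simp only [Stmt.wf] at hwf
    obtain ⟨c₁, h₁, h₂, h₃, h₄, h₅⟩ := run_code hE e hwf (by omega) he hc hcode.left
    have hi := hcode.right.get
    rw [← h₂] at hi
    have hr := run_trans h₁ (run_one (S := S) (w := E.w) (input := E.input) hi rfl)
    have ho : c₁.out ++ [c₁.reg (fr 88)] = (τ.log ++ [(e.val E τ, τ.arr)]).map Prod.fst := by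
      rw [List.map_append, h₄.out]; simp only [List.map_cons, List.map_nil]; rw [← h₅]
    refine ⟨_, _, hr, ?_, ⟨h₄.par, h₄.var, h₄.lt, h₄.mem, ho⟩, ?_, List.prefix_append _ _, ?_⟩
    · simp [Stmt.code, h₂]; omega
    · simp only [Stmt.cost] at hM
      simp only [St.emit, mul_add]; omega
    · intro l x hl hx
      -- The log grows by a single entry, so the old log followed by the new entry is the only
      -- admissible split.
      have e1 : l = τ.log ∧ x = (e.val E τ, τ.arr) := by
        have h1 := hl.length_le
        have h2 := hx.length_le
        simp only [St.emit, List.length_append, List.length_cons, List.length_nil] at h2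
        have := hx.eq_of_length (by simp [St.emit]; omega)
        simpa [St.emit] using List.append_inj this (by omega)
      obtain ⟨rfl, rfl⟩ := e1
      exact ⟨_, Nat.lt_succ_self _, c₁, _, h₁, hr, h₄.out, ho, h₄.mem, rfl⟩
  | seq h₁ h₂ ih₁ ih₂ =>
    simp only [Stmt.wf, Bool.and_eq_true] at hwf
    simp only [Stmt.cost, max_le_iff] at hM
    refine (ih₁ hwf.1 hM.1 hcode.left hc).trans fun c₁ hp hr => ?_
    have := ih₂ hwf.2 hM.2 (c := c₁) (by rw [hp]; exact hcode.right) hr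
    rw [hp] at this
    simpa [Stmt.code, add_assoc] using this
  | @ite_true e s t τ τ' he hv h ih =>
    simp only [Stmt.wf, Bool.and_eq_true] at hwf
    simp only [Stmt.cost, max_le_iff] at hM
    simp only [Stmt.code] at hcode
    obtain ⟨c₁, h₁, h₂, h₃⟩ := run_test hE hwf.1.1 he hc hcode.left.left.left
    rw [if_neg hv] at h₂
    have hc1 := hcode.left.left.right
    have hc2 := hcode.left.right.get
    simp only [List.length_append, List.length_cons, List.length_nil, ← add_assoc, zero_add]
      at hc1 hc2
    rw [← h₂] at hc1
    refine Goes.snoc (.cons (τ := τ) (τ₁ := τ.tick) h₁ ?_ rfl (ih hwf.1.2 hM.2.1 hc1 h₃)) ?_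
    · simp only [St.tick, mul_add]; omega
    · rw [h₂, hc2]
      simp only [Stmt.code, List.length_append, List.length_cons, List.length_nil, ← add_assoc,
        zero_add]
  | @ite_false e s t τ τ' he hv h ih =>
    simp only [Stmt.wf, Bool.and_eq_true] at hwf
    simp only [Stmt.cost, max_le_iff] at hM
    simp only [Stmt.code] at hcode
    obtain ⟨c₁, h₁, h₂, h₃⟩ := run_test hE hwf.1.1 he hc hcode.left.left.left
    rw [if_pos hv] at h₂
    have hc1 := hcode.right
    simp only [List.length_append, List.length_cons, List.length_nil, ← add_assoc, zero_add]
      at hc1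
    have hc3 : CodeAt code c₁.pc (t.code c₁.pc) := by
      rw [h₂]; convert hc1 using 1
    have := Goes.cons (τ := τ) (τ₁ := τ.tick) h₁ (z := 0) ?_ rfl (ih hwf.2 hM.2.2 hc3 h₃)
    · convert this using 1
      rw [h₂]
      simp only [Stmt.code, List.length_append, List.length_cons, List.length_nil, ← add_assoc,
        zero_add]
    · simp only [St.tick, mul_add]; omega
  | @loop_done e s τ he hv =>
    simp only [Stmt.wf, Bool.and_eq_true] at hwf
    simp only [Stmt.cost, max_le_iff] at hM
    simp only [Stmt.code] at hcode
    obtain ⟨c₁, h₁, h₂, h₃⟩ := run_test hE hwf.1 he hc hcode.left.left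
    rw [if_pos hv] at h₂
    refine .single h₁ ?_ h₃ ?_ rfl
    · rw [h₂]
      simp only [Stmt.code, List.length_append, List.length_cons, List.length_nil]
      omega
    · simp only [St.tick, mul_add]; omega
  | @loop_step e s τ τ₁ τ₂ he hv h₁ h₂ ih₁ ih₂ =>
    have hwf' := hwf
    have hM' := hM
    have hcode' := hcode
    simp only [Stmt.wf, Bool.and_eq_true] at hwf
    simp only [Stmt.cost, max_le_iff] at hM
    simp only [Stmt.code] at hcode
    obtain ⟨c₁, k₁, k₂, k₃⟩ := run_test hE hwf.1 he hc hcode.left.left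
    rw [if_neg hv] at k₂
    have hc1 := hcode.left.right
    have hc2 := hcode.right.get
    simp only [List.length_append, List.length_cons, List.length_nil, ← add_assoc, zero_add]
      at hc1 hc2
    rw [← k₂] at hc1
    refine (Goes.snoc (.cons (τ := τ) (τ₁ := τ.tick) k₁ ?_ rfl (ih₁ hwf.2 hM.2 hc1 k₃))
      (by rw [k₂, hc2])).trans
      fun c₂ hp hr => ?_
    · simp only [St.tick, mul_add]; omega
    · have := ih₂ hwf' hM' (c := c₂) (by rw [hp]; exact hcode') hr
      rwa [hp] at this

/-! ### Weakest preconditions -/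

instance : Add Expr := ⟨.bin .add⟩
instance : Sub Expr := ⟨.bin .sub⟩
instance : Mul Expr := ⟨.bin .mul⟩
instance : Div Expr := ⟨.bin .div⟩
instance : Mod Expr := ⟨.bin .mod⟩

section
variable (E : Env) (τ : St) (a b : Expr)

@[simp] theorem val_add : (a + b).val E τ = a.val E τ + b.val E τ := rfl
@[simp] theorem val_sub : (a - b).val E τ = a.val E τ - b.val E τ := rfl
@[simp] theorem val_mul : (a * b).val E τ = a.val E τ * b.val E τ := rfl
@[simp] theorem val_div : (a / b).val E τ = a.val E τ / b.val E τ := rfl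
@[simp] theorem val_mod : (a % b).val E τ = a.val E τ % b.val E τ := rfl
@[simp] theorem val_lt : (Expr.bin .lt a b).val E τ = if a.val E τ < b.val E τ then 1 else 0 := rfl
@[simp] theorem val_shl : (Expr.bin .shl a b).val E τ = (a.val E τ <<< b.val E τ) % 2 ^ E.w := rfl
@[simp] theorem val_shr : (Expr.bin .shr a b).val E τ = a.val E τ >>> b.val E τ := rfl
@[simp] theorem val_or : (Expr.bin .or a b).val E τ = a.val E τ ||| b.val E τ := rfl
@[simp] theorem val_xor : (Expr.bin .xor a b).val E τ = a.val E τ ^^^ b.val E τ := rfl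
@[simp] theorem val_lit (c : ℕ) : (Expr.lit c).val E τ = c := rfl
@[simp] theorem val_var (x : ℕ) : (Expr.var x).val E τ = τ.reg x := rfl
@[simp] theorem val_par (i : ℕ) : (Expr.par i).val E τ = E.par i := rfl
@[simp] theorem val_inp : (Expr.inp a).val E τ = rd E.input (a.val E τ) := rfl
@[simp] theorem val_word (i : ℕ) : (Expr.word i a).val E τ = τ.arr i (a.val E τ) := rfl
@[simp] theorem val_field (i : ℕ) : (Expr.field i a).val E τ = τ.arr i (a.val E τ) := rfl

@[simp] theorem ok_add : (a + b).ok E τ ↔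
    a.ok E τ ∧ b.ok E τ ∧ a.val E τ + b.val E τ < 2 ^ E.w := Iff.rfl
@[simp] theorem ok_sub : (a - b).ok E τ ↔ a.ok E τ ∧ b.ok E τ ∧ b.val E τ ≤ a.val E τ := Iff.rfl
@[simp] theorem ok_mul : (a * b).ok E τ ↔
    a.ok E τ ∧ b.ok E τ ∧ a.val E τ * b.val E τ < 2 ^ E.w := Iff.rfl
@[simp] theorem ok_div : (a / b).ok E τ ↔ a.ok E τ ∧ b.ok E τ :=
  ⟨fun h => ⟨h.1, h.2.1⟩, fun h => ⟨h.1, h.2, trivial⟩⟩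
@[simp] theorem ok_mod : (a % b).ok E τ ↔ a.ok E τ ∧ b.ok E τ :=
  ⟨fun h => ⟨h.1, h.2.1⟩, fun h => ⟨h.1, h.2, trivial⟩⟩
@[simp] theorem ok_lt : (Expr.bin .lt a b).ok E τ ↔ a.ok E τ ∧ b.ok E τ :=
  ⟨fun h => ⟨h.1, h.2.1⟩, fun h => ⟨h.1, h.2, trivial⟩⟩
@[simp] theorem ok_shl : (Expr.bin .shl a b).ok E τ ↔ a.ok E τ ∧ b.ok E τ :=
  ⟨fun h => ⟨h.1, h.2.1⟩, fun h => ⟨h.1, h.2, trivial⟩⟩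
@[simp] theorem ok_shr : (Expr.bin .shr a b).ok E τ ↔ a.ok E τ ∧ b.ok E τ :=
  ⟨fun h => ⟨h.1, h.2.1⟩, fun h => ⟨h.1, h.2, trivial⟩⟩
@[simp] theorem ok_or : (Expr.bin .or a b).ok E τ ↔ a.ok E τ ∧ b.ok E τ :=
  ⟨fun h => ⟨h.1, h.2.1⟩, fun h => ⟨h.1, h.2, trivial⟩⟩
@[simp] theorem ok_xor : (Expr.bin .xor a b).ok E τ ↔ a.ok E τ ∧ b.ok E τ :=
  ⟨fun h => ⟨h.1, h.2.1⟩, fun h => ⟨h.1, h.2, trivial⟩⟩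
@[simp] theorem ok_lit (c : ℕ) : (Expr.lit c).ok E τ ↔ c < 2 ^ E.w := Iff.rfl
@[simp] theorem ok_var (x : ℕ) : (Expr.var x).ok E τ ↔ True := Iff.rfl
@[simp] theorem ok_par (i : ℕ) : (Expr.par i).ok E τ ↔ True := Iff.rfl
@[simp] theorem ok_inp : (Expr.inp a).ok E τ ↔ a.ok E τ ∧ a.val E τ < E.input.length := Iff.rfl
@[simp] theorem ok_word (i : ℕ) : (Expr.word i a).ok E τ ↔ a.ok E τ ∧ a.val E τ < E.wlen i :=
  Iff.rfl
@[simp] theorem ok_field (i : ℕ) : (Expr.field i a).ok E τ ↔ a.ok E τ ∧ a.val E τ < E.plen i :=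
  Iff.rfl

end

section
variable (τ : St) (b i v x y : ℕ)

@[simp] theorem St.tick_reg : τ.tick.reg = τ.reg := rfl
@[simp] theorem St.tick_arr : τ.tick.arr = τ.arr := rfl
@[simp] theorem St.tick_log : τ.tick.log = τ.log := rfl
@[simp] theorem St.tick_clk : τ.tick.clk = τ.clk + 1 := rfl
@[simp] theorem St.setReg_reg : (τ.setReg x v).reg y = if y = x then v else τ.reg y := by
  simp [St.setReg, Function.update_apply]
@[simp] theorem St.setReg_arr : (τ.setReg x v).arr = τ.arr := rfl
@[simp] theorem St.setReg_log : (τ.setReg x v).log = τ.log := rfl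
@[simp] theorem St.setReg_clk : (τ.setReg x v).clk = τ.clk + 1 := rfl
@[simp] theorem St.setArr_reg : (τ.setArr b i v).reg = τ.reg := rfl
@[simp] theorem St.setArr_arr : (τ.setArr b i v).arr x =
    if x = b then Function.update (τ.arr b) i v else τ.arr x := by
  simp [St.setArr, Function.update_apply]
@[simp] theorem St.setArr_log : (τ.setArr b i v).log = τ.log := rfl
@[simp] theorem St.setArr_clk : (τ.setArr b i v).clk = τ.clk + 1 := rfl
@[simp] theorem St.emit_reg : (τ.emit v).reg = τ.reg := rfl
@[simp] theorem St.emit_arr : (τ.emit v).arr = τ.arr := rfl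
@[simp] theorem St.emit_log : (τ.emit v).log = τ.log ++ [(v, τ.arr)] := rfl
@[simp] theorem St.emit_clk : (τ.emit v).clk = τ.clk + 1 := rfl

end

/-- `s` leads from `τ` to a state with property `Q`. -/
def wp (E : Env) (s : Stmt) (τ : St) (Q : St → Prop) : Prop := ∃ τ', Big E s τ τ' ∧ Q τ'

theorem wp.mono {E : Env} {s : Stmt} {τ : St} {Q Q' : St → Prop} (h : wp E s τ Q)
    (hQ : ∀ τ', Q τ' → Q' τ') : wp E s τ Q' :=
  let ⟨τ', h₁, h₂⟩ := h
  ⟨τ', h₁, hQ _ h₂⟩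

section
variable {E : Env} {τ : St} {Q : St → Prop}

@[simp] theorem wp_skip : wp E .skip τ Q ↔ Q τ := by
  constructor
  · rintro ⟨_, ⟨⟩, h⟩; exact h
  · exact fun h => ⟨_, .skip τ, h⟩

@[simp] theorem wp_assign {x e} :
    wp E (.assign x e) τ Q ↔ e.ok E τ ∧ Q (τ.setReg x (e.val E τ)) := by
  constructor
  · rintro ⟨_, ⟨⟩, h⟩; exact ⟨by assumption, h⟩
  · exact fun h => ⟨_, .assign h.1, h.2⟩

@[simp] theorem wp_storeWord {b i e} : wp E (.storeWord b i e) τ Q ↔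
    i.ok E τ ∧ e.ok E τ ∧ i.val E τ < E.wlen b ∧ Q (τ.setArr b (i.val E τ) (e.val E τ)) := by
  constructor
  · rintro ⟨_, ⟨⟩, h⟩; exact ⟨by assumption, by assumption, by assumption, h⟩
  · exact fun h => ⟨_, .storeWord h.1 h.2.1 h.2.2.1, h.2.2.2⟩

@[simp] theorem wp_storeField {b i e} : wp E (.storeField b i e) τ Q ↔
    i.ok E τ ∧ e.ok E τ ∧ i.val E τ < E.plen b ∧ e.val E τ < E.par 3 ∧
      Q (τ.setArr b (i.val E τ) (e.val E τ)) := by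
  constructor
  · rintro ⟨_, ⟨⟩, h⟩; exact ⟨by assumption, by assumption, by assumption, by assumption, h⟩
  · exact fun h => ⟨_, .storeField h.1 h.2.1 h.2.2.1 h.2.2.2.1, h.2.2.2.2⟩

@[simp] theorem wp_report {e} :
    wp E (.report e) τ Q ↔ e.ok E τ ∧ Q (τ.emit (e.val E τ)) := by
  constructor
  · rintro ⟨_, ⟨⟩, h⟩; exact ⟨by assumption, h⟩
  · exact fun h => ⟨_, .report h.1, h.2⟩

@[simp] theorem wp_seq {s t} : wp E (.seq s t) τ Q ↔ wp E s τ fun τ' => wp E t τ' Q := by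
  constructor
  · rintro ⟨_, ⟨⟩, h⟩; exact ⟨_, by assumption, _, by assumption, h⟩
  · rintro ⟨_, h₁, _, h₂, h⟩; exact ⟨_, .seq h₁ h₂, h⟩

theorem wp_ite {e s t} : wp E (.ite e s t) τ Q ↔ e.ok E τ ∧
    (e.val E τ ≠ 0 → wp E s τ.tick Q) ∧ (e.val E τ = 0 → wp E t τ.tick Q) := by
  constructor
  · rintro ⟨_, ⟨⟩, h⟩
    · exact ⟨by assumption, fun _ => ⟨_, by assumption, h⟩, fun h => by contradiction⟩
    · exact ⟨by assumption, fun h => by contradiction, fun _ => ⟨_, by assumption, h⟩⟩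
  · rintro ⟨h₁, h₂, h₃⟩
    by_cases hv : e.val E τ = 0
    · obtain ⟨τ', h, h'⟩ := h₃ hv
      exact ⟨τ', .ite_false h₁ hv h, h'⟩
    · obtain ⟨τ', h, h'⟩ := h₂ hv
      exact ⟨τ', .ite_true h₁ hv h, h'⟩

/-- The rule for loops, with an invariant and a measure. -/
theorem wp_loop {e s} (I : St → Prop) (μ : St → ℕ) (hI : I τ)
    (h : ∀ τ, I τ → e.ok E τ ∧ (e.val E τ = 0 → Q τ.tick) ∧
      (e.val E τ ≠ 0 → wp E s τ.tick fun τ' => I τ' ∧ μ τ' < μ τ)) : wp E (.loop e s) τ Q := by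
  induction hm : μ τ using Nat.strong_induction_on generalizing τ with
  | _ m ih =>
    obtain ⟨h₁, h₂, h₃⟩ := h τ hI
    by_cases hv : e.val E τ = 0
    · exact ⟨_, .loop_done h₁ hv, h₂ hv⟩
    · obtain ⟨τ', h₄, h₅, h₆⟩ := h₃ hv
      obtain ⟨τ'', h₇, h₈⟩ := ih _ (hm ▸ h₆) h₅ rfl
      exact ⟨τ'', .loop_step h₁ hv h₄ h₇, h₈⟩

end

/-- `τ'` differs from `τ` only in the variables `R`, in the arrays `B`, and in the clock. -/
structure Frame (R B : List ℕ) (τ τ' : St) : Prop where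
  reg : ∀ x, x ∉ R → τ'.reg x = τ.reg x
  arr : ∀ b, b ∉ B → τ'.arr b = τ.arr b
  log : τ'.log = τ.log

attribute [irreducible] wp

namespace Frame

variable {R B : List ℕ} {τ τ' : St} {x b i v : ℕ}

@[simp] theorem refl : Frame R B τ τ := ⟨fun _ _ => rfl, fun _ _ => rfl, rfl⟩

@[simp] theorem tick_iff : Frame R B τ τ'.tick ↔ Frame R B τ τ' :=
  ⟨fun h => ⟨h.reg, h.arr, h.log⟩, fun h => ⟨h.reg, h.arr, h.log⟩⟩

@[simp] theorem setReg_iff (hx : x ∈ R) : Frame R B τ (τ'.setReg x v) ↔ Frame R B τ τ' := by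
  have : ∀ y, y ∉ R → y ≠ x := fun y hy h => hy (h ▸ hx)
  constructor
  · exact fun h => ⟨fun y hy => by simpa [this y hy] using h.reg y hy, h.arr, h.log⟩
  · exact fun h => ⟨fun y hy => by simpa [this y hy] using h.reg y hy, h.arr, h.log⟩

@[simp] theorem setArr_iff (hb : b ∈ B) : Frame R B τ (τ'.setArr b i v) ↔ Frame R B τ τ' := by
  have : ∀ y, y ∉ B → y ≠ b := fun y hy h => hy (h ▸ hb)
  constructor
  · exact fun h => ⟨h.reg, fun y hy => by simpa [this y hy] using h.arr y hy, h.log⟩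
  · exact fun h => ⟨h.reg, fun y hy => by simpa [this y hy] using h.arr y hy, h.log⟩

theorem trans {τ'' : St} (h : Frame R B τ τ') (h' : Frame R B τ' τ'') : Frame R B τ τ'' :=
  ⟨fun x hx => (h'.reg x hx).trans (h.reg x hx), fun b hb => (h'.arr b hb).trans (h.arr b hb),
    h'.log.trans h.log⟩

theorem mono {R' B' : List ℕ} (h : Frame R B τ τ') (hR : R ⊆ R') (hB : B ⊆ B') :
    Frame R' B' τ τ' :=
  ⟨fun x hx => h.reg x fun h' => hx (hR h'), fun b hb => h.arr b fun h' => hb (hB h'), h.log⟩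

end Frame

/-- `a < b` as an expression. -/
abbrev Expr.lt (a b : Expr) : Expr := .bin .lt a b

infixr:60 " ;; " => Stmt.seq

/-! ### Parameters and memory layout -/

namespace Par

/-- The logarithm of `n`. -/
def lg (n : ℕ) : ℕ := Nat.size n
/-- The iterated logarithm of `n`. -/
def ll (n : ℕ) : ℕ := Nat.size (Nat.size n)
/-- Bits of a field of a packed array. -/
def fb (n : ℕ) : ℕ := 8 * ll n
/-- Fields of a word. -/
def fw (n w : ℕ) : ℕ := w / fb n
/-- Entries of a segment of the stack. -/
def seg (n : ℕ) : ℕ := n / lg n + 1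
/-- Vertices of a small block. -/
def sb (n : ℕ) : ℕ := ll n ^ 2
/-- Small blocks of a large block. -/
def bb (n : ℕ) : ℕ := 4 ^ ll n
/-- Vertices of a large block. -/
def lb (n : ℕ) : ℕ := sb n * bb n
/-- Degrees below this threshold are small. -/
def thr (n : ℕ) : ℕ := 16 ^ ll n
/-- Bits of a chunk. -/
def ch (n : ℕ) : ℕ := lg n / 2 + 1
/-- Number of chunks. -/
def nch (n : ℕ) : ℕ := 2 ^ ch n

/-- The numbers of entries of the arrays. -/
def len (n w : ℕ) : ℕ → ℕ
  | 13 => n / lb n + 1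
  | 14 => n / thr n * lb n
  | 15 => n / lb n + 1
  | 16 => n / lb n + 1
  | 17 => nch n * sb n
  | 18 => 2 * n / w + 1
  | 19 => n / sb n + 1
  | 20 => n / sb n + 1
  | 21 => 2 * (2 * n / ch n) * sb n
  | 22 => 2 * seg n
  | 23 => 2 * seg n
  | 24 => lg n + 2
  | 25 => n
  | 26 => n
  | 27 => n
  | _ => 0

/-- The packed arrays. -/
def packed (b : ℕ) : Bool := (19 ≤ b && b < 22) || 25 ≤ b

/-- The numbers of words of the arrays. -/
def area (n w b : ℕ) : ℕ := if packed b then len n w b / fw n w + 1 else len n w b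

/-- The base addresses of the arrays. -/
def base (n w b : ℕ) : ℕ := 28 + ∑ j ∈ Finset.Ico 13 b, area n w j

/-- The values of the parameters. -/
def value (n w : ℕ) : ℕ → ℕ
  | 0 => n
  | 1 => fw n w
  | 2 => fb n
  | 3 => 2 ^ fb n
  | 4 => w
  | 5 => lg n
  | 6 => seg n
  | 7 => sb n
  | 8 => bb n
  | 9 => lb n
  | 10 => thr n
  | 11 => ch n
  | 12 => nch n
  | b => if b < 28 then base n w b else 0

/-- The surroundings of the main programs; only the first `k` parameters name arrays, and
the last one names the first words of memory, which hold the parameters. -/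
def env (n w k : ℕ) (input : List ℕ) : Env where
  w := w
  input := input
  par := value n w
  wlen b := if b = 47 then 28 else if b < k ∧ ¬ packed b then len n w b else 0
  plen b := if b < k ∧ packed b then len n w b else 0

section
variable (n w k : ℕ) (input : List ℕ)

@[simp] theorem env_w : (env n w k input).w = w := rfl
@[simp] theorem env_input : (env n w k input).input = input := rfl
@[simp] theorem par_0 : (env n w k input).par 0 = n := rfl
@[simp] theorem par_1 : (env n w k input).par 1 = fw n w := rfl
@[simp] theorem par_2 : (env n w k input).par 2 = fb n := rfl
@[simp] theorem par_3 : (env n w k input).par 3 = 2 ^ fb n := rfl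
@[simp] theorem par_4 : (env n w k input).par 4 = w := rfl
@[simp] theorem par_5 : (env n w k input).par 5 = lg n := rfl
@[simp] theorem par_6 : (env n w k input).par 6 = seg n := rfl
@[simp] theorem par_7 : (env n w k input).par 7 = sb n := rfl
@[simp] theorem par_8 : (env n w k input).par 8 = bb n := rfl
@[simp] theorem par_9 : (env n w k input).par 9 = lb n := rfl
@[simp] theorem par_10 : (env n w k input).par 10 = thr n := rfl
@[simp] theorem par_11 : (env n w k input).par 11 = ch n := rfl
@[simp] theorem par_12 : (env n w k input).par 12 = nch n := rfl
@[simp] theorem wlen_13 : (env n w 28 input).wlen 13 = n / lb n + 1 := rfl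
@[simp] theorem wlen_14 : (env n w 28 input).wlen 14 = n / thr n * lb n := rfl
@[simp] theorem wlen_15 : (env n w 28 input).wlen 15 = n / lb n + 1 := rfl
@[simp] theorem wlen_16 : (env n w 28 input).wlen 16 = n / lb n + 1 := rfl
@[simp] theorem wlen_17 : (env n w 28 input).wlen 17 = nch n * sb n := rfl
@[simp] theorem wlen_18 : (env n w 28 input).wlen 18 = 2 * n / w + 1 := rfl
@[simp] theorem plen_19 : (env n w 28 input).plen 19 = n / sb n + 1 := rfl
@[simp] theorem plen_20 : (env n w 28 input).plen 20 = n / sb n + 1 := rfl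
@[simp] theorem plen_21 : (env n w 28 input).plen 21 = 2 * (2 * n / ch n) * sb n := rfl
@[simp] theorem wlen_22 : (env n w 28 input).wlen 22 = 2 * seg n := rfl
@[simp] theorem wlen_23 : (env n w 28 input).wlen 23 = 2 * seg n := rfl
@[simp] theorem wlen_24 : (env n w 28 input).wlen 24 = lg n + 2 := rfl
@[simp] theorem plen_25 : (env n w 28 input).plen 25 = n := rfl
@[simp] theorem plen_26 : (env n w 28 input).plen 26 = n := rfl
@[simp] theorem plen_27 : (env n w 28 input).plen 27 = n := rfl
@[simp] theorem wlen_13' : (env n w 22 input).wlen 13 = n / lb n + 1 := rfl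
@[simp] theorem wlen_14' : (env n w 22 input).wlen 14 = n / thr n * lb n := rfl
@[simp] theorem wlen_15' : (env n w 22 input).wlen 15 = n / lb n + 1 := rfl
@[simp] theorem wlen_16' : (env n w 22 input).wlen 16 = n / lb n + 1 := rfl
@[simp] theorem wlen_17' : (env n w 22 input).wlen 17 = nch n * sb n := rfl
@[simp] theorem wlen_18' : (env n w 22 input).wlen 18 = 2 * n / w + 1 := rfl
@[simp] theorem plen_19' : (env n w 22 input).plen 19 = n / sb n + 1 := rfl
@[simp] theorem plen_20' : (env n w 22 input).plen 20 = n / sb n + 1 := rfl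
@[simp] theorem plen_21' : (env n w 22 input).plen 21 = 2 * (2 * n / ch n) * sb n := rfl

end

/-! ### Elementary bounds for the parameters -/

theorem lg_pos {n : ℕ} (hn : 0 < n) : 0 < lg n := Nat.size_pos.mpr hn
theorem ll_pos {n : ℕ} (hn : 0 < n) : 0 < ll n := Nat.size_pos.mpr (lg_pos hn)
theorem seg_pos (n : ℕ) : 0 < seg n := Nat.succ_pos _
theorem sb_pos {n : ℕ} (hn : 0 < n) : 0 < sb n := pow_pos (ll_pos hn) 2
theorem bb_pos (n : ℕ) : 0 < bb n := pow_pos (by norm_num) _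
theorem lb_pos {n : ℕ} (hn : 0 < n) : 0 < lb n := Nat.mul_pos (sb_pos hn) (bb_pos n)
theorem thr_pos (n : ℕ) : 0 < thr n := pow_pos (by norm_num) _
theorem ch_pos (n : ℕ) : 0 < ch n := Nat.succ_pos _
theorem lg_lt (n : ℕ) : lg n < 2 ^ ll n := Nat.lt_size_self _
theorem lt_two_pow_lg (n : ℕ) : n < 2 ^ lg n := Nat.lt_size_self _
theorem lg_le (n : ℕ) : lg n ≤ n := Nat.size_le.mpr Nat.lt_two_pow_self

/-- Every number that the programs handle is small compared to `2 ^ w`. -/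
structure Bounds (n m w X : ℕ) : Prop where
  pos : 0 < n
  nm_le : n + m ≤ X
  lb_le : lb n ≤ X
  thr_le : thr n ≤ X
  tables_le : n / thr n * lb n ≤ X
  pow_le : 2 ^ fb n ≤ X
  nch_le : nch n * sb n ≤ X
  lt_le : len n w 21 ≤ X
  w_le : w ≤ X
  X_lt : 100 * X + 100 ≤ 2 ^ w
  fb_le : fb n ≤ w
  ch_le : ch n ≤ w
  thr_pow : thr n ≤ 2 ^ fb n
  lg_pow : lg n + 4 ≤ 2 ^ fb n

theorem Bounds.w_ne {n m w X : ℕ} (h : Bounds n m w X) : w ≠ 0 := by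
  rintro rfl
  have := h.X_lt
  simp at this

end Par

end WordRAM

open WordRAM.Par WordRAM.Expr WordRAM.Stmt

namespace WordRAM

/-! ### The dynamic degree sequence -/

/-- The counts `c` of `n` vertices, stored in the packed array `cnt`, except for the blocks of `B`
vertices with an entry in `ptr`, whose counts are in `tab`.  There are `al` of these blocks. -/
structure Counts (n B T : ℕ) (ptr tab cnt : ℕ → ℕ) (al : ℕ) (c : ℕ → ℕ) : Prop where
  ptr_eq : ∀ v < n, ptr (v / B) ≠ 0 → ∃ i < al, ptr (v / B) = i * B + 1
  inj : ∀ u < n, ∀ v < n, ptr (u / B) ≠ 0 → ptr (u / B) = ptr (v / B) → u / B = v / B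
  small : ∀ v < n, ptr (v / B) = 0 → cnt v = c v ∧ c v < T
  large : ∀ v < n, ptr (v / B) ≠ 0 → tab (ptr (v / B) - 1 + v % B) = c v
  sum_le : al * T + ∑ v ∈ Finset.range n, (if ptr (v / B) = 0 then c v else 0) ≤
    ∑ v ∈ Finset.range n, c v

namespace Counts

variable {n B T : ℕ} {ptr tab cnt : ℕ → ℕ} {al : ℕ} {c : ℕ → ℕ}

theorem sum_update {n v : ℕ} (hv : v < n) (f : ℕ → ℕ) (x : ℕ) :
    ∑ u ∈ Finset.range n, Function.update f v x u + f v = ∑ u ∈ Finset.range n, f u + x := by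
  rw [← Finset.add_sum_erase (Finset.range n) _ (Finset.mem_range.mpr hv),
    ← Finset.add_sum_erase (Finset.range n) f (Finset.mem_range.mpr hv), Function.update_self,
    Finset.sum_congr (g := fun u => f u) rfl
      fun u hu => Function.update_of_ne (Finset.ne_of_mem_erase hu) x f]
  omega

theorem init (hT : 0 < T) : Counts n B T (fun _ => 0) (fun _ => 0) (fun _ => 0) 0 fun _ => 0 where
  ptr_eq _ _ h := absurd rfl h
  inj _ _ _ _ h := absurd rfl h
  small _ _ _ := ⟨rfl, hT⟩
  large _ _ h := absurd rfl h
  sum_le := by simp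

theorem le_sum (h : Counts n B T ptr tab cnt al c) : al * T ≤ ∑ v ∈ Finset.range n, c v := by
  have := h.sum_le; omega

theorem sum_ite_update {p : ℕ → Prop} [DecidablePred p] {v : ℕ} (hv : v < n) (c : ℕ → ℕ) :
    ∑ u ∈ Finset.range n, (if p u then Function.update c v (c v + 1) u else 0) ≤
      ∑ u ∈ Finset.range n, (if p u then c u else 0) + if p v then 1 else 0 := by
  have := sum_update hv (fun u => if p u then c u else 0) (if p v then c v + 1 else 0)
  have e : ∀ u, (if p u then Function.update c v (c v + 1) u else 0) =
      Function.update (fun u => if p u then c u else 0) v (if p v then c v + 1 else 0) u := by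
    intro u
    by_cases hu : u = v
    · subst hu; simp
    · simp [hu]
  simp only [e]
  split_ifs at this ⊢ <;> omega

/-- By `ptr_eq` and `inj`, blocks with tables occupy disjoint stretches, so the cell of `v`
represents no other vertex. -/
theorem incr_large (hB : 0 < B) (h : Counts n B T ptr tab cnt al c) {v : ℕ} (hv : v < n)
    (hp : ptr (v / B) ≠ 0) :
    Counts n B T ptr (Function.update tab (ptr (v / B) - 1 + v % B) (c v + 1)) cnt al
      (Function.update c v (c v + 1)) where
  ptr_eq := h.ptr_eq
  inj := h.inj
  small u hu hpu := by
    have : u ≠ v := by rintro rfl; exact hp hpu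
    simpa [this] using h.small u hu hpu
  large u hu hpu := by
    by_cases huv : u = v
    · subst huv; simp
    · rw [Function.update_of_ne huv, Function.update_of_ne]
      · exact h.large u hu hpu
      · intro he
        obtain ⟨i, -, hi⟩ := h.ptr_eq u hu hpu
        obtain ⟨j, -, hj⟩ := h.ptr_eq v hv hp
        have h1 := Nat.mod_lt u hB
        have h2 := Nat.mod_lt v hB
        have e1 : (i * B + u % B) / B = i := by
          rw [mul_comm, Nat.mul_add_div hB, Nat.div_eq_of_lt h1, add_zero]
        have e2 : (j * B + v % B) / B = j := by
          rw [mul_comm, Nat.mul_add_div hB, Nat.div_eq_of_lt h2, add_zero]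
        rw [hi, hj, Nat.add_sub_cancel, Nat.add_sub_cancel] at he
        have hij : i = j := by rw [← e1, ← e2, he]
        subst hij
        have := h.inj u hu v hv hpu (by rw [hi, hj])
        apply huv
        rw [← Nat.div_add_mod u B, ← Nat.div_add_mod v B, this]
        omega
  sum_le := by
    have h1 := sum_update hv c (c v + 1)
    have h2 := sum_ite_update (p := fun u => ptr (u / B) = 0) hv c
    have h3 := h.sum_le
    simp only [hp, if_false] at h2
    omega

theorem incr_small (h : Counts n B T ptr tab cnt al c) {v : ℕ} (hv : v < n)
    (hp : ptr (v / B) = 0) (hc : c v + 1 < T) :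
    Counts n B T ptr tab (Function.update cnt v (c v + 1)) al
      (Function.update c v (c v + 1)) where
  ptr_eq := h.ptr_eq
  inj := h.inj
  small u hu hpu := by
    by_cases huv : u = v
    · subst huv; simpa using hc
    · simpa [huv] using h.small u hu hpu
  large u hu hpu := by
    have : u ≠ v := by rintro rfl; exact hpu hp
    simpa [this] using h.large u hu hpu
  sum_le := by
    have h1 := sum_update hv c (c v + 1)
    have h2 := sum_ite_update (p := fun u => ptr (u / B) = 0) hv c
    have h3 := h.sum_le
    simp only [hp, if_true] at h2
    omega

/-- A block whose counts become large gets a table. -/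
theorem incr_alloc (hB : 0 < B) (h : Counts n B T ptr tab cnt al c) {v : ℕ} (hv : v < n)
    (hp : ptr (v / B) = 0) (hc : c v + 1 = T) {tab' : ℕ → ℕ}
    (h₁ : ∀ i < al * B, tab' i = tab i)
    (h₂ : ∀ i < B, v / B * B + i < n → tab' (al * B + i) = cnt (v / B * B + i)) :
    Counts n B T (Function.update ptr (v / B) (al * B + 1))
      (Function.update tab' (al * B + v % B) (c v + 1)) cnt (al + 1)
      (Function.update c v (c v + 1)) where
  ptr_eq u hu hpu := by
    by_cases hb : u / B = v / B
    · exact ⟨al, by omega, by rw [hb, Function.update_self]⟩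
    · rw [Function.update_of_ne hb] at hpu ⊢
      obtain ⟨i, hi, h'⟩ := h.ptr_eq u hu hpu
      exact ⟨i, by omega, h'⟩
  inj u hu u' hu' hpu he := by
    by_cases hb : u / B = v / B <;> by_cases hb' : u' / B = v / B
    · rw [hb, hb']
    · rw [hb, Function.update_self, Function.update_of_ne hb'] at he
      obtain ⟨i, hi, h'⟩ := h.ptr_eq u' hu' (by omega)
      rw [h'] at he
      have := Nat.eq_of_mul_eq_mul_right hB (Nat.succ.inj he)
      omega
    · rw [hb', Function.update_self, Function.update_of_ne hb] at he
      obtain ⟨i, hi, h'⟩ := h.ptr_eq u hu (by omega)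
      rw [h'] at he
      have := Nat.eq_of_mul_eq_mul_right hB (Nat.succ.inj he)
      omega
    · rw [Function.update_of_ne hb] at hpu
      rw [Function.update_of_ne hb, Function.update_of_ne hb'] at he
      exact h.inj u hu u' hu' hpu he
  small u hu hpu := by
    by_cases hb : u / B = v / B
    · rw [hb, Function.update_self] at hpu; omega
    · rw [Function.update_of_ne hb] at hpu
      have : u ≠ v := by rintro rfl; exact hb rfl
      simpa [this] using h.small u hu hpu
  large u hu hpu := by
    have hmod := Nat.mod_lt u hB
    by_cases hb : u / B = v / B
    · rw [hb, Function.update_self, Nat.add_sub_cancel]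
      by_cases huv : u = v
      · subst huv; simp
      · have hne : u % B ≠ v % B := by
          intro h'
          apply huv
          rw [← Nat.div_add_mod u B, ← Nat.div_add_mod v B, hb, h']
        have hu' : v / B * B + u % B = u := by rw [← hb, mul_comm]; exact Nat.div_add_mod u B
        rw [Function.update_of_ne huv, Function.update_of_ne (by omega),
          h₂ _ hmod (by omega), hu']
        exact (h.small u hu (by rw [hb, hp])).1
    · rw [Function.update_of_ne hb] at hpu ⊢
      have huv : u ≠ v := by rintro rfl; exact hb rfl
      obtain ⟨i, hi, h'⟩ := h.ptr_eq u hu hpu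
      have hlt : ptr (u / B) - 1 + u % B < al * B := by
        have := Nat.mul_le_mul_right B (Nat.succ_le_of_lt hi)
        rw [Nat.succ_mul] at this; omega
      rw [Function.update_of_ne huv, Function.update_of_ne (by omega), h₁ _ hlt]
      exact h.large u hu hpu
  sum_le := by
    have h1 := sum_update hv c (c v + 1)
    have h3 := h.sum_le
    -- The whole block of `v` leaves the sum of the small counts, which loses at least `c v`, that
    -- is `T - 1`. Together with the new child this pays `T` for the new table.
    have h4 : ∑ u ∈ Finset.range n, (if Function.update ptr (v / B) (al * B + 1) (u / B) = 0
        then Function.update c v (c v + 1) u else 0) + c v ≤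
        ∑ u ∈ Finset.range n, (if ptr (u / B) = 0 then c u else 0) := by
      rw [← Finset.add_sum_erase _ _ (Finset.mem_range.mpr hv),
        ← Finset.add_sum_erase _ (fun u => if ptr (u / B) = 0 then c u else 0)
          (Finset.mem_range.mpr hv)]
      simp only [Function.update_self, hp, if_true, Nat.add_eq_zero_iff, one_ne_zero, and_false,
        if_false, zero_add]
      rw [add_comm, Nat.add_le_add_iff_left]
      refine Finset.sum_le_sum fun u hu => ?_
      have huv := Finset.ne_of_mem_erase hu
      rw [Function.update_of_ne huv]
      by_cases hb : u / B = v / B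
      · simp [hb]
      · rw [Function.update_of_ne hb]
    rw [add_mul]
    omega

end Counts

/-! ### Counting children on the machine -/

/-- Increase the count of the vertex in variable `1`.  Variable `6` holds the number of tables. -/
def incrCode : Stmt :=
  assign 12 (var 1 / par 9) ;;
  ite (word 13 (var 12))
    (storeWord 14 (word 13 (var 12) - lit 1 + var 1 % par 9)
      (word 14 (word 13 (var 12) - lit 1 + var 1 % par 9) + lit 1))
    (ite (Expr.lt (field 27 (var 1) + lit 1) (par 10))
      (storeField 27 (var 1) (field 27 (var 1) + lit 1))
      (storeWord 13 (var 12) (var 6 * par 9 + lit 1) ;;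
       assign 8 (lit 0) ;;
       loop (Expr.lt (var 8) (par 9))
        (ite (Expr.lt (var 12 * par 9 + var 8) (par 0))
          (storeWord 14 (var 6 * par 9 + var 8) (field 27 (var 12 * par 9 + var 8))) skip ;;
         assign 8 (var 8 + lit 1)) ;;
       storeWord 14 (var 6 * par 9 + var 1 % par 9) (field 27 (var 1) + lit 1) ;;
       assign 6 (var 6 + lit 1)))

/-- The cost of copying a block is charged to its new table: `4 * lb n + 8` is paid for an increase
of variable `6`, and all else is constant. That the counts sum to less than `n` keeps the number of
tables within `n / thr n`. -/
theorem wp_incr {n m w X : ℕ} (hX : Bounds n m w X) {input : List ℕ} {τ : St} {c : ℕ → ℕ} {v : ℕ}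
    (hc : Counts n (lb n) (thr n) (τ.arr 13) (τ.arr 14) (τ.arr 27) (τ.reg 6) c)
    (hv : τ.reg 1 = v) (hvn : v < n) (hs : ∑ u ∈ Finset.range n, c u < n) :
    wp (env n w 28 input) incrCode τ fun τ' =>
      Counts n (lb n) (thr n) (τ'.arr 13) (τ'.arr 14) (τ'.arr 27) (τ'.reg 6)
        (Function.update c v (c v + 1)) ∧
      Frame [6, 8, 12] [13, 14, 27] τ τ' ∧
      τ'.clk + (4 * lb n + 8) * τ.reg 6 ≤ τ.clk + (4 * lb n + 8) * τ'.reg 6 + 8 := by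
  have hw0 := hX.w_ne
  obtain ⟨hn, hnm, hlb, hthr, htab, hpow, hnch, hlt, hw, hXw, -, -, htp, -⟩ := hX
  have hB := lb_pos hn
  have hcv : c v < n := lt_of_le_of_lt
    (Finset.single_le_sum (f := c) (fun _ _ => Nat.zero_le _) (Finset.mem_range.mpr hvn)) hs
  have hdiv : v / lb n < n / lb n + 1 := Nat.lt_succ_of_le (Nat.div_le_div_right hvn.le)
  have hmod := Nat.mod_lt v hB
  have hal : ∀ i, i < τ.reg 6 → i * lb n + lb n ≤ n / thr n * lb n := by
    intro i hi
    have h1 : τ.reg 6 ≤ n / thr n := by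
      rw [Nat.le_div_iff_mul_le (thr_pos n)]
      exact hc.le_sum.trans hs.le
    have := Nat.mul_le_mul_right (lb n) (Nat.succ_le_of_lt (hi.trans_le h1))
    rwa [Nat.succ_mul] at this
  simp only [incrCode, wp_seq, wp_assign, wp_ite, wp_storeWord, wp_storeField]
  by_cases hp : τ.arr 13 (v / lb n) = 0
  · obtain ⟨hs1, hs2⟩ := hc.small v hvn hp
    by_cases hT : c v + 1 < thr n
    · simp [hv, hp, hs1, hT, hdiv, hvn, hc.incr_small hvn hp hT]
      omega
    · have hT' : c v + 1 = thr n := by omega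
      have hal' : τ.reg 6 * lb n + lb n ≤ n / thr n * lb n := by
        have h1 : τ.reg 6 + 1 ≤ n / thr n := by
          rw [Nat.le_div_iff_mul_le (thr_pos n)]
          -- Before anything is written, `incr_alloc` is applied to an idealised table, only to
          -- extract the bound on the number of tables which shows that there is room for one more.
          have h2 := (hc.incr_alloc hB hvn hp hT' (tab' := fun i => if i < τ.reg 6 * lb n then
            τ.arr 14 i else τ.arr 27 (v / lb n * lb n + (i - τ.reg 6 * lb n)))
            (fun i hi => by simp [hi]) (fun i hi _ => by simp)).le_sum
          have h3 := Counts.sum_update hvn c (c v + 1)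
          omega
        have := Nat.mul_le_mul_right (lb n) h1
        rwa [Nat.succ_mul] at this
      have hvb := Nat.div_mul_le_self v (lb n)
      have hk : (4 * lb n + 8) * (τ.reg 6 + 1) = (4 * lb n + 8) * τ.reg 6 + 4 * lb n + 8 := by
        ring
      simp [hv, hp, hs1, hT, hdiv, hvn]
      and_intros
      any_goals omega
      apply wp_loop (I := fun σ => ∃ i ≤ lb n, σ.reg 8 = i ∧ σ.reg 1 = v ∧ σ.reg 12 = v / lb n ∧
        σ.reg 6 = τ.reg 6 ∧ Frame [6, 8, 12] [13, 14, 27] τ σ ∧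
        σ.arr 13 = Function.update (τ.arr 13) (v / lb n) (τ.reg 6 * lb n + 1) ∧
        σ.arr 27 = τ.arr 27 ∧ σ.clk ≤ τ.clk + 5 + 4 * i ∧
        (∀ j < τ.reg 6 * lb n, σ.arr 14 j = τ.arr 14 j) ∧
        ∀ j < i, v / lb n * lb n + j < n →
          σ.arr 14 (τ.reg 6 * lb n + j) = τ.arr 27 (v / lb n * lb n + j))
        (μ := fun σ => lb n - σ.reg 8)
      · simp [hv]
      · rintro σ ⟨i, hi, h8, h1, h12, h6, hF, h13, h27, hclk, hold, hnew⟩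
        refine ⟨by simp, ?_, ?_⟩
        · simp only [val_lt, val_var, val_par, par_9, h8, ite_eq_right_iff, one_ne_zero, imp_false]
          intro hi'
          obtain rfl : i = lb n := by omega
          have := hc.incr_alloc hB hvn hp hT' hold hnew
          have hr6 := Nat.le_mul_of_pos_right (τ.reg 6) hB
          simp [h6, h1, h27, h13, hs1, hF, hvn, this]
          omega
        · simp only [val_lt, val_var, val_par, par_9, h8, ne_eq, ite_eq_right_iff, one_ne_zero,
            imp_false, not_not]
          intro hi'
          simp [h8, wp_ite, h12, h6, h27, h1, hF, h13]
          and_intros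
          any_goals omega
          · intro hlt'
            and_intros
            any_goals omega
            · intro j hj
              rw [Function.update_of_ne (by omega)]
              exact hold j hj
            · intro j hj hjn
              by_cases hji : j = i
              · simp [hji]
              · rw [Function.update_of_ne (by omega)]
                exact hnew j (by omega) hjn
          · intro hle
            and_intros
            any_goals omega
            · exact fun j hj hjn => hnew j (by omega) hjn
  · obtain ⟨i, hi, hpi⟩ := hc.ptr_eq v hvn hp
    have := hal i hi
    have hl := hc.large v hvn hp
    have hinc := hc.incr_large hB hvn hp
    simp only [hpi, Nat.add_sub_cancel] at hl hinc
    simp [hv, hpi, hdiv, hl, hinc]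
    omega

end WordRAM

/-! ### Depth-first search with an explicit stack -/

section

variable {n : ℕ} (nbr : Fin n → List (Fin n))

/-- The number of vertices that have not been found. -/
def unfound (f : List (Fin n × Option (Fin n))) : ℕ :=
  (Finset.univ.filter fun v => v ∉ f.map Prod.fst).card

theorem unfound_anti {f f' : List (Fin n × Option (Fin n))} (h : f <+: f') :
    unfound f' ≤ unfound f := by
  refine Finset.card_le_card fun v hv => ?_
  simp only [Finset.mem_filter, Finset.mem_univ, true_and] at hv ⊢
  exact fun h' => hv ((h.map Prod.fst).subset h')

theorem unfound_append {f : List (Fin n × Option (Fin n))} {v : Fin n} (p : Option (Fin n))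
    (hv : v ∉ f.map Prod.fst) : unfound (f ++ [(v, p)]) < unfound f := by
  refine Finset.card_lt_card ⟨fun u hu => ?_, fun h => ?_⟩
  · simp only [Finset.mem_filter, Finset.mem_univ, true_and, List.map_append, List.mem_append,
      not_or] at hu ⊢
    exact hu.1
  · have := h (Finset.mem_filter.mpr ⟨Finset.mem_univ v, hv⟩)
    simp at this

theorem foldl_prefix {α β : Type*} {g : List α → β → List α} (hg : ∀ f u, f <+: g f u)
    (l : List β) (f : List α) : f <+: l.foldl g f := by
  induction l generalizing f with
  | nil => exact List.prefix_rfl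
  | cons u l ih => exact (hg f u).trans (ih _)

theorem dfsVisit_prefix (d : ℕ) (f : List (Fin n × Option (Fin n))) (p : Option (Fin n))
    (v : Fin n) : f <+: dfsVisit nbr d f p v := by
  induction d generalizing f p v with
  | zero => exact List.prefix_rfl
  | succ d ih =>
    rw [dfsVisit]
    split
    · exact List.prefix_rfl
    · exact (List.prefix_append _ _).trans (foldl_prefix (fun f u => ih f _ u) _ _)

/-- Each nested visit takes place after one more vertex has been discovered. So the number of
undiscovered vertices bounds the depth of the recursion, and all sufficient amounts of fuel agree.
-/
theorem dfsVisit_fuel (d d' : ℕ) {f : List (Fin n × Option (Fin n))} (p : Option (Fin n))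
    (v : Fin n) (h : unfound f ≤ d) (h' : unfound f ≤ d') :
    dfsVisit nbr d f p v = dfsVisit nbr d' f p v := by
  induction d generalizing d' f p v with
  | zero =>
    have hv : v ∈ f.map Prod.fst := by
      by_contra hv
      have := Finset.card_eq_zero.mp (Nat.le_zero.mp h)
      exact Finset.notMem_empty v (this ▸ Finset.mem_filter.mpr ⟨Finset.mem_univ v, hv⟩)
    cases d' <;> simp only [dfsVisit, hv, if_true]
  | succ d ih =>
    cases d' with
    | zero =>
      have hv : v ∈ f.map Prod.fst := by
        by_contra hv
        have := Finset.card_eq_zero.mp (Nat.le_zero.mp h')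
        exact Finset.notMem_empty v (this ▸ Finset.mem_filter.mpr ⟨Finset.mem_univ v, hv⟩)
      simp only [dfsVisit, hv, if_true]
    | succ d' =>
      by_cases hv : v ∈ f.map Prod.fst
      · simp only [dfsVisit, hv, if_true]
      · simp only [dfsVisit, hv, if_false]
        have hlt := unfound_append p hv
        have key : ∀ (l : List (Fin n)) (g : List (Fin n × Option (Fin n))), unfound g ≤ d →
            unfound g ≤ d' → l.foldl (fun f u => dfsVisit nbr d f (some v) u) g =
              l.foldl (fun f u => dfsVisit nbr d' f (some v) u) g := by
          intro l
          induction l with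
          | nil => exact fun _ _ _ => rfl
          | cons u l ihl =>
            intro g hg hg'
            rw [List.foldl_cons, List.foldl_cons, ← ih d' (some v) u hg hg']
            have := unfound_anti (dfsVisit_prefix nbr d g (some v) u)
            exact ihl _ (by omega) (by omega)
        exact key _ _ (by omega) (by omega)

/-- A visit, with enough fuel. -/
def visit (f : List (Fin n × Option (Fin n))) (p : Option (Fin n)) (v : Fin n) :
    List (Fin n × Option (Fin n)) := dfsVisit nbr n f p v

variable {nbr}

theorem unfound_le (f : List (Fin n × Option (Fin n))) : unfound f ≤ n :=
  (Finset.card_le_univ _).trans (Fintype.card_fin n).le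

theorem visit_of_mem {f : List (Fin n × Option (Fin n))} {p : Option (Fin n)} {v : Fin n}
    (hv : v ∈ f.map Prod.fst) : visit nbr f p v = f := by
  obtain _ | n := n
  · exact v.elim0
  · simp only [visit, dfsVisit, hv, if_true]

theorem visit_of_not_mem {f : List (Fin n × Option (Fin n))} {p : Option (Fin n)} {v : Fin n}
    (hv : v ∉ f.map Prod.fst) : visit nbr f p v =
      (nbr v).foldl (fun f u => visit nbr f (some v) u) (f ++ [(v, p)]) := by
  -- Fuel `n + 1` gives the same result, and one unfolding leaves fuel `n` for the visits of the
  -- neighbours, so the recursion closes on `visit`.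
  rw [visit, dfsVisit_fuel nbr n (n + 1) p v (unfound_le f) ((unfound_le f).trans (Nat.le_succ n)),
    dfsVisit]
  simp only [hv, if_false]
  rfl

/-- What remains to be done when the stack has the entries `sv i`, `i < h`, with `sr i` neighbours
treated. -/
def contin (nbr : Fin n → List (Fin n)) (sv : ℕ → Fin n) (sr : ℕ → ℕ) :
    ℕ → List (Fin n × Option (Fin n)) → List (Fin n × Option (Fin n))
  | 0, f => f
  | h + 1, f => contin nbr sv sr h
      (((nbr (sv h)).drop (sr h)).foldl (fun f u => visit nbr f (some (sv h)) u) f)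

theorem contin_congr {sv sv' : ℕ → Fin n} {sr sr' : ℕ → ℕ} {h : ℕ}
    (hs : ∀ i < h, sv i = sv' i ∧ sr i = sr' i) (f : List (Fin n × Option (Fin n))) :
    contin nbr sv sr h f = contin nbr sv' sr' h f := by
  induction h generalizing f with
  | zero => rfl
  | succ h ih =>
    rw [contin, contin, (hs h (by omega)).1, (hs h (by omega)).2, ih fun i hi => hs i (by omega)]

/-- Nothing is left to fold over. Together with the next two lemmas this shows that no step on the
explicit stack changes the eventual result. -/
theorem contin_pop {sv : ℕ → Fin n} {sr : ℕ → ℕ} {h : ℕ} (hr : (nbr (sv h)).length ≤ sr h)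
    (f : List (Fin n × Option (Fin n))) : contin nbr sv sr (h + 1) f = contin nbr sv sr h f := by
  rw [contin, List.drop_eq_nil_of_le hr, List.foldl_nil]

theorem contin_found {sv : ℕ → Fin n} {sr : ℕ → ℕ} {h : ℕ} {u : Fin n}
    (hu : (nbr (sv h))[sr h]? = some u) {f : List (Fin n × Option (Fin n))}
    (hf : u ∈ f.map Prod.fst) : contin nbr sv sr (h + 1) f =
      contin nbr sv (Function.update sr h (sr h + 1)) (h + 1) f := by
  obtain ⟨hlt, hu⟩ := List.getElem?_eq_some_iff.mp hu
  rw [contin, contin, Function.update_self, List.drop_eq_getElem_cons hlt, List.foldl_cons, hu,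
    visit_of_mem hf]
  exact contin_congr (fun i hi => ⟨rfl, by rw [Function.update_of_ne (by omega)]⟩) _

theorem contin_push {sv : ℕ → Fin n} {sr : ℕ → ℕ} {h : ℕ} {u : Fin n}
    (hu : (nbr (sv h))[sr h]? = some u) {f : List (Fin n × Option (Fin n))}
    (hf : u ∉ f.map Prod.fst) : contin nbr sv sr (h + 1) f =
      contin nbr (Function.update sv (h + 1) u)
        (Function.update (Function.update sr h (sr h + 1)) (h + 1) 0) (h + 2)
        (f ++ [(u, some (sv h))]) := by
  obtain ⟨hlt, hu⟩ := List.getElem?_eq_some_iff.mp hu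
  rw [contin, contin, contin, Function.update_self, Function.update_self,
    Function.update_of_ne (show h ≠ h + 1 by omega), Function.update_of_ne (show h ≠ h +
        1 by omega),
    Function.update_self, List.drop_zero, List.drop_eq_getElem_cons hlt, List.foldl_cons, hu,
    visit_of_not_mem hf]
  exact contin_congr (fun i hi => ⟨by rw [Function.update_of_ne (by omega)], by
    rw [Function.update_of_ne (by omega), Function.update_of_ne (by omega)]⟩) _

/-- The invariant of the search: `f` are the found vertices, and the stack has the entries `sv i`,
`i < h`, with `sr i` neighbours treated. -/
structure Search (nbr : Fin n → List (Fin n)) (f : List (Fin n × Option (Fin n))) (h : ℕ)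
    (sv : ℕ → Fin n) (sr : ℕ → ℕ) : Prop where
  nodup : (f.map Prod.fst).Nodup
  mem : ∀ i < h, sv i ∈ f.map Prod.fst
  inj : ∀ i j, i < j → j < h → sv i ≠ sv j
  le : ∀ i < h, sr i ≤ (nbr (sv i)).length
  found : ∀ i < h, ∀ r < sr i, ∀ x, (nbr (sv i))[r]? = some x → x ∈ f.map Prod.fst
  link : ∀ i, i + 1 < h → 0 < sr i ∧ (nbr (sv i))[sr i - 1]? = some (sv (i + 1))
  skip : ∀ i j r, i < j → j < h → r + 1 < sr i → (nbr (sv i))[r]? ≠ some (sv j)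

namespace Search

variable {f : List (Fin n × Option (Fin n))} {h : ℕ} {sv : ℕ → Fin n} {sr : ℕ → ℕ}

theorem init (sv : ℕ → Fin n) (sr : ℕ → ℕ) : Search nbr [] 0 sv sr where
  nodup := List.nodup_nil
  mem i hi := absurd hi (by omega)
  inj i j _ hj := absurd hj (by omega)
  le i hi := absurd hi (by omega)
  found i hi := absurd hi (by omega)
  link i hi := absurd hi (by omega)
  skip i j r _ hj := absurd hj (by omega)

theorem nodup_append (hs : Search nbr f h sv sr) {v : Fin n} (p : Option (Fin n))
    (hv : v ∉ f.map Prod.fst) : ((f ++ [(v, p)]).map Prod.fst).Nodup := by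
  simp only [List.map_append, List.map_cons, List.map_nil]
  exact List.nodup_append.mpr ⟨hs.nodup, List.nodup_singleton _, fun a ha b hb => by
    rw [List.mem_singleton] at hb; rintro rfl; exact hv (hb ▸ ha)⟩

theorem root (hs : Search nbr f 0 sv sr) {v : Fin n} (hv : v ∉ f.map Prod.fst) :
    Search nbr (f ++ [(v, none)]) 1 (Function.update sv 0 v) (Function.update sr 0 0) where
  nodup := hs.nodup_append none hv
  mem i hi := by obtain rfl : i = 0 := by omega
                 simp
  inj i j hij hj := by omega
  le i hi := by obtain rfl : i = 0 := by omega
                simp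
  found i hi r hr := by obtain rfl : i = 0 := by omega
                        simp at hr
  link i hi := by omega
  skip i j r hij hj := by omega

theorem pop (hs : Search nbr f (h + 1) sv sr) : Search nbr f h sv sr where
  nodup := hs.nodup
  mem i hi := hs.mem i (by omega)
  inj i j hij hj := hs.inj i j hij (by omega)
  le i hi := hs.le i (by omega)
  found i hi := hs.found i (by omega)
  link i hi := hs.link i (by omega)
  skip i j r hij hj := hs.skip i j r hij (by omega)

theorem advance (hs : Search nbr f (h + 1) sv sr) {u : Fin n}
    (hu : (nbr (sv h))[sr h]? = some u) (hf : u ∈ f.map Prod.fst) :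
    Search nbr f (h + 1) sv (Function.update sr h (sr h + 1)) where
  nodup := hs.nodup
  mem := hs.mem
  inj := hs.inj
  le i hi := by
    by_cases hih : i = h
    · subst hih
      rw [Function.update_self]
      exact (List.getElem?_eq_some_iff.mp hu).1
    · rw [Function.update_of_ne hih]; exact hs.le i hi
  found i hi r hr x hx := by
    by_cases hih : i = h
    · subst hih
      rw [Function.update_self] at hr
      by_cases hr' : r = sr i
      · subst hr'
        rw [hu] at hx
        exact Option.some.inj hx ▸ hf
      · exact hs.found i hi r (by omega) x hx
    · rw [Function.update_of_ne hih] at hr; exact hs.found i hi r hr x hx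
  link i hi := by rw [Function.update_of_ne (by omega)]; exact hs.link i hi
  skip i j r hij hj hr := by
    rw [Function.update_of_ne (by omega)] at hr; exact hs.skip i j r hij hj hr

/-- For the new top, `skip` holds because `u` is undiscovered, whereas all treated neighbours of
stack entries have been discovered. This is what later allows a scan of a neighbour list to
recognise the successor on the stack. -/
theorem push (hs : Search nbr f (h + 1) sv sr) {u : Fin n}
    (hu : (nbr (sv h))[sr h]? = some u) (hf : u ∉ f.map Prod.fst) :
    Search nbr (f ++ [(u, some (sv h))]) (h + 2) (Function.update sv (h + 1) u)
      (Function.update (Function.update sr h (sr h + 1)) (h + 1) 0) where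
  nodup := hs.nodup_append _ hf
  mem i hi := by
    by_cases hih : i = h + 1
    · subst hih; simp
    · rw [Function.update_of_ne hih, List.map_append]
      exact List.mem_append_left _ (hs.mem i (by omega))
  inj i j hij hj := by
    rw [Function.update_of_ne (show i ≠ h + 1 by omega)]
    by_cases hjh : j = h + 1
    · subst hjh
      rw [Function.update_self]
      rintro rfl
      exact hf (hs.mem i (by omega))
    · rw [Function.update_of_ne hjh]; exact hs.inj i j hij (by omega)
  le i hi := by
    by_cases hih : i = h + 1
    · subst hih; simp
    · rw [Function.update_of_ne hih, Function.update_of_ne hih]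
      by_cases hih' : i = h
      · subst hih'
        rw [Function.update_self]
        exact (List.getElem?_eq_some_iff.mp hu).1
      · rw [Function.update_of_ne hih']; exact hs.le i (by omega)
  found i hi r hr x hx := by
    by_cases hih : i = h + 1
    · subst hih; simp at hr
    · rw [Function.update_of_ne hih] at hr hx
      by_cases hih' : i = h
      · subst hih'
        rw [Function.update_self] at hr
        by_cases hr' : r = sr i
        · subst hr'
          rw [hu] at hx
          simp [Option.some.inj hx]
        · rw [List.map_append]
          exact List.mem_append_left _ (hs.found i (by omega) r (by omega) x hx)
      · rw [Function.update_of_ne hih'] at hr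
        rw [List.map_append]
        exact List.mem_append_left _ (hs.found i (by omega) r hr x hx)
  link i hi := by
    rw [Function.update_of_ne (show i ≠ h + 1 by omega),
      Function.update_of_ne (show i ≠ h + 1 by omega)]
    by_cases hih : i = h
    · subst hih; simpa using hu
    · rw [Function.update_of_ne hih, Function.update_of_ne (by omega)]
      exact hs.link i (by omega)
  skip i j r hij hj hr := by
    rw [Function.update_of_ne (show i ≠ h + 1 by omega)] at hr ⊢
    by_cases hjh : j = h + 1
    · subst hjh
      rw [Function.update_self]
      intro hx
      refine hf (hs.found i (by omega) r ?_ u hx)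
      by_cases hih : i = h
      · subst hih; rw [Function.update_self] at hr; omega
      · rw [Function.update_of_ne hih] at hr; omega
    · rw [Function.update_of_ne hjh]
      rw [Function.update_of_ne (by omega)] at hr
      exact hs.skip i j r hij (by omega) hr

theorem length_le (hs : Search nbr f h sv sr) : f.length ≤ n := by
  have := hs.nodup.length_le_card
  simpa using this

theorem length_lt (hs : Search nbr f h sv sr) {v : Fin n} (hv : v ∉ f.map Prod.fst) :
    f.length < n := by
  have := (hs.nodup_append none hv).length_le_card
  simp at this; omega

theorem sum_le (hs : Search nbr f h sv sr) (g : Fin n → ℕ) :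
    (f.map fun e => g e.1).sum ≤ ∑ v, g v := by
  have h1 : (f.map fun e => g e.1).sum = ∑ v ∈ (f.map Prod.fst).toFinset, g v := by
    rw [List.sum_toFinset _ hs.nodup, List.map_map]; rfl
  rw [h1]
  exact Finset.sum_le_sum_of_subset (Finset.subset_univ _)

theorem le_n (hs : Search nbr f h sv sr) : h ≤ n := by
  have : Function.Injective fun i : Fin h => sv i := by
    intro i j hij
    by_contra hne
    rcases lt_or_gt_of_ne (fun h => hne (Fin.ext h) : (i : ℕ) ≠ j) with hlt | hlt
    · exact hs.inj i j hlt j.2 hij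
    · exact hs.inj j i hlt i.2 hij.symm
  simpa using Fintype.card_le_of_injective _ this

end Search

/-! ### Numbers of children -/

/-- The numbers of children, as a function on `ℕ`. -/
def kids (f : List (Fin n × Option (Fin n))) (v : ℕ) : ℕ :=
  f.countP fun e => e.2.map Fin.val = some v

theorem kids_eq (f : List (Fin n × Option (Fin n))) (v : Fin n) : kids f v = childCount f v := by
  refine List.countP_congr fun e _ => ?_
  rcases e with ⟨u, _ | p⟩
  · simp
  · simp [Fin.ext_iff]

theorem kids_root (f : List (Fin n × Option (Fin n))) (u : Fin n) :
    kids (f ++ [(u, none)]) = kids f := by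
  funext v; simp [kids]

theorem kids_append (f : List (Fin n × Option (Fin n))) (u v : Fin n) :
    kids (f ++ [(u, some v)]) = Function.update (kids f) v (kids f v + 1) := by
  funext x
  by_cases hx : x = v
  · subst hx; simp [kids]
  · rw [Function.update_of_ne hx]
    simp [kids, Ne.symm hx]

/-- Each discovered vertex has at most one parent. -/
theorem sum_kids_le (f : List (Fin n × Option (Fin n))) :
    ∑ v ∈ Finset.range n, kids f v ≤ f.length := by
  induction f using List.reverseRecOn with
  | nil => simp [kids]
  | append_singleton f e ih =>
    rcases e with ⟨u, _ | p⟩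
    · rw [kids_root]; simp; omega
    · rw [kids_append]
      have := WordRAM.Counts.sum_update p.2 (kids f) (kids f p + 1)
      simp; omega

end

/-! ### The input -/

open WordRAM (rd)

/-- The input is the adjacency array of a graph with `m` edges. -/
structure InputOk {n : ℕ} (nbr : Fin n → List (Fin n)) (m : ℕ) (input : List ℕ) : Prop where
  length : input.length = n + m + 1
  zero : rd input 0 = n
  succ : ∀ v : Fin n, rd input (v + 1) = rd input v + (nbr v).length
  get : ∀ (v u : Fin n) r, (nbr v)[r]? = some u → rd input (rd input v + 1 + r) = u + 1
  le : ∀ v : Fin n, rd input v + (nbr v).length ≤ n + m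
  lt : ∀ x ∈ input, x ≤ n + m

theorem getElem?_flatten_ofFn {α : Type*} {n : ℕ} (g : Fin n → List α) (v : Fin n) (r : ℕ) (x : α)
    (hx : (g v)[r]? = some x) :
    (List.ofFn g).flatten[∑ u ∈ Finset.Iio v, (g u).length + r]? = some x := by
  induction n with
  | zero => exact v.elim0
  | succ n ih =>
    rw [List.ofFn_succ, List.flatten_cons]
    refine Fin.cases (fun hx => ?_) (fun v hx => ?_) v hx
    · have : Finset.Iio (0 : Fin (n + 1)) = ∅ := by ext u; simp
      rw [this, Finset.sum_empty, zero_add, List.getElem?_append_left]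
      · exact hx
      · exact (List.getElem?_eq_some_iff.mp hx).1
    · have : ∑ u ∈ Finset.Iio v.succ, (g u).length =
          (g 0).length + ∑ u ∈ Finset.Iio v, (g u.succ).length := by
        have h1 : Finset.Iio v.succ = insert 0 ((Finset.Iio v).map (Fin.succEmb n)) := by
          ext u
          refine Fin.cases ?_ (fun u => ?_) u
          · simp
          · simp
        rw [h1, Finset.sum_insert (by simp), Finset.sum_map]
        rfl
      rw [this, add_assoc, List.getElem?_append_right (by omega), Nat.add_sub_cancel_left]
      exact ih (fun u => g u.succ) v hx

/-- The leading entry `n` acts as the end of a fictitious list in front of the first one. Hence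
entry `v` is the end of the preceding list for every vertex, the first one included, and no case
distinction is needed on the machine. -/
theorem AdjacencyLists.inputOk {n : ℕ} (hn : 0 < n) {G : Digraph (Fin n)} (A : AdjacencyLists G) :
    InputOk A.nbr A.m A.array := by
  have hhead : ∀ v : Fin n, rd A.array (v + 1) = n + ∑ u ∈ Finset.Iic v, (A.nbr u).length := by
    intro v
    rw [rd, AdjacencyLists.array, List.cons_append, List.getD_cons_succ,
      List.getD_append _ _ _ _ (by simp), List.getD_eq_getElem _ _ (by simp)]
    simp
  have hiic : ∀ v : Fin n, ∑ u ∈ Finset.Iic v, (A.nbr u).length =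
      ∑ u ∈ Finset.Iio v, (A.nbr u).length + (A.nbr v).length := by
    intro v
    rw [← Finset.Iio_insert, Finset.sum_insert (by simp), add_comm]
  have hhead' : ∀ v : Fin n, rd A.array v = n + ∑ u ∈ Finset.Iio v, (A.nbr u).length := by
    rintro ⟨_ | v, hv⟩
    · have : Finset.Iio (⟨0, hv⟩ : Fin n) = ∅ := by
        ext u; simp [Fin.lt_def]
      rw [this]
      simp [AdjacencyLists.array, rd]
    · have := hhead ⟨v, by omega⟩
      rw [this]
      congr 2
      ext u
      simp [Fin.lt_def, Fin.le_def]
  have hle : ∀ v : Fin n, ∑ u ∈ Finset.Iic v, (A.nbr u).length ≤ A.m := fun v =>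
    Finset.sum_le_sum_of_subset (Finset.subset_univ _)
  have hlen : A.array.length = n + A.m + 1 := by
    simp only [AdjacencyLists.array, List.length_append, List.length_cons, List.length_ofFn,
      List.length_flatten, List.map_ofFn, List.sum_ofFn, AdjacencyLists.m, Function.comp_def,
      List.length_map]
    omega
  refine ⟨hlen, by simp [AdjacencyLists.array, rd], fun v => ?_, fun v u r hr => ?_, fun v => ?_,
    ?_⟩
  · rw [hhead, hhead', hiic, add_assoc]
  · rw [hhead']
    have h1 := getElem?_flatten_ofFn (fun v => (A.nbr v).map vertexLabel) v r (vertexLabel u)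
      (by rw [List.getElem?_map, hr]; rfl)
    simp only [List.length_map] at h1
    rw [rd, AdjacencyLists.array, List.getD_eq_getElem?_getD, List.getElem?_append_right
      (by simp; omega)]
    simp only [List.length_cons, List.length_ofFn]
    rw [show n + ∑ u ∈ Finset.Iio v, (A.nbr u).length + 1 + r - (n + 1) =
      ∑ u ∈ Finset.Iio v, (A.nbr u).length + r by omega, h1]
    rfl
  · have := hle v
    rw [hiic] at this
    rw [hhead']; omega
  · intro x hx
    simp only [AdjacencyLists.array, List.mem_append, List.mem_cons, List.mem_ofFn,
      List.mem_flatten] at hx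
    rcases hx with (rfl | ⟨v, rfl⟩) | ⟨l, ⟨v, rfl⟩, hx⟩
    · omega
    · have := hle v; omega
    · obtain ⟨u, -, rfl⟩ := List.mem_map.mp hx
      simp only [vertexLabel]; omega

namespace WordRAM

/-! ### The stack and its segments -/

namespace Par

theorem lt_seg_mul {n : ℕ} (hn : 0 < n) : n < lg n * seg n := by
  rw [seg, mul_comm]
  exact Nat.lt_mul_of_div_lt (Nat.lt_succ_self _) (lg_pos hn)

theorem div_seg_lt {n i : ℕ} (hn : 0 < n) (hi : i ≤ n) : i / seg n < lg n := by
  rw [Nat.div_lt_iff_lt_mul (seg_pos n)]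
  exact hi.trans_lt (lt_seg_mul hn)

/-- Groups of `d / l + 1` neighbours strike the balance: their numbers do not exceed `l`, so that
they fit into a field, and the scan of one group takes only about `d / l` steps. -/
theorem div_group_le {l d r : ℕ} (hl : 0 < l) (hr : r ≤ d) : r / (d / l + 1) ≤ l := by
  rw [← Nat.lt_succ_iff, Nat.div_lt_iff_lt_mul (Nat.succ_pos _)]
  have := Nat.lt_mul_of_div_lt (Nat.lt_succ_self (d / l)) hl
  calc r ≤ d := hr
    _ < (d / l + 1) * l := this
    _ ≤ (l + 1) * (d / l + 1) := by rw [mul_comm]; exact Nat.mul_le_mul_right _ (Nat.le_succ l)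

end Par

/-- The machine's view of the stack: the `lo` lowest entries are known only roughly, the others are
in the buffer. -/
structure StackRep {n : ℕ} (nbr : Fin n → List (Fin n)) (input : List ℕ)
    (f : List (Fin n × Option (Fin n))) (h lo : ℕ) (sv : ℕ → Fin n) (sr : ℕ → ℕ)
    (arr : ℕ → ℕ → ℕ) : Prop where
  dvd : seg n ∣ lo
  le : lo ≤ h
  le_buf : h ≤ lo + 2 * seg n
  buf : ∀ i, lo ≤ i → i < h → arr 22 (i % (2 * seg n)) = sv i ∧
    arr 23 (i % (2 * seg n)) = rd input (sv i) + 1 + sr i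
  white : ∀ v : Fin n, v ∉ f.map Prod.fst → arr 25 v = 0
  black : ∀ v : Fin n, v ∈ f.map Prod.fst → (∀ i < h, sv i ≠ v) → arr 25 v = 1
  gray : ∀ i, lo ≤ i → i < h → arr 25 (sv i) = 2
  dropped : ∀ i < lo, arr 25 (sv i) = 3 + i / seg n ∧
    arr 26 (sv i) = (sr i - 1) / ((nbr (sv i)).length / lg n + 1)
  trail : ∀ j, j * seg n < lo → arr 24 j = sv (j * seg n)

/-! ### Dropping a segment of the stack -/

/-- Remove the lowest segment from the buffer. -/
def dropCode : Stmt :=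
  assign 9 (var 5 / par 6) ;;
  storeWord 24 (var 9) (word 22 (var 5 % (lit 2 * par 6))) ;;
  assign 8 (var 5) ;;
  loop (Expr.lt (var 8) (var 5 + par 6))
   (assign 7 (var 8 % (lit 2 * par 6)) ;;
    assign 10 (word 22 (var 7)) ;;
    storeField 26 (var 10) ((word 23 (var 7) - lit 2 - inp (var 10)) /
      ((inp (var 10 + lit 1) - inp (var 10)) / par 5 + lit 1)) ;;
    storeField 25 (var 10) (lit 3 + var 9) ;;
    assign 8 (var 8 + lit 1)) ;;
  assign 5 (var 5 + par 6)

theorem add_div_seg {n lo i : ℕ} (hd : seg n ∣ lo) (h : lo ≤ i) (h' : i < lo + seg n) :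
    i / seg n = lo / seg n := by
  obtain ⟨j, rfl⟩ := hd
  have hq := seg_pos n
  rw [Nat.mul_div_cancel_left _ hq, Nat.div_eq_of_lt_le]
  · rw [mul_comm]; exact h
  · rw [Nat.succ_mul, mul_comm]; exact h'

/-- The buffer is full, so a whole segment remains above the one that leaves. In particular each
dropped entry has a successor on the stack, and by `link` it has a last treated neighbour, whose
group number is recorded. -/
theorem wp_drop {n m w X : ℕ} (hX : Bounds n m w X) {nbr : Fin n → List (Fin n)} {input : List ℕ}
    (hin : InputOk nbr m input) {τ : St} {f : List (Fin n × Option (Fin n))} {h lo : ℕ}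
    {sv : ℕ → Fin n} {sr : ℕ → ℕ} (hs : Search nbr f h sv sr)
    (hr : StackRep nbr input f h lo sv sr τ.arr) (h5 : τ.reg 5 = lo) (hh : h = lo + 2 * seg n) :
    wp (env n w 28 input) dropCode τ fun τ' =>
      StackRep nbr input f h (lo + seg n) sv sr τ'.arr ∧ τ'.reg 5 = lo + seg n ∧
      Frame [5, 7, 8, 9, 10] [24, 25, 26] τ τ' ∧ τ'.clk ≤ τ.clk + 6 * seg n + 5 := by
  have hw0 := hX.w_ne
  obtain ⟨hn, hnm, hlb, hthr, htab, hpow, hnch, hlt, hw, hXw, -, -, htp, hlp⟩ := hX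
  have hq := seg_pos n
  have hhn := hs.le_n
  have hlo : lo / seg n < lg n := div_seg_lt hn (by omega)
  have hmod : ∀ i, i % (2 * seg n) < 2 * seg n := fun i => Nat.mod_lt _ (by omega)
  have hb := hr.buf lo le_rfl (by omega)
  simp [dropCode, h5, hmod]
  and_intros
  any_goals omega
  apply wp_loop (I := fun σ => ∃ i ≤ lo + seg n, lo ≤ i ∧ σ.reg 8 = i ∧ σ.reg 5 = lo ∧
    σ.reg 9 = lo / seg n ∧ Frame [5, 7, 8, 9, 10] [24, 25, 26] τ σ ∧
    σ.arr 24 = Function.update (τ.arr 24) (lo / seg n) (sv lo) ∧ 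
    σ.clk + 6 * lo ≤ τ.clk + 3 + 6 * i ∧
    (∀ j, lo ≤ j → j < i → σ.arr 25 (sv j) = 3 + lo / seg n ∧
      σ.arr 26 (sv j) = (sr j - 1) / ((nbr (sv j)).length / lg n + 1)) ∧
    ∀ v : Fin n, (∀ j, lo ≤ j → j < i → sv j ≠ v) →
      σ.arr 25 v = τ.arr 25 v ∧ σ.arr 26 v = τ.arr 26 v) (μ := fun σ => lo + seg n - σ.reg 8)
  · simp [h5, hb.1]
    omega
  · rintro σ ⟨i, hi, hi', h8, h5', h9, hF, h24, hclk, hnew, hold⟩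
    have a22 := hF.arr 22 (by simp)
    have a23 := hF.arr 23 (by simp)
    refine ⟨by simp [h5']; omega, ?_, ?_⟩
    · simp only [val_lt, val_var, val_par, val_add, par_6, h8, h5', ite_eq_right_iff, one_ne_zero,
        imp_false]
      intro hlt'
      obtain rfl : i = lo + seg n := by omega
      simp [h5', hF]
      refine ⟨by omega, ?_, by omega⟩
      refine ⟨(hr.dvd).add (dvd_refl _), by omega, by omega, fun i hi hi' => ?_, fun v hv => ?_,
        fun v hv hv' => ?_, fun i hi hi' => ?_, fun i hi => ?_, fun j hj => ?_⟩
      · rw [a22, a23]; exact hr.buf i (by omega) hi'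
      · rw [(hold v fun j _ hj he => hv (he ▸ hs.mem j (by omega))).1]; exact hr.white v hv
      · rw [(hold v fun j _ hj => hv' j (by omega)).1]; exact hr.black v hv hv'
      · rw [(hold _ fun j _ hj => hs.inj j i (by omega) hi').1]; exact hr.gray i (by omega) hi'
      · by_cases hil : i < lo
        · obtain ⟨e1, e2⟩ := hold (sv i) fun j hj _ => (hs.inj i j (by omega) (by omega)).symm
          rw [e1, e2]
          exact hr.dropped i hil
        · rw [add_div_seg hr.dvd (by omega) hi]
          exact hnew i (by omega) hi
      · rw [h24]
        by_cases hjl : j = lo / seg n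
        · subst hjl
          rw [Function.update_self, Nat.div_mul_cancel hr.dvd]
        · rw [Function.update_of_ne hjl]
          refine hr.trail j ?_
          obtain ⟨k, rfl⟩ := hr.dvd
          rw [Nat.mul_div_cancel_left _ hq] at hjl
          have : j < k + 1 := by
            by_contra hc
            have := Nat.mul_le_mul_right (seg n) (not_lt.mp hc)
            rw [Nat.succ_mul, mul_comm k] at this
            omega
          rw [mul_comm]
          exact Nat.mul_lt_mul_of_pos_left (by omega) hq
    · simp only [val_lt, val_var, val_par, val_add, par_6, h8, h5', ne_eq, ite_eq_right_iff,
        one_ne_zero, imp_false, not_not]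
      intro hlt'
      obtain ⟨b1, b2⟩ := hr.buf i hi' (by omega)
      have hlink := hs.link i (by omega)
      have hle := hs.le i (by omega)
      have hsucc := hin.succ (sv i)
      have hinle := hin.le (sv i)
      have hvlt := (sv i).2
      have hgrp := div_group_le (lg_pos hn) (show sr i - 1 ≤ (nbr (sv i)).length by omega)
      have hdl := Nat.div_le_self (nbr (sv i)).length (lg n)
      rw [← a22] at b1
      rw [← a23] at b2
      -- The buffer holds the position of the next neighbour, and the list starts one after the end
      -- of the preceding list; subtracting `2` therefore leads to the index of the last treated
      -- neighbour.
      have e1 : rd input (sv i) + 1 + sr i - 2 - rd input (sv i) = sr i - 1 := by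
        omega
      simp [h8, h9, h5', b1, b2, hmod, hin.length, hF, h24, hsucc, e1]
      and_intros
      any_goals omega
      · intro j hj hj'
        by_cases hji : j = i
        · subst hji; simp
        · have hne : (sv j : ℕ) ≠ sv i := fun he => hs.inj j i (by omega) (by omega) (Fin.ext he)
          rw [Function.update_of_ne hne, Function.update_of_ne hne]
          exact hnew j hj (by omega)
      · intro v hv
        have hne : (v : ℕ) ≠ sv i := fun he => hv i hi' le_rfl (Fin.ext he.symm)
        rw [Function.update_of_ne hne, Function.update_of_ne hne]
        exact hold v fun j hj hj' => hv j hj (by omega)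

/-! ### Rebuilding a segment of the stack -/

/-- Bring the topmost segment outside of the buffer back, when the buffer holds only the top entry
of the stack, with the vertex in variable `1`. -/
def restoreCode : Stmt :=
  assign 9 (var 5 / par 6 - lit 1) ;;
  storeField 25 (var 1) (lit 3 + var 9) ;;
  assign 10 (word 24 (var 9)) ;;
  assign 8 (var 5 - par 6) ;;
  loop (Expr.lt (var 8) (var 5))
   (storeField 25 (var 10) (lit 2) ;;
    assign 11 (inp (var 10) + lit 1 +
      field 26 (var 10) * ((inp (var 10 + lit 1) - inp (var 10)) / par 5 + lit 1)) ;;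
    loop (.bin .xor (field 25 (inp (var 11) - lit 1)) (lit 3 + var 9)) (assign 11 (var 11 + lit 1)) ;;
    storeWord 22 (var 8 % (lit 2 * par 6)) (var 10) ;;
    storeWord 23 (var 8 % (lit 2 * par 6)) (var 11 + lit 1) ;;
    assign 10 (inp (var 11) - lit 1) ;;
    assign 8 (var 8 + lit 1)) ;;
  assign 5 (var 5 - par 6)

/-- The entries of the stack are distinct, so their degrees add up to at most the total degree. This
bounds the time for scanning one group per entry. -/
theorem sum_seg_le {n : ℕ} {nbr : Fin n → List (Fin n)} {f h} {sv : ℕ → Fin n} {sr : ℕ → ℕ}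
    (hs : Search nbr f h sv sr) {a b : ℕ} (hb : b ≤ h) (l : ℕ) (hl : 0 < l) :
    ∑ i ∈ Finset.Ico a b, (nbr (sv i)).length / l ≤ (∑ v, (nbr v).length) / l := by
  rw [Nat.le_div_iff_mul_le hl, Finset.sum_mul]
  calc ∑ i ∈ Finset.Ico a b, (nbr (sv i)).length / l * l
      ≤ ∑ i ∈ Finset.Ico a b, (nbr (sv i)).length :=
        Finset.sum_le_sum fun i _ => Nat.div_mul_le_self _ _
    _ = ∑ v ∈ (Finset.Ico a b).image sv, (nbr v).length := by
        rw [Finset.sum_image]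
        intro i hi j hj hij
        simp only [Finset.coe_Ico, Set.mem_Ico] at hi hj
        by_contra hne
        rcases lt_or_gt_of_ne hne with hlt | hlt
        · exact hs.inj i j hlt (by omega) hij
        · exact hs.inj j i hlt (by omega) hij.symm
    _ ≤ ∑ v, (nbr v).length := Finset.sum_le_sum_of_subset (Finset.subset_univ _)

/-- Serves the cyclic buffer, whose live indices lie in a window of its length. -/
theorem mod_ne_mod {q lo i j : ℕ} (hi : lo ≤ i) (hij : i < j) (hj : j < lo + q) :
    i % q ≠ j % q := by
  intro h
  have h1 := Nat.div_add_mod i q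
  have h2 := Nat.div_add_mod j q
  have h3 : (j - i) = q * (j / q - i / q) := by
    rw [Nat.mul_sub]; omega
  have h4 : 0 < j / q - i / q := by
    by_contra hc
    rw [Nat.eq_zero_of_not_pos hc] at h3; omega
  have := Nat.le_mul_of_pos_right q h4
  omega

/-- The segment is rebuilt upwards from its recorded lowest vertex. A rebuilt entry gets colour `2`
at once, so that it is not taken for a successor again. The top entry, the only one in the buffer,
temporarily receives the colour of the segment, because it is the successor of the highest rebuilt
entry. The conclusion describes the stack after the top entry has been blackened, which is what
`popCode` does next. -/
theorem wp_restore {n m w X : ℕ} (hX : Bounds n m w X) {nbr : Fin n → List (Fin n)}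
    {input : List ℕ} (hin : InputOk nbr m input) {τ : St} {f : List (Fin n × Option (Fin n))}
    {lo : ℕ} {sv : ℕ → Fin n} {sr : ℕ → ℕ} (hs : Search nbr f (lo + 1) sv sr)
    (hr : StackRep nbr input f (lo + 1) lo sv sr τ.arr) (h5 : τ.reg 5 = lo) (hlo : lo ≠ 0)
    (h1 : τ.reg 1 = sv lo) :
    wp (env n w 28 input) restoreCode τ fun τ' =>
      StackRep nbr input f lo (lo - seg n) sv sr
        (Function.update τ'.arr 25 (Function.update (τ'.arr 25) (sv lo) 1)) ∧
      τ'.reg 5 = lo - seg n ∧ Frame [5, 8, 9, 10, 11] [22, 23, 25] τ τ' ∧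
      τ'.clk ≤ τ.clk + 6 + 9 * seg n + 2 * ((∑ v, (nbr v).length) / lg n) := by
  have hw0 := hX.w_ne
  obtain ⟨hn, hnm, hlb, hthr, htab, hpow, hnch, hlt, hw, hXw, -, -, htp, hlp⟩ := hX
  have hq := seg_pos n
  have hhn := hs.le_n
  obtain ⟨k, rfl⟩ := hr.dvd
  obtain _ | k := k
  · simp at hlo
  have hk : (seg n * (k + 1)) / seg n = k + 1 := Nat.mul_div_cancel_left _ hq
  have hlok : k + 1 < lg n := by rw [← hk]; exact div_seg_lt hn (by omega)
  set lo := seg n * (k + 1) with hlo_def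
  have hlo' : lo - seg n = seg n * k := by rw [hlo_def, Nat.mul_succ, Nat.add_sub_cancel]
  have hsl : seg n ≤ lo := by rw [hlo_def, Nat.mul_succ]; omega
  have hmod : ∀ i, i % (2 * seg n) < 2 * seg n := fun i => Nat.mod_lt _ (by omega)
  have htr : τ.arr 24 k = sv (lo - seg n) := by
    rw [hlo', mul_comm]
    exact hr.trail k (by rw [mul_comm]; omega)
  have hcol : ∀ i, lo - seg n ≤ i → i < lo → i / seg n = k := by
    intro i hi hi'
    rw [add_div_seg (lo := lo - seg n) (by rw [hlo']; exact dvd_mul_right _ _) hi (by omega), hlo',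
      Nat.mul_div_cancel_left _ hq]
  simp [restoreCode, h5, hk, h1]
  and_intros
  any_goals omega
  apply wp_loop (I := fun σ => ∃ i ≤ lo, lo - seg n ≤ i ∧ σ.reg 8 = i ∧ σ.reg 5 = lo ∧
    σ.reg 9 = k ∧ σ.reg 10 = sv i ∧ Frame [5, 8, 9, 10, 11] [22, 23, 25] τ σ ∧
    σ.clk ≤ τ.clk + 4 +
      ∑ j ∈ Finset.Ico (lo - seg n) i, (9 + 2 * ((nbr (sv j)).length / lg n)) ∧
    (∀ j, lo - seg n ≤ j → j < i → σ.arr 25 (sv j) = 2 ∧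
      σ.arr 22 (j % (2 * seg n)) = sv j ∧
      σ.arr 23 (j % (2 * seg n)) = rd input (sv j) + 1 + sr j) ∧
    σ.arr 25 (sv lo) = 3 + k ∧
    ∀ v : Fin n, (∀ j, lo - seg n ≤ j → j < i → sv j ≠ v) → v ≠ sv lo →
      σ.arr 25 v = τ.arr 25 v) (μ := fun σ => lo - σ.reg 8)
  · refine ⟨lo - seg n, by omega, le_rfl, ?_⟩
    simp [h5, htr]
    refine ⟨fun j hj hj' => by omega, fun v _ hv => ?_⟩
    rw [Function.update_of_ne (fun he => hv (Fin.ext he))]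
  · rintro σ ⟨i, hi, hi', h8, h5', h9, h10, hF, hclk, hnew, htop, hold⟩
    have a24 := hF.arr 24 (by simp)
    have a26 := hF.arr 26 (by simp)
    refine ⟨by simp, ?_, ?_⟩
    · simp only [val_lt, val_var, h8, h5', ite_eq_right_iff, one_ne_zero, imp_false]
      intro hlt'
      obtain rfl : i = lo := by omega
      have hsum := sum_seg_le hs (a := lo - seg n) (b := lo) (by omega) (lg n) (lg_pos hn)
      rw [Finset.sum_add_distrib, ← Finset.mul_sum, Finset.sum_const, Nat.card_Ico,
        smul_eq_mul, show lo - (lo - seg n) = seg n by omega, mul_comm] at hclk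
      simp [h5', hF, hsl]
      refine ⟨?_, by omega⟩
      have hupd : ∀ v : Fin n, v ≠ sv lo →
          Function.update (σ.arr 25) (sv lo : ℕ) 1 v = σ.arr 25 v := fun v hv =>
        Function.update_of_ne (fun he => hv (Fin.ext he)) _ _
      refine ⟨by rw [hlo']; exact dvd_mul_right _ _, by omega, by omega, fun j hj hj' => ?_,
        fun v hv => ?_, fun v hv hv' => ?_, fun j hj hj' => ?_, fun j hj => ?_, fun j hj => ?_⟩
      · simpa using (hnew j hj hj').2
      · have hne : v ≠ sv lo := by rintro rfl; exact hv (hs.mem lo (by omega))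
        rw [Function.update_self, hupd v hne,
          hold v (fun j _ _ he => hv (he ▸ hs.mem j (by omega))) hne]
        exact hr.white v hv
      · by_cases hvi : v = sv lo
        · subst hvi; simp
        · rw [Function.update_self, hupd v hvi, hold v (fun j _ hj => hv' j (by omega)) hvi]
          refine hr.black v hv fun j hj => ?_
          by_cases hji : j = lo
          · subst hji; exact Ne.symm hvi
          · exact hv' j (by omega)
      · rw [Function.update_self, hupd _ (hs.inj j lo hj' (by omega))]
        exact (hnew j hj hj').1
      · rw [Function.update_self, hupd _ (hs.inj j lo (by omega) (by omega)),
          Function.update_of_ne (by omega), a26,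
          hold _ (fun j' _ hj' => (hs.inj j j' (by omega) (by omega)).symm)
            (hs.inj j lo (by omega) (by omega))]
        exact hr.dropped j (by omega)
      · rw [Function.update_of_ne (by omega), a24]
        exact hr.trail j (by omega)
    · simp only [val_lt, val_var, h8, h5', ne_eq, ite_eq_right_iff, one_ne_zero, imp_false, not_not]
      intro hlt'
      obtain ⟨hl1, hl2⟩ := hs.link i (by omega)
      have hle := hs.le i (by omega)
      have hsucc := hin.succ (sv i)
      have hinle := hin.le (sv i)
      have hvlt := (sv i).2
      set g := (nbr (sv i)).length / lg n + 1 with hg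
      have hgrp : σ.arr 26 (sv i) = (sr i - 1) / g := by
        rw [a26]; exact (hr.dropped i hlt').2
      have hgm := Nat.div_mul_le_self (sr i - 1) g
      have hgl : sr i - 1 < (sr i - 1) / g * g + g := by
        have e1 := Nat.div_add_mod (sr i - 1) g
        have e2 := Nat.mod_lt (sr i - 1) (show 0 < g from Nat.succ_pos _)
        rw [mul_comm] at e1
        omega
      have hlen := hin.length
      have hdl := Nat.div_le_self (nbr (sv i)).length (lg n)
      have hne : ∀ {v : Fin n}, v ≠ sv i → (v : ℕ) ≠ sv i := fun h he => h (Fin.ext he)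
      have hnext : Function.update (σ.arr 25) (sv i : ℕ) 2 (sv (i + 1)) = 3 + k := by
        rw [Function.update_of_ne (hne (hs.inj i (i + 1) (by omega) (by omega)).symm)]
        by_cases hil : i + 1 = lo
        · rw [hil]; exact htop
        · rw [hold _ (fun j _ hj => hs.inj j (i + 1) (by omega) (by omega))
            (hs.inj (i + 1) lo (by omega) (by omega)), (hr.dropped (i + 1) (by omega)).1,
            hcol (i + 1) (by omega) (by omega)]
      -- An earlier neighbour has been discovered. If it is off the stack, it is black. Otherwise
      -- `skip` says that it does not lie above entry `i`: it is `sv i` itself or was rebuilt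
      -- before, with colour `2`, or it belongs to a lower segment, with a smaller colour.
      have hskip : ∀ r, r < sr i - 1 → ∀ y : Fin n, (nbr (sv i))[r]? = some y →
          Function.update (σ.arr 25) (sv i : ℕ) 2 y ≠ 3 + k := by
        intro r hr' y hy
        by_cases hyi : y = sv i
        · subst hyi; simp; omega
        · rw [Function.update_of_ne (hne hyi)]
          by_cases hst : ∃ j < lo + 1, sv j = y
          · obtain ⟨j, hj, rfl⟩ := hst
            have hji : j < i := by
              by_contra hc
              have : j ≠ i := by rintro rfl; exact hyi rfl
              exact hs.skip i j r (by omega) hj (by omega) hy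
            by_cases hjl : lo - seg n ≤ j
            · rw [(hnew j hjl hji).1]; omega
            · rw [hold _ (fun j' _ hj' => (hs.inj j j' (by omega) (by omega)).symm)
                (hs.inj j lo (by omega) (by omega)), (hr.dropped j (by omega)).1]
              have : j / seg n < k := by
                rw [Nat.div_lt_iff_lt_mul hq, mul_comm]; omega
              omega
          · have hst' : ∀ j < lo + 1, sv j ≠ y := fun j hj he => hst ⟨j, hj, he⟩
            rw [hold _ (fun j _ hj => hst' j (by omega)) (hst' lo (by omega)).symm,
              hr.black y (hs.found i (by omega) r (by omega) y hy) hst']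
            omega
      simp [h10, hsucc, hgrp, ← hg]
      and_intros
      any_goals omega
      -- The scan stays within one group of `g` neighbours, so it makes at most `g - 1` steps of two
      -- clock units each.
      apply wp_loop (I := fun ρ => ∃ r, (sr i - 1) / g * g ≤ r ∧ r ≤ sr i - 1 ∧
        ρ.reg 11 = rd input (sv i) + 1 + r ∧
        ρ.reg 8 = i ∧ ρ.reg 5 = lo ∧ ρ.reg 9 = k ∧ ρ.reg 10 = sv i ∧
        Frame [5, 8, 9, 10, 11] [22, 23, 25] τ ρ ∧
        ρ.clk ≤ σ.clk + 3 + 2 * (r - (sr i - 1) / g * g) ∧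
        ρ.arr 22 = σ.arr 22 ∧ ρ.arr 23 = σ.arr 23 ∧
        ρ.arr 25 = Function.update (σ.arr 25) (sv i) 2)
        (μ := fun ρ => rd input (sv i) + 1 + sr i - ρ.reg 11)
      · refine ⟨_, le_rfl, hgm, ?_⟩
        simp [h8, h5', h9, h10, hF]
      · rintro ρ ⟨r, hr1, hr2, g11, g8, g5, g9, g10, gF, gclk, g22, g23, g25⟩
        obtain ⟨y, hy⟩ : ∃ y, (nbr (sv i))[r]? = some y := ⟨_, List.getElem?_eq_getElem (by omega)⟩
        have hrd := hin.get _ _ _ hy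
        have hylt := y.2
        refine ⟨by simp [g11, hlen, hrd, hylt]; omega, ?_, ?_⟩
        · simp only [val_xor, val_field, val_sub, val_inp, val_var, g11, env_input, hrd, val_lit,
            Nat.add_sub_cancel, val_add, g9, Nat.xor_eq_zero_iff, g25]
          intro he
          obtain rfl : r = sr i - 1 := by
            by_contra hne'
            exact hskip r (by omega) y hy he
          obtain rfl : y = sv (i + 1) := Option.some.inj (hy.symm.trans hl2)
          simp [g11, g8, g5, g9, g10, gF, hmod, hlen, hrd]
          and_intros
          any_goals omega
          · rw [Finset.sum_Ico_succ_top (by omega)]; omega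
          · intro j hj hj'
            by_cases hji : j = i
            · subst hji; simp [g25]; omega
            · have hjm : j % (2 * seg n) ≠ i % (2 * seg n) :=
                mod_ne_mod (lo := lo - seg n) (by omega) (by omega) (by omega)
              rw [Function.update_of_ne hjm, Function.update_of_ne hjm, g22, g23, g25,
                Function.update_of_ne (hne (hs.inj j i (by omega) (by omega)))]
              exact hnew j (by omega) (by omega)
          · rw [g25, Function.update_of_ne (hne (hs.inj i lo (by omega) (by omega)).symm), htop]
          · intro v hv hv'
            rw [g25, Function.update_of_ne (hne fun he => hv i (by omega) le_rfl he.symm)]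
            exact hold v (fun j hj hj' => hv j (by omega) (by omega)) hv'
        · simp only [val_xor, val_field, val_sub, val_inp, val_var, g11, env_input, hrd, val_lit,
            Nat.add_sub_cancel, val_add, g9, ne_eq, Nat.xor_eq_zero_iff, g25]
          intro he
          have hrs : r ≠ sr i - 1 := by
            rintro rfl
            rw [Option.some.inj (hy.symm.trans hl2)] at he
            exact he hnext
          simp [g11, g8, g5, g9, g10, gF, g22, g23, g25]
          refine ⟨by omega, ⟨r + 1, by omega, by omega, by omega, by omega⟩, by omega⟩

/-! ### The search -/

namespace StackRep

variable {n : ℕ} {nbr : Fin n → List (Fin n)} {input : List ℕ} {f : List (Fin n × Option (Fin n))}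
  {h lo : ℕ} {sv : ℕ → Fin n} {sr : ℕ → ℕ} {arr arr' : ℕ → ℕ → ℕ}

theorem advance (hr : StackRep nbr input f (h + 1) lo sv sr arr) (hlo : lo ≤ h)
    (h22 : arr' 22 = arr 22)
    (h23 : arr' 23 = Function.update (arr 23) (h % (2 * seg n))
      (rd input (sv h) + 1 + (sr h + 1)))
    (h24 : arr' 24 = arr 24) (h25 : arr' 25 = arr 25) (h26 : arr' 26 = arr 26) :
    StackRep nbr input f (h + 1) lo sv (Function.update sr h (sr h + 1)) arr' where
  dvd := hr.dvd
  le := hr.le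
  le_buf := hr.le_buf
  buf i hi hi' := by
    have h1 := hr.le_buf
    by_cases hih : i = h
    · subst hih
      rw [h22, h23, Function.update_self, Function.update_self]
      exact ⟨(hr.buf i hi hi').1, rfl⟩
    · rw [h22, h23, Function.update_of_ne hih,
        Function.update_of_ne (mod_ne_mod hi (by omega) (by omega))]
      exact hr.buf i hi hi'
  white := by rw [h25]; exact hr.white
  black := by rw [h25]; exact hr.black
  gray := by rw [h25]; exact hr.gray
  dropped i hi := by rw [h25, h26, Function.update_of_ne (by omega)]; exact hr.dropped i hi
  trail := by rw [h24]; exact hr.trail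

theorem push (hr : StackRep nbr input f h lo sv sr arr) (hs : ∀ i < h, sv i ∈ f.map Prod.fst)
    (hlo : h < lo + 2 * seg n) {u : Fin n} {p : Option (Fin n)} (hu : u ∉ f.map Prod.fst)
    (h22 : arr' 22 = Function.update (arr 22) (h % (2 * seg n)) u)
    (h23 : arr' 23 = Function.update (arr 23) (h % (2 * seg n)) (rd input u + 1))
    (h24 : arr' 24 = arr 24) (h25 : arr' 25 = Function.update (arr 25) u 2)
    (h26 : arr' 26 = arr 26) :
    StackRep nbr input (f ++ [(u, p)]) (h + 1) lo (Function.update sv h u)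
      (Function.update sr h 0) arr' := by
  have hle := hr.le
  have hne : ∀ i < h, (sv i : ℕ) ≠ u := fun i hi he => hu (Fin.ext he ▸ hs i hi)
  refine ⟨hr.dvd, by omega, by omega, fun i hi hi' => ?_, fun v hv => ?_, fun v hv hv' => ?_,
    fun i hi hi' => ?_, fun i hi => ?_, fun j hj => ?_⟩
  · by_cases hih : i = h
    · subst hih; simp [h22, h23]
    · have hm : i % (2 * seg n) ≠ h % (2 * seg n) := mod_ne_mod hi (by omega) hlo
      rw [h22, h23, Function.update_of_ne hm, Function.update_of_ne hm, Function.update_of_ne hih,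
        Function.update_of_ne hih]
      exact hr.buf i hi (by omega)
  · simp only [List.map_append, List.map_cons, List.map_nil, List.mem_append, List.mem_singleton,
      not_or] at hv
    rw [h25, Function.update_of_ne fun he => hv.2 (Fin.ext he)]
    exact hr.white v hv.1
  · have hvu : v ≠ u := fun he => hv' h (by omega) (by simp [he])
    rw [h25, Function.update_of_ne fun he => hvu (Fin.ext he)]
    refine hr.black v ?_ fun i hi he => hv' i (by omega) ?_
    · simpa [hvu] using hv
    · rw [Function.update_of_ne (by omega)]; exact he
  · by_cases hih : i = h
    · subst hih; simp [h25]
    · rw [h25, Function.update_of_ne hih, Function.update_of_ne (hne i (by omega))]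
      exact hr.gray i hi (by omega)
  · rw [h25, h26, Function.update_of_ne (show i ≠ h by omega),
      Function.update_of_ne (show i ≠ h by omega), Function.update_of_ne (hne i (by omega))]
    exact hr.dropped i hi
  · rw [h24, Function.update_of_ne (by omega)]
    exact hr.trail j hj

theorem pop (hr : StackRep nbr input f (h + 1) lo sv sr arr) (hs : Search nbr f (h + 1) sv sr)
    (hlo : lo ≤ h) (h22 : arr' 22 = arr 22) (h23 : arr' 23 = arr 23) (h24 : arr' 24 = arr 24)
    (h25 : arr' 25 = Function.update (arr 25) (sv h) 1) (h26 : arr' 26 = arr 26) :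
    StackRep nbr input f h lo sv sr arr' := by
  have hbuf := hr.le_buf
  have hne : ∀ i < h, (sv i : ℕ) ≠ sv h := fun i hi he =>
    hs.inj i h hi (by omega) (Fin.ext he)
  refine ⟨hr.dvd, hlo, by omega, fun i hi hi' => ?_, fun v hv => ?_, fun v hv hv' => ?_,
    fun i hi hi' => ?_, fun i hi => ?_, fun j hj => ?_⟩
  · rw [h22, h23]; exact hr.buf i hi (by omega)
  · rw [h25, Function.update_of_ne fun he => hv ((Fin.ext he : v = sv h) ▸ hs.mem h (by omega))]
    exact hr.white v hv
  · rw [h25]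
    by_cases hvh : v = sv h
    · subst hvh; simp
    · rw [Function.update_of_ne fun he => hvh (Fin.ext he)]
      refine hr.black v hv fun i hi he => ?_
      by_cases hih : i = h
      · subst hih; exact hvh he.symm
      · exact hv' i (by omega) he
  · rw [h25, Function.update_of_ne (hne i (by omega))]; exact hr.gray i hi (by omega)
  · rw [h25, h26, Function.update_of_ne (hne i (by omega))]; exact hr.dropped i hi
  · rw [h24]; exact hr.trail j hj

end StackRep

/-! ### Invariant and amortised time of the search -/

/-- The number of neighbours and stack entries that remain to be treated. -/
def remaining {n : ℕ} (nbr : Fin n → List (Fin n)) (sv : ℕ → Fin n) (sr : ℕ → ℕ) (h : ℕ) : ℕ :=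
  ∑ i ∈ Finset.range h, ((nbr (sv i)).length - sr i + 1)

theorem remaining_congr {n : ℕ} {nbr : Fin n → List (Fin n)} {sv sv' : ℕ → Fin n} {sr sr' : ℕ → ℕ}
    {h : ℕ} (hs : ∀ i < h, sv i = sv' i ∧ sr i = sr' i) :
    remaining nbr sv sr h = remaining nbr sv' sr' h :=
  Finset.sum_congr rfl fun i hi => by
    rw [(hs i (Finset.mem_range.mp hi)).1, (hs i (Finset.mem_range.mp hi)).2]

/-- The log lists the found vertices, with correct counts at the time of their discovery. -/
structure LogOk {n : ℕ} (f : List (Fin n × Option (Fin n))) (log : List (ℕ × (ℕ → ℕ → ℕ))) :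
    Prop where
  fst : log.map Prod.fst = f.map fun e => vertexLabel e.1
  counts : ∀ k x, log[k]? = some x →
    ∃ al, Counts n (lb n) (thr n) (x.2 13) (x.2 14) (x.2 27) al (kids (f.take (k + 1)))

theorem LogOk.append {n : ℕ} {f : List (Fin n × Option (Fin n))} {log : List (ℕ × (ℕ → ℕ → ℕ))}
    (hl : LogOk f log) {e : Fin n × Option (Fin n)} {x : ℕ} {arr : ℕ → ℕ → ℕ} {al : ℕ}
    (hx : x = vertexLabel e.1)
    (hc : Counts n (lb n) (thr n) (arr 13) (arr 14) (arr 27) al (kids (f ++ [e]))) :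
    LogOk (f ++ [e]) (log ++ [(x, arr)]) where
  fst := by simp [hl.fst, hx]
  counts k y hy := by
    have hlen : log.length = f.length := by simpa using congrArg List.length hl.fst
    rcases lt_trichotomy k log.length with hk | hk | hk
    · rw [List.getElem?_append_left hk] at hy
      rw [List.take_append_of_le_length (by omega)]
      exact hl.counts k y hy
    · subst hk
      simp at hy
      subst hy
      exact ⟨al, by rw [List.take_of_length_le (by simp; omega)]; exact hc⟩
    · rw [List.getElem?_eq_none (by simp; omega)] at hy
      cases hy

/-- The cost of moving a segment. -/
def moveCost (n d : ℕ) : ℕ := 9 * seg n + 2 * (d / lg n) + 6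

/-- The invariant of the search, whose result is `D`, and which has still to visit `roots`. -/
structure DfsInv {n : ℕ} (nbr : Fin n → List (Fin n)) (input : List ℕ)
    (D : List (Fin n × Option (Fin n))) (roots : List (Fin n)) (g : ℕ × ℕ × (ℕ → ℕ)) (c₀ : ℕ)
    (f : List (Fin n × Option (Fin n))) (h lo : ℕ) (sv : ℕ → Fin n) (sr : ℕ → ℕ) (ev : ℕ)
    (τ : St) : Prop where
  search : Search nbr f h sv sr
  stack : StackRep nbr input f h lo sv sr τ.arr
  counts : Counts n (lb n) (thr n) (τ.arr 13) (τ.arr 14) (τ.arr 27) (τ.reg 6) (kids f)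
  log : LogOk f τ.log
  others : (τ.reg 0, τ.reg 39, τ.arr 18) = g
  height : τ.reg 4 = h
  low : τ.reg 5 = lo
  lt : h = 0 ∨ lo < h
  result : roots.foldl (fun f v => visit nbr f none v) (contin nbr sv sr h f) = D
  ev_le : seg n * ev + (h - lo - seg n) + (lo + seg n - h) + h ≤ 2 * f.length + seg n
  clk : τ.clk + 40 * remaining nbr sv sr h ≤ c₀ +
    40 * (f.map fun e => (nbr e.1).length + 2).sum +
    ev * moveCost n (∑ v, (nbr v).length) + (4 * lb n + 8) * τ.reg 6

theorem Big.clk_le {E : Env} {s : Stmt} {τ τ' : St} (h : Big E s τ τ') : τ.clk ≤ τ'.clk := by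
  induction h with
  | skip => exact le_rfl
  | assign | storeWord | storeField | report | loop_done => exact Nat.le_succ _
  | seq _ _ h₁ h₂ => exact h₁.trans h₂
  | ite_true _ _ _ h | ite_false _ _ _ h => exact (Nat.le_succ _).trans h
  | loop_step _ _ _ _ h₁ h₂ => exact (Nat.le_succ _).trans (h₁.trans h₂)

theorem wp.clk_le {E : Env} {s : Stmt} {τ : St} {Q : St → Prop} (h : wp E s τ Q) :
    wp E s τ fun τ' => Q τ' ∧ τ.clk ≤ τ'.clk := by
  delta wp at h ⊢
  obtain ⟨τ', h₁, h₂⟩ := h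
  exact ⟨τ', h₁, h₂, h₁.clk_le⟩

/-- Each test advances the clock, so a bound for the clock under the invariant is by itself a proof
of termination. -/
theorem wp_loop_of_clk_le {E : Env} {e : Expr} {s : Stmt} {τ : St} {Q : St → Prop} (I : St → Prop)
    (N : ℕ) (hI : I τ) (hN : ∀ τ, I τ → τ.clk ≤ N)
    (h : ∀ τ, I τ → e.ok E τ ∧ (e.val E τ = 0 → Q τ.tick) ∧
      (e.val E τ ≠ 0 → wp E s τ.tick I)) : wp E (.loop e s) τ Q := by
  refine wp_loop I (fun τ => N + 1 - τ.clk) hI fun τ hτ => ?_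
  obtain ⟨h₁, h₂, h₃⟩ := h τ hτ
  refine ⟨h₁, h₂, fun hv => (h₃ hv).clk_le.mono fun τ' ⟨h₄, h₅⟩ => ⟨h₄, ?_⟩⟩
  have := hN τ hτ
  rw [St.tick_clk] at h₅
  omega

/-- Pop the top entry of the stack, with the vertex in variable `1`. -/
def popCode : Stmt :=
  ite (Expr.lt (var 5 + lit 1) (var 4)) skip (ite (var 5) restoreCode skip) ;;
  storeField 25 (var 1) (lit 1) ;;
  assign 4 (var 4 - lit 1)

/-- Discover the vertex in variable `3`, a child of the vertex in variable `1`. -/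
def pushCode : Stmt :=
  ite (Expr.lt (var 4) (var 5 + lit 2 * par 6)) skip dropCode ;;
  incrCode ;;
  storeField 25 (var 3) (lit 2) ;;
  report (var 3 + lit 1) ;;
  storeWord 23 ((var 4 - lit 1) % (lit 2 * par 6)) (var 2 + lit 1) ;;
  storeWord 22 (var 4 % (lit 2 * par 6)) (var 3) ;;
  storeWord 23 (var 4 % (lit 2 * par 6)) (inp (var 3) + lit 1) ;;
  assign 4 (var 4 + lit 1)

/-- One step of the search with non-empty stack. -/
def stepCode : Stmt :=
  assign 7 ((var 4 - lit 1) % (lit 2 * par 6)) ;;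
  assign 1 (word 22 (var 7)) ;;
  assign 2 (word 23 (var 7)) ;;
  ite (Expr.lt (inp (var 1 + lit 1)) (var 2)) popCode
    (assign 3 (inp (var 2) - lit 1) ;;
     ite (field 25 (var 3)) (storeWord 23 (var 7) (var 2 + lit 1)) pushCode)

/-- Start the search at the undiscovered vertex in variable `1`. -/
def rootCode : Stmt :=
  storeField 25 (var 1) (lit 2) ;;
  report (var 1 + lit 1) ;;
  storeWord 22 (lit 0) (var 1) ;;
  storeWord 23 (lit 0) (inp (var 1) + lit 1) ;;
  assign 4 (lit 1)

/-- The search, from the vertex with the label in variable `39`. -/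
def searchCode : Stmt :=
  assign 0 (lit 0) ;; assign 4 (lit 0) ;; assign 5 (lit 0) ;; assign 6 (lit 0) ;;
  loop (Expr.lt (var 0) (par 0 + lit 1))
   (ite (var 0) (assign 1 (var 0 - lit 1)) (assign 1 (var 39 - lit 1)) ;;
    assign 0 (var 0 + lit 1) ;;
    ite (field 25 (var 1)) skip rootCode ;;
    loop (var 4) stepCode)

section

variable {n m w X : ℕ} {nbr : Fin n → List (Fin n)} {input : List ℕ}
  {D : List (Fin n × Option (Fin n))} {roots : List (Fin n)} {g : ℕ × ℕ × (ℕ → ℕ)} {c₀ : ℕ}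
  {f : List (Fin n × Option (Fin n))} {h lo : ℕ} {sv : ℕ → Fin n} {sr : ℕ → ℕ} {ev : ℕ} {τ : St}

/-- Dropped, buffered and finished vertices all have nonzero colours, so a single comparison with
zero decides whether a vertex has been discovered. -/
theorem DfsInv.colour (hi : DfsInv nbr input D roots g c₀ f h lo sv sr ev τ) (v : Fin n) :
    τ.arr 25 v ≠ 0 ↔ v ∈ f.map Prod.fst := by
  refine ⟨fun hv => by_contra fun hf => hv (hi.stack.white v hf), fun hv => ?_⟩
  by_cases hst : ∃ i < h, sv i = v
  · obtain ⟨i, hih, rfl⟩ := hst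
    by_cases hil : i < lo
    · rw [(hi.stack.dropped i hil).1]; simp
    · rw [hi.stack.gray i (not_lt.mp hil) hih]; omega
  · rw [hi.stack.black v hv fun i hih he => hst ⟨i, hih, he⟩]; omega

theorem DfsInv.congr_others (hi : DfsInv nbr input D roots g c₀ f h lo sv sr ev τ) {τ' : St}
    {k : ℕ} {g' : ℕ × ℕ × (ℕ → ℕ)} (hr : ∀ x ∈ [4, 5, 6], τ'.reg x = τ.reg x)
    (hg : (τ'.reg 0, τ'.reg 39, τ'.arr 18) = g') (ha : τ'.arr = τ.arr) (hl : τ'.log = τ.log)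
    (hk : τ'.clk ≤ τ.clk + k) : DfsInv nbr input D roots g' (c₀ + k) f h lo sv sr ev τ' := by
  simp only [List.mem_cons, List.not_mem_nil, or_false, forall_eq_or_imp, forall_eq] at hr
  obtain ⟨h4, h5, h6⟩ := hr
  have := hi.clk
  exact ⟨hi.search, ha ▸ hi.stack, by rw [ha, h6]; exact hi.counts, hl ▸ hi.log,
    hg, by rw [h4]; exact hi.height, by rw [h5]; exact hi.low, hi.lt,
    hi.result, hi.ev_le, by rw [h6]; omega⟩

theorem DfsInv.congr (hi : DfsInv nbr input D roots g c₀ f h lo sv sr ev τ) {τ' : St} {k : ℕ}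
    (hr : ∀ x ∈ [0, 39, 4, 5, 6], τ'.reg x = τ.reg x) (ha : τ'.arr = τ.arr) (hl : τ'.log = τ.log)
    (hk : τ'.clk ≤ τ.clk + k) : DfsInv nbr input D roots g (c₀ + k) f h lo sv sr ev τ' :=
  hi.congr_others (fun x hx => hr x (List.mem_cons_of_mem _ (List.mem_cons_of_mem _ hx)))
    (by rw [hr 0 (by simp), hr 39 (by simp), ha]; exact hi.others) ha hl hk

theorem remaining_succ : remaining nbr sv sr (h + 1) =
    remaining nbr sv sr h + ((nbr (sv h)).length - sr h + 1) := Finset.sum_range_succ _ _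

/-- The finished entry releases at least one unit of `remaining`, which is worth `40`: the amount
`30` makes up for the slack in `c₀`, and `10` is the clock allowance of this step. -/
theorem DfsInv.pop (hi : DfsInv nbr input D roots g (c₀ + 30) f (h + 1) lo sv sr ev τ)
    (hlen : (nbr (sv h)).length ≤ sr h) {τ' : St} {lo' ev' : ℕ}
    (hr : StackRep nbr input f h lo' sv sr τ'.arr)
    (ha : τ'.arr 13 = τ.arr 13 ∧ τ'.arr 14 = τ.arr 14 ∧ τ'.arr 27 = τ.arr 27 ∧
      τ'.arr 18 = τ.arr 18)
    (hreg : ∀ x ∈ [0, 39, 6], τ'.reg x = τ.reg x) (hl : τ'.log = τ.log) (h4 : τ'.reg 4 = h)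
    (h5 : τ'.reg 5 = lo') (hlt : h = 0 ∨ lo' < h)
    (hev : seg n * ev' + (h - lo' - seg n) + (lo' + seg n - h) + h ≤ 2 * f.length + seg n)
    (hk : τ'.clk + ev * moveCost n (∑ v, (nbr v).length) ≤
      τ.clk + 10 + ev' * moveCost n (∑ v, (nbr v).length)) :
    DfsInv nbr input D roots g c₀ f h lo' sv sr ev' τ' := by
  simp only [List.mem_cons, List.not_mem_nil, or_false, forall_eq_or_imp, forall_eq] at hreg
  obtain ⟨h0, h39, h6⟩ := hreg
  obtain ⟨a1, a2, a3, a4⟩ := ha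
  have hc := hi.clk
  rw [remaining_succ] at hc
  exact ⟨hi.search.pop, hr, by rw [a1, a2, a3, h6]; exact hi.counts, hl ▸ hi.log,
    by rw [h0, h39, a4]; exact hi.others, h4, h5, hlt,
    by rw [← contin_pop hlen]; exact hi.result, hev, by rw [h6]; omega⟩

/-- When the last buffered entry is popped and dropped entries lie below, the segment is rebuilt
while that entry is still known, since the rebuilding ends at it. -/
theorem wp_pop (hX : Bounds n m w X) (hin : InputOk nbr m input)
    (hi : DfsInv nbr input D roots g (c₀ + 30) f (h + 1) lo sv sr ev τ) (h1 : τ.reg 1 = sv h)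
    (hlen : (nbr (sv h)).length ≤ sr h) :
    wp (env n w 28 input) popCode τ fun τ' => ∃ h' lo' ev',
      DfsInv nbr input D roots g c₀ f h' lo' sv sr ev' τ' := by
  have hw0 := hX.w_ne
  have hle : lo ≤ h := by have := hi.lt; omega
  have hhn := hi.search.le_n
  have h4 := hi.height
  have h5 := hi.low
  have hev := hi.ev_le
  have hvlt := (sv h).2
  have hq := seg_pos n
  have hB := hX
  obtain ⟨hn, hnm, hlb, hthr, htab, hpow, hnch, hlt, hw, hXw, -, -, htp, hlp⟩ := hX
  have hfb : fb n ≠ 0 := (Nat.mul_pos (by omega) (ll_pos hn)).ne'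
  -- The two cases in which no segment moves differ only in the number `k` of tests that were made.
  have keep : ∀ k ≤ 2, (h = 0 ∨ lo < h) → ∃ h' lo' ev', DfsInv nbr input D roots g c₀ f h' lo' sv sr
      ev' ((({ τ with clk := τ.clk + k } : St).setArr 25 (τ.reg 1) 1).setReg 4 h) := by
    intro k hk hlt
    refine ⟨h, lo, ev, hi.pop hlen (hi.stack.pop hi.search hle ?_ ?_ ?_ ?_ ?_) ?_ ?_ ?_ ?_ ?_ hlt ?_
      ?_⟩
    all_goals first | (simp [h5, h1]; done) | (simp; omega) | omega
  simp only [popCode, wp_seq, wp_ite]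
  refine ⟨by simp [h5]; omega, fun hv => ?_, fun hv => ?_⟩
  · simp [h4, h5] at hv
    have := keep 1 (by omega) (by omega)
    simp [h4, h1]
    refine ⟨hw0, hfb, hw0, ?_⟩
    rw [← h1]; exact this
  · simp [h4, h5] at hv
    obtain rfl : h = lo := by omega
    refine ⟨by simp, fun hv' => ?_, fun hv' => ?_⟩
    · simp [h5] at hv'
      refine (wp_restore hB hin (τ := τ.tick.tick) hi.search hi.stack h5 hv' h1).mono ?_
      rintro σ ⟨hst, g5, gF, gclk⟩
      have g1 := gF.reg 1 (by simp)
      have g4 := gF.reg 4 (by simp)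
      simp at g1 g4 gclk
      simp [g4, g1, h1, h4]
      refine ⟨hw0, hfb, hw0, h, h - seg n, ev + 1,
        hi.pop hlen ?_ ?_ ?_ ?_ ?_ ?_ ?_ ?_ ?_⟩
      · exact hst
      · have a1 := gF.arr 13 (by simp)
        have a2 := gF.arr 14 (by simp)
        have a3 := gF.arr 27 (by simp)
        have a4 := gF.arr 18 (by simp)
        simp at a1 a2 a3 a4
        simp [a1, a2, a3, a4]
      · have b1 := gF.reg 0 (by simp)
        have b2 := gF.reg 39 (by simp)
        have b3 := gF.reg 6 (by simp)
        simp at b1 b2 b3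
        simp [b1, b2, b3]
      · simpa using gF.log
      · simp
      · simp [g5]
      · omega
      · have := Nat.le_of_dvd (by omega) hi.stack.dvd
        rw [Nat.mul_succ]; omega
      · simp [moveCost, Nat.succ_mul]; omega
    · simp [h5] at hv'
      have := keep 2 (by omega) (by omega)
      simp [h4, h1]
      refine ⟨hw0, hfb, hw0, ?_⟩
      rw [← h1]; exact this

end

section

variable {n m w X : ℕ} {nbr : Fin n → List (Fin n)} {input : List ℕ}
  {D : List (Fin n × Option (Fin n))} {roots : List (Fin n)} {g : ℕ × ℕ × (ℕ → ℕ)} {c₀ : ℕ}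
  {f : List (Fin n × Option (Fin n))} {h lo : ℕ} {sv : ℕ → Fin n} {sr : ℕ → ℕ} {ev : ℕ} {τ : St}

/-- The bound `ev_le` is a potential argument. The potential is the height plus the distance between
the fill of the buffer and one segment. A push raises it by at most `2`, matched by the new
discovered vertex, and a pop does not raise it. A drop takes the fill from two segments to one and
so releases `seg n`, which pays for the move; rebuilding does the same from an empty buffer. -/
theorem wp_room (hX : Bounds n m w X) (hin : InputOk nbr m input)
    (hi : DfsInv nbr input D roots g c₀ f h lo sv sr ev τ) :
    wp (env n w 28 input) (ite (Expr.lt (var 4) (var 5 + lit 2 * par 6)) skip dropCode) τ fun τ' =>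
      ∃ lo' ev', DfsInv nbr input D roots g (c₀ + 2) f h lo' sv sr ev' τ' ∧ h < lo' + 2 * seg n ∧
        ∀ x ∈ [1, 2, 3], τ'.reg x = τ.reg x := by
  have hw0 := hX.w_ne
  have hhn := hi.search.le_n
  have hev := hi.ev_le
  have hq := seg_pos n
  have hlen := hi.search.length_le
  have hle := hi.stack.le
  have hbuf := hi.stack.le_buf
  have hB := hX
  obtain ⟨hn, hnm, hlb, hthr, htab, hpow, hnch, hlt, hw, hXw, -, -, htp, hlp⟩ := hX
  have hsn : seg n ≤ n + 1 := Nat.succ_le_succ (Nat.div_le_self _ _)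
  rw [wp_ite]
  refine ⟨by simp [hi.low]; omega, fun hv => ?_, fun hv => ?_⟩
  · simp [hi.height, hi.low] at hv
    simp only [wp_skip]
    exact ⟨lo, ev, hi.congr (by simp) rfl rfl (by simp), hv, by simp⟩
  · simp [hi.height, hi.low] at hv
    have hh : h = lo + 2 * seg n := by omega
    refine (wp_drop hB hin (τ := τ.tick) hi.search hi.stack hi.low hh).mono ?_
    rintro σ ⟨hst, g5, gF, gclk⟩
    have hc := hi.clk
    have fr : ∀ x, x ∉ [5, 7, 8, 9, 10] → σ.reg x = τ.reg x := gF.reg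
    have fa : ∀ x, x ∉ [24, 25, 26] → σ.arr x = τ.arr x := gF.arr
    refine ⟨lo + seg n, ev + 1, ⟨hi.search, hst, ?_, ?_, ?_, ?_, g5, by omega, hi.result, ?_, ?_⟩,
      by omega, fun x hx => fr x ?_⟩
    · rw [fa 13 (by simp), fa 14 (by simp), fa 27 (by simp), fr 6 (by simp)]
      exact hi.counts
    · rw [gF.log]; exact hi.log
    · rw [fr 0 (by simp), fr 39 (by simp), fa 18 (by simp)]; exact hi.others
    · rw [fr 4 (by simp)]; exact hi.height
    · rw [Nat.mul_succ]; omega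
    · rw [fr 6 (by simp)]
      simp at gclk
      have hm : moveCost n (∑ v, (nbr v).length) =
        9 * seg n + 2 * ((∑ v, (nbr v).length) / lg n) + 6 := rfl
      rw [Nat.succ_mul ev]
      omega
    · simp only [List.mem_cons, List.not_mem_nil, or_false] at hx ⊢
      omega

/-- Room is made first, so the buffer cannot overflow. The count of the parent is raised before the
report, so that at the moment of reporting the memory already agrees with the list that includes the
new vertex. -/
theorem wp_push (hX : Bounds n m w X) (hin : InputOk nbr m input)
    (hi : DfsInv nbr input D roots g (c₀ + 30) f (h + 1) lo sv sr ev τ) {u : Fin n}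
    (hu : (nbr (sv h))[sr h]? = some u) (hf : u ∉ f.map Prod.fst) (h1 : τ.reg 1 = sv h)
    (h2 : τ.reg 2 = rd input (sv h) + 1 + sr h) (h3 : τ.reg 3 = u) :
    wp (env n w 28 input) pushCode τ fun τ' => ∃ f' h' lo' sv' sr' ev',
      DfsInv nbr input D roots g c₀ f' h' lo' sv' sr' ev' τ' := by
  have hw0 := hX.w_ne
  have hq := seg_pos n
  rw [pushCode, wp_seq]
  refine (wp_room hX hin hi).mono ?_
  clear hi
  rintro τ₁ ⟨lo, ev, hi, hroom, hregs⟩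
  simp only [List.mem_cons, List.not_mem_nil, or_false, forall_eq_or_imp, forall_eq, h1, h2,
    h3] at hregs
  obtain ⟨r1, r2, r3⟩ := hregs
  clear h1 h2 h3
  have hlen := hi.search.length_lt hf
  have hsum := sum_kids_le f
  have hfb : fb n ≠ 0 := (Nat.mul_pos (by omega) (ll_pos hX.pos)).ne'
  rw [wp_seq]
  refine (wp_incr hX hi.counts r1 (sv h).2 (by omega)).mono ?_
  rintro σ ⟨hcnt, hF, hclk⟩
  have fr : ∀ x, x ∉ [6, 8, 12] → σ.reg x = τ₁.reg x := hF.reg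
  have fa : ∀ x, x ∉ [13, 14, 27] → σ.arr x = τ₁.arr x := hF.arr
  rw [← kids_append f u] at hcnt
  have e2 := (fr 2 (by simp)).trans r2
  have e3 := (fr 3 (by simp)).trans r3
  have e4 := (fr 4 (by simp)).trans hi.height
  have e5 := (fr 5 (by simp)).trans hi.low
  -- The step is split into moving the parent past `u` and pushing `u`; the arrays in between exist
  -- only in the proof.
  have hadv := hi.stack.advance (arr' := fun b => if b = 23 then Function.update (τ₁.arr 23)
    (h % (2 * seg n)) (rd input (sv h) + 1 + (sr h + 1)) else τ₁.arr b)
    (by have := hi.lt; omega) (by simp) (by simp) (by simp) (by simp) (by simp)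
  have hlt := (List.getElem?_eq_some_iff.mp hu).1
  have hhn := hi.search.le_n
  have hin1 := hin.le (sv h)
  have hin2 := hin.le u
  have hsn : seg n ≤ n + 1 := Nat.succ_le_succ (Nat.div_le_self _ _)
  have hmod : ∀ i, i % (2 * seg n) < 2 * seg n := fun i => Nat.mod_lt _ (by omega)
  have hun := u.2
  have hinl := hin.length
  have hev := hi.ev_le
  have hc := hi.clk
  have hl := hi.lt
  have hpow : 4 ≤ 2 ^ fb n := by have := hX.lg_pow; omega
  obtain ⟨hn, hnm, hlb, hthr, htab, -, hnch, hlt', hw, hXw, -, -, htp, hlp⟩ := hX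
  simp [e2, e3, e4, hmod]
  and_intros
  any_goals omega
  refine ⟨f ++ [(u, some (sv h))], h + 2, lo, _, _, ev, ⟨hi.search.push hu hf,
    hadv.push hi.search.mem hroom hf ?_ ?_ ?_ ?_ ?_, ?_, ?_, ?_, ?_, ?_, ?_, ?_, ?_, ?_⟩⟩
  · simp [fa]
  · simp [fa, add_assoc]
  · simp [fa]
  · simp [fa]
  · simp [fa]
  · simpa using hcnt
  · simp only [St.setReg_log, St.setArr_log, St.emit_log, hF.log]
    exact hi.log.append rfl (by simpa using hcnt)
  · simpa [fr, fa] using hi.others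
  · simp
  · simpa using e5
  · omega
  · rw [← contin_push hu hf]; exact hi.result
  · rw [List.length_append, List.length_singleton]; omega
  · rw [remaining_succ] at hc
    have : remaining nbr (Function.update sv (h + 1) u)
        (Function.update (Function.update sr h (sr h + 1)) (h + 1) 0) h = remaining nbr sv sr h :=
      remaining_congr fun i hi => by
        rw [Function.update_of_ne (by omega), Function.update_of_ne (by omega),
          Function.update_of_ne (by omega)]
        exact ⟨rfl, rfl⟩
    rw [remaining_succ, remaining_succ, this, Function.update_of_ne (show h ≠ h + 1 by omega),
      Function.update_of_ne (show h ≠ h + 1 by omega), Function.update_self, Function.update_self,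
      Function.update_self, List.map_append, List.sum_append]
    simp only [St.setReg_clk, St.setArr_clk, St.emit_clk, St.setReg_reg, St.setArr_reg, St.emit_reg,
      List.map_cons, List.map_nil, List.sum_singleton]
    simp only [Nat.reduceEqDiff, if_false]
    omega

theorem wp_step (hX : Bounds n m w X) (hin : InputOk nbr m input)
    (hi : DfsInv nbr input D roots g c₀ f (h + 1) lo sv sr ev τ) :
    wp (env n w 28 input) stepCode τ.tick fun τ' => ∃ f' h' lo' sv' sr' ev',
      DfsInv nbr input D roots g c₀ f' h' lo' sv' sr' ev' τ' := by
  have hw0 := hX.w_ne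
  have hq := seg_pos n
  have hcol := hi.colour
  have hmod : ∀ i, i % (2 * seg n) < 2 * seg n := fun i => Nat.mod_lt _ (by omega)
  have hlo : lo ≤ h := by have := hi.lt; omega
  obtain ⟨b1, b2⟩ := hi.stack.buf h hlo (by omega)
  have hsr := hi.search.le h (by omega)
  have hsucc := hin.succ (sv h)
  have hin1 := hin.le (sv h)
  have hinl := hin.length
  have hvlt := (sv h).2
  have hhn := hi.search.le_n
  have hsn : seg n ≤ n + 1 := Nat.succ_le_succ (Nat.div_le_self _ _)
  have h4 := hi.height
  have hfb : fb n ≠ 0 := (Nat.mul_pos (by omega) (ll_pos hX.pos)).ne'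
  obtain ⟨hn, hnm, -, -, -, -, -, -, -, hXw, -, -, -, -⟩ := id hX
  simp [stepCode, wp_ite, h4, b1, b2, hmod, hinl, hsucc]
  refine ⟨⟨hw0, by omega, by omega⟩, ⟨⟨hw0, by omega⟩, by omega⟩, fun hgt => ?_, fun hle => ?_⟩
  · refine (wp_pop hX hin (hi.congr (k := 30) ?_ ?_ ?_ ?_) ?_ (by omega)).mono ?_
    any_goals simp
    exact fun τ' h' lo' ev' hτ' => ⟨f, h', lo', sv, sr, ev', hτ'⟩
  · obtain ⟨u, hu⟩ : ∃ u, (nbr (sv h))[sr h]? = some u :=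
      ⟨_, List.getElem?_eq_getElem (show sr h < (nbr (sv h)).length by omega)⟩
    have hrd := hin.get _ _ _ hu
    have hun := u.2
    rw [hrd, Nat.add_sub_cancel]
    refine ⟨⟨by omega, hw0, by omega⟩, hun, fun hv => ⟨⟨hw0, by omega⟩, ?_⟩, fun hv => ?_⟩
    · have hf := (hcol u).mp hv
      have hc := hi.clk
      rw [remaining_succ] at hc
      refine ⟨f, h + 1, lo, sv, Function.update sr h (sr h + 1), ev, hi.search.advance hu hf,
        hi.stack.advance hlo ?_ ?_ ?_ ?_ ?_, ?_, ?_, ?_, ?_, ?_, hi.lt, ?_, hi.ev_le, ?_⟩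
      any_goals simp [add_assoc]
      · exact hi.counts
      · exact hi.log
      · exact hi.others
      · exact h4
      · exact hi.low
      · rw [← contin_found hu hf]; exact hi.result
      · have : remaining nbr sv (Function.update sr h (sr h + 1)) h = remaining nbr sv sr h :=
          remaining_congr fun i hi => ⟨rfl, Function.update_of_ne (by omega) _ _⟩
        rw [remaining_succ, this, Function.update_self]
        have := (List.getElem?_eq_some_iff.mp hu).1
        simp only [List.sum_map_add] at hc
        simp at hc
        omega
    · exact wp_push hX hin (hi.congr (by simp) rfl rfl (by simp)) hu
        (fun hf => (hcol u).mpr hf hv) (by simp) (by simp) (by simp)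

theorem DfsInv.skip_root {v : Fin n} (hi : DfsInv nbr input D (v :: roots) g c₀ f 0 lo sv sr ev τ)
    (hv : v ∈ f.map Prod.fst) : DfsInv nbr input D roots g c₀ f 0 lo sv sr ev τ :=
  { hi with
    result := by
      have := hi.result
      rwa [contin, List.foldl_cons, visit_of_mem hv] at this }

theorem wp_root (hX : Bounds n m w X) (hin : InputOk nbr m input) {v : Fin n}
    (hi : DfsInv nbr input D (v :: roots) g (c₀ + 30) f 0 lo sv sr ev τ) (h1 : τ.reg 1 = v)
    (hv : v ∉ f.map Prod.fst) :
    wp (env n w 28 input) rootCode τ fun τ' => ∃ f' h' lo' sv' sr' ev',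
      DfsInv nbr input D roots g c₀ f' h' lo' sv' sr' ev' τ' := by
  have hw0 := hX.w_ne
  have hq := seg_pos n
  have hvn := v.2
  have hlo : lo = 0 := by have := hi.stack.le; omega
  have hpow : 4 ≤ 2 ^ fb n := by have := hX.lg_pow; omega
  have hinl := hin.length
  have hin1 := hin.le v
  have hfb : fb n ≠ 0 := (Nat.mul_pos (by omega) (ll_pos hX.pos)).ne'
  obtain ⟨hn, hnm, -, -, -, -, -, -, -, hXw, -, -, -, -⟩ := id hX
  subst hlo
  have hev := hi.ev_le
  have hc := hi.clk
  simp [rootCode, h1]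
  and_intros
  any_goals omega
  refine ⟨f ++ [(v, none)], 1, 0, _, _, ev, hi.search.root hv,
    hi.stack.push (fun _ h => absurd h (by omega)) (by omega) hv ?_ ?_ ?_ ?_ ?_, ?_, ?_, ?_, ?_, ?_,
    ?_, ?_, ?_, ?_⟩
  any_goals simp
  · rw [kids_root]; exact hi.counts
  · exact hi.log.append (al := τ.reg 6) rfl (by rw [kids_root]; exact hi.counts)
  · exact hi.others
  · exact hi.low
  · have := hi.result
    rw [contin, List.foldl_cons, visit_of_not_mem hv] at this
    simpa [contin] using this
  · omega
  · simp only [List.sum_map_add] at hc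
    simp [remaining] at hc ⊢
    omega

theorem DfsInv.sum_le (hi : DfsInv nbr input D roots g c₀ f h lo sv sr ev τ) :
    (f.map fun e => (nbr e.1).length + 2).sum ≤ ∑ v, (nbr v).length + 2 * n := by
  have h1 := hi.search.sum_le fun v => (nbr v).length
  have h2 := hi.search.length_le
  simp only [List.sum_map_add]
  simp
  omega

theorem DfsInv.tables_le (hi : DfsInv nbr input D roots g c₀ f h lo sv sr ev τ) :
    τ.reg 6 ≤ n / thr n := by
  rw [Nat.le_div_iff_mul_le (thr_pos n)]
  exact hi.counts.le_sum.trans ((sum_kids_le f).trans hi.search.length_le)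

/-- A crude bound, which serves only to show that the inner loop ends. -/
theorem DfsInv.clk_le (hi : DfsInv nbr input D roots g c₀ f h lo sv sr ev τ) :
    τ.clk ≤ c₀ + 40 * (∑ v, (nbr v).length + 2 * n) +
      (2 * n + seg n) * moveCost n (∑ v, (nbr v).length) + (4 * lb n + 8) * n := by
  have h1 := hi.clk
  have h2 := hi.sum_le
  have h3 := hi.search.length_le
  have h4 : ev ≤ 2 * n + seg n := by
    have := hi.ev_le
    have := Nat.le_mul_of_pos_left ev (seg_pos n)
    omega
  have h5 := Nat.mul_le_mul_right (moveCost n (∑ v, (nbr v).length)) h4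
  have h6 := Nat.mul_le_mul_left (4 * lb n + 8) (hi.tables_le.trans (Nat.div_le_self _ _))
  omega

theorem wp_search (hX : Bounds n m w X) (hin : InputOk nbr m input) (s : Fin n)
    (h39 : τ.reg 39 = s + 1) (harr : ∀ b < 28, τ.arr b = fun _ => 0) (hlog : τ.log = [])
    (hD : (s :: List.finRange n).foldl (fun f v => visit nbr f none v) [] = D)
    (hm : ∑ v, (nbr v).length = m) :
    wp (env n w 28 input) searchCode τ fun τ' => ∃ al ev, ev ≤ 2 * lg n ∧ al ≤ n / thr n ∧
      Counts n (lb n) (thr n) (τ'.arr 13) (τ'.arr 14) (τ'.arr 27) al (kids D) ∧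
      LogOk D τ'.log ∧ τ'.arr 18 = (fun _ => 0) ∧
      τ'.clk ≤ τ.clk + 100 * n + 40 * m + 20 + ev * moveCost n m + (4 * lb n + 8) * al := by
  have hw0 := hX.w_ne
  have hq := seg_pos n
  have hs := s.2
  obtain ⟨hn, hnm, -, -, -, -, -, -, -, hXw, -, -, -, -⟩ := id hX
  have hroots : (s :: List.finRange n).length = n + 1 := by simp
  simp [searchCode]
  apply wp_loop (I := fun σ => ∃ r ≤ n + 1, ∃ f lo sv sr ev, σ.reg 0 = r ∧
    DfsInv nbr input D ((s :: List.finRange n).drop r) (r, s + 1, fun _ => 0) (τ.clk + 4 + 10 * r)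
      f 0 lo sv sr ev σ) (μ := fun σ => n + 1 - σ.reg 0)
  · refine ⟨0, by omega, [], 0, fun _ => s, fun _ => 0, 0, by simp, Search.init _ _, ?_, ?_, ?_, ?_,
      ?_, ?_, ?_, ?_, ?_, ?_⟩
    any_goals simp [h39, harr, contin, remaining, hD]
    · refine ⟨by simp, le_rfl, by omega, fun i _ h => absurd h (by omega), fun v _ =>
        by simp [harr],
        fun v hv => by simp at hv, fun i _ h => absurd h (by omega), fun i h => absurd h (by omega),
        fun j h => absurd h (by omega)⟩
    · exact Counts.init (thr_pos n)
    · exact ⟨by simp [hlog], by simp [hlog]⟩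
  · rintro σ ⟨r, hr, f, lo, sv, sr, ev, h0, hi⟩
    have hg := hi.others
    simp only [Prod.mk.injEq] at hg
    refine ⟨by simp; omega, ?_, ?_⟩
    · simp only [val_lt, val_var, val_par, val_add, val_lit, par_0, h0, ite_eq_right_iff,
        one_ne_zero, imp_false]
      intro hr'
      obtain rfl : r = n + 1 := by omega
      have hres := hi.result
      rw [List.drop_eq_nil_of_le (by simp), contin, List.foldl_nil] at hres
      subst hres
      have hc := hi.clk
      have hsum := hi.sum_le
      have hlen := hi.search.length_le
      have hev := hi.ev_le
      have hlo := hi.stack.le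
      have hal := hi.tables_le
      rw [hm] at hc hsum
      refine ⟨σ.reg 6, ev, ?_, hal, hi.counts, hi.log, hg.2.2, ?_⟩
      -- With an empty stack the distance term equals `seg n`, so `ev_le` reduces to `seg n * ev ≤ 2
      -- * f.length`, and `2 * n` is less than `2 * lg n` segments.
      · have h1 := lt_seg_mul hn
        have h2 : seg n * ev ≤ seg n * (2 * lg n) := by
          rw [show seg n * (2 * lg n) = 2 * (lg n * seg n) by ring]; omega
        exact Nat.le_of_mul_le_mul_left h2 hq
      · simp only [St.tick_clk]
        omega
    · simp only [val_lt, val_var, val_par, val_add, val_lit, par_0, h0, ne_eq, ite_eq_right_iff,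
        one_ne_zero, imp_false, not_not]
      intro hr'
      obtain ⟨v, hv⟩ : ∃ v, (s :: List.finRange n)[r]? = some v :=
        ⟨_, List.getElem?_eq_getElem (by omega)⟩
      have hdrop : (s :: List.finRange n).drop r = v :: (s :: List.finRange n).drop (r + 1) := by
        obtain ⟨h1, h2⟩ := List.getElem?_eq_some_iff.mp hv
        rw [List.drop_eq_getElem_cons h1, h2]
      have hv' : (if r = 0 then (s : ℕ) else r - 1) = v := by
        obtain _ | r := r
        · simp at hv; simp [hv]
        · obtain ⟨h1, h2⟩ := List.getElem?_eq_some_iff.mp hv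
          simp at h2
          simp [← h2]
      rw [hdrop] at hi
      have hvn := v.2
      have htest : wp (env n w 28 input)
          (ite (var 0) (assign 1 (var 0 - lit 1)) (assign 1 (var 39 - lit 1))) σ.tick fun ρ =>
          ρ.reg 1 = v ∧ (∀ x ≠ 1, ρ.reg x = σ.reg x) ∧ ρ.arr = σ.arr ∧ ρ.log = σ.log ∧
            ρ.clk = σ.clk + 3 := by
        simp [wp_ite, h0, hg.2.1, hw0]
        constructor
        · intro hr0
          rw [if_neg hr0] at hv'
          exact ⟨by omega, hv', fun x hx h => absurd h hx⟩
        · intro hr0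
          rw [if_pos hr0] at hv'
          exact ⟨hv', fun x hx h => absurd h hx⟩
      rw [wp_seq]
      refine htest.mono ?_
      rintro ρ ⟨h1, hreg, harr', hlog', hclk⟩
      have hi' : DfsInv nbr input D (v :: (s :: List.finRange n).drop (r + 1))
          (r + 1, s + 1, fun _ => 0) (τ.clk + 4 + 10 * r + 5) f 0 lo sv sr ev
          (ρ.setReg 0 (r + 1)).tick := by
        refine hi.congr_others ?_ ?_ harr' hlog' ?_
        · simp [hreg]
        · simp [hreg, hg.2.1, harr', hg.2.2]
        · simp [hclk]
      rw [wp_seq, wp_assign, wp_seq, wp_ite]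
      have hcol := hi'.colour v
      -- The inner loop is treated once for both cases: with an empty stack, if the root was known,
      -- and with the root as the only entry, if it was new.
      have hdisc : ∀ ρ' : St, (∃ f' h' lo' sv' sr' ev', DfsInv nbr input D
          ((s :: List.finRange n).drop (r + 1)) (r + 1, s + 1, fun _ => 0)
          (τ.clk + 4 + 10 * r + 5) f' h' lo' sv' sr' ev' ρ') →
          wp (env n w 28 input) (loop (var 4) stepCode) ρ' fun τ' =>
            (∃ r ≤ n + 1, ∃ f lo sv sr ev, τ'.reg 0 = r ∧
              DfsInv nbr input D ((s :: List.finRange n).drop r) (r, s + 1, fun _ => 0)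
                (τ.clk + 4 + 10 * r) f 0 lo sv sr ev τ') ∧
            n + 1 - τ'.reg 0 < n + 1 - r := by
        intro ρ' hρ'
        refine wp_loop_of_clk_le (I := fun ρ' => ∃ f' h' lo' sv' sr' ev', DfsInv nbr input D
          ((s :: List.finRange n).drop (r + 1)) (r + 1, s + 1, fun _ => 0)
          (τ.clk + 4 + 10 * r + 5) f' h' lo' sv' sr' ev' ρ') _ hρ'
          (fun ρ ⟨f', h', lo', sv', sr', ev', hρ⟩ => hρ.clk_le) ?_
        rintro ρ ⟨f', h', lo', sv', sr', ev', hρ⟩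
        have h4 := hρ.height
        have ho := hρ.others
        simp only [Prod.mk.injEq] at ho
        refine ⟨by simp, fun hz => ?_, fun hz => ?_⟩
        · rw [val_var, h4] at hz
          subst hz
          refine ⟨⟨r + 1, by omega, f', lo', sv', sr', ev', ho.1, ?_⟩, ?_⟩
          · have := hρ.congr (τ' := ρ.tick) (k := 5) (by simp) rfl rfl (by simp)
            rwa [show τ.clk + 4 + 10 * r + 5 + 5 = τ.clk + 4 + 10 * (r + 1) by ring] at this
          · simp only [St.tick_reg, ho.1]; omega
        · rw [val_var, h4] at hz
          obtain ⟨h', rfl⟩ := Nat.exists_eq_succ_of_ne_zero hz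
          exact wp_step hX hin hρ
      have hr0 : ρ.reg 0 = r := (hreg 0 (by simp)).trans h0
      refine ⟨by simp [hr0]; omega, by simp [h1], fun hv => ?_, fun hv => ?_⟩
      · rw [wp_skip]
        simp [h1] at hv
        refine hdisc _ ⟨f, 0, lo, sv, sr, ev, ?_⟩
        have := hi'.skip_root (hcol.mp (by simpa using hv))
        simpa [hr0] using this
      · simp [h1] at hv
        have hi'' := hi'.congr (τ' := (ρ.setReg 0 (r + 1)).tick) (k := 30) (by simp) rfl rfl
          (by simp)
        have hval : (var 0 + lit 1).val (env n w 28 input) ρ = r + 1 := by simp [hr0]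
        rw [hval]
        refine (wp_root hX hin hi'' (by simp [h1]) fun hf => hcol.mpr hf (by simpa using hv)).mono
          ?_
        exact fun ρ' hρ' => hdisc ρ' hρ'

end

end WordRAM

/-! ### Unary strings -/

/-- The lengths of the runs of ones that end with a zero; the first run is `c` longer. -/
def runLengths : ℕ → List Bool → List ℕ
  | _, [] => []
  | c, true :: l => runLengths (c + 1) l
  | c, false :: l => c :: runLengths 0 l

/-- The numbers `d 0, …, d (v - 1)` in unary. -/
def unary (d : ℕ → ℕ) (v : ℕ) : List Bool :=
  (List.range v).flatMap fun u => List.replicate (d u) true ++ [false]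

/-- The starting positions of the numbers in the unary string. -/
def unaryPos (d : ℕ → ℕ) (v : ℕ) : ℕ := ∑ u ∈ Finset.range v, (d u + 1)

theorem unary_succ (d : ℕ → ℕ) (v : ℕ) :
    unary d (v + 1) = unary d v ++ List.replicate (d v) true ++ [false] := by
  simp [unary, List.range_succ]

theorem unaryPos_succ (d : ℕ → ℕ) (v : ℕ) : unaryPos d (v + 1) = unaryPos d v + d v + 1 :=
  Finset.sum_range_succ _ _

theorem length_unary (d : ℕ → ℕ) (v : ℕ) : (unary d v).length = unaryPos d v := by
  induction v with
  | zero => rfl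
  | succ v ih => rw [unary_succ, unaryPos_succ]; simp [ih, add_assoc]

theorem unaryPos_mono (d : ℕ → ℕ) {u v : ℕ} (h : u ≤ v) : unaryPos d u ≤ unaryPos d v :=
  Finset.sum_le_sum_of_subset (Finset.range_mono h)

/-- One zero for each vertex, and as many ones as the degrees sum up to. -/
theorem unaryPos_le (d : ℕ → ℕ) {v n : ℕ} (h : v ≤ n) (hd : ∑ u ∈ Finset.range n, d u ≤ n) :
    unaryPos d v ≤ 2 * n := by
  refine (unaryPos_mono d h).trans ?_
  rw [unaryPos, Finset.sum_add_distrib]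
  simp; omega

theorem unaryPos_add_le (d : ℕ → ℕ) (u k T : ℕ) (h : ∀ i < k, d (u + i) + 1 ≤ T) :
    unaryPos d (u + k) ≤ unaryPos d u + k * T := by
  induction k with
  | zero => simp
  | succ k ih =>
    have := ih fun i hi => h i (by omega)
    have := h k (by omega)
    rw [← add_assoc, unaryPos_succ, Nat.succ_mul]; omega

theorem runLengths_replicate (c k : ℕ) (l : List Bool) :
    runLengths c (List.replicate k true ++ false :: l) = (c + k) :: runLengths 0 l := by
  induction k generalizing c with
  | zero => rfl
  | succ k ih => rw [List.replicate_succ, List.cons_append, runLengths, ih]; congr 1; omega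

/-- Each code word ends with a zero, which resets the counter, so whatever follows cannot disturb
the decoding. The table lookup depends on this, since a chunk may contain bits from beyond its
block. -/
theorem runLengths_unary (d : ℕ → ℕ) (v : ℕ) (l : List Bool) :
    runLengths 0 (unary d v ++ l) = (List.range v).map d ++ runLengths 0 l := by
  induction v generalizing l with
  | zero => rfl
  | succ v ih =>
    rw [unary_succ, List.append_assoc, List.append_assoc, List.singleton_append, ih,
      runLengths_replicate, List.range_succ]
    simp

theorem unary_add (d : ℕ → ℕ) (u k : ℕ) :
    unary d (u + k) = unary d u ++ unary (fun i => d (u + i)) k := by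
  induction k with
  | zero => simp [unary]
  | succ k ih => rw [← add_assoc, unary_succ, ih, unary_succ]; simp

namespace WordRAM

/-- The array `arr` of `w`-bit words stores the string `l`, followed by zeros. -/
def StrOk (w : ℕ) (arr : ℕ → ℕ) (l : List Bool) : Prop :=
  ∀ i, (arr (i / w)).testBit (i % w) = l.getD i false

namespace StrOk

variable {w : ℕ} {arr : ℕ → ℕ} {l : List Bool}

theorem nil : StrOk w (fun _ => 0) [] := fun i => by simp

/-- The array is zero beyond the string, so appending a zero requires no write. -/
theorem push_false (h : StrOk w arr l) : StrOk w arr (l ++ [false]) := fun i => by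
  rw [h i]
  rcases lt_trichotomy i l.length with hi | rfl | hi
  · rw [List.getD_append _ _ _ _ hi]
  · simp
  · rw [List.getD_eq_default _ _ hi.le, List.getD_eq_default _ _ (by simp; omega)]

theorem push_true (h : StrOk w arr l) : StrOk w (Function.update arr (l.length / w)
    (arr (l.length / w) ||| 2 ^ (l.length % w))) (l ++ [true]) := fun i => by
  have key : i ≠ l.length → l.getD i false = (l ++ [true]).getD i false := by
    intro hi
    rcases lt_or_gt_of_ne hi with hi | hi
    · rw [List.getD_append _ _ _ _ hi]
    · rw [List.getD_eq_default _ _ hi.le, List.getD_eq_default _ _ (by simp; omega)]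
  by_cases hi : i = l.length
  · subst hi; simp
  · rw [← key hi]
    by_cases hd : i / w = l.length / w
    · rw [hd, Function.update_self, Nat.testBit_or, ← hd, h i, Nat.testBit_two_pow]
      have : l.length % w ≠ i % w := by
        intro he
        apply hi
        rw [← Nat.div_add_mod i w, ← Nat.div_add_mod l.length w, hd, he]
      simp [this]
    · rw [Function.update_of_ne hd, h i]

theorem memBits {mem : ℕ → ℕ} {b : ℕ} (hw : 0 < w) (h : StrOk w arr l)
    (hm : ∀ i < l.length, mem (b + i / w) = arr (i / w)) :
    memBits w mem (w * b) l.length = l := by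
  refine List.ext_getElem (by simp [WordRAM.memBits]) fun i h1 h2 => ?_
  have := h i
  simp only [WordRAM.memBits, List.getElem_map, List.getElem_range]
  rw [Nat.mul_add_div hw, Nat.mul_add_mod, hm i h2, this, List.getD_eq_getElem _ _ h2]

/-- As `x` stays within one word, a shift and a mask extract it. Nothing is said about the bits
behind it, which may be further code or padding. -/
theorem chunk {p c : ℕ} {x y : List Bool} (hc : p % w + x.length ≤ w)
    (h : StrOk w arr l) (hl : ∃ z, l = z ++ x ++ y ∧ z.length = p) (hx : x.length ≤ c) :
    ∃ y', (List.range c).map ((arr (p / w) >>> (p % w)) % 2 ^ c).testBit = x ++ y' := by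
  obtain ⟨z, rfl, rfl⟩ := hl
  refine ⟨_, (List.prefix_iff_eq_append.mp ?_).symm⟩
  rw [List.prefix_iff_eq_take]
  refine List.ext_getElem (by simp; omega) fun i h1 h2 => ?_
  have := h (z.length + i)
  have e : z.length = w * (z.length / w) + z.length % w := (Nat.div_add_mod _ _).symm
  have e1 : (z.length + i) / w = z.length / w := by
    rw [show z.length + i = w * (z.length / w) + (z.length % w + i) by omega,
      Nat.mul_add_div (by omega), Nat.div_eq_of_lt (show z.length % w + i < w by omega), add_zero]
  have e2 : (z.length + i) % w = z.length % w + i := by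
    rw [show z.length + i = w * (z.length / w) + (z.length % w + i) by omega,
      Nat.mul_add_mod, Nat.mod_eq_of_lt (show z.length % w + i < w by omega)]
  rw [e1, e2] at this
  simp only [List.getElem_take, List.getElem_map, List.getElem_range, Nat.testBit_mod_two_pow,
    Nat.testBit_shiftRight, this]
  rw [List.append_assoc, List.getD_append_right _ _ _ _ (by omega), Nat.add_sub_cancel_left,
    List.getD_append _ _ _ _ h1, List.getD_eq_getElem _ _ h1]
  simp; omega

end StrOk

/-! ### Reading and writing degrees -/

/-- Put the count of the vertex in variable `1` into variable `2`. -/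
def countCode : Stmt :=
  assign 12 (var 1 / par 9) ;;
  ite (word 13 (var 12)) (assign 2 (word 14 (word 13 (var 12) - lit 1 + var 1 % par 9)))
    (assign 2 (field 27 (var 1)))

theorem Counts.table_lt {n : ℕ} (hn : 0 < n) {ptr tab cnt : ℕ → ℕ} {al : ℕ} {c : ℕ → ℕ}
    (hc : Counts n (lb n) (thr n) ptr tab cnt al c) (hs : ∑ u ∈ Finset.range n, c u ≤ n) {v : ℕ}
    (hv : v < n) (hp : ptr (v / lb n) ≠ 0) :
    ptr (v / lb n) - 1 + v % lb n < n / thr n * lb n := by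
  obtain ⟨i, hi, hpi⟩ := hc.ptr_eq v hv hp
  have h1 : al ≤ n / thr n := by
    rw [Nat.le_div_iff_mul_le (thr_pos n)]
    exact hc.le_sum.trans hs
  have := Nat.mul_le_mul_right (lb n) (Nat.succ_le_of_lt (hi.trans_le h1))
  rw [Nat.succ_mul] at this
  have := Nat.mod_lt v (lb_pos hn)
  omega

theorem wp_count {n m w X : ℕ} (hX : Bounds n m w X) {input : List ℕ} {τ : St} {c : ℕ → ℕ}
    {v al : ℕ} (hc : Counts n (lb n) (thr n) (τ.arr 13) (τ.arr 14) (τ.arr 27) al c)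
    (hv : τ.reg 1 = v) (hvn : v < n) (hs : ∑ u ∈ Finset.range n, c u ≤ n) :
    wp (env n w 28 input) countCode τ fun τ' =>
      τ'.reg 2 = c v ∧ Frame [2, 12] [] τ τ' ∧ τ'.clk = τ.clk + 3 := by
  have hw0 := hX.w_ne
  obtain ⟨hn, -, hlb, -, htab, -, -, -, -, hXw, -, -, -, -⟩ := hX
  have hdiv : v / lb n < n / lb n + 1 := Nat.lt_succ_of_le (Nat.div_le_div_right hvn.le)
  simp only [countCode, wp_seq, wp_assign, wp_ite]
  by_cases hp : τ.arr 13 (v / lb n) = 0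
  · simp [hv, hp, hdiv, hvn, (hc.small v hvn hp).1]
  · have h1 := hc.large v hvn hp
    have h2 := hc.table_lt hn hs hvn hp
    simp [hv, hp, hdiv, h1]
    omega

/-- Append as many ones to the string as variable `2` says. -/
def onesCode : Stmt :=
  loop (var 2)
   (storeWord 18 (var 7 / par 4)
      (.bin .or (word 18 (var 7 / par 4)) (.bin .shl (lit 1) (var 7 % par 4))) ;;
    assign 7 (var 7 + lit 1) ;;
    assign 2 (var 2 - lit 1))

theorem wp_ones {n m w X : ℕ} (hX : Bounds n m w X) {input : List ℕ} {τ : St} {l : List Bool}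
    {k : ℕ} (hl : StrOk w (τ.arr 18) l) (h7 : τ.reg 7 = l.length) (h2 : τ.reg 2 = k)
    (hk : l.length + k ≤ 2 * n) :
    wp (env n w 28 input) onesCode τ fun τ' =>
      StrOk w (τ'.arr 18) (l ++ List.replicate k true) ∧ τ'.reg 7 = l.length + k ∧
      Frame [2, 7] [18] τ τ' ∧ τ'.clk = τ.clk + 4 * k + 1 := by
  have hw0 := hX.w_ne
  obtain ⟨hn, hnm, -, -, -, -, -, -, -, hXw, -, -, -, -⟩ := hX
  apply wp_loop (I := fun σ => ∃ i ≤ k, σ.reg 2 = k - i ∧ σ.reg 7 = l.length + i ∧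
    StrOk w (σ.arr 18) (l ++ List.replicate i true) ∧ Frame [2, 7] [18] τ σ ∧
    σ.clk = τ.clk + 4 * i) (μ := fun σ => σ.reg 2)
  · exact ⟨0, by omega, by omega, by omega, by simpa using hl, by simp, by omega⟩
  · rintro σ ⟨i, hi, e2, e7, hS, hF, hclk⟩
    refine ⟨by simp, fun hz => ?_, fun hz => ?_⟩
    · rw [val_var, e2] at hz
      obtain rfl : i = k := by omega
      exact ⟨hS, e7, by simpa using hF, by simp [hclk]⟩
    · rw [val_var, e2] at hz
      have hd : (l.length + i) / w ≤ 2 * n / w := Nat.div_le_div_right (by omega)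
      have hmod : (l.length + i) % w < w := Nat.mod_lt _ (by omega)
      have h1w : 1 < 2 ^ w := Nat.one_lt_two_pow hw0
      have hsh : (1 <<< ((l.length + i) % w)) % 2 ^ w = 2 ^ ((l.length + i) % w) := by
        rw [Nat.shiftLeft_eq, one_mul, Nat.mod_eq_of_lt (Nat.pow_lt_pow_right (by norm_num) hmod)]
      have hpush := hS.push_true
      simp only [List.length_append, List.length_replicate, List.append_assoc,
        ← List.replicate_succ'] at hpush
      simp [e7, e2, hsh]
      refine ⟨by omega, by omega, by omega, by omega, ?_⟩
      refine ⟨⟨i + 1, by omega, by omega, by omega, hpush, hF, by omega⟩, by omega⟩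

/-- Write the degrees of the vertices from variable `1` up to variable `14`. -/
def writeCode : Stmt :=
  loop (Expr.lt (var 1) (var 14))
   (countCode ;; onesCode ;; assign 7 (var 7 + lit 1) ;; assign 1 (var 1 + lit 1))

/-- The time is charged to the string, seven units per bit; the terminating zero of a vertex pays
for the constant part. -/
theorem wp_write {n m w X : ℕ} (hX : Bounds n m w X) {input : List ℕ} {τ : St} {c : ℕ → ℕ}
    {v v' al : ℕ} (hc : Counts n (lb n) (thr n) (τ.arr 13) (τ.arr 14) (τ.arr 27) al c)
    (hs : ∑ u ∈ Finset.range n, c u ≤ n) (hS : StrOk w (τ.arr 18) (unary c v))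
    (h7 : τ.reg 7 = unaryPos c v) (h1 : τ.reg 1 = v) (h14 : τ.reg 14 = v') (hvv : v ≤ v')
    (hv : v' ≤ n) :
    wp (env n w 28 input) writeCode τ fun τ' =>
      StrOk w (τ'.arr 18) (unary c v') ∧ τ'.reg 7 = unaryPos c v' ∧
      Frame [1, 2, 7, 12] [18] τ τ' ∧ τ'.clk + 7 * unaryPos c v ≤ τ.clk + 7 * unaryPos c v' + 1 := by
  have hw0 := hX.w_ne
  obtain ⟨hn, hnm, -, -, -, -, -, -, -, hXw, -, -, -, -⟩ := id hX
  apply wp_loop (I := fun σ => ∃ u ≤ v', σ.reg 1 = u ∧ σ.reg 7 = unaryPos c u ∧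
    StrOk w (σ.arr 18) (unary c u) ∧ Frame [1, 2, 7, 12] [18] τ σ ∧
    σ.clk + 7 * unaryPos c v ≤ τ.clk + 7 * unaryPos c u) (μ := fun σ => v' - σ.reg 1)
  · exact ⟨v, hvv, h1, h7, hS, by simp, le_rfl⟩
  · rintro σ ⟨u, hu, e1, e7, hS, hF, hclk⟩
    have e14 := (hF.reg 14 (by simp)).trans h14
    refine ⟨by simp, fun hz => ?_, fun hz => ?_⟩
    · simp [e1, e14] at hz
      obtain rfl : u = v' := by omega
      exact ⟨hS, e7, by simpa using hF, by simp; omega⟩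
    · simp [e1, e14] at hz
      have hc' : Counts n (lb n) (thr n) (σ.tick.arr 13) (σ.tick.arr 14) (σ.tick.arr 27) al c := by
        simp only [St.tick_arr]
        rw [hF.arr 13 (by simp), hF.arr 14 (by simp), hF.arr 27 (by simp)]
        exact hc
      have hpos := unaryPos_le c (show u + 1 ≤ n by omega) hs
      rw [unaryPos_succ] at hpos
      rw [wp_seq]
      refine (wp_count hX hc' (τ := σ.tick) e1 (by omega) hs).mono ?_
      rintro ρ ⟨f2, fF, fclk⟩
      rw [wp_seq]
      refine (wp_ones hX (l := unary c u) (k := c u) ?_ ?_ f2 (by rw [length_unary]; omega)).mono ?_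
      · rw [fF.arr 18 (by simp)]; exact hS
      · rw [fF.reg 7 (by simp), length_unary]; exact e7
      · rintro ω ⟨gS, g7, gF, gclk⟩
        have g1 : ω.reg 1 = u := (gF.reg 1 (by simp)).trans ((fF.reg 1 (by simp)).trans e1)
        rw [length_unary] at g7
        have hgF : Frame [1, 2, 7, 12] [18] τ ω :=
          ((hF.trans (Frame.tick_iff.mpr Frame.refl)).trans (fF.mono (by simp) (by simp))).trans
            (gF.mono (by simp) (by simp))
        simp at fclk
        simp [g7, g1, hgF]
        refine ⟨by omega, by omega, ?_, by omega⟩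
        refine ⟨hz, by rw [unaryPos_succ], ?_, by rw [unaryPos_succ]; omega⟩
        rw [unary_succ]; exact gS.push_false

/-! ### Writing the final representation -/

namespace Par

theorem ll_sq_lt (n : ℕ) : ll n ^ 2 < 4 ^ ll n := by
  calc ll n ^ 2 < (2 ^ ll n) ^ 2 := Nat.pow_lt_pow_left Nat.lt_two_pow_self (by norm_num)
    _ = 4 ^ ll n := by rw [← pow_mul, mul_comm, pow_mul]; norm_num

/-- In a large block without a table no code word is longer than `thr n`, so this makes relative
positions fit into a field. It holds because `ll n ^ 2` is below `4 ^ ll n`, and `4 * 4 * 16 = 2 ^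
8`. -/
theorem lb_mul_thr_lt (n : ℕ) : lb n * thr n < 2 ^ fb n := by
  have h : 2 ^ fb n = 4 ^ ll n * 4 ^ ll n * 16 ^ ll n := by
    rw [← mul_pow, ← mul_pow, fb, pow_mul]; norm_num
  rw [h, lb, sb, bb, thr]
  exact Nat.mul_lt_mul_of_pos_right
    (Nat.mul_lt_mul_of_pos_right (ll_sq_lt n) (by positivity)) (by positivity)

theorem bb_lt (n : ℕ) (hn : 0 < n) : bb n < 2 ^ fb n := by
  rw [bb, fb, pow_mul]
  exact Nat.pow_lt_pow_left (by norm_num) (ll_pos hn).ne'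

theorem div_lb (n v : ℕ) : v / lb n = v / sb n / bb n := (Nat.div_div_eq_div_mul _ _ _).symm

end Par

/-- Copy the degrees of the vertices from variable `1` up to variable `14` to the list of long
blocks, which has as many entries as variable `8` says. -/
def copyCode : Stmt :=
  loop (Expr.lt (var 1) (var 14))
   (storeField 21 (var 8 * par 7 + var 1 % par 7) (field 27 (var 1)) ;; assign 1 (var 1 + lit 1))

theorem wp_copy {n m w X : ℕ} (hX : Bounds n m w X) {input : List ℕ} {τ : St} {d : ℕ → ℕ}
    {b v' lc : ℕ} (h1 : τ.reg 1 = b * sb n) (h14 : τ.reg 14 = v') (h8 : τ.reg 8 = lc)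
    (hb : b * sb n ≤ v') (hv' : v' ≤ (b + 1) * sb n) (hvn : v' ≤ n)
    (hlc : (lc + 1) * sb n ≤ 2 * (2 * n / ch n) * sb n)
    (hd : ∀ v, b * sb n ≤ v → v < v' → τ.arr 27 v = d v ∧ d v < thr n) :
    wp (env n w 28 input) copyCode τ fun τ' =>
      (∀ v, b * sb n ≤ v → v < v' → τ'.arr 21 (lc * sb n + v % sb n) = d v) ∧
      (∀ i < lc * sb n, τ'.arr 21 i = τ.arr 21 i) ∧ Frame [1] [21] τ τ' ∧
      τ'.clk + 3 * (b * sb n) ≤ τ.clk + 3 * v' + 1 := by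
  have hw0 := hX.w_ne
  have hltle := hX.lt_le
  have htp := hX.thr_pow
  obtain ⟨hn, hnm, -, -, -, -, -, -, -, hXw, -, -, -, -⟩ := id hX
  have hsb := sb_pos hn
  have hsucc : (lc + 1) * sb n = lc * sb n + sb n := Nat.succ_mul _ _
  have hsucc' : (b + 1) * sb n = b * sb n + sb n := Nat.succ_mul _ _
  change 2 * (2 * n / ch n) * sb n ≤ X at hltle
  apply wp_loop (I := fun σ => ∃ u ≤ v', b * sb n ≤ u ∧ σ.reg 1 = u ∧
    (∀ v, b * sb n ≤ v → v < u → σ.arr 21 (lc * sb n + v % sb n) = d v) ∧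
    (∀ i < lc * sb n, σ.arr 21 i = τ.arr 21 i) ∧ Frame [1] [21] τ σ ∧
    σ.clk + 3 * (b * sb n) ≤ τ.clk + 3 * u) (μ := fun σ => v' - σ.reg 1)
  · exact ⟨b * sb n, hb, le_rfl, h1, fun v h h' => absurd h' (by omega), fun _ _ => rfl, by simp,
      le_rfl⟩
  · rintro σ ⟨u, hu, hu', e1, hnew, hold, hF, hclk⟩
    have e14 := (hF.reg 14 (by simp)).trans h14
    have e8 := (hF.reg 8 (by simp)).trans h8
    have e27 := hF.arr 27 (by simp)
    refine ⟨by simp, fun hz => ?_, fun hz => ?_⟩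
    · simp [e1, e14] at hz
      obtain rfl : u = v' := by omega
      exact ⟨hnew, hold, by simpa using hF, by simp; omega⟩
    · simp [e1, e14] at hz
      obtain ⟨d1, d2⟩ := hd u hu' hz
      have hmod := Nat.mod_lt u hsb
      simp [e1, e8, e27, d1, hF]
      and_intros
      any_goals omega
      · intro v hv hvu
        by_cases hvu' : v = u
        · subst hvu'; simp
        · have := mod_ne_mod (q := sb n) hv (show v < u by omega) (by omega)
          rw [Function.update_of_ne (by omega)]
          exact hnew v hv (by omega)
      · intro i hi
        rw [Function.update_of_ne (by omega)]
        exact hold i hi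

/-! ### Short and long blocks of the unary string -/

/-- The representation of the first `b` small blocks. -/
structure BlocksOk (n w : ℕ) (d ptr : ℕ → ℕ) (b lc : ℕ) (off loff rel lrel lt : ℕ → ℕ) : Prop where
  off_eq : ∀ a, a * bb n < b → off a = unaryPos d (a * lb n)
  loff_le : ∀ a, a * bb n < b → loff a ≤ lc ∧ lc + a * bb n ≤ loff a + b
  rel_eq : ∀ c < b, ptr (c / bb n) = 0 → off (c / bb n) + rel c = unaryPos d (c * sb n)
  short : ∀ c < b, ptr (c / bb n) = 0 → lrel c = 0 →
    unaryPos d (min ((c + 1) * sb n) n) - unaryPos d (c * sb n) ≤ ch n ∧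
    unaryPos d (c * sb n) % w + (unaryPos d (min ((c + 1) * sb n) n) - unaryPos d (c * sb n)) ≤ w
  long : ∀ c < b, ptr (c / bb n) = 0 → lrel c ≠ 0 → loff (c / bb n) + lrel c ≤ lc ∧
    ∀ v < n, v / sb n = c → lt ((loff (c / bb n) + lrel c - 1) * sb n + v % sb n) = d v
  count_le : lc ≤ unaryPos d (min (b * sb n) n) / ch n + unaryPos d (min (b * sb n) n) / w

/-- Store the place of the block with the number in variable `9`, which has been written. -/
def blockPlaceCode : Stmt :=
  ite (word 13 (var 10)) skip
   (storeField 19 (var 9) (var 11 - word 15 (var 10)) ;;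
    ite (.bin .or (Expr.lt (par 11) (var 7 - var 11))
        (Expr.lt (par 4) (var 11 % par 4 + (var 7 - var 11))))
     (storeField 20 (var 9) (var 8 - word 16 (var 10) + lit 1) ;;
      assign 1 (var 9 * par 7) ;;
      copyCode ;;
      assign 8 (var 8 + lit 1))
     (storeField 20 (var 9) (lit 0)))

/-- Write the degrees of the small block in variable `9`. -/
def blockCode : Stmt :=
  assign 10 (var 9 / par 8) ;;
  ite (var 9 % par 8) skip (storeWord 15 (var 10) (var 7) ;; storeWord 16 (var 10) (var 8)) ;;
  (assign 11 (var 7) ;;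
   assign 14 (var 9 * par 7 + par 7) ;;
   ite (Expr.lt (par 0) (var 14)) (assign 14 (par 0)) skip ;;
   assign 1 (var 9 * par 7)) ;;
  writeCode ;;
  blockPlaceCode ;;
  assign 9 (var 9 + lit 1)

section

variable {n m w X : ℕ} {d ptr : ℕ → ℕ} {b lc : ℕ} {off loff rel lrel lt : ℕ → ℕ}

theorem BlocksOk.congr (h : BlocksOk n w d ptr b lc off loff rel lrel lt) {off' loff' : ℕ → ℕ}
    (hk : ∀ a, a * bb n < b → off' a = off a ∧ loff' a = loff a) :
    BlocksOk n w d ptr b lc off' loff' rel lrel lt := by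
  have key : ∀ c < b, off' (c / bb n) = off (c / bb n) ∧ loff' (c / bb n) = loff (c / bb n) :=
    fun c hc => hk _ ((Nat.div_mul_le_self _ _).trans_lt hc)
  refine ⟨fun a ha => ?_, fun a ha => ?_, fun c hc hp => ?_, h.short, fun c hc hp hl => ?_,
    h.count_le⟩
  · rw [(hk a ha).1]; exact h.off_eq a ha
  · rw [(hk a ha).2]; exact h.loff_le a ha
  · rw [(key c hc).1]; exact h.rel_eq c hc hp
  · rw [(key c hc).2]; exact h.long c hc hp hl

/-- What is known about earlier blocks refers only to old entries, all of which are preserved, so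
the hypotheses list just the conditions on block `b`. -/
theorem BlocksOk.succ (hn : 0 < n) (h : BlocksOk n w d ptr b lc off loff rel lrel lt)
    (hoff : off (b / bb n) = unaryPos d (b / bb n * lb n))
    (hlo : lc ≤ loff (b / bb n) + b % bb n ∧ loff (b / bb n) ≤ lc) {lc' : ℕ}
    {rel' lrel' lt' : ℕ → ℕ} (hrel : ∀ c < b, rel' c = rel c ∧ lrel' c = lrel c)
    (hlt : ∀ i < lc * sb n, lt' i = lt i) (hlc : lc ≤ lc' ∧ lc' ≤ lc + 1)
    (hnew : ptr (b / bb n) = 0 → off (b / bb n) + rel' b = unaryPos d (b * sb n))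
    (hshort : ptr (b / bb n) = 0 → lrel' b = 0 →
      unaryPos d (min ((b + 1) * sb n) n) - unaryPos d (b * sb n) ≤ ch n ∧
      unaryPos d (b * sb n) % w +
        (unaryPos d (min ((b + 1) * sb n) n) - unaryPos d (b * sb n)) ≤ w)
    (hlong : ptr (b / bb n) = 0 → lrel' b ≠ 0 → loff (b / bb n) + lrel' b ≤ lc' ∧
      ∀ v < n, v / sb n = b → lt' ((loff (b / bb n) + lrel' b - 1) * sb n + v % sb n) = d v)
    (hcount : lc' ≤ unaryPos d (min ((b + 1) * sb n) n) / ch n +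
      unaryPos d (min ((b + 1) * sb n) n) / w) :
    BlocksOk n w d ptr (b + 1) lc' off loff rel' lrel' lt' := by
  have hbb := bb_pos n
  have hdm := Nat.div_add_mod b (bb n)
  -- A large block enters the scope exactly when `b` is its first small block.
  have hlast : ∀ a, a * bb n < b + 1 → ¬ a * bb n < b → a = b / bb n ∧ b % bb n = 0 := by
    intro a h1 h2
    obtain rfl : b = a * bb n := by omega
    simp [hbb]
  have hcase : ∀ {c}, c < b + 1 → ¬ c < b → c = b := fun h1 h2 => by omega
  refine ⟨fun a ha => ?_, fun a ha => ?_, fun c hc hp => ?_, fun c hc hp hl => ?_,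
    fun c hc hp hl => ?_, hcount⟩
  · by_cases hab : a * bb n < b
    · exact h.off_eq a hab
    · rw [(hlast a ha hab).1]; exact hoff
  · by_cases hab : a * bb n < b
    · have := h.loff_le a hab; omega
    · obtain ⟨h1, h2⟩ := hlast a ha hab
      rw [h1, mul_comm]; omega
  · by_cases hcb : c < b
    · rw [(hrel c hcb).1]; exact h.rel_eq c hcb hp
    · obtain rfl := hcase hc hcb; exact hnew hp
  · by_cases hcb : c < b
    · rw [(hrel c hcb).2] at hl; exact h.short c hcb hp hl
    · obtain rfl := hcase hc hcb; exact hshort hp hl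
  · by_cases hcb : c < b
    · rw [(hrel c hcb).2] at hl ⊢
      obtain ⟨h1, h2⟩ := h.long c hcb hp hl
      refine ⟨by omega, fun v hv hvc => ?_⟩
      rw [hlt _ ?_]
      · exact h2 v hv hvc
      · have h3 := Nat.mul_le_mul_right (sb n) (show loff (c / bb n) + lrel c - 1 + 1 ≤ lc by omega)
        rw [Nat.succ_mul] at h3
        have := Nat.mod_lt v (sb_pos hn)
        omega
    · obtain rfl := hcase hc hcb; exact hlong hp hl

/-- A long block is longer than a chunk or crosses a word boundary. Accordingly the quotient of the
written length by `ch n` or by `w` grows over the block, which preserves `count_le`. The entry `0`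
marks a short block; for a long one the place in the list, relative to the large block, is stored
increased by one, and it is at most `bb n`. -/
theorem wp_place (hX : Bounds n m w X) {input : List ℕ} {tab : ℕ → ℕ} {σ : St}
    {al : ℕ} (hc : Counts n (lb n) (thr n) (σ.arr 13) tab (σ.arr 27) al d)
    (hs : ∑ u ∈ Finset.range n, d u ≤ n) (hb : b * sb n ≤ n)
    (hB : BlocksOk n w d (σ.arr 13) b (σ.reg 8) (σ.arr 15) (σ.arr 16) (σ.arr 19) (σ.arr 20)
      (σ.arr 21))
    (hoff : σ.arr 15 (b / bb n) = unaryPos d (b / bb n * lb n))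
    (hlo : σ.reg 8 ≤ σ.arr 16 (b / bb n) + b % bb n ∧ σ.arr 16 (b / bb n) ≤ σ.reg 8)
    (h9 : σ.reg 9 = b) (h10 : σ.reg 10 = b / bb n) (h11 : σ.reg 11 = unaryPos d (b * sb n))
    (h14 : σ.reg 14 = min ((b + 1) * sb n) n)
    (h7 : σ.reg 7 = unaryPos d (min ((b + 1) * sb n) n)) :
    wp (env n w 28 input) blockPlaceCode σ fun σ' =>
      BlocksOk n w d (σ.arr 13) (b + 1) (σ'.reg 8) (σ.arr 15) (σ.arr 16) (σ'.arr 19) (σ'.arr 20)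
        (σ'.arr 21) ∧ Frame [1, 8] [19, 20, 21] σ σ' ∧
      σ'.clk + 3 * (b * sb n) ≤ σ.clk + 7 + 3 * min ((b + 1) * sb n) n := by
  have hw0 := hX.w_ne
  obtain ⟨hn, hnm, hlb, -, -, -, -, hlt, hwX, hXw, -, hchw, hthr, -⟩ := id hX
  have hsb := sb_pos hn
  have hbb := bb_pos n
  have hbbl := bb_lt n hn
  have hch := ch_pos n
  have hmul : (b + 1) * sb n = b * sb n + sb n := Nat.succ_mul _ _
  have hblb : b / bb n ≤ n / lb n := by
    rw [div_lb]; exact Nat.div_le_div_right ((Nat.le_div_iff_mul_le hsb).mpr hb)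
  have hbsb : b ≤ n / sb n := (Nat.le_div_iff_mul_le hsb).mpr hb
  have hbn : b ≤ n := hbsb.trans (Nat.div_le_self _ _)
  have hdm := Nat.div_add_mod b (bb n)
  have hbm := Nat.mod_lt b hbb
  have hab : b / bb n * lb n + b % bb n * sb n = b * sb n := by
    conv_rhs => rw [← hdm]
    rw [lb]; ring
  have hlc := hB.count_le
  rw [min_eq_left hb] at hlc
  set P := unaryPos d (b * sb n) with hP
  set v' := min ((b + 1) * sb n) n with hv'
  set P' := unaryPos d v' with hP'
  have hPP : P ≤ P' := unaryPos_mono d (by omega)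
  have hP2 : P' ≤ 2 * n := unaryPos_le d (min_le_right _ _) hs
  have hPch := Nat.div_le_div_right (c := ch n) hPP
  have hPw := Nat.div_le_div_right (c := w) hPP
  have hcnt₀ : σ.reg 8 ≤ P' / ch n + P' / w := by omega
  have hblk : ∀ v, b / bb n * lb n ≤ v → v < v' → v / lb n = b / bb n := by
    intro v h1 h2
    have h3 : b % bb n * sb n + sb n ≤ lb n := by
      rw [← Nat.succ_mul, lb, mul_comm (sb n)]; exact Nat.mul_le_mul_right _ hbm
    exact Nat.div_eq_of_lt_le h1 (by rw [Nat.succ_mul]; omega)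
  rw [blockPlaceCode, wp_ite]
  refine ⟨by simp [h10]; omega, fun hp => ?_, fun hp => ?_⟩
  · simp [h10] at hp
    rw [wp_skip]
    refine ⟨hB.succ hn hoff hlo (fun c _ => ⟨rfl, rfl⟩) (fun _ _ => rfl) ⟨le_rfl, Nat.le_succ _⟩
      (absurd · hp)
      (absurd · hp) (absurd · hp) hcnt₀, by simp, by simp; omega⟩
  · simp [h10] at hp
    have hsmall : ∀ v, b / bb n * lb n ≤ v → v < v' → σ.arr 27 v = d v ∧ d v < thr n := fun v h1 h2
      =>
      hc.small v (by omega) (by rw [hblk v h1 h2]; exact hp)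
    -- Without a table all degrees of the large block up to here are below the threshold, which
    -- bounds the distance from its start.
    have hrel : P ≤ unaryPos d (b / bb n * lb n) + lb n * thr n := by
      rw [hP, ← hab]
      refine (unaryPos_add_le d _ _ (thr n) fun i hi => ?_).trans ?_
      · exact (hsmall _ (by omega) (by omega)).2
      · refine Nat.add_le_add_left (Nat.mul_le_mul_right _ ?_) _
        rw [lb, mul_comm (sb n)]; exact Nat.mul_le_mul_right _ hbm.le
    have hrel' : unaryPos d (b / bb n * lb n) ≤ P := unaryPos_mono d (by omega)
    have hlbthr := lb_mul_thr_lt n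
    have hnsb := Nat.div_le_self n (sb n)
    have hmodw : P % w < w := Nat.mod_lt _ (by omega)
    rw [wp_seq, wp_storeField]
    refine ⟨by simp, by simp [h10, h11, hoff]; omega, by simp [h9]; omega,
      by simp [h10, h11, hoff]; omega, ?_⟩
    have hv19 : (var 11 - word 15 (var 10)).val (env n w 28 input) σ.tick =
      P - unaryPos d (b / bb n * lb n) := by simp [h10, h11, hoff]
    have hv9 : (var 9).val (env n w 28 input) σ.tick = b := by simp [h9]
    rw [hv19, hv9, wp_ite]
    set σ₁ := σ.tick.setArr 19 b (P - unaryPos d (b / bb n * lb n)) with hσ₁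
    refine ⟨by simp [hσ₁, h11, h7]; omega, fun hlong => ?_, fun hshort => ?_⟩
    · have hlong' : ch n < P' - P ∨ w < P % w + (P' - P) := by
        by_contra hcon
        rw [not_or] at hcon
        simp [hσ₁, h11, h7, hcon.1, hcon.2] at hlong
      have hcnt : σ.reg 8 + 1 ≤ P' / ch n + P' / w := by
        rcases hlong' with hl | hl
        · have : (P + ch n) / ch n ≤ P' / ch n := Nat.div_le_div_right (by omega)
          rw [Nat.add_div_right _ hch] at this
          omega
        · have h1 := Nat.div_add_mod P w
          have : P / w + 1 ≤ P' / w := by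
            rw [Nat.le_div_iff_mul_le (by omega), Nat.succ_mul, mul_comm]; omega
          omega
      -- Since `ch n ≤ w`, the second quotient is at most the first.
      have hcap : P' / ch n + P' / w ≤ 2 * (2 * n / ch n) := by
        have h1 : P' / ch n ≤ 2 * n / ch n := Nat.div_le_div_right hP2
        have h2 : P' / w ≤ P' / ch n := Nat.div_le_div_left hchw hch
        omega
      have hlcap : (σ.reg 8 + 1) * sb n ≤ 2 * (2 * n / ch n) * sb n :=
        Nat.mul_le_mul_right _ (hcnt.trans hcap)
      have h8X : σ.reg 8 + 1 ≤ X := by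
        refine le_trans ?_ (hlcap.trans hlt)
        exact Nat.le_mul_of_pos_right _ hsb
      simp [hσ₁, h9, h10]
      and_intros
      any_goals omega
      refine (wp_copy hX (b := b) (v' := v') (lc := σ.reg 8) (d := d) (by simp) (by simp [h14])
        (by simp) (by omega) (min_le_left _ _) (min_le_right _ _) hlcap ?_).mono ?_
      · intro v h1 h2
        exact hsmall v (by omega) h2
      · rintro ρ ⟨knew, kold, kF, kclk⟩
        have k8 := kF.reg 8 (by simp)
        have k19 := kF.arr 19 (by simp)
        have k20 := kF.arr 20 (by simp)
        simp at k8 k19 k20 kclk kold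
        simp [k8, k19, k20]
        refine ⟨by omega, hB.succ hn hoff hlo (fun c hcb => ?_) kold ⟨Nat.le_succ _, le_rfl⟩
          (fun _ => ?_)
          (fun _ h0 => ?_) (fun _ _ => ?_) hcnt, ?_, by omega⟩
        · rw [Function.update_of_ne hcb.ne, Function.update_of_ne hcb.ne]; exact ⟨rfl, rfl⟩
        · rw [Function.update_self, hoff]; omega
        · rw [Function.update_self] at h0; omega
        · rw [Function.update_self]
          refine ⟨by omega, fun v hv hvb => ?_⟩
          rw [show σ.arr 16 (b / bb n) + (σ.reg 8 - σ.arr 16 (b / bb n) + 1) - 1 = σ.reg 8 by omega]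
          have h1 := Nat.div_add_mod v (sb n)
          have h2 := Nat.mod_lt v hsb
          rw [hvb, mul_comm] at h1
          exact knew v (by omega) (by omega)
        · refine Frame.trans ?_ (kF.mono (by simp) (by simp))
          simp
    · have hshort' : P' - P ≤ ch n ∧ P % w + (P' - P) ≤ w := by
        by_contra hcon
        by_cases h1 : ch n < P' - P
        · by_cases h2 : w < P % w + (P' - P) <;> simp [hσ₁, h11, h7, h1, h2] at hshort
        · have h2 : w < P % w + (P' - P) := by omega
          simp [hσ₁, h11, h7, h1, h2] at hshort
      simp [hσ₁, h9]
      refine ⟨by omega, hB.succ hn hoff hlo (fun c hcb => ?_) (fun _ _ => rfl) ⟨le_rfl, Nat.le_succ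
        _⟩ (fun _ => ?_)
        (fun _ _ => hshort') (fun _ h0 => ?_) hcnt₀, by omega⟩
      · rw [Function.update_of_ne hcb.ne, Function.update_of_ne hcb.ne]; exact ⟨rfl, rfl⟩
      · rw [Function.update_self, hoff]; omega
      · rw [Function.update_self] at h0; omega

end

/-! ### Construction of the string and its directory -/

/-- The invariant of the construction. -/
structure BuildInv (n w : ℕ) (d : ℕ → ℕ) (τ : St) (b : ℕ) (σ : St) : Prop where
  index : σ.reg 9 = b
  pos : σ.reg 7 = unaryPos d (min (b * sb n) n)
  blocks : BlocksOk n w d (τ.arr 13) b (σ.reg 8) (σ.arr 15) (σ.arr 16) (σ.arr 19) (σ.arr 20)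
    (σ.arr 21)
  str : StrOk w (σ.arr 18) (unary d (min (b * sb n) n))
  frame : Frame [1, 2, 7, 8, 9, 10, 11, 12, 14] [15, 16, 18, 19, 20, 21] τ σ

theorem wp_block {n m w X : ℕ} (hX : Bounds n m w X) {input : List ℕ} {τ : St} {d : ℕ → ℕ}
    {al : ℕ} (hc : Counts n (lb n) (thr n) (τ.arr 13) (τ.arr 14) (τ.arr 27) al d)
    (hs : ∑ u ∈ Finset.range n, d u ≤ n) {b : ℕ} (hb : b ≤ n / sb n) {σ : St}
    (hi : BuildInv n w d τ b σ) :
    wp (env n w 28 input) blockCode σ fun σ' => BuildInv n w d τ (b + 1) σ' ∧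
      σ'.clk + 10 * unaryPos d (min (b * sb n) n) ≤
        σ.clk + 24 + 10 * unaryPos d (min ((b + 1) * sb n) n) := by
  have hw0 := hX.w_ne
  obtain ⟨hn, hnm, hlb, -, -, -, -, hlt, hwX, hXw, -, hchw, -, -⟩ := id hX
  have hsb := sb_pos hn
  have hbb := bb_pos n
  have hbn : b * sb n ≤ n := (Nat.le_div_iff_mul_le hsb).mp hb
  have hmin : min (b * sb n) n = b * sb n := min_eq_left hbn
  have hsucc : (b + 1) * sb n = b * sb n + sb n := Nat.succ_mul _ _
  have hsblb : sb n ≤ lb n := Nat.le_mul_of_pos_right _ hbb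
  have hle : b ≤ b * sb n := Nat.le_mul_of_pos_right _ hsb
  have hblb : b / bb n ≤ n / lb n := by
    rw [div_lb]; exact Nat.div_le_div_right hb
  have hdm := Nat.div_add_mod b (bb n)
  have hbm := Nat.mod_lt b hbb
  obtain ⟨i9, i7, iB, iS, iF⟩ := hi
  rw [hmin] at i7 iS ⊢
  set a := b / bb n with ha
  have hab : a * lb n + b % bb n * sb n = b * sb n := by
    conv_rhs => rw [← hdm]
    rw [lb]; ring
  have hpos2 := unaryPos_le d hbn hs
  have hlc := iB.count_le
  rw [hmin] at hlc
  simp only [blockCode]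
  rw [wp_seq, wp_assign, wp_seq]
  -- At the first small block of a large one, the absolute position and the number of long blocks so
  -- far are recorded; at the others the invariant provides them.
  have hhead : wp (env n w 28 input)
      (ite (var 9 % par 8) skip (storeWord 15 (var 10) (var 7) ;; storeWord 16 (var 10) (var 8)))
      (σ.setReg 10 a) fun ρ => (∀ x, ρ.reg x = (σ.setReg 10 a).reg x) ∧
        Frame [] [15, 16] (σ.setReg 10 a) ρ ∧
        ρ.clk ≤ σ.clk + 4 ∧ ρ.arr 15 a = unaryPos d (a * lb n) ∧
        (∀ a', a' * bb n < b → ρ.arr 15 a' = σ.arr 15 a' ∧ ρ.arr 16 a' = σ.arr 16 a') ∧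
        σ.reg 8 ≤ ρ.arr 16 a + b % bb n ∧ ρ.arr 16 a ≤ σ.reg 8 := by
    simp [wp_ite, i9]
    refine ⟨fun hz => ?_, fun hz => ⟨by omega, ?_, fun a' ha' => ?_⟩⟩
    · have hab' : a * bb n < b := by rw [mul_comm]; omega
      have := iB.loff_le a hab'
      rw [mul_comm] at this
      exact ⟨iB.off_eq a hab', by omega, this.1⟩
    · rw [i7, ← hab, hz]; simp
    · have : a' ≠ a := by rintro rfl; rw [mul_comm] at ha'; omega
      simp [this]
  have hval : (var 9 / par 8).val (env n w 28 input) σ = a := by simp [i9, ha]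
  rw [hval]
  refine ⟨by simp, hhead.mono ?_⟩
  clear hhead
  rintro ρ ⟨hreg, hF, hclk, hoff, hkeep, hlo1, hlo2⟩
  set v' := min ((b + 1) * sb n) n with hv'
  have hbv : b * sb n ≤ v' := by omega
  have hmid : wp (env n w 28 input) (assign 11 (var 7) ;; assign 14 (var 9 * par 7 + par 7) ;;
      ite (Expr.lt (par 0) (var 14)) (assign 14 (par 0)) skip ;; assign 1 (var 9 * par 7)) ρ fun ρ'
          =>
      Frame [1, 11, 14] [] ρ ρ' ∧ ρ'.reg 11 = unaryPos d (b * sb n) ∧ ρ'.reg 14 = v' ∧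
        ρ'.reg 1 = b * sb n ∧ ρ'.clk ≤ ρ.clk + 5 := by
    have hr9 : ρ.reg 9 = b := by rw [hreg]; simpa using i9
    have hr7 : ρ.reg 7 = unaryPos d (b * sb n) := by rw [hreg]; simpa using i7
    simp [wp_ite, hr9, hr7]
    omega
  rw [wp_seq]
  refine hmid.mono ?_
  clear hmid
  rintro ρ₁ ⟨gF, g11, g14, g1, gclk⟩
  have fr : ∀ x, x ∉ [1, 10, 11, 14] → ρ₁.reg x = σ.reg x := by
    intro x hx
    simp only [List.mem_cons, List.not_mem_nil, or_false, not_or] at hx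
    rw [gF.reg x (by simp; omega), hreg]; simp [hx]
  have fa : ∀ x, x ∉ [15, 16] → ρ₁.arr x = σ.arr x := fun x hx =>
    (gF.arr x (by simp)).trans (hF.arr x hx)
  have fl : ρ₁.log = σ.log := gF.log.trans hF.log
  have e15 : ρ₁.arr 15 = ρ.arr 15 := gF.arr 15 (by simp)
  have e16 : ρ₁.arr 16 = ρ.arr 16 := gF.arr 16 (by simp)
  have e10 : ρ₁.reg 10 = a := (gF.reg 10 (by simp)).trans (by rw [hreg]; simp)
  rw [← e15] at hoff hkeep
  rw [← e16] at hkeep hlo1 hlo2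
  have ft : ∀ x, x ∉ [15, 16, 18, 19, 20, 21] → ρ₁.arr x = τ.arr x := fun x hx =>
    (fa x (by simp at hx ⊢; omega)).trans (iF.arr x hx)
  rw [wp_seq]
  refine (wp_write hX (τ := ρ₁) (c := d) (v := b * sb n) (v' := v') (al := al) ?_ hs ?_ ?_ g1 g14
    hbv
    (min_le_right _ _)).mono ?_
  · rw [ft 13 (by simp), ft 14 (by simp), ft 27 (by simp)]; exact hc
  · rw [fa 18 (by simp)]; exact iS
  · rw [fr 7 (by simp)]; exact i7
  rintro ρ₂ ⟨kS, k7, kF, kclk⟩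
  have p13 : ρ₂.arr 13 = τ.arr 13 := (kF.arr 13 (by simp)).trans (ft 13 (by simp))
  have p27 : ρ₂.arr 27 = τ.arr 27 := (kF.arr 27 (by simp)).trans (ft 27 (by simp))
  have p15 := kF.arr 15 (by simp)
  have p16 := kF.arr 16 (by simp)
  have p19 := (kF.arr 19 (by simp)).trans (fa 19 (by simp))
  have p20 := (kF.arr 20 (by simp)).trans (fa 20 (by simp))
  have p21 := (kF.arr 21 (by simp)).trans (fa 21 (by simp))
  have p8 := (kF.reg 8 (by simp)).trans (fr 8 (by simp))
  have p9 := (kF.reg 9 (by simp)).trans (fr 9 (by simp))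
  rw [wp_seq]
  refine (wp_place hX (b := b) (d := d) (al := al) (tab := τ.arr 14) (σ := ρ₂) ?_ hs hbn ?_ ?_ ?_
    (p9.trans i9) ((kF.reg 10 (by simp)).trans e10) ((kF.reg 11 (by simp)).trans g11)
    ((kF.reg 14 (by simp)).trans g14) k7).mono ?_
  · rw [p13, p27]; exact hc
  · rw [p13, p15, p16, p19, p20, p21, p8]
    exact iB.congr hkeep
  · rw [p15]; exact hoff
  · rw [p8, p16]; exact ⟨hlo1, hlo2⟩
  rintro ρ₃ ⟨qB, qF, qclk⟩
  -- Each vertex occupies at least one bit, so the time for copying a block can be charged to its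
  -- bits as well.
  have hpos : unaryPos d (b * sb n) + (v' - b * sb n) ≤ unaryPos d v' := by
    have h1 : ∀ k, unaryPos d (b * sb n) + k ≤ unaryPos d (b * sb n + k) := by
      intro k
      induction k with
      | zero => simp
      | succ k ih => rw [← add_assoc, ← add_assoc, unaryPos_succ]; omega
    have := h1 (v' - b * sb n)
    rwa [Nat.add_sub_cancel' hbv] at this
  have q9 : ρ₃.reg 9 = b := (qF.reg 9 (by simp)).trans (p9.trans i9)
  have hbn' : b ≤ n := hle.trans hbn
  simp only [wp_assign]
  refine ⟨by simp [q9]; omega, ⟨by simp [q9], ?_, ?_, ?_, ?_⟩, ?_⟩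
  · simpa [qF.reg 7 (by simp)] using k7
  · rw [p13, p15, p16] at qB
    simp [qF.arr 15 (by simp), qF.arr 16 (by simp), p15, p16]
    exact qB
  · simpa [qF.arr 18 (by simp)] using kS
  · refine iF.trans ?_
    have h1 : Frame [1, 2, 7, 8, 9, 10, 11, 12, 14] [15, 16, 18, 19, 20, 21] σ ρ₁ :=
      ⟨fun x hx => fr x (by simp at hx ⊢; omega), fun x hx => fa x (by simp at hx ⊢; omega), fl⟩
    have h2 := (h1.trans (kF.mono (by simp) (by simp))).trans (qF.mono (by simp) (by simp))
    simpa using h2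
  · simp
    omega

/-! ### Lookup table for chunks -/

/-- The lengths of the runs in the chunk `x`. -/
def chunkRuns (n x : ℕ) : List ℕ := runLengths 0 ((List.range (ch n)).map x.testBit)

/-- Write the table for the chunk in variable `1`. -/
def chunkCode : Stmt :=
  assign 2 (var 1) ;; assign 7 (lit 0) ;; assign 8 (lit 0) ;; assign 9 (lit 0) ;;
  loop (Expr.lt (var 9) (par 11))
   (ite (var 2 % lit 2) (assign 7 (var 7 + lit 1))
     (ite (Expr.lt (var 8) (par 7)) (storeWord 17 (var 1 * par 7 + var 8) (var 7)) skip ;;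
      assign 8 (var 8 + lit 1) ;;
      assign 7 (lit 0)) ;;
    assign 2 (var 2 / lit 2) ;;
    assign 9 (var 9 + lit 1))

/-- Write the table for all chunks. -/
def tableCode : Stmt :=
  assign 1 (lit 0) ;;
  loop (Expr.lt (var 1) (par 12)) (chunkCode ;; assign 1 (var 1 + lit 1))

section

variable {n m w X : ℕ} {input : List ℕ} {τ : St}

theorem wp_chunk (hX : Bounds n m w X) {x : ℕ} (h1 : τ.reg 1 = x) (hx : x < nch n) :
    wp (env n w 28 input) chunkCode τ fun τ' =>
      (∀ j < sb n, ∀ k, (chunkRuns n x)[j]? = some k → τ'.arr 17 (x * sb n + j) = k) ∧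
      (∀ i < x * sb n, τ'.arr 17 i = τ.arr 17 i) ∧ Frame [2, 7, 8, 9] [17] τ τ' ∧
      τ'.clk ≤ τ.clk + 5 + 8 * ch n := by
  have hw0 := hX.w_ne
  obtain ⟨hn, hnm, -, -, -, -, hnch, -, hwX, hXw, -, hchw, -, -⟩ := id hX
  have hsb := sb_pos hn
  have hidx : x * sb n + sb n ≤ nch n * sb n := by
    rw [← Nat.succ_mul]; exact Nat.mul_le_mul_right _ hx
  simp [chunkCode, h1]
  -- Here `ws` are the completed runs and `c` is the length of the current one. Runs from number `sb
  -- n` on are counted but not stored, since a block has no more vertices.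
  apply wp_loop (I := fun σ => ∃ i ≤ ch n, ∃ ws : List ℕ, ∃ c ≤ i, ws.length ≤ i ∧ σ.reg 9 = i ∧
    σ.reg 2 = x / 2 ^ i ∧ σ.reg 7 = c ∧ σ.reg 8 = ws.length ∧
    (∀ l, runLengths 0 ((List.range i).map x.testBit ++ l) = ws ++ runLengths c l) ∧
    (∀ j < sb n, ∀ k, ws[j]? = some k → σ.arr 17 (x * sb n + j) = k) ∧
    (∀ i < x * sb n, σ.arr 17 i = τ.arr 17 i) ∧ Frame [2, 7, 8, 9] [17] τ σ ∧
    σ.clk ≤ τ.clk + 4 + 8 * i) (μ := fun σ => ch n - σ.reg 9)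
  · exact ⟨0, by omega, [], 0, le_rfl, by simp⟩
  · rintro σ ⟨i, hi, ws, c, hci, hwi, e9, e2, e7, e8, hruns, hnew, hold, hF, hclk⟩
    have e1 := (hF.reg 1 (by simp)).trans h1
    refine ⟨by simp, fun hz => ?_, fun hz => ?_⟩
    · simp [e9] at hz
      obtain rfl : i = ch n := by omega
      refine ⟨?_, hold, by simpa using hF, by simp; omega⟩
      have := hruns []
      rw [List.append_nil, runLengths, List.append_nil] at this
      rwa [← this] at hnew
    · simp [e9] at hz
      have hdiv : x / 2 ^ i / 2 = x / 2 ^ (i + 1) := by rw [Nat.div_div_eq_div_mul, pow_succ]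
      have hmap : ∀ l, (List.range (i + 1)).map x.testBit ++ l =
          (List.range i).map x.testBit ++ (x.testBit i :: l) := by
        intro l; rw [List.range_succ]; simp
      have hbit := Nat.testBit_eq_decide_div_mod_eq (x := x) (i := i)
      simp [wp_ite, e2, hdiv, e9]
      and_intros
      any_goals omega
      · intro hodd
        rw [hodd] at hbit
        simp [e7, e8]
        refine ⟨by omega, by omega, by omega, ⟨hz, hci, ws, by omega, rfl, ?_, hnew, hold, hF,
          by omega⟩, by omega⟩
        intro l
        rw [hmap, hruns, hbit]; rfl
      · intro heven
        rw [heven] at hbit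
        have hruns' : ∀ l, runLengths 0 ((List.range (i + 1)).map x.testBit ++ l) =
            (ws ++ [c]) ++ runLengths 0 l := by
          intro l
          rw [hmap, hruns, hbit, List.append_assoc]; rfl
        simp [e7, e8, e1]
        refine ⟨fun hlt => ?_, fun hge => ?_⟩
        · refine ⟨by omega, by omega, by omega, by omega, by omega, ⟨hz, ws ++ [c],
            by simp; omega, by simp, hruns', ?_, ?_, hF, by omega⟩, by omega⟩
          · intro j hj k hk
            rcases lt_trichotomy j ws.length with hjl | hjl | hjl
            · rw [List.getElem?_append_left hjl] at hk
              rw [Function.update_of_ne (by omega)]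
              exact hnew j hj k hk
            · subst hjl
              simp at hk
              simp [hk]
            · rw [List.getElem?_eq_none (by simp; omega)] at hk
              cases hk
          · intro i' hi'
            rw [Function.update_of_ne (by omega)]; exact hold i' hi'
        · refine ⟨by omega, by omega, by omega, ⟨hz, ws ++ [c], by simp; omega, by simp, hruns', ?_,
            hold,
            hF, by omega⟩, by omega⟩
          intro j hj k hk
          rw [List.getElem?_append_left (by omega)] at hk
          exact hnew j hj k hk

/-- The table `tab` holds the lengths of the runs in all chunks. -/
def TableOk (n : ℕ) (tab : ℕ → ℕ) (N : ℕ) : Prop :=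
  ∀ x < N, ∀ j < sb n, ∀ k, (chunkRuns n x)[j]? = some k → tab (x * sb n + j) = k

theorem wp_table (hX : Bounds n m w X) :
    wp (env n w 28 input) tableCode τ fun τ' => TableOk n (τ'.arr 17) (nch n) ∧
      Frame [1, 2, 7, 8, 9] [17] τ τ' ∧ τ'.clk ≤ τ.clk + 2 + nch n * (8 * ch n + 7) := by
  have hw0 := hX.w_ne
  obtain ⟨hn, hnm, -, -, -, -, hnch, -, hwX, hXw, -, hchw, -, -⟩ := id hX
  have hsb := sb_pos hn
  have hnX : nch n ≤ X := (Nat.le_mul_of_pos_right _ hsb).trans hnch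
  simp [tableCode]
  apply wp_loop (I := fun σ => ∃ x ≤ nch n, σ.reg 1 = x ∧ TableOk n (σ.arr 17) x ∧
    Frame [1, 2, 7, 8, 9] [17] τ σ ∧ σ.clk ≤ τ.clk + 1 + x * (8 * ch n + 7))
    (μ := fun σ => nch n - σ.reg 1)
  · exact ⟨0, by simp, by simp, fun x hx => absurd hx (by omega), by simp, by simp⟩
  · rintro σ ⟨x, hx, e1, hT, hF, hclk⟩
    refine ⟨by simp, fun hz => ?_, fun hz => ?_⟩
    · simp [e1] at hz
      obtain rfl : x = nch n := by omega
      exact ⟨hT, by simpa using hF, by simp; omega⟩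
    · simp [e1] at hz
      rw [wp_seq]
      refine (wp_chunk hX (τ := σ.tick) (by simpa using e1) hz).mono ?_
      rintro ρ ⟨gnew, gold, gF, gclk⟩
      have g1 := gF.reg 1 (by simp)
      have hF' : Frame [1, 2, 7, 8, 9] [17] τ ρ :=
        (hF.trans (Frame.tick_iff.mpr Frame.refl)).trans (gF.mono (by simp) (by simp))
      simp [e1] at g1 gclk gold
      simp [g1, hF']
      refine ⟨by omega, ⟨hz, fun y hy j hj k hk => ?_, ?_⟩, by omega⟩
      · by_cases hyx : y = x
        · subst hyx; exact gnew j hj k hk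
        · have h3 := Nat.mul_le_mul_right (sb n) (show y + 1 ≤ x by omega)
          rw [Nat.succ_mul] at h3
          rw [gold _ (by omega)]
          exact hT y (by omega) j hj k hk
      · rw [Nat.succ_mul]; omega

/-! ### Final representation and constant-time query -/

/-- The final representation of the degree sequence. -/
structure Final (n w : ℕ) (d : ℕ → ℕ) (arr : ℕ → ℕ → ℕ) : Prop where
  counts : ∃ cnt al, Counts n (lb n) (thr n) (arr 13) (arr 14) cnt al d
  blocks : ∃ lc, BlocksOk n w d (arr 13) (n / sb n + 1) lc (arr 15) (arr 16) (arr 19) (arr 20)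
    (arr 21)
  str : StrOk w (arr 18) (unary d n)
  table : TableOk n (arr 17) (nch n)

/-- Build the final representation. -/
def buildCode : Stmt :=
  (assign 7 (lit 0) ;; assign 8 (lit 0) ;; assign 9 (lit 0) ;;
   loop (Expr.lt (var 9) (par 0 / par 7 + lit 1)) blockCode) ;;
  tableCode

theorem wp_build (hX : Bounds n m w X) {d : ℕ → ℕ} {al : ℕ}
    (hc : Counts n (lb n) (thr n) (τ.arr 13) (τ.arr 14) (τ.arr 27) al d)
    (hs : ∑ u ∈ Finset.range n, d u ≤ n) (hz : τ.arr 18 = fun _ => 0) :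
    wp (env n w 28 input) buildCode τ fun τ' => Final n w d τ'.arr ∧ τ'.log = τ.log ∧
      τ'.clk ≤ τ.clk + 6 + 25 * (n / sb n + 1) + 20 * n + nch n * (8 * ch n + 7) := by
  have hw0 := hX.w_ne
  obtain ⟨hn, hnm, -, -, -, -, hnch, -, hwX, hXw, -, hchw, -, -⟩ := id hX
  have hsb := sb_pos hn
  have hbb := bb_pos n
  have hdiv := Nat.div_le_self n (sb n)
  -- The last block may be incomplete or empty, but `n / sb n + 1` blocks always cover all vertices.
  have hall : min ((n / sb n + 1) * sb n) n = n := by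
    have h1 := Nat.div_add_mod n (sb n)
    have h2 := Nat.mod_lt n hsb
    rw [Nat.succ_mul, mul_comm]; omega
  rw [buildCode, wp_seq]
  have hmain : wp (env n w 28 input) (assign 7 (lit 0) ;; assign 8 (lit 0) ;; assign 9 (lit 0) ;;
      loop (Expr.lt (var 9) (par 0 / par 7 + lit 1)) blockCode) τ fun σ =>
      BuildInv n w d τ (n / sb n + 1) σ ∧
      σ.clk ≤ τ.clk + 4 + 25 * (n / sb n + 1) + 10 * unaryPos d n := by
    simp
    apply wp_loop (I := fun σ => ∃ b ≤ n / sb n + 1, BuildInv n w d τ b σ ∧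
      σ.clk ≤ τ.clk + 3 + 25 * b + 10 * unaryPos d (min (b * sb n) n))
      (μ := fun σ => n / sb n + 1 - σ.reg 9)
    · refine ⟨0, Nat.zero_le _, ⟨by simp, by simp [unaryPos],
        ?_, by simpa [hz, unary] using StrOk.nil,
        by simp⟩, by simp⟩
      exact ⟨fun a h => absurd h (by omega), fun a h => absurd h (by omega),
        fun c h => absurd h (by omega), fun c h => absurd h (by omega),
        fun c h => absurd h (by omega), by simp⟩
    · rintro σ ⟨b, hb, hi, hclk⟩
      have e9 := hi.index
      refine ⟨by simp; exact ⟨hw0, lt_of_le_of_lt (Nat.succ_le_succ hdiv) (by omega)⟩, fun hz => ?_,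
        fun hz => ?_⟩
      · simp [e9] at hz
        obtain rfl : b = n / sb n + 1 := by omega
        rw [hall] at hclk
        exact ⟨⟨hi.index, hi.pos, hi.blocks, hi.str, by simpa using hi.frame⟩, by simp; omega⟩
      · simp [e9] at hz
        have hi' : BuildInv n w d τ b σ.tick :=
          ⟨hi.index, hi.pos, hi.blocks, hi.str, by simpa using hi.frame⟩
        refine (wp_block hX hc hs (by omega) hi').mono ?_
        rintro ρ ⟨hρ, gclk⟩
        rw [St.tick_clk] at gclk
        have := hρ.index
        exact ⟨⟨b + 1, by omega, hρ, by omega⟩, by omega⟩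
  refine hmain.mono ?_
  rintro σ ⟨hi, hclk⟩
  refine (wp_table hX).mono ?_
  rintro ρ ⟨gT, gF, gclk⟩
  have f13 : ρ.arr 13 = τ.arr 13 := (gF.arr 13 (by simp)).trans (hi.frame.arr 13 (by simp))
  have f14 : ρ.arr 14 = τ.arr 14 := (gF.arr 14 (by simp)).trans (hi.frame.arr 14 (by simp))
  have hB := hi.blocks
  have hS := hi.str
  have hp := unaryPos_le d le_rfl hs
  rw [hall] at hS
  refine ⟨⟨⟨τ.arr 27, al, by rw [f13, f14]; exact hc⟩, ⟨σ.reg 8, ?_⟩, ?_, gT⟩,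
    gF.log.trans hi.frame.log, by omega⟩
  · rw [f13, gF.arr 15 (by simp), gF.arr 16 (by simp), gF.arr 19 (by simp), gF.arr 20 (by simp),
      gF.arr 21 (by simp)]
    exact hB
  · rw [gF.arr 18 (by simp)]; exact hS

/-- Put the degree of the vertex in variable `1` into variable `2`. -/
def queryCode : Stmt :=
  assign 12 (var 1 / par 9) ;;
  ite (word 13 (var 12)) (assign 2 (word 14 (word 13 (var 12) - lit 1 + var 1 % par 9)))
   (assign 10 (var 1 / par 7) ;;
    ite (field 20 (var 10))
     (assign 2 (field 21 ((word 16 (var 12) + field 20 (var 10) - lit 1) * par 7 + var 1 % par 7)))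
     (assign 11 (word 15 (var 12) + field 19 (var 10)) ;;
      assign 8 (.bin .shr (word 18 (var 11 / par 4)) (var 11 % par 4) % par 12) ;;
      assign 2 (word 17 (var 8 * par 7 + var 1 % par 7))))

/-- There are three cases: a large block with a table, a long small block with listed degrees, and a
short one, answered through its chunk. The environment ends before array `22`, so the small counts
of the search are not available; this is why `Final` quantifies over them. -/
theorem wp_query (hX : Bounds n m w X) {d : ℕ → ℕ} (hfin : Final n w d τ.arr)
    (hs : ∑ u ∈ Finset.range n, d u ≤ n) {v : ℕ} (hv : τ.reg 1 = v) (hvn : v < n) :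
    wp (env n w 22 input) queryCode τ fun τ' => τ'.reg 2 = d v ∧ τ'.arr = τ.arr ∧ τ'.log = τ.log ∧
      τ'.clk ≤ τ.clk + 7 := by
  have hw0 := hX.w_ne
  obtain ⟨hn, hnm, hlb, -, htab, -, hnch, hlt, hwX, hXw, -, hchw, -, -⟩ := id hX
  have hsb := sb_pos hn
  have hbb := bb_pos n
  have hch := ch_pos n
  obtain ⟨⟨cnt, al, hc⟩, ⟨lc, hB⟩, hS, hT⟩ := hfin
  have hdiv : v / lb n < n / lb n + 1 := Nat.lt_succ_of_le (Nat.div_le_div_right hvn.le)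
  have hdivs : v / sb n < n / sb n + 1 := Nat.lt_succ_of_le (Nat.div_le_div_right hvn.le)
  have hmod := Nat.mod_lt v hsb
  have hdm := Nat.div_add_mod v (sb n)
  simp only [queryCode, wp_seq, wp_assign, wp_ite]
  by_cases hp : τ.arr 13 (v / lb n) = 0
  · have hp' := hp
    rw [div_lb] at hp'
    have hrel := hB.rel_eq _ hdivs hp'
    have hlong := hB.long _ hdivs hp'
    have hshort := hB.short _ hdivs hp'
    rw [← div_lb] at hrel hlong
    by_cases hl : τ.arr 20 (v / sb n) = 0
    · obtain ⟨s1, s2⟩ := hshort hl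
      set u := v / sb n * sb n with hu
      set k := min ((v / sb n + 1) * sb n) n - u with hk
      have hsucc : (v / sb n + 1) * sb n = u + sb n := Nat.succ_mul _ _
      rw [mul_comm] at hdm
      have huk : min ((v / sb n + 1) * sb n) n = u + k := by omega
      have hlen : unaryPos d (u + k) = unaryPos d u + (unary (fun i => d (u + i)) k).length := by
        rw [← length_unary, unary_add, List.length_append, length_unary]
      have hstr : unary d n = unary d u ++ unary (fun i => d (u + i)) k ++
          unary (fun i => d (u + k + i)) (n - (u + k)) := by
        rw [← unary_add, ← unary_add, show u + k + (n - (u + k)) = n by omega]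
      rw [huk] at s1 s2
      have hpos2 : unaryPos d u ≤ 2 * n := unaryPos_le d (by omega) hs
      have hposw : unaryPos d u / w ≤ 2 * n / w := Nat.div_le_div_right hpos2
      -- The chunk starts with the complete code of the block, so its first runs are the degrees of
      -- the block, in the order of the vertices.
      obtain ⟨y', hy'⟩ := hS.chunk (p := unaryPos d u) (c := ch n)
        (x := unary (fun i => d (u + i)) k) (by omega) ⟨_, hstr, length_unary _ _⟩ (by omega)
      set x := (τ.arr 18 (unaryPos d u / w) >>> (unaryPos d u % w)) % 2 ^ ch n with hx
      have hxlt : x < nch n := Nat.mod_lt _ (by positivity)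
      have hres : τ.arr 17 (x * sb n + v % sb n) = d v := by
        refine hT x hxlt _ hmod _ ?_
        rw [chunkRuns, hy', runLengths_unary, List.getElem?_append_left (by simp; omega)]
        rw [List.getElem?_map, List.getElem?_range (by omega)]
        rw [Option.map_some, show u + v % sb n = v from hdm]
      have hxsb : x * sb n + sb n ≤ nch n * sb n := by
        rw [← Nat.succ_mul]; exact Nat.mul_le_mul_right _ hxlt
      have hmodw : unaryPos d u % w < w := Nat.mod_lt _ (by omega)
      rw [nch] at hxsb hnch
      simp [hv, hp, hdiv, hdivs, hl, hrel, ← hx, hres, nch]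
      omega
    · obtain ⟨l1, l2⟩ := hlong hl
      have l3 := l2 v hvn rfl
      have hcap : lc ≤ 2 * (2 * n / ch n) := by
        have h0 := hB.count_le
        have hpos := unaryPos_le d (min_le_right ((n / sb n + 1) * sb n) n) hs
        have h1 := Nat.div_le_div_right (c := ch n) hpos
        have h2 := Nat.div_le_div_right (c := w) hpos
        have h3 : 2 * n / w ≤ 2 * n / ch n := Nat.div_le_div_left hchw hch
        omega
      change 2 * (2 * n / ch n) * sb n ≤ X at hlt
      have h3 := Nat.mul_le_mul_right (sb n)
        (show τ.arr 16 (v / lb n) + τ.arr 20 (v / sb n) - 1 + 1 ≤ 2 * (2 * n / ch n) by omega)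
      rw [Nat.succ_mul] at h3
      have h4 : τ.arr 16 (v / lb n) + τ.arr 20 (v / sb n) - 1 ≤
        (τ.arr 16 (v / lb n) + τ.arr 20 (v / sb n) - 1) * sb n := Nat.le_mul_of_pos_right _ hsb
      simp [hv, hp, hdiv, hdivs, hl, l3]
      omega
  · have h1 := hc.large v hvn hp
    have h2 := hc.table_lt hn hs hvn hp
    simp [hv, hp, hdiv, h1]
    omega

end

/-! ### Preservation of memory -/

/-- The statement does not write to array `b`. -/
def Stmt.keeps (b : ℕ) : Stmt → Bool
  | .skip => true
  | .assign _ _ => true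
  | .storeWord b' _ _ => decide (b' ≠ b)
  | .storeField b' _ _ => decide (b' ≠ b)
  | .report _ => true
  | .seq s t => s.keeps b && t.keeps b
  | .ite _ s t => s.keeps b && t.keeps b
  | .loop _ s => s.keeps b

/-- The query programs read the parameters from the header, so the header must be intact at the end
and at every moment of reporting. A syntactic check of the code suffices. -/
theorem Big.keeps {E : Env} {b : ℕ} {s : Stmt} {τ τ' : St} (h : Big E s τ τ') (hs : s.keeps b) :
    τ'.arr b = τ.arr b ∧ ∀ x ∈ τ'.log, x ∈ τ.log ∨ x.2 b = τ.arr b := by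
  have trans : ∀ {τ τ₁ τ₂ : St}, (τ₁.arr b = τ.arr b ∧ ∀ x ∈ τ₁.log, x ∈ τ.log ∨ x.2 b = τ.arr b) →
      (τ₂.arr b = τ₁.arr b ∧ ∀ x ∈ τ₂.log, x ∈ τ₁.log ∨ x.2 b = τ₁.arr b) →
      τ₂.arr b = τ.arr b ∧ ∀ x ∈ τ₂.log, x ∈ τ.log ∨ x.2 b = τ.arr b := by
    rintro τ τ₁ τ₂ ⟨h₁, h₂⟩ ⟨h₃, h₄⟩
    refine ⟨h₃.trans h₁, fun x hx => ?_⟩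
    rcases h₄ x hx with hx | hx
    · exact h₂ x hx
    · exact Or.inr (hx.trans h₁)
  induction h with
  | skip => exact ⟨rfl, fun x hx => Or.inl hx⟩
  | assign => exact ⟨rfl, fun x hx => Or.inl hx⟩
  | storeWord =>
    simp only [Stmt.keeps, ne_eq, decide_eq_true_eq] at hs
    exact ⟨by simp [Ne.symm hs], fun x hx => Or.inl hx⟩
  | storeField =>
    simp only [Stmt.keeps, ne_eq, decide_eq_true_eq] at hs
    exact ⟨by simp [Ne.symm hs], fun x hx => Or.inl hx⟩
  | report =>
    refine ⟨rfl, fun x hx => ?_⟩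
    simp only [St.emit_log, List.mem_append, List.mem_singleton] at hx
    rcases hx with hx | rfl
    · exact Or.inl hx
    · exact Or.inr rfl
  | seq _ _ ih₁ ih₂ =>
    simp only [Stmt.keeps, Bool.and_eq_true] at hs
    exact trans (ih₁ hs.1) (ih₂ hs.2)
  | ite_true _ _ _ ih =>
    simp only [Stmt.keeps, Bool.and_eq_true] at hs
    exact ih hs.1
  | ite_false _ _ _ ih =>
    simp only [Stmt.keeps, Bool.and_eq_true] at hs
    exact ih hs.2
  | loop_done => exact ⟨rfl, fun x hx => Or.inl hx⟩
  | loop_step _ _ _ _ ih₁ ih₂ => exact trans (ih₁ hs) (ih₂ hs)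

theorem wp.keeps {E : Env} {b : ℕ} {s : Stmt} {τ : St} {Q : St → Prop} (h : wp E s τ Q)
    (hs : s.keeps b) : wp E s τ fun τ' => Q τ' ∧
      τ'.arr b = τ.arr b ∧ ∀ x ∈ τ'.log, x ∈ τ.log ∨ x.2 b = τ.arr b := by
  delta wp at h ⊢
  obtain ⟨τ', h₁, h₂⟩ := h
  exact ⟨τ', h₁, h₂, h₁.keeps hs⟩

/-- The instruction does not write to memory. -/
def Instr.pure : Instr 128 → Bool
  | .store _ _ => false
  | _ => true

/-- That queries leave the memory unchanged is read off their code: it contains no store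
instruction. -/
theorem run_mem {code : List (Instr 128)} {w : ℕ} {input : List ℕ} {S t : ℕ} {c c' : Config 128}
    (hcode : code.all Instr.pure) (h : (prog code).run w input S t c = some c') :
    c'.mem = c.mem := by
  induction t generalizing c with
  | zero => simp only [Program.run, Option.some.injEq] at h; rw [h]
  | succ t ih =>
    simp only [Program.run] at h
    obtain ⟨c₁, h₁, h₂⟩ := Option.bind_eq_some_iff.mp h
    refine (ih h₂).trans ?_
    simp only [Program.step] at h₁
    obtain ⟨i, hi, h₁⟩ := Option.bind_eq_some_iff.mp h₁
    have := List.all_eq_true.mp hcode i (List.mem_of_getElem? hi)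
    cases i <;> simp_all [Program.exec, Instr.pure] <;> try (subst h₁; rfl)
    · obtain ⟨x, _, rfl⟩ := h₁; rfl
    · obtain ⟨_, rfl⟩ := h₁; rfl

/-- The statement does not write to memory. -/
def Stmt.pure : Stmt → Bool
  | .skip => true
  | .assign _ _ => true
  | .storeWord _ _ _ => false
  | .storeField _ _ _ => false
  | .report _ => true
  | .seq s t => s.pure && t.pure
  | .ite _ s t => s.pure && t.pure
  | .loop _ s => s.pure

theorem Expr.code_pure (e : Expr) (d : ℕ) : (e.code d).all Instr.pure := by
  induction e generalizing d <;> simp only [Expr.code, List.all_append, List.all_cons, *] <;> rfl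

theorem Stmt.code_pure {s : Stmt} (h : s.pure) (l : ℕ) : (s.code l).all Instr.pure := by
  induction s generalizing l <;>
    simp_all [Stmt.pure, Stmt.code, Instr.pure, -List.all_eq_true, Expr.code_pure]

/-! ### Programs with a prologue -/

/-- The surroundings of a prologue: all memory is one array, with number `47`, and parameter `0` is
the argument. -/
def preEnv (w : ℕ) (input : List ℕ) (S x : ℕ) : Env where
  w := w
  input := input
  par i := if i = 0 then x else 0
  wlen b := if b = 47 then S else 0
  plen _ := 0

section
variable (w : ℕ) (input : List ℕ) (S x : ℕ)
@[simp] theorem preEnv_w : (preEnv w input S x).w = w := rfl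
@[simp] theorem preEnv_input : (preEnv w input S x).input = input := rfl
@[simp] theorem preEnv_par : (preEnv w input S x).par 0 = x := rfl
@[simp] theorem preEnv_wlen : (preEnv w input S x).wlen 47 = S := rfl
end

theorem preEnv_valid {w : ℕ} {input : List ℕ} {S x : ℕ} (hw : 0 < w) (hS : S ≤ 2 ^ w)
    (hi : ∀ x ∈ input, x < 2 ^ w) : (preEnv w input S x).Valid S where
  w_pos := hw
  S_le := hS
  input_lt := hi
  word_lt b i h := by
    simp only [preEnv] at h ⊢
    split at h <;> simp_all
  field_lt b i h := by simp [preEnv] at h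
  field_par b i h := by simp [preEnv] at h
  word_word b b' i i' hb h h' := by
    simp only [preEnv] at h h'
    split at h <;> split at h' <;> simp_all
  word_field b b' i i' h h' := by simp [preEnv] at h'
  field_field b b' i i' hb h h' := by simp [preEnv] at h'

/-- Copy the variables `0, …, 27` to the parameters. -/
def moveCode : List (Instr 128) := (List.range 28).map fun i => .move (fr i) (fr (48 + i))

/-- A program that sets the parameters and then goes on with `s`. -/
def withPrologue (pre s : Stmt) : List (Instr 128) :=
  pre.code 0 ++ (moveCode ++ (s.code ((pre.code 0).length + 28) ++ [.halt]))

theorem execs_moves {w : ℕ} {input : List ℕ} {S k : ℕ} (hk : k ≤ 28) (c : Config 128) :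
    ∃ c', execs w input S ((List.range k).map fun i => .move (fr i) (fr (48 + i))) c = some c' ∧
      c'.mem = c.mem ∧ c'.out = c.out ∧ (∀ i < k, c'.reg (fr i) = c.reg (fr (48 + i))) ∧
      ∀ i < 128, k ≤ i → c'.reg (fr i) = c.reg (fr i) := by
  induction k with
  | zero => exact ⟨c, rfl, rfl, rfl, by simp, fun _ _ _ => rfl⟩
  | succ k ih =>
    obtain ⟨c', h₁, h₂, h₃, h₄, h₅⟩ := ih (by omega)
    refine ⟨{ c' with pc := c'.pc + 1, reg := Function.update c'.reg (fr k) (c'.reg (fr (48 + k)))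
      },
      ?_, h₂, h₃, fun i hi => ?_, fun i hi hki => ?_⟩
    · rw [List.range_succ, List.map_append, execs_append, h₁]
      rfl
    · simp only [Function.update_apply, fr_inj (show i < 128 by omega) (show k < 128 by omega)]
      split
      · subst i; exact h₅ _ (by omega) (by omega)
      · exact h₄ i (by omega)
    · simp only [Function.update_apply, fr_inj hi (show k < 128 by omega)]
      rw [if_neg (by omega)]
      exact h₅ i hi (by omega)

/-- The initial abstract state. -/
def initSt (mem : ℕ → ℕ) : St := ⟨fun _ => 0, fun _ => mem, [], 0⟩

/-- The two phases view the same machine differently. In the prologue the memory is a single array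
and the parameters are computed in variables. After the moves these values are the parameters of
`E`, and `hrep` reinterprets the memory as its arrays. The variables keep their values, which hands
the argument on to the second phase. -/
theorem withPrologue_goes {pre s : Stmt} {w : ℕ} {input : List ℕ} {S x M : ℕ} {mem : ℕ → ℕ}
    {E : Env} (hEw : E.w = w) (hEi : E.input = input) (hE : E.Valid S)
    (hpar : ∀ i, 28 ≤ i → E.par i = 0)
    (hx : x < 2 ^ w) (hmem : ∀ a, mem a < 2 ^ w) (hpre : pre.wf) (hs : s.wf)
    (hM : pre.cost ≤ M) (hM' : s.cost ≤ M) {τ₁ τ₂ τ₃ : St}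
    (h₁ : Big (preEnv w input S x) pre (initSt mem) τ₁) (hlog : τ₁.log = [])
    (hreg : ∀ i < 28, τ₁.reg i = E.par i)
    (hτ : τ₂.reg = τ₁.reg ∧ τ₂.log = [] ∧ τ₂.clk = 0)
    (hrep : ∀ mem', (∀ a < S, mem' a = τ₁.arr 47 a) → (∀ a, mem' a < 2 ^ w) →
      MemRep E τ₂.arr mem')
    (h₂ : Big E s τ₂ τ₃) :
    ∃ t c', t ≤ M * τ₁.clk + 28 + M * τ₃.clk ∧
      (prog (withPrologue pre s)).run w input S t
        ((prog (withPrologue pre s)).start w mem [x]) = some c' ∧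
      (prog (withPrologue pre s)).Halted c' ∧ Rep E τ₃ c' ∧
      ∀ l y, l ++ [y] <+: τ₃.log →
        Moment E S (withPrologue pre s) ((prog (withPrologue pre s)).start w mem [x]) t l y := by
  subst hEw hEi
  set code := withPrologue pre s with hcode
  set c₀ : Config 128 := (prog code).start E.w mem [x] with hc₀
  have hreg₀ : ∀ i < 128, c₀.reg (fr i) = if i = 0 then x else 0 := by
    intro i hi
    show ([x].getD (fr i).val 0) % 2 ^ E.w = _
    rw [fr_val hi]
    split
    · subst i; simp [Nat.mod_eq_of_lt hx]
    · obtain ⟨j, rfl⟩ := Nat.exists_eq_succ_of_ne_zero ‹i ≠ 0›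
      simp
  have hrep₀ : Rep (preEnv E.w E.input S x) (initSt mem) c₀ := by
    refine ⟨fun i hi => hreg₀ i (by omega), fun i hi => ?_, fun r => ?_, ⟨hmem, ?_, ?_⟩, rfl⟩
    · rw [hreg₀ _ (by omega), if_neg (by omega)]; rfl
    · exact Nat.mod_lt _ (by positivity)
    · intro b i hi
      simp only [preEnv] at hi ⊢
      split at hi
      · subst b; simp [initSt, hc₀, Program.start]
      · simp at hi
    · intro b i hi
      simp [preEnv] at hi
  have hcodeAt : CodeAt code 0 code := ⟨[], [], by simp, rfl⟩
  obtain ⟨t₁, c₁, r₁, pc₁, rep₁, ht₁, -, -⟩ := h₁.goes (preEnv_valid hE.w_pos hE.S_le hE.input_lt)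
    (code := code) hpre hM (c := c₀) hcodeAt.left hrep₀
  obtain ⟨c₂, e₂, m₂, o₂, g₂, k₂⟩ := execs_moves (w := E.w) (input := E.input) (S := S) (k := 28)
    le_rfl c₁
  have hpc₁ : c₁.pc = 0 + (pre.code 0).length := pc₁
  obtain ⟨r₂, pc₂⟩ := run_execs (code := code) (by rw [hpc₁]; exact hcodeAt.right.left) (by decide)
    e₂
  simp only [List.length_map, List.length_range] at r₂ pc₂
  have hpc₂ : c₂.pc = 0 + (pre.code 0).length + moveCode.length := by
    rw [pc₂, hpc₁]; simp [moveCode]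
  have hfr : ∀ r : Fin 128, r = fr r.val := fun r => by rw [Fin.ext_iff, fr_val r.2]
  have rep₂ : Rep E τ₂ c₂ := by
    refine ⟨fun i hi => ?_, fun i hi => ?_, fun r => ?_, ?_, ?_⟩
    · by_cases h : i < 28
      · rw [g₂ i h, rep₁.var i (by omega), hreg i h]
      · rw [k₂ i (by omega) (by omega), rep₁.par i hi, hpar i (by omega)]
        simp only [preEnv]; rw [if_neg (by omega)]
    · rw [k₂ _ (by omega) (by omega), rep₁.var i hi, hτ.1]
    · rw [hfr r]
      by_cases h : r.val < 28
      · rw [g₂ _ h]; exact rep₁.lt _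
      · rw [k₂ _ r.2 (by omega)]; exact rep₁.lt _
    · rw [m₂]
      refine hrep _ (fun a ha => ?_) rep₁.mem.lt
      simpa [preEnv] using rep₁.mem.word 47 a (by simpa using ha)
    · rw [o₂, rep₁.out, hlog, hτ.2.1]
  obtain ⟨t₃, c₃, r₃, pc₃, rep₃, ht₃, -, mom⟩ := h₂.goes hE (code := code) hs hM' (c := c₂)
    (by
      have := hcodeAt.right.right.left
      rw [hpc₂]
      convert this using 2
      simp [moveCode]) rep₂
  have r₁₂ := run_trans (P := prog code) r₁ r₂
  refine ⟨t₁ + 28 + t₃, c₃, ?_, run_trans r₁₂ r₃, ?_, rep₃, fun l y hl => ?_⟩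
  · rw [hτ.2.2] at ht₃
    omega
  · have := hcodeAt.right.right.right.get
    show code[c₃.pc]? = _
    rw [pc₃, hpc₂, ← this]
    congr 1
    simp [moveCode]
  · have := mom l y (by rw [hτ.2.1]; exact List.nil_prefix) hl
    exact this.shift r₁₂

/-! ### Prologues -/

/-- `f 0; …; f (k - 1)`. -/
def Stmt.upto (f : ℕ → Stmt) : ℕ → Stmt
  | 0 => .skip
  | k + 1 => .seq (upto f k) (f k)

/-- Load the first words of memory into variables. -/
def loadCode : Stmt := assign 39 (par 0) ;; Stmt.upto (fun i => assign i (word 47 (lit i))) 28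

theorem wp_load {w : ℕ} {input : List ℕ} {S x : ℕ} {mem : ℕ → ℕ} (hS : 28 ≤ S) (hS' : S ≤ 2 ^ w) :
    wp (preEnv w input S x) loadCode (initSt mem) fun τ => τ.reg 39 = x ∧
      (∀ i < 28, τ.reg i = mem i) ∧ τ.log = [] ∧ τ.arr 47 = mem ∧ τ.clk = 29 := by
  rw [loadCode, wp_seq, wp_assign]
  refine ⟨trivial, ?_⟩
  suffices h : ∀ k ≤ 28, ∀ σ : St, σ.reg 39 = x → σ.arr 47 = mem →
      wp (preEnv w input S x) (Stmt.upto (fun i => assign i (word 47 (lit i))) k) σ fun τ =>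
        τ.reg 39 = x ∧ (∀ i < k, τ.reg i = mem i) ∧ τ.log = σ.log ∧ τ.arr 47 = mem ∧
        τ.clk = σ.clk + k from
    h 28 le_rfl _ (by simp) rfl
  intro k hk σ h39 h47
  induction k with
  | zero => simp [Stmt.upto, h39, h47]
  | succ k ih =>
    rw [Stmt.upto, wp_seq]
    refine (ih (by omega)).mono ?_
    rintro τ ⟨h1, h2, h3, h4, h5⟩
    rw [wp_assign]
    refine ⟨⟨?_, ?_⟩, ?_, fun i hi => ?_, h3, h4, ?_⟩
    · rw [ok_lit, preEnv_w]; omega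
    · rw [val_lit, preEnv_wlen]; omega
    · simp [h1]; omega
    · simp only [St.setReg_reg, val_word, val_lit, h4]
      split
      · rw [‹i = k›]
      · exact h2 i (by omega)
    · simp [h5]; omega

/-- Store variables into the first words of memory. -/
def headerCode : Stmt := Stmt.upto (fun i => storeWord 47 (lit i) (var i)) 28

theorem wp_header {w : ℕ} {input : List ℕ} {S x : ℕ} (hS : 28 ≤ S) (hS' : S ≤ 2 ^ w) (σ : St)
    (h47 : σ.arr 47 = fun _ => 0) :
    wp (preEnv w input S x) headerCode σ fun τ => τ.reg = σ.reg ∧ τ.log = σ.log ∧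
      τ.arr 47 = (fun a => if a < 28 then σ.reg a else 0) ∧ τ.clk = σ.clk + 28 := by
  suffices h : ∀ k ≤ 28, wp (preEnv w input S x)
      (Stmt.upto (fun i => storeWord 47 (lit i) (var i)) k) σ fun τ => τ.reg = σ.reg ∧
        τ.log = σ.log ∧ τ.arr 47 = (fun a => if a < k then σ.reg a else 0) ∧ τ.clk = σ.clk + k from
    h 28 le_rfl
  intro k hk
  induction k with
  | zero => simp [Stmt.upto, h47]
  | succ k ih =>
    rw [Stmt.upto, wp_seq]
    refine (ih (by omega)).mono ?_
    rintro τ ⟨h1, h2, h3, h4⟩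
    rw [wp_storeWord]
    refine ⟨?_, trivial, ?_, h1, h2, ?_, ?_⟩
    · rw [ok_lit, preEnv_w]; omega
    · rw [val_lit, preEnv_wlen]; omega
    · funext a
      simp only [St.setArr_arr, val_lit, val_var, h3, h1, if_true, Function.update_apply]
      split
      · subst a; simp
      · have : a < k + 1 ↔ a < k := by omega
        simp [this]
    · simp [h4]; omega

/-- Put the word length into variable `4`. -/
def widthCode : Stmt :=
  assign 4 (lit 0) ;; assign 28 (lit 1) ;;
  loop (var 28) (assign 28 (bin .shl (var 28) (lit 1)) ;; assign 4 (var 4 + lit 1))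

/-- A one that is shifted left vanishes after exactly `w` steps, since shifts are reduced modulo `2
^ w`. In this way a program that does not depend on `w` finds it out. -/
theorem wp_width {E : Env} (hw : 0 < E.w) (τ : St) :
    wp E widthCode τ fun τ' => τ'.reg 4 = E.w ∧ Frame [4, 28] [] τ τ' ∧
      τ'.clk = τ.clk + 3 + 3 * E.w := by
  have h1 : 1 < 2 ^ E.w := Nat.one_lt_two_pow hw.ne'
  simp only [widthCode, wp_seq, wp_assign, ok_lit, val_lit]
  refine ⟨by omega, h1, ?_⟩
  apply wp_loop (I := fun σ => ∃ i ≤ E.w, σ.reg 4 = i ∧ σ.reg 28 = 2 ^ i % 2 ^ E.w ∧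
    Frame [4, 28] [] τ σ ∧ σ.clk = τ.clk + 2 + 3 * i) (μ := fun σ => E.w - σ.reg 4)
  · exact ⟨0, by omega, by simp, by simp [Nat.mod_eq_of_lt h1], by simp, by simp⟩
  rintro σ ⟨i, hi, h4, h28, hf, hc⟩
  have hlt : i < E.w → 2 ^ i % 2 ^ E.w = 2 ^ i := fun h =>
    Nat.mod_eq_of_lt (Nat.pow_lt_pow_right (by norm_num) h)
  refine ⟨trivial, fun hz => ?_, fun hz => ?_⟩
  · have : i = E.w := by
      by_contra hne
      rw [val_var, h28, hlt (by omega)] at hz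
      have := Nat.two_pow_pos i
      omega
    refine ⟨by simp [h4, this], by simpa using hf, ?_⟩
    rw [St.tick_clk, hc, this]; omega
  · have hne : i < E.w := by
      by_contra hne
      have : i = E.w := by omega
      simp [h28, this] at hz
    have hw' := Nat.lt_two_pow_self (n := E.w)
    simp only [wp_seq, wp_assign]
    refine ⟨⟨trivial, h1, trivial⟩, ⟨trivial, h1, ?_⟩, ⟨i + 1, hne, ?_, ?_, ?_, ?_⟩, ?_⟩
    · simp [Op.ok, h4]; omega
    · simp [h4]
    · simp [h28, hlt hne, Nat.shiftLeft_eq, pow_succ]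
    · simp [hf]
    · simp [hc]; ring
    · simp only [St.setReg_reg, St.tick_reg, val_add, val_var, val_lit]
      simp [h4]; omega

/-- Put the number of binary digits of variable `x` into variable `y`. -/
def sizeCode (x y : ℕ) : Stmt :=
  assign 28 (var x) ;; assign y (lit 0) ;;
  loop (var 28) (assign 28 (var 28 / lit 2) ;; assign y (var y + lit 1))

theorem size_half {x : ℕ} (hx : x ≠ 0) : Nat.size (x / 2) + 1 = Nat.size x := by
  have := Nat.size_bit (b := x.bodd) (n := x.div2) (by rwa [Nat.bit_bodd_div2])
  rw [Nat.bit_bodd_div2, Nat.div2_val] at this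
  exact this.symm

theorem wp_size {E : Env} (x y : ℕ) (hy : y ≠ 28) (τ : St) (hx : τ.reg x + 2 < 2 ^ E.w) :
    wp E (sizeCode x y) τ fun τ' => τ'.reg y = Nat.size (τ.reg x) ∧ Frame [y, 28] [] τ τ' ∧
      τ'.clk = τ.clk + 3 + 3 * Nat.size (τ.reg x) := by
  have hsz : Nat.size (τ.reg x) ≤ τ.reg x := Nat.size_le.mpr Nat.lt_two_pow_self
  simp only [sizeCode, wp_seq, wp_assign, ok_lit, val_lit]
  refine ⟨trivial, by omega, ?_⟩
  apply wp_loop (I := fun σ => Nat.size (σ.reg 28) + σ.reg y = Nat.size (τ.reg x) ∧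
    Frame [y, 28] [] τ σ ∧ σ.clk = τ.clk + 2 + 3 * σ.reg y) (μ := fun σ => σ.reg 28)
  · simp [hy.symm]
  rintro σ ⟨h1, hf, hc⟩
  refine ⟨trivial, fun hz => ?_, fun hz => ?_⟩
  · rw [val_var] at hz
    rw [hz, Nat.size_zero, zero_add] at h1
    exact ⟨h1, by simpa using hf, by simp [hc, h1]; omega⟩
  · rw [val_var] at hz
    have h2 := size_half hz
    simp only [wp_seq, wp_assign]
    refine ⟨⟨trivial, by rw [ok_lit]; omega, trivial⟩, ⟨trivial, by rw [ok_lit]; omega, ?_⟩,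
      ⟨?_, ?_, ?_⟩, ?_⟩
    · simp [Op.ok, hy]; omega
    · simp [hy, hy.symm]; omega
    · simp [hf]
    · simp [hy, hc]; omega
    · have := Nat.div_lt_self (Nat.pos_of_ne_zero hz) (by norm_num : 1 < 2)
      simpa [hy.symm] using this

/-- Compute the parameters `1, …, 12` from variables `0`, `4`, `5` and `29`. -/
def scalarCode : Stmt :=
  assign 2 (lit 8 * var 29) ;; assign 1 (var 4 / var 2) ;; assign 3 (bin .shl (lit 1) (var 2)) ;;
  assign 6 (var 0 / var 5 + lit 1) ;; assign 7 (var 29 * var 29) ;;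
  assign 8 (bin .shl (lit 1) (lit 2 * var 29)) ;; assign 9 (var 7 * var 8) ;;
  assign 10 (bin .shl (lit 1) (lit 4 * var 29)) ;; assign 11 (var 5 / lit 2 + lit 1) ;;
  assign 12 (bin .shl (lit 1) (var 11))

theorem wp_scalar {n m w X : ℕ} (hX : Bounds n m w X) {input : List ℕ} {S x : ℕ} {τ : St}
    (h0 : τ.reg 0 = n) (h4 : τ.reg 4 = w) (h5 : τ.reg 5 = lg n) (h29 : τ.reg 29 = ll n) :
    wp (preEnv w input S x) scalarCode τ fun τ' => (∀ i < 13, τ'.reg i = value n w i) ∧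
      τ'.reg 39 = τ.reg 39 ∧ τ'.arr = τ.arr ∧ τ'.log = τ.log ∧ τ'.clk = τ.clk + 10 := by
  obtain ⟨hn, hnm, hlb, hthr, htab, hpow, hnch, hlt, hw, hXw, hfb, hch, htp, hlp⟩ := id hX
  have hw0 := hX.w_ne
  have hmod : ∀ {e}, 2 ^ e ≤ X → 2 ^ e % 2 ^ w = 2 ^ e := fun h => Nat.mod_eq_of_lt (by omega)
  have hnch' : nch n ≤ X := le_trans (Nat.le_mul_of_pos_right _ (sb_pos hn)) hnch
  have hsb : sb n ≤ X := le_trans (Nat.le_mul_of_pos_right _ (bb_pos n)) hlb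
  have hbb : bb n ≤ X := le_trans (Nat.le_mul_of_pos_left _ (sb_pos hn)) hlb
  -- The powers of four and of sixteen are computed as shifts of a one.
  have e8 : bb n = 2 ^ (2 * ll n) := by rw [bb, pow_mul]; norm_num
  have e10 : thr n = 2 ^ (4 * ll n) := by rw [thr, pow_mul]; norm_num
  have h1 : ll n ≤ X := le_trans (by rw [sb]; nlinarith [ll_pos hn]) hsb
  have h2 := Nat.div_le_self n (lg n)
  have h3 : lg n ≤ n := lg_le n
  have d3 : 2 ^ (8 * ll n) % 2 ^ w = 2 ^ fb n := hmod hpow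
  have d8 : 2 ^ (2 * ll n) % 2 ^ w = bb n := by rw [hmod (e8 ▸ hbb), e8]
  have d10 : 2 ^ (4 * ll n) % 2 ^ w = thr n := by rw [hmod (e10 ▸ hthr), e10]
  have d12 : 2 ^ ch n % 2 ^ w = nch n := hmod hnch'
  have e7 : ll n * ll n = sb n := by rw [sb, sq]
  have e11 : lg n / 2 + 1 = ch n := rfl
  have e6 : n / lg n + 1 = seg n := rfl
  have e9 : sb n * bb n = lb n := rfl
  have e2 : 8 * ll n = fb n := rfl
  simp only [scalarCode, wp_seq, wp_assign]
  simp only [ok_add, ok_mul, ok_div, ok_shl, ok_lit, ok_var, val_add, val_mul, val_div, val_shl,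
    val_lit, val_var, preEnv_w, St.setReg_reg, St.setReg_arr, St.setReg_log, St.setReg_clk,
    Nat.shiftLeft_eq, one_mul, h0, h4, h5, h29, Nat.reduceEqDiff, if_true, if_false,
    d8, d10, e7, e11, e6, d12, e9, e2, true_and, and_true]
  and_intros
  any_goals omega
  · intro i hi
    interval_cases i <;> simp [value, fw, h0, h4, h5, hmod hpow]

/-- Compute the base addresses. -/
def baseCode : Stmt :=
  (assign 13 (lit 28) ;; assign 14 (var 13 + (var 0 / var 9 + lit 1)) ;;
  assign 15 (var 14 + var 0 / var 10 * var 9) ;; assign 16 (var 15 + (var 0 / var 9 + lit 1)) ;;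
  assign 17 (var 16 + (var 0 / var 9 + lit 1)) ;; assign 18 (var 17 + var 12 * var 7) ;;
  assign 19 (var 18 + (lit 2 * var 0 / var 4 + lit 1)) ;;
  assign 20 (var 19 + ((var 0 / var 7 + lit 1) / var 1 + lit 1))) ;;
  assign 21 (var 20 + ((var 0 / var 7 + lit 1) / var 1 + lit 1)) ;;
  assign 22 (var 21 + (lit 2 * (lit 2 * var 0 / var 11) * var 7 / var 1 + lit 1)) ;;
  assign 23 (var 22 + lit 2 * var 6) ;; assign 24 (var 23 + lit 2 * var 6) ;;
  assign 25 (var 24 + (var 5 + lit 2)) ;; assign 26 (var 25 + (var 0 / var 1 + lit 1)) ;;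
  assign 27 (var 26 + (var 0 / var 1 + lit 1))

theorem base_succ (n w : ℕ) {b : ℕ} (hb : 13 ≤ b) : base n w (b + 1) = base n w b + area n w b := by
  rw [base, base, Finset.sum_Ico_succ_top hb, add_assoc]

theorem base_mono (n w : ℕ) {b b' : ℕ} (h : b ≤ b') : base n w b ≤ base n w b' :=
  Nat.add_le_add_left (Finset.sum_le_sum_of_subset (Finset.Ico_subset_Ico_right h)) _

theorem len_le {n m w X : ℕ} (hX : Bounds n m w X) (b : ℕ) : len n w b ≤ 3 * X + 2 := by
  obtain ⟨hn, hnm, hlb, hthr, htab, hpow, hnch, hlt, hw, hXw, hfb, hch, htp, hlp⟩ := id hX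
  have h1 := Nat.div_le_self n (lb n)
  have h2 := Nat.div_le_self n (sb n)
  have h3 := Nat.div_le_self (2 * n) w
  have h4 : seg n ≤ n + 1 := Nat.succ_le_succ (Nat.div_le_self _ _)
  have h5 := lg_le n
  have l21 : 2 * (2 * n / ch n) * sb n ≤ X := hlt
  unfold len
  split <;> omega

theorem area_le {n m w X : ℕ} (hX : Bounds n m w X) (b : ℕ) : area n w b ≤ 3 * X + 3 := by
  have := len_le hX b
  have h1 := Nat.div_le_self (len n w b) (fw n w)
  rw [area]
  split <;> omega

/-- Crude, but sufficient: `Bounds.X_lt` leaves room for a factor of one hundred, so no address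
overflows. -/
theorem base_le {n m w X : ℕ} (hX : Bounds n m w X) : base n w 28 ≤ 45 * X + 73 := by
  have := Finset.sum_le_card_nsmul (Finset.Ico 13 28) (area n w) _ fun b _ => area_le hX b
  simp only [Nat.card_Ico, smul_eq_mul] at this
  change 28 + (Finset.Ico 13 28).sum (area n w) ≤ _
  omega

theorem wp_base {n m w X : ℕ} (hX : Bounds n m w X) {input : List ℕ} {S x : ℕ} {τ : St}
    (h : ∀ i < 13, τ.reg i = value n w i) :
    wp (preEnv w input S x) baseCode τ fun τ' => (∀ i < 28, τ'.reg i = value n w i) ∧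
      τ'.reg 39 = τ.reg 39 ∧ τ'.arr = τ.arr ∧ τ'.log = τ.log ∧ τ'.clk = τ.clk + 15 := by
  have hbase : ∀ b ≤ 28, base n w b < 2 ^ w := fun b hb => by
    have := base_mono n w hb
    have := base_le hX
    have := hX.X_lt
    omega
  obtain ⟨hn, hnm, hlb, hthr, htab, hpow, hnch, hlt, hw, hXw, hfb, hch, htp, hlp⟩ := id hX
  have h0 : τ.reg 0 = n := h 0 (by norm_num)
  have h1 : τ.reg 1 = fw n w := h 1 (by norm_num)
  have h4 : τ.reg 4 = w := h 4 (by norm_num)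
  have h5 : τ.reg 5 = lg n := h 5 (by norm_num)
  have h6 : τ.reg 6 = seg n := h 6 (by norm_num)
  have h7 : τ.reg 7 = sb n := h 7 (by norm_num)
  have h9 : τ.reg 9 = lb n := h 9 (by norm_num)
  have h10 : τ.reg 10 = thr n := h 10 (by norm_num)
  have h11 : τ.reg 11 = ch n := h 11 (by norm_num)
  have h12 : τ.reg 12 = nch n := h 12 (by norm_num)
  have l21 : 2 * (2 * n / ch n) * sb n ≤ X := hlt
  have l1 := Nat.div_le_self (2 * n) (ch n)
  have l2 := Nat.div_le_self n (sb n)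
  have l3 : seg n ≤ n + 1 := Nat.succ_le_succ (Nat.div_le_self _ _)
  have l5 := lg_le n
  have area_lt : ∀ b, area n w b + 1 < 2 ^ w := fun b => by
    have := area_le hX b
    omega
  have b13 : 28 = base n w 13 := by simp [base]
  have b14 : base n w 13 + (n / lb n + 1) = base n w 14 := (base_succ n w le_rfl).symm
  have b15 : base n w 14 + n / thr n * lb n = base n w 15 := (base_succ n w (by norm_num)).symm
  have b16 : base n w 15 + (n / lb n + 1) = base n w 16 := (base_succ n w (by norm_num)).symm
  have b17 : base n w 16 + (n / lb n + 1) = base n w 17 := (base_succ n w (by norm_num)).symm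
  have b18 : base n w 17 + nch n * sb n = base n w 18 := (base_succ n w (by norm_num)).symm
  have b19 : base n w 18 + (2 * n / w + 1) = base n w 19 := (base_succ n w (by norm_num)).symm
  have b20 : base n w 19 + ((n / sb n + 1) / fw n w + 1) = base n w 20 :=
    (base_succ n w (by norm_num)).symm
  have b21 : base n w 20 + ((n / sb n + 1) / fw n w + 1) = base n w 21 :=
    (base_succ n w (by norm_num)).symm
  have b22 : base n w 21 + (2 * (2 * n / ch n) * sb n / fw n w + 1) = base n w 22 :=
    (base_succ n w (by norm_num)).symm
  have b23 : base n w 22 + 2 * seg n = base n w 23 := (base_succ n w (by norm_num)).symm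
  have b24 : base n w 23 + 2 * seg n = base n w 24 := (base_succ n w (by norm_num)).symm
  have b25 : base n w 24 + (lg n + 2) = base n w 25 := (base_succ n w (by norm_num)).symm
  have b26 : base n w 25 + (n / fw n w + 1) = base n w 26 := (base_succ n w (by norm_num)).symm
  have b27 : base n w 26 + (n / fw n w + 1) = base n w 27 := (base_succ n w (by norm_num)).symm
  have l13 : n / lb n + 1 < 2 ^ w := by have := area_lt 13; exact (Nat.lt_succ_self _).trans this
  have l14 : n / thr n * lb n < 2 ^ w := by omega
  have l18 : 2 * n / w + 1 < 2 ^ w := (Nat.lt_succ_self _).trans (area_lt 18)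
  have l19 : (n / sb n + 1) / fw n w + 1 < 2 ^ w := (Nat.lt_succ_self _).trans (area_lt 19)
  have l21' : 2 * (2 * n / ch n) * sb n / fw n w + 1 < 2 ^ w :=
    (Nat.lt_succ_self _).trans (area_lt 21)
  have l25 : n / fw n w + 1 < 2 ^ w := (Nat.lt_succ_self _).trans (area_lt 25)
  rw [baseCode, wp_seq]
  refine wp.mono (Q := fun σ => (∀ i < 21, σ.reg i = value n w i) ∧
    σ.reg 39 = τ.reg 39 ∧ σ.arr = τ.arr ∧ σ.log = τ.log ∧ σ.clk = τ.clk + 8) ?_ ?_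
  · simp only [wp_seq, wp_assign]
    simp only [ok_add, ok_mul, ok_div, ok_lit, ok_var, val_add, val_mul, val_div,
      val_lit, val_var, preEnv_w, St.setReg_reg, St.setReg_arr, St.setReg_log, St.setReg_clk,
      h0, h1, h4, h7, h9, h10, h12, Nat.reduceEqDiff, if_true, if_false,
      b13, b14, b15, b16, b17, b18, b19, b20, true_and, and_true]
    and_intros
    any_goals first | exact hbase _ (by norm_num) | omega
    intro i hi
    interval_cases i <;> simp [h, value]
  rintro σ ⟨g, g39, garr, glog, gclk⟩
  have g0 : σ.reg 0 = n := g 0 (by norm_num)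
  have g1 : σ.reg 1 = fw n w := g 1 (by norm_num)
  have g5 : σ.reg 5 = lg n := g 5 (by norm_num)
  have g6 : σ.reg 6 = seg n := g 6 (by norm_num)
  have g7 : σ.reg 7 = sb n := g 7 (by norm_num)
  have g11 : σ.reg 11 = ch n := g 11 (by norm_num)
  have g20 : σ.reg 20 = base n w 20 := g 20 (by norm_num)
  simp only [wp_seq, wp_assign]
  simp only [ok_add, ok_mul, ok_div, ok_lit, ok_var, val_add, val_mul, val_div,
    val_lit, val_var, preEnv_w, St.setReg_reg, St.setReg_arr, St.setReg_log, St.setReg_clk,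
    g0, g1, g5, g6, g7, g11, g20, Nat.reduceEqDiff, if_true, if_false,
    b21, b22, b23, b24, b25, b26, b27, true_and, and_true, g39, garr, glog, gclk]
  and_intros
  any_goals first | exact hbase _ (by norm_num) | omega
  intro i hi
  interval_cases i <;> simp [g, value]

/-- Compute all parameters, from the argument and the input, and store them. -/
def setupCode : Stmt :=
  (assign 39 (par 0) ;; assign 0 (inp (lit 0)) ;; widthCode ;; sizeCode 0 5 ;; sizeCode 5 29) ;;
  scalarCode ;; baseCode ;; headerCode

theorem wp_setup {n m w X : ℕ} (hX : Bounds n m w X) {input : List ℕ} (hin : 0 < input.length)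
    (hn : rd input 0 = n) {S x : ℕ} (hS : 28 ≤ S) (hS' : S ≤ 2 ^ w) :
    wp (preEnv w input S x) setupCode (initSt fun _ => 0) fun τ => τ.reg 39 = x ∧
      (∀ i < 28, τ.reg i = value n w i) ∧ τ.log = [] ∧
      τ.arr 47 = (fun a => if a < 28 then value n w a else 0) ∧ τ.clk ≤ 3 * w + 6 * n + 64 := by
  have hw := Nat.pos_of_ne_zero hX.w_ne
  have hXw := hX.X_lt
  have hnX := hX.nm_le
  rw [setupCode, wp_seq]
  refine wp.mono (Q := fun σ => σ.reg 39 = x ∧ σ.reg 0 = n ∧ σ.reg 4 = w ∧ σ.reg 5 = lg n ∧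
    σ.reg 29 = ll n ∧ σ.arr = (fun _ _ => 0) ∧ σ.log = [] ∧ σ.clk ≤ 3 * w + 6 * n + 11) ?_ ?_
  · simp only [wp_seq, wp_assign]
    refine ⟨trivial, ⟨by rw [ok_lit, preEnv_w]; omega, hin⟩, ?_⟩
    refine (wp_width (E := preEnv w input S x) hw _).mono ?_
    rintro σ₁ ⟨a₁, f₁, c₁⟩
    have r0 : σ₁.reg 0 = n := by rw [f₁.reg 0 (by simp)]; simpa using hn
    refine (wp_size 0 5 (by norm_num) σ₁ (by rw [r0, preEnv_w]; omega)).mono ?_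
    rintro σ₂ ⟨a₂, f₂, c₂⟩
    have hlg := lg_le n
    have hlg' : Nat.size n = lg n := rfl
    have hll : Nat.size (Nat.size n) ≤ Nat.size n := Nat.size_le.mpr Nat.lt_two_pow_self
    rw [r0] at a₂ c₂
    refine (wp_size 5 29 (by norm_num) σ₂ (by rw [a₂, preEnv_w]; omega)).mono ?_
    rintro σ₃ ⟨a₃, f₃, c₃⟩
    rw [a₂] at a₃ c₃
    refine ⟨?_, ?_, ?_, ?_, a₃, ?_, ?_, ?_⟩
    · rw [f₃.reg 39 (by simp), f₂.reg 39 (by simp), f₁.reg 39 (by simp)]; simp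
    · rw [f₃.reg 0 (by simp), f₂.reg 0 (by simp), r0]
    · rw [f₃.reg 4 (by simp), f₂.reg 4 (by simp), a₁, preEnv_w]
    · rw [f₃.reg 5 (by simp), a₂]; rfl
    · funext b
      rw [f₃.arr b (by simp), f₂.arr b (by simp), f₁.arr b (by simp)]; rfl
    · rw [f₃.log, f₂.log, f₁.log]; rfl
    · rw [preEnv_w] at c₁
      have e : (initSt fun _ => 0).clk = 0 := rfl
      simp only [St.setReg_clk, e] at c₁
      omega
  rintro σ ⟨h39, h0, h4, h5, h29, harr, hlog, hclk⟩
  rw [wp_seq]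
  refine (wp_scalar hX h0 h4 h5 h29).mono ?_
  rintro σ₁ ⟨a₁, b₁, c₁, d₁, e₁⟩
  rw [wp_seq]
  refine (wp_base hX a₁).mono ?_
  rintro σ₂ ⟨a₂, b₂, c₂, d₂, e₂⟩
  refine (wp_header hS hS' σ₂ (by rw [c₂, c₁, harr])).mono ?_
  rintro σ₃ ⟨a₃, b₃, c₃, d₃⟩
  refine ⟨by rw [a₃, b₂, b₁, h39], fun i hi => by rw [a₃, a₂ i hi], by rw [b₃, d₂, d₁, hlog], ?_,
    by omega⟩
  rw [c₃]
  funext a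
  split
  · exact a₂ a ‹_›
  · rfl

/-! ### The programs -/

/-- The search, and the construction of the final representation. -/
def mainCode : Stmt := searchCode ;; buildCode

/-- Report the current degree of the vertex with the label in variable `39`. -/
def currentCode : Stmt := assign 1 (var 39 - lit 1) ;; countCode ;; report (var 2)

/-- Report the final degree of the vertex with the label in variable `39`. -/
def finalCode : Stmt := assign 1 (var 39 - lit 1) ;; queryCode ;; report (var 2)

set_option maxRecDepth 10000 in
theorem codes_wf : setupCode.wf ∧ loadCode.wf ∧ mainCode.wf ∧ currentCode.wf ∧ finalCode.wf := by
  decide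

set_option maxRecDepth 10000 in
theorem mainCode_keeps : mainCode.keeps 47 := by decide

set_option maxRecDepth 10000 in
theorem codes_pure : loadCode.pure ∧ currentCode.pure ∧ finalCode.pure := by decide

theorem withPrologue_pure {pre s : Stmt} (hp : pre.pure) (hs : s.pure) :
    (withPrologue pre s).all Instr.pure := by
  simp only [withPrologue, List.all_append, Bool.and_eq_true]
  exact ⟨Stmt.code_pure hp _, by decide, Stmt.code_pure hs _, rfl⟩

/-! ### The memory layout -/

theorem env_wlen_cases {n w k b i : ℕ} {input : List ℕ} (h : i < (env n w k input).wlen b) :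
    (b = 47 ∧ i < 28 ∧ (env n w k input).par b = 0) ∨
    (13 ≤ b ∧ b < k ∧ b < 28 ∧ packed b = false ∧ i < area n w b ∧
      (env n w k input).par b = base n w b) := by
  simp only [env] at h ⊢
  split at h
  · subst b; exact Or.inl ⟨rfl, h, rfl⟩
  split at h
  · rename_i hb
    have hp : packed b = false := by simpa using hb.2
    have h13 : 13 ≤ b := by
      by_contra hlt
      have : len n w b = 0 := by interval_cases b <;> rfl
      omega
    have h25 : b < 25 := by
      by_contra hlt
      simp [packed] at hp
      omega
    refine Or.inr ⟨h13, hb.1, by omega, hp, ?_, ?_⟩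
    · simpa [area, hp] using h
    · interval_cases b <;> rfl
  · omega

theorem env_plen_cases {n w k b i : ℕ} {input : List ℕ} (hk : k ≤ 28)
    (h : i < (env n w k input).plen b) :
    13 ≤ b ∧ b < k ∧ packed b = true ∧ i / fw n w < area n w b ∧
      (env n w k input).par b = base n w b := by
  simp only [env] at h ⊢
  split at h
  · rename_i hb
    have h13 : 13 ≤ b := by
      by_contra hlt
      have : len n w b = 0 := by interval_cases b <;> rfl
      omega
    refine ⟨h13, hb.1, hb.2, ?_, ?_⟩
    · simp only [area, hb.2, if_true]
      exact Nat.lt_succ_of_le (Nat.div_le_div_right h.le)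
    · have := hb.1.trans_le hk
      interval_cases b <;> rfl
  · omega

theorem base_ge (n w b : ℕ) : 28 ≤ base n w b := Nat.le_add_right _ _

theorem base_add_lt {n w b b' i : ℕ} (hb : 13 ≤ b) (h : b < b') (hi : i < area n w b) :
    base n w b + i < base n w b' := by
  have h1 := base_succ n w hb
  have h2 := base_mono n w (show b + 1 ≤ b' from h)
  omega

theorem Par.Bounds.fb_pos {n m w X : ℕ} (hX : Bounds n m w X) : 0 < fb n :=
  Nat.mul_pos (by norm_num) (ll_pos hX.pos)

/-- The arrays occupy consecutive stretches of memory from address `28` on, so any two of them are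
separated by the base address of the later one; the header lies in front of all. -/
theorem env_valid {n m w X : ℕ} (hX : Bounds n m w X) {k : ℕ} (hk : k ≤ 28) {input : List ℕ}
    (hin : ∀ x ∈ input, x < 2 ^ w) : (env n w k input).Valid (base n w k) where
  w_pos := Nat.pos_of_ne_zero hX.w_ne
  S_le := by
    have := base_mono n w hk
    have := base_le hX
    have := hX.X_lt
    rw [env_w]; omega
  input_lt := hin
  word_lt b i h := by
    rcases env_wlen_cases h with ⟨_, h1, h2⟩ | ⟨h1, h2, _, _, h3, h4⟩
    · have := base_ge n w k
      omega
    · rw [h4]; exact base_add_lt h1 h2 h3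
  field_lt b i h := by
    obtain ⟨h1, h2, _, h3, h4⟩ := env_plen_cases hk h
    rw [h4]; exact base_add_lt h1 h2 h3
  field_par b i h := by
    have h1 := hX.fb_pos
    have h2 : 2 ^ fb n < 2 ^ w := by
      have := hX.pow_le
      have := hX.X_lt
      omega
    exact ⟨Nat.div_pos hX.fb_le h1, Nat.div_mul_le_self _ _,
      (Nat.pow_lt_pow_iff_right (by norm_num)).mp h2, rfl⟩
  word_word b b' i i' hb h h' := by
    have g1 := base_ge n w b
    have g2 := base_ge n w b'
    rcases env_wlen_cases h with ⟨h0, h1, h2⟩ | ⟨h1, h2, _, _, h3, h4⟩ <;>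
      rcases env_wlen_cases h' with ⟨h0', h1', h2'⟩ | ⟨h1', h2', _, _, h3', h4'⟩
    · omega
    · omega
    · omega
    · rcases Nat.lt_or_gt_of_ne hb with h | h
      · have := base_add_lt h1 h h3
        omega
      · have := base_add_lt h1' h h3'
        omega
  word_field b b' i i' h h' := by
    have g2 := base_ge n w b'
    have g3 := Nat.zero_le (i' / fw n w)
    obtain ⟨h1', h2', hp', h3', h4'⟩ := env_plen_cases hk h'
    rw [par_1]
    rcases env_wlen_cases h with ⟨h0, h1, h2⟩ | ⟨h1, h2, _, hp, h3, h4⟩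
    · omega
    · have hb : b ≠ b' := by rintro rfl; simp [hp] at hp'
      rcases Nat.lt_or_gt_of_ne hb with h | h
      · have := base_add_lt h1 h h3
        omega
      · have := base_add_lt h1' h h3'
        omega
  field_field b b' i i' hb h h' := by
    obtain ⟨h1, h2, _, h3, h4⟩ := env_plen_cases hk h
    obtain ⟨h1', h2', _, h3', h4'⟩ := env_plen_cases hk h'
    have g3 := Nat.zero_le (i / fw n w)
    have g4 := Nat.zero_le (i' / fw n w)
    rw [par_1]
    rcases Nat.lt_or_gt_of_ne hb with h | h
    · have := base_add_lt h1 h h3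
      omega
    · have := base_add_lt h1' h h3'
      omega

/-! ### Estimates -/

namespace Par

/-- Applied to `lg n`, it compares powers of the logarithm with `n`; applied to `ll n`, it compares
powers of `ll n` with `lg n`. -/
theorem cube_le (x : ℕ) : x ^ 3 ≤ 4 * 2 ^ x := by
  rcases Nat.lt_or_ge x 4 with h | h
  · interval_cases x <;> norm_num
  · induction x, h using Nat.le_induction with
    | base => norm_num
    | succ x hx ih => rw [pow_succ 2]; nlinarith [Nat.mul_le_mul hx hx]

theorem fourth_le (x : ℕ) : x ^ 4 ≤ 21 * 2 ^ x := by
  rcases Nat.lt_or_ge x 6 with h | h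
  · interval_cases x <;> norm_num
  · induction x, h using Nat.le_induction with
    | base => norm_num
    | succ x hx ih =>
      have h2 : 36 ≤ x ^ 2 := by nlinarith
      have h3 : 6 * x ^ 2 ≤ x ^ 3 := by rw [pow_succ x 2]; nlinarith
      have h4 : 6 * x ^ 3 ≤ x ^ 4 := by rw [pow_succ x 3]; nlinarith [Nat.zero_le (x ^ 3)]
      have e : (x + 1) ^ 4 = x ^ 4 + 4 * x ^ 3 + 6 * x ^ 2 + 4 * x + 1 := by ring
      rw [e, pow_succ 2]
      nlinarith

variable {n : ℕ}

theorem two_pow_size_le {x : ℕ} (hx : 0 < x) : 2 ^ Nat.size x ≤ 2 * x := by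
  obtain ⟨s, hs⟩ := Nat.exists_eq_succ_of_ne_zero (Nat.size_pos.mpr hx).ne'
  have : 2 ^ s ≤ x := Nat.lt_size.mp (by omega)
  rw [hs, pow_succ]; omega

theorem two_pow_lg_le (hn : 0 < n) : 2 ^ lg n ≤ 2 * n := two_pow_size_le hn

theorem two_pow_ll_le (hn : 0 < n) : 2 ^ ll n ≤ 2 * lg n := two_pow_size_le (lg_pos hn)

theorem ll_le_lg (n : ℕ) : ll n ≤ lg n := lg_le _

theorem bb_eq (n : ℕ) : bb n = 2 ^ ll n * 2 ^ ll n := by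
  rw [bb, ← mul_pow]; norm_num

theorem thr_eq (n : ℕ) : thr n = 2 ^ ll n * 2 ^ ll n * (2 ^ ll n * 2 ^ ll n) := by
  rw [thr, ← mul_pow, ← mul_pow]; norm_num

theorem lg_sq_le (hn : 0 < n) : lg n * lg n ≤ 8 * n := by
  have h1 := cube_le (lg n)
  have h2 := two_pow_lg_le hn
  have h3 := lg_pos hn
  have h4 : lg n * lg n * 1 ≤ lg n * lg n * lg n := Nat.mul_le_mul_left _ h3
  have h5 : lg n ^ 3 = lg n * lg n * lg n := by ring
  omega

theorem ll_mul_lg_le_lb (n : ℕ) : ll n * lg n ≤ lb n := by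
  rw [lb, bb_eq, sb]
  have h1 := (lg_lt n).le
  have h2 := Nat.two_pow_pos (ll n)
  have h3 : ll n ≤ ll n ^ 2 := Nat.le_self_pow (by norm_num) _
  exact Nat.mul_le_mul h3 (h1.trans (Nat.le_mul_of_pos_left _ h2))

/-- This explains the choice of the threshold: `lb n` is `ll n ^ 2 * 4 ^ ll n`, the factor `lg n` is
below `2 ^ ll n`, and `ll n ^ 3` is at most `4 * 2 ^ ll n`, which altogether stays below `4 * 16 ^
ll n`. Hence `n / thr n` tables of `lb n` words take `O(n / ll n)` bits. -/
theorem mul_lb_le_thr (n : ℕ) : ll n * lg n * lb n ≤ 4 * thr n := by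
  rw [lb, bb_eq, sb, thr_eq]
  have h1 := (lg_lt n).le
  have h2 := cube_le (ll n)
  calc ll n * lg n * (ll n ^ 2 * (2 ^ ll n * 2 ^ ll n))
      = ll n ^ 3 * lg n * (2 ^ ll n * 2 ^ ll n) := by ring
    _ ≤ 4 * 2 ^ ll n * 2 ^ ll n * (2 ^ ll n * 2 ^ ll n) := by gcongr
    _ = _ := by ring

theorem ch_le_lg (hn : 0 < n) : ch n ≤ lg n := by
  have := lg_pos hn
  rw [ch]; omega

/-- A chunk has about half of the bits of `n`, so there are about `√n` chunks; the other half of the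
exponent absorbs the logarithmic factors. -/
theorem lg_mul_nch_le (hn : 0 < n) : lg n * lg n * nch n ≤ 128 * n := by
  have h1 : lg n ≤ 2 * (lg n - lg n / 2) := by omega
  set h := lg n - lg n / 2 with hh
  have h2 : h * h ≤ 4 * 2 ^ h := by
    have h1 := cube_le h
    have h3 : h * h * 1 ≤ h ^ 3 := by
      rcases Nat.eq_zero_or_pos h with h0 | h0
      · simp [h0]
      · calc h * h * 1 ≤ h * h * h := Nat.mul_le_mul_left _ h0
          _ = h ^ 3 := by ring
    omega
  have h3 : 2 ^ h * 2 ^ (lg n / 2) = 2 ^ lg n := by rw [← pow_add]; congr 1; omega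
  have h4 := two_pow_lg_le hn
  calc lg n * lg n * nch n ≤ 2 * h * (2 * h) * (2 ^ (lg n / 2) * 2) := by
        rw [nch, ch, pow_succ]; gcongr
    _ = 8 * (h * h) * 2 ^ (lg n / 2) := by ring
    _ ≤ 8 * (4 * 2 ^ h) * 2 ^ (lg n / 2) := by gcongr
    _ = 32 * (2 ^ h * 2 ^ (lg n / 2)) := by ring
    _ ≤ 128 * n := by rw [h3]; omega

theorem ll_mul_table_le (hn : 0 < n) : ll n * (lg n * (nch n * sb n)) ≤ 1024 * n := by
  have h1 := cube_le (ll n)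
  have h2 := two_pow_ll_le hn
  calc ll n * (lg n * (nch n * sb n)) = ll n ^ 3 * (lg n * nch n) := by rw [sb]; ring
    _ ≤ 8 * lg n * (lg n * nch n) := by gcongr; omega
    _ = 8 * (lg n * lg n * nch n) := by ring
    _ ≤ 1024 * n := by have := lg_mul_nch_le hn; omega

/-- Rounding down the number of fields in a word wastes less than half of the word, so packing costs
at most a factor of two, plus one word. -/
theorem packed_le {w N : ℕ} (h0 : 0 < fb n) (hw : fb n ≤ w) :
    w * (N / fw n w + 1) ≤ 2 * fb n * N + w := by
  have h1 : 1 ≤ w / fb n := Nat.div_pos hw h0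
  have h2 : w ≤ 2 * fb n * fw n w := by
    have := Nat.div_add_mod w (fb n)
    have := Nat.mod_lt w h0
    rw [fw]
    nlinarith
  have h3 : fw n w * (N / fw n w) ≤ N := Nat.mul_div_le _ _
  calc w * (N / fw n w + 1) ≤ 2 * fb n * fw n w * (N / fw n w) + w := by
        rw [mul_add, mul_one]; gcongr
    _ = 2 * fb n * (fw n w * (N / fw n w)) + w := by ring
    _ ≤ _ := by gcongr

variable {w B : ℕ}

theorem ll_mul_div_lb_le (hn : 0 < n) (hw : w ≤ B * lg n) :
    ll n * (w * (n / lb n + 1)) ≤ 9 * B * n := by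
  have h1 := ll_mul_lg_le_lb n
  have h2 := Nat.div_mul_le_self n (lb n)
  have h3 := lg_sq_le hn
  have h4 := ll_le_lg n
  calc ll n * (w * (n / lb n + 1)) ≤ ll n * (B * lg n * (n / lb n + 1)) := by gcongr
    _ = B * (n / lb n * (ll n * lg n) + ll n * lg n) := by ring
    _ ≤ B * (n / lb n * lb n + lg n * lg n) := by gcongr
    _ ≤ B * (n + 8 * n) := by gcongr
    _ = _ := by ring

theorem ll_mul_tables_le (hw : w ≤ B * lg n) :
    ll n * (w * (n / thr n * lb n)) ≤ 4 * B * n := by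
  have h1 := mul_lb_le_thr n
  have h2 := Nat.div_mul_le_self n (thr n)
  calc ll n * (w * (n / thr n * lb n)) ≤ ll n * (B * lg n * (n / thr n * lb n)) := by gcongr
    _ = B * (n / thr n * (ll n * lg n * lb n)) := by ring
    _ ≤ B * (n / thr n * (4 * thr n)) := by gcongr
    _ = 4 * B * (n / thr n * thr n) := by ring
    _ ≤ _ := by gcongr

theorem ll_mul_w_le (hn : 0 < n) (hw : w ≤ B * lg n) : ll n * w ≤ 8 * B * n := by
  have h3 := lg_sq_le hn
  have h4 := ll_le_lg n
  calc ll n * w ≤ lg n * (B * lg n) := by gcongr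
    _ = B * (lg n * lg n) := by ring
    _ ≤ B * (8 * n) := by gcongr
    _ = _ := by ring

/-- The space of the final representation. -/
theorem base_22_le (hn : 0 < n) (hw : w ≤ B * lg n) (hfb : fb n ≤ w) :
    ll n * (w * base n w 22) ≤ ll n * (2 * n) + (1600 * B + 12000) * n := by
  have hl := ll_pos hn
  have hfb0 : 0 < fb n := Nat.mul_pos (by norm_num) hl
  -- Each part except the string is bounded by a multiple of `n` after multiplication by `ll n`,
  -- hence takes `O(n / ll n)` bits.
  have a1 := ll_mul_div_lb_le hn hw
  have a2 := ll_mul_tables_le hw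
  have a3 : ll n * (w * (nch n * sb n)) ≤ 1024 * B * n := by
    calc ll n * (w * (nch n * sb n)) ≤ ll n * (B * lg n * (nch n * sb n)) := by gcongr
      _ = B * (ll n * (lg n * (nch n * sb n))) := by ring
      _ ≤ B * (1024 * n) := Nat.mul_le_mul_left _ (ll_mul_table_le hn)
      _ = _ := by ring
  have a4 := ll_mul_w_le hn hw
  have a5 : ll n * (w * (2 * n / w + 1)) ≤ ll n * (2 * n) + 8 * B * n := by
    have := Nat.mul_div_le (2 * n) w
    calc ll n * (w * (2 * n / w + 1)) = ll n * (w * (2 * n / w)) + ll n * w := by ring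
      _ ≤ _ := by gcongr
  have a6 : ll n * (w * ((n / sb n + 1) / fw n w + 1)) ≤ 144 * n + 8 * B * n := by
    have h1 := packed_le (N := n / sb n + 1) hfb0 hfb
    have h2 := Nat.div_mul_le_self n (sb n)
    have h3 : ll n * ll n ≤ 8 * n :=
      le_trans (Nat.mul_le_mul (ll_le_lg n) (ll_le_lg n)) (lg_sq_le hn)
    calc _ ≤ ll n * (2 * fb n * (n / sb n + 1) + w) := by gcongr
      _ = 16 * (n / sb n * sb n) + 16 * (ll n * ll n) + ll n * w := by rw [fb, sb]; ring
      _ ≤ 16 * n + 16 * (8 * n) + 8 * B * n := by gcongr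
      _ = _ := by ring
  have a7 : ll n * (w * (2 * (2 * n / ch n) * sb n / fw n w + 1)) ≤ 5376 * n + 8 * B * n := by
    have h1 := packed_le (N := 2 * (2 * n / ch n) * sb n) hfb0 hfb
    have h2 := Nat.div_mul_le_self (2 * n) (ch n)
    -- A long block has `ll n ^ 2` entries of `8 * ll n` bits; with the extra factor `ll n` this is
    -- a fourth power, which the denominator `ch n` in the number of long blocks absorbs.
    have h3 : ll n ^ 4 ≤ 84 * ch n := by
      have := fourth_le (ll n)
      have := two_pow_ll_le hn
      have : lg n ≤ 2 * ch n := by rw [ch]; omega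
      omega
    calc _ ≤ ll n * (2 * fb n * (2 * (2 * n / ch n) * sb n) + w) := by gcongr
      _ = 32 * (2 * n / ch n * ll n ^ 4) + ll n * w := by rw [fb, sb]; ring
      _ ≤ 32 * (2 * n / ch n * (84 * ch n)) + 8 * B * n := by gcongr
      _ = 2688 * (2 * n / ch n * ch n) + 8 * B * n := by ring
      _ ≤ 2688 * (2 * n) + 8 * B * n := by gcongr
      _ = _ := by ring
  have e : base n w 22 = 28 + (3 * (n / lb n + 1) + n / thr n * lb n + nch n * sb n +
      (2 * n / w + 1) + 2 * ((n / sb n + 1) / fw n w + 1) +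
      (2 * (2 * n / ch n) * sb n / fw n w + 1)) := by
    simp only [base, Finset.sum_Ico_eq_sum_range]
    simp [Finset.sum_range_succ, area, packed, len]
    ring
  rw [e]
  nlinarith

theorem ll_le_lglg (n : ℕ) : ll n ≤ 2 * lglg n := by
  have h1 : Nat.size n ≤ Nat.log 2 n + 1 := Nat.size_le.mpr (Nat.lt_pow_succ_log_self (by norm_num)
    n)
  have h2 : Nat.log 2 n < 2 ^ lglg n := Nat.lt_pow_succ_log_self (by norm_num) _
  have h3 : ll n ≤ lglg n + 1 := Nat.size_le.mpr (by rw [pow_succ]; omega)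
  have h4 : 0 < lglg n := Nat.succ_pos _
  omega

/-- The space of the search. -/
theorem base_28_le (hn : 0 < n) (hw : w ≤ B * lg n) (hfb : fb n ≤ w) :
    w * (256 + base n w 28) ≤ (6000 * B + 12200) * (n * lglg n) := by
  have hl := ll_pos hn
  have hfb0 : 0 < fb n := Nat.mul_pos (by norm_num) hl
  have h22 := base_22_le hn hw hfb
  have h1 : w * base n w 22 ≤ (1600 * B + 12002) * n := by
    refine Nat.le_of_mul_le_mul_left (h22.trans ?_) hl
    calc _ ≤ ll n * (2 * n) + ll n * ((1600 * B + 12000) * n) :=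
          Nat.add_le_add_left (Nat.le_mul_of_pos_left _ hl) _
      _ = _ := by ring
  have h2 : w ≤ B * n := hw.trans (Nat.mul_le_mul_left _ (lg_le n))
  have h3 : w * seg n ≤ 2 * B * n := by
    have := Nat.div_mul_le_self n (lg n)
    have := lg_le n
    calc w * seg n ≤ B * lg n * (n / lg n + 1) := by rw [seg]; gcongr
      _ = B * (n / lg n * lg n + lg n) := by ring
      _ ≤ B * (n + n) := by gcongr
      _ = _ := by ring
  have h4 : w * (lg n + 2) ≤ 10 * B * n := by
    have := lg_sq_le hn
    have := lg_le n
    calc w * (lg n + 2) ≤ B * lg n * (lg n + 2) := by gcongr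
      _ = B * (lg n * lg n + 2 * lg n) := by ring
      _ ≤ B * (8 * n + 2 * n) := by gcongr
      _ = _ := by ring
  have h5 := packed_le (N := n) hfb0 hfb
  have h6 := ll_le_lglg n
  have e : base n w 28 = base n w 22 + (4 * seg n + (lg n + 2) + 3 * (n / fw n w + 1)) := by
    rw [base_succ n w (by norm_num : 13 ≤ 27), base_succ n w (by norm_num : 13 ≤ 26),
      base_succ n w (by norm_num : 13 ≤ 25), base_succ n w (by norm_num : 13 ≤ 24),
      base_succ n w (by norm_num : 13 ≤ 23), base_succ n w (by norm_num : 13 ≤ 22)]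
    simp [area, packed, len]
    ring
  have h7 : 2 * fb n * n ≤ 32 * (n * lglg n) := by
    calc 2 * fb n * n = 16 * (n * ll n) := by rw [fb]; ring
      _ ≤ 16 * (n * (2 * lglg n)) := by gcongr
      _ = _ := by ring
  have h8 : n ≤ n * lglg n := Nat.le_mul_of_pos_right _ (Nat.succ_pos _)
  have h9 : w * (256 + base n w 28) ≤ (2000 * B + 12002) * n + 96 * (n * lglg n) := by
    rw [e]; nlinarith
  calc _ ≤ _ := h9
    _ ≤ (2000 * B + 12002) * (n * lglg n) + 96 * (n * lglg n) := by gcongr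
    _ ≤ _ := by nlinarith

theorem tendsto_ll : Filter.Tendsto ll Filter.atTop Filter.atTop := by
  refine Filter.tendsto_atTop.mpr fun b => Filter.eventually_atTop.mpr ⟨2 ^ 2 ^ b, fun n hn => ?_⟩
  have h1 : 2 ^ b < Nat.size n := Nat.lt_size.mpr hn
  exact (Nat.lt_size.mpr h1.le).le

theorem isLittleO_div_ll (K : ℕ) :
    (fun n => ((K * n / ll n : ℕ) : ℝ)) =o[Filter.atTop] fun n : ℕ => (n : ℝ) := by
  rw [Asymptotics.isLittleO_iff]
  intro c hc
  obtain ⟨b, hb⟩ := exists_nat_gt (K / c)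
  filter_upwards [tendsto_ll.eventually_ge_atTop (b + 1)] with n hn
  rw [Real.norm_natCast, Real.norm_natCast]
  have h1 : (0 : ℝ) < ll n := by exact_mod_cast (by omega : 0 < ll n)
  have h2 : (K : ℝ) ≤ c * ll n := by
    rw [div_lt_iff₀ hc] at hb
    have : (b : ℝ) ≤ ll n := by exact_mod_cast (by omega : b ≤ ll n)
    nlinarith
  refine Nat.cast_div_le.trans ?_
  rw [div_le_iff₀ h1]
  push_cast
  nlinarith [(Nat.cast_nonneg n : (0 : ℝ) ≤ n)]

/-- The time of the search. -/
theorem time_le {m al ev : ℕ} (hn : 0 < n) (hev : ev ≤ 2 * lg n) (hal : al ≤ n / thr n) :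
    100 * n + 40 * m + 20 + ev * moveCost n m + (4 * lb n + 8) * al + 6 + 25 * (n / sb n + 1) +
      20 * n + nch n * (8 * ch n + 7) ≤ 5000 * (n + m) := by
  -- There are at most `2 * lg n` moves of cost `O((n + m) / lg n + 1)`, so the logarithms cancel.
  have h1 : ev * moveCost n m ≤ 60 * n + 4 * m := by
    have h1 := Nat.div_mul_le_self n (lg n)
    have h2 := Nat.div_mul_le_self m (lg n)
    have h3 := lg_le n
    calc ev * moveCost n m ≤ 2 * lg n * moveCost n m := by gcongr
      _ = 18 * (n / lg n * lg n) + 4 * (m / lg n * lg n) + 30 * lg n := by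
        rw [moveCost, seg]; ring
      _ ≤ 18 * n + 4 * m + 30 * n := by gcongr
      _ ≤ _ := by omega
  have h2 : (4 * lb n + 8) * al ≤ 48 * n := by
    have h1 := Nat.div_mul_le_self n (thr n)
    have h2 : lb n ≤ 4 * thr n := le_trans
      (Nat.le_mul_of_pos_left _ (Nat.mul_pos (ll_pos hn) (lg_pos hn))) (mul_lb_le_thr n)
    have h3 := lb_pos hn
    calc (4 * lb n + 8) * al ≤ 12 * lb n * (n / thr n) := by gcongr; omega
      _ ≤ 12 * (4 * thr n) * (n / thr n) := by gcongr
      _ = 48 * (n / thr n * thr n) := by ring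
      _ ≤ _ := by gcongr
  have h3 : nch n * (8 * ch n + 7) ≤ 1920 * n := by
    have h1 := lg_mul_nch_le hn
    have h2 := ch_le_lg hn
    have h3 := lg_pos hn
    have h4 : 8 * ch n + 7 ≤ 15 * (lg n * lg n) := by nlinarith
    calc nch n * (8 * ch n + 7) ≤ nch n * (15 * (lg n * lg n)) := by gcongr
      _ = 15 * (lg n * lg n * nch n) := by ring
      _ ≤ _ := by omega
  have h4 := Nat.div_le_self n (sb n)
  omega

end Par

end WordRAM

/-! ### Properties of depth-first search -/

section

variable {n : ℕ} {nbr : Fin n → List (Fin n)}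

theorem dfsVisit_nodup (d : ℕ) {f : List (Fin n × Option (Fin n))} (p : Option (Fin n)) (v : Fin n)
    (hf : (f.map Prod.fst).Nodup) : ((dfsVisit nbr d f p v).map Prod.fst).Nodup := by
  induction d generalizing f p v with
  | zero => exact hf
  | succ d ih =>
    rw [dfsVisit]
    split
    · exact hf
    · rename_i hv
      have h0 : ((f ++ [(v, p)]).map Prod.fst).Nodup := by
        rw [List.map_append, List.nodup_append]
        exact ⟨hf, List.nodup_singleton _, fun a ha b hb h => hv (by simp_all)⟩
      generalize f ++ [(v, p)] = f' at h0
      induction nbr v generalizing f' with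
      | nil => exact h0
      | cons u l ihl => exact ihl _ (ih _ _ h0)

variable {G : Digraph (Fin n)} (A : AdjacencyLists G) (s : Fin n)

theorem AdjacencyLists.dfs_length_le : (A.dfs s).length ≤ n := by
  have : ((A.dfs s).map Prod.fst).Nodup := by
    rw [dfs]
    have h0 : (([] : List (Fin n × Option (Fin n))).map Prod.fst).Nodup := List.nodup_nil
    generalize ([] : List (Fin n × Option (Fin n))) = f at h0
    induction s :: List.finRange n generalizing f with
    | nil => exact h0
    | cons u l ih => exact ih _ (dfsVisit_nodup _ _ _ h0)
  simpa using this.length_le_card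

/-- Needed for the moment at which nothing has been reported: the first report concerns a root,
which leaves all counts at zero. -/
theorem AdjacencyLists.root_prefix_dfs (hn : 0 < n) : [(s, none)] <+: A.dfs s := by
  obtain ⟨k, rfl⟩ := Nat.exists_eq_succ_of_ne_zero hn.ne'
  rw [dfs, List.foldl_cons]
  refine List.IsPrefix.trans ?_ (foldl_prefix (fun f u => dfsVisit_prefix (nbr := A.nbr) _ f _ u) _
    _)
  rw [dfsVisit, if_neg (by simp)]
  exact foldl_prefix (fun f u => dfsVisit_prefix (nbr := A.nbr) _ f _ u) _ _

theorem AdjacencyLists.m_le : A.m ≤ n * n := by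
  rw [m]
  calc ∑ v, (A.nbr v).length ≤ ∑ _v : Fin n, n := Finset.sum_le_sum fun v _ => by
        simpa using (A.nodup v).length_le_card
    _ = n * n := by simp

end

namespace WordRAM

/-- As neighbour lists have no repetitions, `n + m` is polynomial in `n`. So `lg (n + m)` is at most
`2 * lg n`, and the word length is `O(lg n)`. -/
theorem size_le_lg {n m : ℕ} (hm : m ≤ n * n) : Nat.size (n + m) ≤ 2 * lg n := by
  rw [Nat.size_le, mul_comm, pow_mul]
  have := lt_two_pow_lg n
  nlinarith

/-- All quantities are at most `2 ^ (16 * L)` or obviously small, and `24 * L ≤ w` gives `16 * L ≤ w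
- 8`. The eight bits left over provide the factor of more than one hundred in `X_lt`. -/
theorem bounds_of_le {n m w : ℕ} (hn : 0 < n) (hw : 24 * Nat.size (n + m) ≤ w) :
    Bounds n m w (2 ^ (w - 8)) := by
  set L := Nat.size (n + m) with hL
  have hL0 : 0 < L := Nat.size_pos.mpr (by omega)
  have hlg : lg n ≤ L := Nat.size_le_size (by omega)
  have hll : ll n ≤ lg n := ll_le_lg n
  have hl0 := ll_pos hn
  have hch : ch n ≤ lg n := ch_le_lg hn
  have hnm : n + m ≤ 2 ^ L := (Nat.lt_size_self _).le
  have hpow : ∀ {k}, k ≤ 16 * L → 2 ^ k ≤ 2 ^ (w - 8) := fun h =>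
    Nat.pow_le_pow_right (by norm_num) (by omega)
  have hsb : sb n ≤ 2 ^ (2 * ll n) := by
    rw [sb, mul_comm, pow_mul]
    exact Nat.pow_le_pow_left Nat.lt_two_pow_self.le 2
  have hlb : lb n ≤ 2 ^ (4 * ll n) := by
    rw [lb, bb_eq, ← pow_add, show 4 * ll n = 2 * ll n + (ll n + ll n) by ring, pow_add _
      (2 * ll n)]
    exact Nat.mul_le_mul_right _ hsb
  have hthr : thr n = 2 ^ (4 * ll n) := by rw [thr, pow_mul]; norm_num
  have h8 : 2 ^ (8 * ll n) = 2 ^ ll n * 2 ^ (7 * ll n) := by rw [← pow_add]; congr 1; ring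
  have h7 : 2 ^ 7 ≤ 2 ^ (7 * ll n) := Nat.pow_le_pow_right (by norm_num) (by omega)
  have hw8 : (w - 8) + 8 = w := by omega
  have hX : w ≤ 2 ^ (w - 8) ∧ 16 ≤ 2 ^ (w - 8) := by
    obtain ⟨y, hy⟩ : ∃ y, w - 8 = y + 4 := ⟨w - 12, by omega⟩
    have := Nat.lt_two_pow_self (n := y)
    rw [hy, pow_add]
    omega
  refine ⟨hn, hnm.trans (hpow (by omega)), hlb.trans (hpow (by omega)), ?_, ?_, hpow ?_, ?_, ?_,
    hX.1, ?_, ?_, by omega, ?_, ?_⟩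
  · rw [hthr]; exact hpow (by omega)
  · calc n / thr n * lb n ≤ 2 ^ L * 2 ^ (4 * ll n) :=
          Nat.mul_le_mul ((Nat.div_le_self _ _).trans (by omega)) hlb
      _ = 2 ^ (L + 4 * ll n) := (pow_add _ _ _).symm
      _ ≤ _ := hpow (by omega)
  · rw [fb]; omega
  · calc nch n * sb n ≤ 2 ^ ch n * 2 ^ (2 * ll n) := Nat.mul_le_mul_left _ hsb
      _ = 2 ^ (ch n + 2 * ll n) := (pow_add _ _ _).symm
      _ ≤ _ := hpow (by omega)
  · calc 2 * (2 * n / ch n) * sb n ≤ 2 * (2 * 2 ^ L) * 2 ^ (2 * ll n) :=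
          Nat.mul_le_mul (Nat.mul_le_mul_left _ ((Nat.div_le_self _ _).trans (by omega))) hsb
      _ = 2 ^ (L + 2 + 2 * ll n) := by rw [pow_add, pow_add]; ring
      _ ≤ _ := hpow (by omega)
  · calc 100 * 2 ^ (w - 8) + 100 ≤ 2 ^ (w - 8) * 2 ^ 8 := by omega
      _ = 2 ^ w := by rw [← pow_add, hw8]
  · rw [fb]; omega
  · rw [hthr, fb]; exact Nat.pow_le_pow_right (by norm_num) (by omega)
  · rw [fb, h8]
    have := lg_lt n
    nlinarith

/-! ### Queries -/

theorem wp.exists_big {E : Env} {s : Stmt} {τ : St} {Q : St → Prop} (h : wp E s τ Q) :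
    ∃ τ', Big E s τ τ' ∧ Q τ' := by
  delta wp at h
  exact h

theorem MemRep.header {n w k : ℕ} {input : List ℕ} {arr : ℕ → ℕ → ℕ} {mem : ℕ → ℕ}
    (h : MemRep (env n w k input) arr mem) {i : ℕ} (hi : i < 28) : mem i = arr 47 i := by
  simpa [env, value] using h.word 47 i hi

/-- The representation of arrays in memory does not involve the input, and fewer arrays mean fewer
conditions. Thus the final query can run without input on an initial part of the memory. -/
theorem MemRep.restrict {n w k : ℕ} {input input' : List ℕ} {arr : ℕ → ℕ → ℕ} {mem : ℕ → ℕ}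
    (h : MemRep (env n w 28 input) arr mem) (hk : k ≤ 28) : MemRep (env n w k input') arr mem where
  lt := h.lt
  word b i hi := by
    refine h.word b i (hi.trans_le ?_)
    simp only [env]
    split_ifs with h₁ h₂ h₃ h₃ <;> first | omega | exact absurd ⟨h₂.1.trans_le hk, h₂.2⟩ h₃
  field b i hi := by
    refine h.field b i (hi.trans_le ?_)
    simp only [env]
    split_ifs with h₂ h₃ h₃ <;> first | omega | exact absurd ⟨h₂.1.trans_le hk, h₂.2⟩ h₃

/-- Common to both query programs: loading the parameters takes `29` clock units, independent of
`n`, and thereafter `s` works on the arrays as they stand in memory. -/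
theorem load_answers {s : Stmt} (hs : s.wf) (hp : s.pure) {n m w X k : ℕ} (hX : Bounds n m w X)
    (hk : k ≤ 28) {input : List ℕ} (hin : ∀ x ∈ input, x < 2 ^ w) {v : ℕ} (hv : v < n)
    {arr : ℕ → ℕ → ℕ} {mem : ℕ → ℕ} (hmem : MemRep (env n w k input) arr mem)
    (harr : ∀ i < 28, arr 47 i = value n w i) {ans T : ℕ}
    (h : ∀ τ : St, τ.reg 39 = v + 1 → τ.arr = arr → τ.log = [] →
      wp (env n w k input) s τ fun τ' => (∃ a, τ'.log = [(ans, a)]) ∧ τ'.clk ≤ τ.clk + T) :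
    (prog (withPrologue loadCode s)).Answers w input (base n w k) mem [v + 1]
      (max loadCode.cost s.cost * 29 + 28 + max loadCode.cost s.cost * T) ans := by
  have hE := env_valid hX hk hin
  have hS : base n w k ≤ 2 ^ w := hE.S_le
  have h1 := wp_load (w := w) (input := input) (x := v + 1) (mem := mem) (base_ge n w k) hS
  obtain ⟨τ₁, b₁, h39, hreg, hlog, h47, hclk⟩ := h1.exists_big
  have h2 := h ⟨τ₁.reg, arr, [], 0⟩ h39 rfl rfl
  obtain ⟨τ₃, b₂, ⟨a, hlog₃⟩, hclk₃⟩ := h2.exists_big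
  have hx : v + 1 < 2 ^ w := by
    have := hX.nm_le
    have := hX.X_lt
    omega
  obtain ⟨t, c, ht, hrun, hhalt, hrep, -⟩ := withPrologue_goes rfl rfl hE
    (fun i hi => by simp only [env]; unfold value; split <;> first | omega | simp_all)
    hx hmem.lt codes_wf.2.1 hs (le_max_left _ _) (le_max_right _ _) b₁ hlog
    (fun i hi => by rw [hreg i hi, hmem.header hi, harr i hi]; rfl)
    (τ₂ := ⟨τ₁.reg, arr, [], 0⟩) ⟨rfl, rfl, rfl⟩
    (fun mem' hm hlt => by
      rw [h47] at hm
      refine ⟨hlt, fun b i hi => ?_, fun b i hi => ?_⟩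
      · rw [hm _ (hE.word_lt b i hi)]; exact hmem.word b i hi
      · rw [hm _ (hE.field_lt b i hi)]; exact hmem.field b i hi) b₂
  refine ⟨t, ht.trans ?_, c, hrun, hhalt, ?_, run_mem (withPrologue_pure codes_pure.1 hp) hrun⟩
  · have h3 : τ₃.clk ≤ T := by simpa using hclk₃
    rw [hclk]
    gcongr
  · rw [hrep.out, hlog₃]; rfl

theorem current_answers {n m w X : ℕ} (hX : Bounds n m w X) {input : List ℕ}
    (hin : ∀ x ∈ input, x < 2 ^ w) {arr : ℕ → ℕ → ℕ} {mem : ℕ → ℕ}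
    (hmem : MemRep (env n w 28 input) arr mem) (harr : ∀ i < 28, arr 47 i = value n w i)
    {c : ℕ → ℕ} {al : ℕ} (hc : Counts n (lb n) (thr n) (arr 13) (arr 14) (arr 27) al c)
    (hs : ∑ u ∈ Finset.range n, c u ≤ n) {v : ℕ} (hv : v < n) :
    (prog (withPrologue loadCode currentCode)).Answers w input (base n w 28) mem [v + 1]
      (max loadCode.cost currentCode.cost * 29 + 28 + max loadCode.cost currentCode.cost * 10)
      (c v) := by
  refine load_answers codes_wf.2.2.2.1 codes_pure.2.1 hX le_rfl hin hv hmem harr ?_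
  intro τ h39 ha hlog
  subst ha
  have hXw := hX.X_lt
  rw [currentCode, wp_seq, wp_assign]
  refine ⟨?_, ?_⟩
  · simp [h39, hX.w_ne]
  rw [wp_seq]
  refine (wp_count (τ := τ.setReg 1 _) hX hc (v := v) (by simp [h39]) hv hs).mono ?_
  rintro τ' ⟨h2, hf, hclk⟩
  rw [wp_report]
  refine ⟨trivial, ⟨τ'.arr, ?_⟩, ?_⟩
  · simp [hf.log, hlog, h2]
  · simp [hclk]

theorem final_answers {n m w X : ℕ} (hX : Bounds n m w X) {arr : ℕ → ℕ → ℕ} {mem : ℕ → ℕ}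
    (hmem : MemRep (env n w 22 []) arr mem) (harr : ∀ i < 28, arr 47 i = value n w i)
    {d : ℕ → ℕ} (hfin : Final n w d arr) (hs : ∑ u ∈ Finset.range n, d u ≤ n) {v : ℕ}
    (hv : v < n) :
    (prog (withPrologue loadCode finalCode)).Answers w [] (base n w 22) mem [v + 1]
      (max loadCode.cost finalCode.cost * 29 + 28 + max loadCode.cost finalCode.cost * 10)
      (d v) := by
  refine load_answers codes_wf.2.2.2.2 codes_pure.2.2 hX (by norm_num) (by simp) hv hmem harr ?_
  intro τ h39 ha hlog
  subst ha
  have hXw := hX.X_lt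
  rw [finalCode, wp_seq, wp_assign]
  refine ⟨?_, ?_⟩
  · simp [h39, hX.w_ne]
  rw [wp_seq]
  refine (wp_query (τ := τ.setReg 1 _) hX hfin hs (v := v) (by simp [h39]) hv).mono ?_
  rintro τ' ⟨h2, -, hlog', hclk⟩
  rw [wp_report]
  refine ⟨trivial, ⟨τ'.arr, ?_⟩, ?_⟩
  · simp [hlog', hlog, h2]
  · simp at hclk ⊢; omega

/-! ### The search -/

theorem wp_main {n m w X : ℕ} {nbr : Fin n → List (Fin n)} {input : List ℕ}
    {D : List (Fin n × Option (Fin n))} {τ : St} (hX : Bounds n m w X)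
    (hin : InputOk nbr m input) (s : Fin n) (h39 : τ.reg 39 = s + 1)
    (harr : ∀ b < 28, τ.arr b = fun _ => 0) (hlog : τ.log = []) (hclk : τ.clk = 0)
    (hD : (s :: List.finRange n).foldl (fun f v => visit nbr f none v) [] = D)
    (hm : ∑ v, (nbr v).length = m) (hlen : D.length ≤ n) :
    wp (env n w 28 input) mainCode τ fun τ' => (Final n w (kids D) τ'.arr ∧ LogOk D τ'.log ∧
      τ'.clk ≤ 5000 * (n + m)) ∧ τ'.arr 47 = τ.arr 47 ∧
      ∀ x ∈ τ'.log, x ∈ τ.log ∨ x.2 47 = τ.arr 47 := by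
  refine wp.keeps ?_ mainCode_keeps
  rw [mainCode, wp_seq]
  refine (wp_search hX hin s h39 harr hlog hD hm).mono ?_
  rintro τ₁ ⟨al, ev, hev, hal, hc, hl, h18, hclk₁⟩
  refine (wp_build hX hc ((sum_kids_le D).trans hlen) h18).mono ?_
  rintro τ₂ ⟨hfin, hlog₂, hclk₂⟩
  refine ⟨hfin, by rw [hlog₂]; exact hl, ?_⟩
  have := time_le (m := m) hX.pos hev hal
  omega

/-- After the set-up the memory is zero except for the header, so all other arrays start out as
zero, as the search and the construction require. -/
theorem search_goes {n m w X : ℕ} {nbr : Fin n → List (Fin n)} {input : List ℕ}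
    {D : List (Fin n × Option (Fin n))} (hX : Bounds n m w X) (hin : InputOk nbr m input)
    (s : Fin n) (hD : (s :: List.finRange n).foldl (fun f v => visit nbr f none v) [] = D)
    (hm : ∑ v, (nbr v).length = m) (hlen : D.length ≤ n) :
    ∃ t c arr log, t ≤ max setupCode.cost mainCode.cost * (3 * w + 6 * n + 64) + 28 +
        max setupCode.cost mainCode.cost * (5000 * (n + m)) ∧
      (prog (withPrologue setupCode mainCode)).run w input (base n w 28) t
        ((prog (withPrologue setupCode mainCode)).start w (fun _ => 0) [(s : ℕ) + 1]) = some c ∧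
      (prog (withPrologue setupCode mainCode)).Halted c ∧
      c.out = log.map Prod.fst ∧ MemRep (env n w 28 input) arr c.mem ∧
      Final n w (kids D) arr ∧ LogOk D log ∧ (∀ i < 28, arr 47 i = value n w i) ∧
      (∀ x ∈ log, ∀ i < 28, x.2 47 i = value n w i) ∧
      ∀ l y, l ++ [y] <+: log →
        Moment (env n w 28 input) (base n w 28) (withPrologue setupCode mainCode)
          ((prog (withPrologue setupCode mainCode)).start w (fun _ => 0) [(s : ℕ) + 1]) t l y := by
  have hXw := hX.X_lt
  have hnm := hX.nm_le
  have hE := env_valid hX le_rfl (fun x hx => (hin.lt x hx).trans_lt (by omega) :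
    ∀ x ∈ input, x < 2 ^ w)
  have hS : base n w 28 ≤ 2 ^ w := hE.S_le
  have h1 := wp_setup hX (by rw [hin.length]; omega) hin.zero (x := (s : ℕ) + 1)
    (base_ge n w 28) hS
  obtain ⟨τ₁, b₁, h39, hreg, hlog, h47, hclk⟩ := h1.exists_big
  have h2 := wp_main (τ := ⟨τ₁.reg, fun b => if b = 47 then τ₁.arr 47 else fun _ => 0, [], 0⟩)
    hX hin s h39 (fun b hb => if_neg (by omega)) rfl rfl hD hm hlen
  obtain ⟨τ₃, b₂, ⟨hfin, hlogOk, hclk₃⟩, k₁, k₂⟩ := h2.exists_big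
  have hsn := s.2
  obtain ⟨t, c, ht, hrun, hhalt, hrep, hmom⟩ := withPrologue_goes rfl rfl hE
    (fun i hi => by simp only [env]; unfold value; split <;> first | omega | simp_all)
    (show (s : ℕ) + 1 < 2 ^ w by omega) (fun _ => by positivity) codes_wf.1 codes_wf.2.2.1
        (le_max_left _ _)
    (le_max_right _ _) b₁ hlog (fun i hi => by rw [hreg i hi]; rfl)
    (τ₂ := ⟨τ₁.reg, fun b => if b = 47 then τ₁.arr 47 else fun _ => 0, [], 0⟩) ⟨rfl, rfl, rfl⟩
    (fun mem' hm' hlt => by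
      refine ⟨hlt, fun b i hi => ?_, fun b i hi => ?_⟩
      · rw [hm' _ (hE.word_lt b i hi)]
        rcases env_wlen_cases hi with ⟨rfl, h1, h2⟩ | ⟨h1, h2, h3, _, _, h4⟩
        · simp [h2]
        · have := base_ge n w b
          simp only [h4, h47]
          rw [if_neg (by omega), if_neg (by omega)]
      · rw [hm' _ (hE.field_lt b i hi)]
        obtain ⟨h1, h2, _, _, h4⟩ := env_plen_cases le_rfl hi
        have := base_ge n w b
        have := Nat.zero_le (i / (env n w 28 input).par 1)
        simp only [h4, h47]
        rw [if_neg (by omega), if_neg (by omega)]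
        simp) b₂
  have harr : ∀ i < 28, (if 47 = 47 then τ₁.arr 47 else fun _ => 0) i = value n w i := by
    intro i hi
    simp [h47, hi]
  refine ⟨t, c, τ₃.arr, τ₃.log, ht.trans ?_, hrun, hhalt, hrep.out, hrep.mem, hfin, hlogOk, ?_, ?_,
    hmom⟩
  · gcongr
  · intro i hi
    rw [k₁]; exact harr i hi
  · intro x hx i hi
    rcases k₂ x hx with h | h
    · simp at h
    · rw [h]; exact harr i hi

end WordRAM

open WordRAM

/-! ### Queries at the moments of reporting, and decoding -/

namespace WordRAM

theorem moment_take {E : Env} {S : ℕ} {code : List (Instr 128)} {c : Config 128} {t : ℕ}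
    {log : List (ℕ × (ℕ → ℕ → ℕ))}
    (h : ∀ l y, l ++ [y] <+: log → Moment E S code c t l y) {k : ℕ} {x : ℕ × (ℕ → ℕ → ℕ)}
    (hx : log[k]? = some x) : Moment E S code c t (log.take k) x ∧
      log.take k ++ [x] = log.take (k + 1) := by
  have e : log.take k ++ [x] = log.take (k + 1) := by simp [List.take_add_one, hx]
  exact ⟨h _ _ (e ▸ List.take_prefix _ _), e⟩

/-- The moments at which the current degrees can be read. -/
theorem moments {n m w X : ℕ} {D : List (Fin n × Option (Fin n))} {s : Fin n} {input : List ℕ}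
    (hX : Bounds n m w X) (hin : ∀ x ∈ input, x < 2 ^ w) (hroot : [(s, none)] <+: D)
    (hlen : D.length ≤ n) {code : List (Instr 128)} {c₀ : Config 128} {t : ℕ}
    {log : List (ℕ × (ℕ → ℕ → ℕ))} (hlog : LogOk D log)
    (h47 : ∀ x ∈ log, ∀ i < 28, x.2 47 i = value n w i)
    (hmom : ∀ l y, l ++ [y] <+: log →
      Moment (env n w 28 input) (base n w 28) code c₀ t l y) (k : ℕ) :
    ∃ t' ≤ t, ∃ c' : Config 128, (prog code).run w input (base n w 28) t' c₀ = some c' ∧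
      c'.out = (D.take k).map (fun e => vertexLabel e.1) ∧ ∀ v : Fin n,
        (prog (withPrologue loadCode currentCode)).Answers w input (base n w 28) c'.mem
          [vertexLabel v]
          (max loadCode.cost currentCode.cost * 29 + 28 + max loadCode.cost currentCode.cost * 10)
          (childCount (D.take k) v) := by
  obtain ⟨D', hD'⟩ := hroot
  have hD1 : D.take 1 = [(s, none)] := by rw [← hD']; rfl
  have hDpos : 0 < D.length := by rw [← hD']; simp
  have hloglen : log.length = D.length := by simpa using congrArg List.length hlog.fst
  have key : ∀ j x, log[j]? = some x → ∀ mem, MemRep (env n w 28 input) x.2 mem → ∀ v : Fin n,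
      (prog (withPrologue loadCode currentCode)).Answers w input (base n w 28) mem [vertexLabel v]
        (max loadCode.cost currentCode.cost * 29 + 28 + max loadCode.cost currentCode.cost * 10)
        (childCount (D.take (j + 1)) v) := by
    intro j x hx mem hmem v
    obtain ⟨al, hc⟩ := hlog.counts j x hx
    rw [← kids_eq]
    exact current_answers hX hin hmem (h47 x (List.mem_of_getElem? hx)) hc
      ((sum_kids_le _).trans ((List.length_take_le' _ _).trans hlen)) v.2
  -- For `k = 0` the instant just before the first report is taken. The counts in memory are then
  -- already those for the root alone, and a root is nobody's child. For `k > 0` the instant just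
  -- after the report of the vertex with index `k - 1` is taken, or after the last report if `k`
  -- exceeds the length of `D`.
  rcases Nat.eq_zero_or_pos k with rfl | hk
  · obtain ⟨t', ht', c₁, c₂, r₁, -, o₁, -, m₁, -⟩ :=
      (moment_take hmom (List.getElem?_eq_getElem (hloglen ▸ hDpos))).1
    refine ⟨t', ht'.le, c₁, r₁, by simpa using o₁, fun v => ?_⟩
    have := key 0 _ (List.getElem?_eq_getElem (hloglen ▸ hDpos)) _ m₁ v
    rw [zero_add, hD1] at this
    simpa [childCount] using this
  · have hmin : D.take k = D.take (min k D.length - 1 + 1) := by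
      rw [Nat.sub_add_cancel (by omega), List.take_eq_take_min]
    have hj : min k D.length - 1 < log.length := by omega
    obtain ⟨h1, h2⟩ := moment_take hmom (List.getElem?_eq_getElem hj)
    obtain ⟨t', ht', c₁, c₂, -, r₂, -, o₂, m₁, m₂⟩ := h1
    refine ⟨t' + 1, ht', c₂, r₂, ?_, fun v => ?_⟩
    · rw [o₂, h2, hmin, List.map_take, hlog.fst, List.map_take]
    · rw [hmin]
      exact key _ _ (List.getElem?_eq_getElem hj) _ (m₂ ▸ m₁) v

/-- The degree sequence can be decoded from its bits. -/
theorem decode_final {n m w X : ℕ} {D : List (Fin n × Option (Fin n))} {input : List ℕ}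
    (hX : Bounds n m w X) (hlen : D.length ≤ n) {arr : ℕ → ℕ → ℕ} {mem : ℕ → ℕ}
    (hmem : MemRep (env n w 28 input) arr mem) (hfin : Final n w (kids D) arr) :
    ∃ L ≤ 2 * n, w * base n w 18 + L ≤ w * base n w 22 ∧
      runLengths 0 (memBits w mem (w * base n w 18) L) = List.ofFn fun v => childCount D v := by
  have hw := Nat.pos_of_ne_zero hX.w_ne
  have hL := unaryPos_le (kids D) le_rfl ((sum_kids_le D).trans hlen)
  have hdiv : ∀ {i}, i < unaryPos (kids D) n → i / w < 2 * n / w + 1 := fun h =>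
    Nat.lt_succ_of_le (Nat.div_le_div_right (by omega))
  refine ⟨unaryPos (kids D) n, hL, ?_, ?_⟩
  · have h1 : base n w 18 + (2 * n / w + 1) ≤ base n w 22 := by
      have h1 : base n w 19 = _ := base_succ n w (by norm_num : 13 ≤ 18)
      have h2 := base_mono n w (by norm_num : 19 ≤ 22)
      have h3 : area n w 18 = 2 * n / w + 1 := rfl
      omega
    have h2 := Nat.div_add_mod (2 * n) w
    have h3 := Nat.mod_lt (2 * n) hw
    calc w * base n w 18 + unaryPos (kids D) n ≤ w * base n w 18 + w * (2 * n / w + 1) := by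
          rw [mul_add w (2 * n / w)]; omega
      _ = w * (base n w 18 + (2 * n / w + 1)) := (mul_add _ _ _).symm
      _ ≤ _ := Nat.mul_le_mul_left _ h1
  · have h1 := hfin.str.memBits (mem := mem) (b := base n w 18) hw fun i hi =>
      hmem.word 18 (i / w) (hdiv (by rwa [length_unary] at hi))
    rw [length_unary] at h1
    have h2 := runLengths_unary (kids D) n []
    rw [List.append_nil] at h2
    rw [h1, h2]
    refine List.ext_getElem (by simp [runLengths]) fun i h3 h4 => ?_
    have hi : i < n := by simpa using h4
    rw [List.getElem_append_left (by simpa using hi)]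
    simpa using kids_eq D ⟨i, hi⟩

end WordRAM

/-- Depth-first search with the degree sequence of its tree.
`P` is the search, `R` reads a current degree during the search, and `Q` reads a degree from the
final representation.  The word length `w` is of the order of `lg (n + m)`. -/
theorem mainTheorem5 :
    ∃ (κ : ℕ) (P R Q : WordRAM.Program) (decode : ℕ → List Bool → List ℕ), ∀ β : ℕ,
    ∃ (C : ℕ) (r : ℕ → ℕ),
      Asymptotics.IsLittleO Filter.atTop (fun n => (r n : ℝ)) (fun n : ℕ => (n : ℝ)) ∧
      ∀ (n : ℕ), 0 < n → ∀ (G : Digraph (Fin n)) (A : AdjacencyLists G) (s : Fin n) (w : ℕ),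
        κ * Nat.size (n + A.m) ≤ w → w ≤ β * Nat.size (n + A.m) →
        ∃ (S t : ℕ) (c : WordRAM.Config P.numRegs),
          -- the search halts after `O(m + n)` steps
          t ≤ C * (n + A.m) ∧
          P.run w A.array S t (P.start w (fun _ => 0) [vertexLabel s]) = some c ∧
          P.Halted c ∧
          -- registers and work memory have `O(n lg lg n)` bits in total
          w * (P.numRegs + R.numRegs + S) ≤ C * (n * lglg n) ∧
          -- the search reports the vertices in the order of discovery
          c.out = (A.dfs s).map (fun e => vertexLabel e.1) ∧
          -- during the search the current degrees can be read in constant time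
          (∀ k ≤ n, ∃ t' ≤ t, ∃ c' : WordRAM.Config P.numRegs,
            P.run w A.array S t' (P.start w (fun _ => 0) [vertexLabel s]) = some c' ∧
            c'.out = ((A.dfs s).take k).map (fun e => vertexLabel e.1) ∧
            ∀ v : Fin n, R.Answers w A.array S c'.mem [vertexLabel v] C
              (childCount ((A.dfs s).take k) v)) ∧
          -- at the end the first `S'` words of memory hold the degree sequence, encoded in at most
          -- `2 n` bits, with at most `r n = o(n)` further bits; degrees are read from these words
          -- alone in constant time
          ∃ S' a L : ℕ, S' ≤ S ∧ w * S' ≤ 2 * n + r n ∧ L ≤ 2 * n ∧ a + L ≤ w * S' ∧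
            decode n (WordRAM.memBits w c.mem a L) = List.ofFn (fun v => childCount (A.dfs s) v) ∧
            ∀ v : Fin n, Q.Answers w [] S' c.mem [vertexLabel v] C (childCount (A.dfs s) v) := by

  -- The constant `24` is the one required by `bounds_of_le`. The decoder can ignore `n`, since the
  -- zeros of the string delimit the entries.
  refine ⟨24, prog (withPrologue setupCode mainCode), prog (withPrologue loadCode currentCode),
    prog (withPrologue loadCode finalCode), fun _ bits => runLengths 0 bits, fun β => ?_⟩
  set M := max setupCode.cost mainCode.cost
  set T₁ := max loadCode.cost currentCode.cost * 29 + 28 + max loadCode.cost currentCode.cost * 10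
    with hT₁
  set T₂ := max loadCode.cost finalCode.cost * 29 + 28 + max loadCode.cost finalCode.cost * 10
    with hT₂
  -- The first two summands cover the time of the search: `M` times the set-up, where `w ≤ 2 * β *
  -- n`, and the main part, and `28` for the moves. Then come the times of the two queries. The last
  -- summand covers the space, from `base_28_le` with `B = 2 * β`.
  refine ⟨M * (6 * β + 5070) + 28 + T₁ + T₂ + (12000 * β + 12200),
    fun n => (3200 * β + 12000) * n / ll n, isLittleO_div_ll _, ?_⟩
  intro n hn G A s w hκ hβ
  have hX := bounds_of_le hn hκ
  have hin := A.inputOk hn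
  have hlen := A.dfs_length_le s
  have hwB : w ≤ 2 * β * lg n := by
    have := Nat.mul_le_mul_left β (size_le_lg A.m_le)
    calc w ≤ _ := hβ
      _ ≤ _ := this
      _ = _ := by ring
  have hwn : w ≤ 2 * β * n := hwB.trans (Nat.mul_le_mul_left _ (lg_le n))
  have hinw : ∀ x ∈ A.array, x < 2 ^ w := fun x hx => by
    have := hin.lt x hx
    have := hX.nm_le
    have := hX.X_lt
    omega
  obtain ⟨t, c, arr, log, ht, hrun, hhalt, hout, hmem, hfin, hlog, h47, hlog47, hmom⟩ :=
    search_goes hX hin s (D := A.dfs s) rfl rfl hlen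
  obtain ⟨L, hL, haL, hdec⟩ := decode_final hX hlen hmem hfin
  refine ⟨base n w 28, t, c, ?_, hrun, hhalt, ?_, by rw [hout, hlog.fst], fun k _ => ?_,
    base n w 22, w * base n w 18, L, base_mono n w (by norm_num), ?_, hL, haL, hdec, fun v => ?_⟩
  · refine ht.trans ?_
    have h1 : 3 * w + 6 * n + 64 ≤ (6 * β + 70) * (n + A.m) := by nlinarith
    calc M * (3 * w + 6 * n + 64) + 28 + M * (5000 * (n + A.m))
        ≤ M * ((6 * β + 70) * (n + A.m)) + 28 * (n + A.m) + M * (5000 * (n + A.m)) := by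
          gcongr; omega
      _ = (M * (6 * β + 5070) + 28) * (n + A.m) := by ring
      _ ≤ _ := Nat.mul_le_mul_right _ (by omega)
  · refine (base_28_le hn hwB hX.fb_le).trans (Nat.mul_le_mul_right _ ?_)
    have : 6000 * (2 * β) = 12000 * β := by ring
    omega
  · obtain ⟨t', ht', c', hr, ho, hans⟩ :=
      moments hX hinw (A.root_prefix_dfs s hn) hlen hlog hlog47 hmom k
    refine ⟨t', ht', c', hr, ho, fun v => ?_⟩
    obtain ⟨u, hu, h⟩ := hans v
    exact ⟨u, hu.trans (by omega), h⟩
  · have h1 := base_22_le hn hwB hX.fb_le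
    have hl := ll_pos hn
    have e : (1600 * (2 * β) + 12000) = 3200 * β + 12000 := by ring
    rw [e] at h1
    -- Dividing `base_22_le` by `ll n` leaves the string of `2 * n` bits and the remainder that is
    -- `o(n)`.
    have h2 : w * base n w 22 - 2 * n ≤ (3200 * β + 12000) * n / ll n := by
      rw [Nat.le_div_iff_mul_le hl, mul_comm, Nat.mul_sub]
      omega
    show w * base n w 22 ≤ 2 * n + (3200 * β + 12000) * n / ll n
    omega
  · obtain ⟨u, hu, h⟩ := final_answers hX (hmem.restrict (by norm_num)) h47 hfin
      ((sum_kids_le _).trans hlen) v.2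
    rw [kids_eq] at h
    exact ⟨u, hu.trans (by omega), h⟩
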